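/- **Theorem (Algebraic Markov type theorem for singular twisted virtual braids).** *Links.* An oriented singular twisted link diagram is a generic immersion of finitely many oriented circles in the plane, decorated with finitely many bars (short arcs crossing the curve transversely) and with each double point marked as a classical, virtual or singular crossing. It is considered up to planar isotopy: put in general position with respect to the height function, it is a word, read from top to bottom, in the elementary pieces (crossing, bar, local maximum, local minimum), and planar isotopy is generated by: interchanging the heights of distant pieces; cancelling a local maximum against an adjacent local minimum; moving a crossing or a bar through a local extremum. Two diagrams are isotopic (represent the same oriented singular twisted link) if they are related by planar isotopy and finitely many of the following moves, for all orientations of the strands: the classical Reidemeister moves R1, R2, R3; the virtual moves V1, V2, V3 (the same with all crossings virtual) and V4 (a strand with two virtual crossings moves past a classical crossing); S1 (a strand with two virtual crossings moves past a singular crossing), S2 (adjacent classical and singular crossings of the same two strands are interchanged), S3 (a strand lying over, or under, both strands of a singular crossing moves past it); T1 (a bar moves past a virtual crossing), T2 (two consecutive bars on a strand cancel), and T3 and S4 (a classical, respectively singular, crossing placed between two virtual crossings of the same two strands is replaced by the same crossing with one bar on each of its four legs). *Braids.* For $n\ge 1$ let $STVB_n$ be the monoid generated by $\sigma_i,\sigma_i^{-1},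 v_i,\tau_i$ $(1\le i\le n-1)$ and $\gamma_i$ $(1\le i\le n)$, subject to the following relations, for all indices for which they make sense: - $\sigma_i\sigma_i^{-1}=\sigma_i^{-1}\sigma_i=e$, $v_i^2=e$, $\gamma_i^2=e$, $\gamma_i\gamma_j=\gamma_j\gamma_i$; - for $|i-j|>1$: $\sigma_i\sigma_j=\sigma_j\sigma_i$, $v_iv_j=v_jv_i$, $\tau_i\tau_j=\tau_j\tau_i$, $\sigma_iv_j=v_j\sigma_i$, $\sigma_i\tau_j=\tau_j\sigma_i$, $\tau_iv_j=v_j\tau_i$; - for $j\ne i,i+1$: $\gamma_jv_i=v_i\gamma_j$, $\sigma_i\gamma_j=\gamma_j\sigma_i$, $\tau_i\gamma_j=\gamma_j\tau_i$; - $\sigma_i\sigma_{i+1}\sigma_i=\sigma_{i+1}\sigma_i\sigma_{i+1}$, $v_iv_{i+1}v_i=v_{i+1}v_iv_{i+1}$, $v_i\sigma_{i+1}v_i=v_{i+1}\sigma_iv_{i+1}$, $v_i\tau_{i+1}v_i=v_{i+1}\tau_iv_{i+1}$; - $\sigma_i\tau_i=\tau_i\sigma_i$, $\sigma_i\sigma_{i+1}\tau_i=\tau_{i+1}\sigma_i\sigma_{i+1}$;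 - $\gamma_{i+1}v_i=v_i\gamma_i$, $v_i\sigma_iv_i=\gamma_{i+1}\gamma_i\sigma_i\gamma_i\gamma_{i+1}$, $v_i\tau_iv_i=\gamma_{i+1}\gamma_i\tau_i\gamma_i\gamma_{i+1}$. Put $STVB_\infty=\bigsqcup_{n\ge1}STVB_n$. A word in the generators is a braid diagram on $n$ downward strands: $\sigma_i$ ($\sigma_i^{-1}$) is a positive (negative) classical crossing of the $i$-th and $(i+1)$-st strands, $v_i$ a virtual and $\tau_i$ a singular one, and $\gamma_i$ is a bar on the $i$-th strand. Its closure is the link diagram obtained by joining its lower endpoints to its upper endpoints by $n$ parallel arcs without crossings. Let $\iota_s^t:STVB_n\to STVB_{n+s+t}$ add $s$ trivial strands on the left and $t$ on the right. *Claim.* Two singular twisted virtual braids, represented by arbitrary words of degrees $m,n\ge 1$, have isotopic closures if and only if their classes are related in $STVB_\infty$ by a finite sequence of the following moves and their inverses (for all signs, and in each move with upper, respectively lower, signs taken throughout): 1. for $\alpha\in STVB_n$, $n\ge1$: real conjugation $\sigma_i^{\pm1}\alpha\sim\alpha\sigma_i^{\pm1}$; virtual conjugation $v_i\alpha\sim\alpha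 v_i$; singular conjugation $\tau_i\alpha\sim\alpha\tau_i$ $(1\le i\le n-1)$; twist conjugation $\gamma_i\alpha\sim\alpha\gamma_i$ $(1\le i\le n)$; 2. for $\alpha\in STVB_n$, $n\ge1$: right real stabilization $\alpha\sim\iota_0^1(\alpha)\sigma_n^{\pm1}$ and right virtual stabilization $\alpha\sim\iota_0^1(\alpha)v_n$; 3. for $\alpha\in STVB_n$, $n\ge2$: right algebraic under-threading $\alpha\sim\iota_0^1(\alpha)\sigma_n^{\pm1}v_{n-1}\sigma_n^{\mp1}$ and left algebraic under-threading $\alpha\sim\iota_1^0(\alpha)\sigma_1^{\pm1}v_2\sigma_1^{\mp1}$; 4. for $\alpha\in STVB_n$, $n\ge2$: right algebraic $rs$-threading $\iota_0^1(\alpha)\tau_nv_{n-1}\sigma_n^{\pm1}\sim\iota_0^1(\alpha)\sigma_n^{\pm1}v_{n-1}\tau_n$ and left algebraic $rs$-threading $\iota_1^0(\alpha)\tau_1v_2\sigma_1^{\pm1}\sim\iota_1^0(\alpha)\sigma_1^{\pm1}v_2\tau_1$. -/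

import Mathlib

namespace STV

/-! ## The monoid of singular twisted virtual braids

Indices start at `0`: the generator of index `i` acts on the strands `i` and `i + 1` (on the strand
`i`, for a bar), counted from the left. A product is read from top to bottom. -/

/-- The generators of the monoid on `n` strands: the classical crossings `σᵢ` (`sigma true i`) and
`σᵢ⁻¹` (`sigma false i`), the virtual crossings `vᵢ`, the singular crossings `τᵢ` and the bars
`γᵢ`. -/
inductive Gen (n : ℕ) : Type
  | sigma (e : Bool) (i : ℕ) (h : i + 1 < n)
  | virt (i : ℕ) (h : i + 1 < n)
  | sing (i : ℕ) (h : i + 1 < n)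
  | bar (i : ℕ) (h : i < n)

/-- Words in the generators, that is, singular twisted virtual braid diagrams on `n` strands. -/
abbrev Word (n : ℕ) : Type := FreeMonoid (Gen n)

namespace Word

variable {n : ℕ}

/-- The one-letter word `σᵢ` (`e = true`) or `σᵢ⁻¹` (`e = false`). -/
def σ (e : Bool) (i : ℕ) (h : i + 1 < n) : Word n := FreeMonoid.of (Gen.sigma e i h)

/-- The one-letter word `vᵢ`. -/
def v (i : ℕ) (h : i + 1 < n) : Word n := FreeMonoid.of (Gen.virt i h)

/-- The one-letter word `τᵢ`. -/
def τ (i : ℕ) (h : i + 1 < n) : Word n := FreeMonoid.of (Gen.sing i h)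

/-- The one-letter word `γᵢ`. -/
def γ (i : ℕ) (h : i < n) : Word n := FreeMonoid.of (Gen.bar i h)

end Word

/-- `|i - j| > 1`. -/
def Far (i j : ℕ) : Prop := i + 1 < j ∨ j + 1 < i

open Word in
/-- The defining relations of the monoid of singular twisted virtual braids on `n` strands. -/
inductive Rel (n : ℕ) : Word n → Word n → Prop
  | sigma_sigma_far (i j : ℕ) (hi : i + 1 < n) (hj : j + 1 < n) (hf : Far i j) :
      Rel n (σ true i hi * σ true j hj) (σ true j hj * σ true i hi)
  | sigma_braid (i : ℕ) (hi : i + 1 < n) (hj : i + 1 + 1 < n) :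
      Rel n (σ true i hi * σ true (i + 1) hj * σ true i hi)
        (σ true (i + 1) hj * σ true i hi * σ true (i + 1) hj)
  | virt_sq (i : ℕ) (hi : i + 1 < n) : Rel n (v i hi * v i hi) 1
  | virt_virt_far (i j : ℕ) (hi : i + 1 < n) (hj : j + 1 < n) (hf : Far i j) :
      Rel n (v i hi * v j hj) (v j hj * v i hi)
  | virt_braid (i : ℕ) (hi : i + 1 < n) (hj : i + 1 + 1 < n) :
      Rel n (v i hi * v (i + 1) hj * v i hi) (v (i + 1) hj * v i hi * v (i + 1) hj)
  | sigma_virt_far (i j : ℕ) (hi : i + 1 < n) (hj : j + 1 < n) (hf : Far i j) :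
      Rel n (σ true i hi * v j hj) (v j hj * σ true i hi)
  | virt_sigma_virt (i : ℕ) (hi : i + 1 < n) (hj : i + 1 + 1 < n) :
      Rel n (v i hi * σ true (i + 1) hj * v i hi) (v (i + 1) hj * σ true i hi * v (i + 1) hj)
  | bar_sq (i : ℕ) (hi : i < n) : Rel n (γ i hi * γ i hi) 1
  | bar_bar (i j : ℕ) (hi : i < n) (hj : j < n) : Rel n (γ i hi * γ j hj) (γ j hj * γ i hi)
  | bar_virt_far (i j : ℕ) (hi : i + 1 < n) (hj : j < n) (h₁ : j ≠ i) (h₂ : j ≠ i + 1) :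
      Rel n (γ j hj * v i hi) (v i hi * γ j hj)
  | sigma_bar_far (i j : ℕ) (hi : i + 1 < n) (hj : j < n) (h₁ : j ≠ i) (h₂ : j ≠ i + 1) :
      Rel n (σ true i hi * γ j hj) (γ j hj * σ true i hi)
  | bar_virt (i : ℕ) (hi : i < n) (hj : i + 1 < n) :
      Rel n (γ (i + 1) hj * v i hj) (v i hj * γ i hi)
  | sigma_twist (i : ℕ) (hi : i < n) (hj : i + 1 < n) :
      Rel n (v i hj * σ true i hj * v i hj)
        (γ (i + 1) hj * γ i hi * σ true i hj * γ i hi * γ (i + 1) hj)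
  | sigma_inv (e : Bool) (i : ℕ) (hi : i + 1 < n) : Rel n (σ e i hi * σ (!e) i hi) 1
  | sing_sing_far (i j : ℕ) (hi : i + 1 < n) (hj : j + 1 < n) (hf : Far i j) :
      Rel n (τ i hi * τ j hj) (τ j hj * τ i hi)
  | sigma_sing_far (i j : ℕ) (hi : i + 1 < n) (hj : j + 1 < n) (hf : Far i j) :
      Rel n (σ true i hi * τ j hj) (τ j hj * σ true i hi)
  | sigma_sing (i : ℕ) (hi : i + 1 < n) :
      Rel n (σ true i hi * τ i hi) (τ i hi * σ true i hi)
  | sigma_sigma_sing (i : ℕ) (hi : i + 1 < n) (hj : i + 1 + 1 < n) :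
      Rel n (σ true i hi * σ true (i + 1) hj * τ i hi)
        (τ (i + 1) hj * σ true i hi * σ true (i + 1) hj)
  | sing_virt_far (i j : ℕ) (hi : i + 1 < n) (hj : j + 1 < n) (hf : Far i j) :
      Rel n (τ i hi * v j hj) (v j hj * τ i hi)
  | virt_sing_virt (i : ℕ) (hi : i + 1 < n) (hj : i + 1 + 1 < n) :
      Rel n (v i hi * τ (i + 1) hj * v i hi) (v (i + 1) hj * τ i hi * v (i + 1) hj)
  | sing_bar_far (i j : ℕ) (hi : i + 1 < n) (hj : j < n) (h₁ : j ≠ i) (h₂ : j ≠ i + 1) :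
      Rel n (τ i hi * γ j hj) (γ j hj * τ i hi)
  | sing_twist (i : ℕ) (hi : i < n) (hj : i + 1 < n) :
      Rel n (v i hj * τ i hj * v i hj)
        (γ (i + 1) hj * γ i hi * τ i hj * γ i hi * γ (i + 1) hj)

/-- The monoid of singular twisted virtual braids on `n` strands. -/
abbrev STVB (n : ℕ) : Type := PresentedMonoid (Rel n)

/-- The braid represented by a word. -/
def braid {n : ℕ} (w : Word n) : STVB n := PresentedMonoid.mk (Rel n) w

/-- The disjoint union of the monoids of singular twisted virtual braids of all positive degrees;
the first component of an element is its degree minus one. -/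
abbrev STVBInfty : Type := Σ n : ℕ, STVB (n + 1)

/-- The action of `iota s t` on generators. -/
def Gen.shift {n : ℕ} (s t : ℕ) : Gen n → Gen (n + s + t)
  | .sigma e i h => .sigma e (i + s) (by omega)
  | .virt i h => .virt (i + s) (by omega)
  | .sing i h => .sing (i + s) (by omega)
  | .bar i h => .bar (i + s) (by omega)

theorem shift_rel {n : ℕ} (s t : ℕ) (a b : Word n) (h : Rel n a b) :
    FreeMonoid.lift (fun g : Gen n => braid (FreeMonoid.of (g.shift s t))) a =
      FreeMonoid.lift (fun g : Gen n => braid (FreeMonoid.of (g.shift s t))) b := by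
  have key : ∀ {a b : Word (n + s + t)}, Rel _ a b → braid a = braid b :=
    fun h => PresentedMonoid.mk_eq_mk_of_rel h
  have hm : ∀ a b : Word (n + s + t), braid a * braid b = braid (a * b) := fun _ _ => rfl
  have h1 : (1 : STVB (n + s + t)) = braid 1 := rfl
  have e : ∀ i : ℕ, i + 1 + s = i + s + 1 := fun i => by omega
  have far : ∀ {i j : ℕ}, Far i j → Far (i + s) (j + s) := fun h => by unfold Far at *; omega
  generalize hf : FreeMonoid.lift (fun g : Gen n => braid (FreeMonoid.of (g.shift s t))) = f
  have fs : ∀ b i h, f (Word.σ b i h) = braid (Word.σ b (i + s) (by omega)) := by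
    intros; rw [← hf]; rfl
  have fv : ∀ i h, f (Word.v i h) = braid (Word.v (i + s) (by omega)) := by
    intros; rw [← hf]; rfl
  have ft : ∀ i h, f (Word.τ i h) = braid (Word.τ (i + s) (by omega)) := by
    intros; rw [← hf]; rfl
  have fg : ∀ i h, f (Word.γ i h) = braid (Word.γ (i + s) (by omega)) := by
    intros; rw [← hf]; rfl
  cases h <;> simp only [map_mul, map_one, fs, fv, ft, fg, hm, h1, e]
  case sigma_sigma_far h => exact key (.sigma_sigma_far _ _ _ _ (far h))
  case sigma_braid => exact key (.sigma_braid _ _ (by omega))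
  case virt_sq => exact key (.virt_sq _ _)
  case virt_virt_far h => exact key (.virt_virt_far _ _ _ _ (far h))
  case virt_braid => exact key (.virt_braid _ _ (by omega))
  case sigma_virt_far h => exact key (.sigma_virt_far _ _ _ _ (far h))
  case virt_sigma_virt => exact key (.virt_sigma_virt _ _ (by omega))
  case bar_sq => exact key (.bar_sq _ _)
  case bar_bar => exact key (.bar_bar _ _ _ _)
  case bar_virt_far => exact key (.bar_virt_far _ _ _ _ (by omega) (by omega))
  case sigma_bar_far => exact key (.sigma_bar_far _ _ _ _ (by omega) (by omega))
  case bar_virt => exact key (.bar_virt _ (by omega) (by omega))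
  case sigma_twist => exact key (.sigma_twist _ (by omega) (by omega))
  case sigma_inv => exact key (.sigma_inv _ _ _)
  case sing_sing_far h => exact key (.sing_sing_far _ _ _ _ (far h))
  case sigma_sing_far h => exact key (.sigma_sing_far _ _ _ _ (far h))
  case sigma_sing => exact key (.sigma_sing _ _)
  case sigma_sigma_sing => exact key (.sigma_sigma_sing _ _ (by omega))
  case sing_virt_far h => exact key (.sing_virt_far _ _ _ _ (far h))
  case virt_sing_virt => exact key (.virt_sing_virt _ _ (by omega))
  case sing_bar_far => exact key (.sing_bar_far _ _ _ _ (by omega) (by omega))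
  case sing_twist => exact key (.sing_twist _ (by omega) (by omega))

/-- The homomorphism that adds `s` trivial strands on the left and `t` trivial strands on the
right. -/
def iota {n : ℕ} (s t : ℕ) : STVB n →* STVB (n + s + t) :=
  PresentedMonoid.lift (fun g : Gen n => braid (FreeMonoid.of (g.shift s t))) (shift_rel s t)

/-- The element `σᵢ` (`e = true`) or `σᵢ⁻¹` (`e = false`). -/
def sigma {n : ℕ} (e : Bool) (i : ℕ) (h : i + 1 < n) : STVB n := braid (Word.σ e i h)

/-- The element `vᵢ`. -/
def virt {n : ℕ} (i : ℕ) (h : i + 1 < n) : STVB n := braid (Word.v i h)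

/-- The element `τᵢ`. -/
def sing {n : ℕ} (i : ℕ) (h : i + 1 < n) : STVB n := braid (Word.τ i h)

/-- The element `γᵢ`. -/
def bar {n : ℕ} (i : ℕ) (h : i < n) : STVB n := braid (Word.γ i h)

/-- The algebraic Markov moves. In the moves on a braid of degree `n + 1`, the last strand has index
`n`; the threading moves need degree at least `2`, and start from a braid of degree `n + 2`. -/
inductive MarkovMove : STVBInfty → STVBInfty → Prop
  | real_conj {n : ℕ} (e : Bool) (i : ℕ) (h : i + 1 < n + 1) (α : STVB (n + 1)) :
      MarkovMove ⟨n, sigma e i h * α⟩ ⟨n, α * sigma e i h⟩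
  | virt_conj {n : ℕ} (i : ℕ) (h : i + 1 < n + 1) (α : STVB (n + 1)) :
      MarkovMove ⟨n, virt i h * α⟩ ⟨n, α * virt i h⟩
  | sing_conj {n : ℕ} (i : ℕ) (h : i + 1 < n + 1) (α : STVB (n + 1)) :
      MarkovMove ⟨n, sing i h * α⟩ ⟨n, α * sing i h⟩
  | twist_conj {n : ℕ} (i : ℕ) (h : i < n + 1) (α : STVB (n + 1)) :
      MarkovMove ⟨n, bar i h * α⟩ ⟨n, α * bar i h⟩
  | real_stab {n : ℕ} (e : Bool) (α : STVB (n + 1)) :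
      MarkovMove ⟨n, α⟩ ⟨n + 1, iota 0 1 α * sigma e n (by omega)⟩
  | virt_stab {n : ℕ} (α : STVB (n + 1)) :
      MarkovMove ⟨n, α⟩ ⟨n + 1, iota 0 1 α * virt n (by omega)⟩
  | right_under {n : ℕ} (e : Bool) (α : STVB (n + 2)) :
      MarkovMove ⟨n + 1, α⟩
        ⟨n + 2, iota 0 1 α * sigma e (n + 1) (by omega) * virt n (by omega) *
          sigma (!e) (n + 1) (by omega)⟩
  | left_under {n : ℕ} (e : Bool) (α : STVB (n + 2)) :
      MarkovMove ⟨n + 1, α⟩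
        ⟨n + 2, iota 1 0 α * sigma e 0 (by omega) * virt 1 (by omega) *
          sigma (!e) 0 (by omega)⟩
  | right_rs {n : ℕ} (e : Bool) (α : STVB (n + 2)) :
      MarkovMove
        ⟨n + 2, iota 0 1 α * sing (n + 1) (by omega) * virt n (by omega) *
          sigma e (n + 1) (by omega)⟩
        ⟨n + 2, iota 0 1 α * sigma e (n + 1) (by omega) * virt n (by omega) *
          sing (n + 1) (by omega)⟩
  | left_rs {n : ℕ} (e : Bool) (α : STVB (n + 2)) :
      MarkovMove
        ⟨n + 2, iota 1 0 α * sing 0 (by omega) * virt 1 (by omega) * sigma e 0 (by omega)⟩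
        ⟨n + 2, iota 1 0 α * sigma e 0 (by omega) * virt 1 (by omega) * sing 0 (by omega)⟩

/-- Two braids differ by a finite sequence of algebraic Markov moves and their inverses. (The
braid relations are equalities in the monoids.) -/
def MarkovEquiv : STVBInfty → STVBInfty → Prop := Relation.EqvGen MarkovMove

/-! ## Singular twisted links

An oriented diagram in the plane is put in general position with respect to the height function and
read from top to bottom: it is a finite sequence of slices, each of which contains one elementary
piece (a crossing, a bar, a local maximum or a local minimum) and otherwise vertical strands. -/

/-- The double points. In a small disc around it, a double point consists of an arc from the upper
right to the lower left (slash) and an arc from the upper left to the lower right (backslash).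
`slash` and `backslash` are the classical crossings at which the arc of this name passes over the
other one. -/
inductive Crossing : Type
  | slash
  | backslash
  | virtual
  | singular

/-- The effect of a quarter turn (equivalently, of switching over and under). -/
def Crossing.flip : Crossing → Crossing
  | .slash => .backslash
  | .backslash => .slash
  | .virtual => .virtual
  | .singular => .singular

/-- A classical crossing. -/
def Crossing.Real (c : Crossing) : Prop := c = .slash ∨ c = .backslash

/-- The elementary pieces. The new strands at a local maximum are directed; `maximum d` has its left
leg directed as `d` and its right leg as `!d`, where `true` is downward. -/
inductive Piece : Type
  | crossing (c : Crossing)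
  | bar
  | maximum (d : Bool)
  | minimum

/-- The number of strands that enter a piece from above. -/
def Piece.top : Piece → ℕ
  | .crossing _ => 2
  | .bar => 1
  | .maximum _ => 0
  | .minimum => 2

/-- The number of strands that leave a piece below. -/
def Piece.bot : Piece → ℕ
  | .crossing _ => 2
  | .bar => 1
  | .maximum _ => 2
  | .minimum => 0

/-- A horizontal slice: a piece with `pos` vertical strands to the left of it. -/
structure Slice : Type where
  pos : ℕ
  piece : Piece

/-- `Slice.Passes S a b`: the slice `S` fits between the rows `a` (above) and `b` (below) of
directed strands (`true` is downward), with directions matching along the curves. -/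
inductive Slice.Passes : Slice → List Bool → List Bool → Prop
  | crossing (l r : List Bool) (c : Crossing) (x y : Bool) :
      Slice.Passes ⟨l.length, .crossing c⟩ (l ++ x :: y :: r) (l ++ y :: x :: r)
  | bar (l r : List Bool) (x : Bool) :
      Slice.Passes ⟨l.length, .bar⟩ (l ++ x :: r) (l ++ x :: r)
  | maximum (l r : List Bool) (d : Bool) :
      Slice.Passes ⟨l.length, .maximum d⟩ (l ++ r) (l ++ d :: (!d) :: r)
  | minimum (l r : List Bool) (d : Bool) :
      Slice.Passes ⟨l.length, .minimum⟩ (l ++ d :: (!d) :: r) (l ++ r)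

/-- The same for a sequence of slices, from top to bottom. -/
inductive Runs : List Slice → List Bool → List Bool → Prop
  | nil (a : List Bool) : Runs [] a a
  | cons {S : Slice} {D : List Slice} {a b c : List Bool} :
      S.Passes a b → Runs D b c → Runs (S :: D) a c

theorem Runs.append {D E : List Slice} {a b c : List Bool} (h : Runs D a b) (h' : Runs E b c) :
    Runs (D ++ E) a c := by
  induction h with
  | nil => exact h'
  | cons p _ ih => exact .cons p (ih h')

/-- Oriented singular twisted link diagrams. -/
def LinkDiagram : Type := {D : List Slice // Runs D [] []}

/-- The local moves on diagrams, for all directions of the strands: the generators of planar isotopy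
(`isotopy_`), and the generalized Reidemeister moves. -/
inductive Move : List Slice → List Slice → Prop
  /-- Distant pieces change their heights; the piece `P` stands to the left of `Q`. -/
  | isotopy_heights (P Q : Piece) (i d : ℕ) :
      Move [⟨i, P⟩, ⟨i + P.bot + d, Q⟩] [⟨i + P.top + d, Q⟩, ⟨i, P⟩]
  /-- A local maximum and a local minimum cancel. -/
  | isotopy_zigzag_left (i : ℕ) (d : Bool) : Move [⟨i, .maximum d⟩, ⟨i + 1, .minimum⟩] []
  | isotopy_zigzag_right (i : ℕ) (d : Bool) : Move [⟨i + 1, .maximum d⟩, ⟨i, .minimum⟩] []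
  /-- A crossing moves from the left to the right of a local extremum. -/
  | isotopy_crossing_maximum (i : ℕ) (d : Bool) (c : Crossing) :
      Move [⟨i + 1, .maximum d⟩, ⟨i, .crossing c⟩] [⟨i, .maximum d⟩, ⟨i + 1, .crossing c.flip⟩]
  | isotopy_crossing_minimum (i : ℕ) (c : Crossing) :
      Move [⟨i, .crossing c⟩, ⟨i + 1, .minimum⟩] [⟨i + 1, .crossing c.flip⟩, ⟨i, .minimum⟩]
  /-- A bar moves from the left to the right of a local extremum. -/
  | isotopy_bar_maximum (i : ℕ) (d : Bool) :
      Move [⟨i, .maximum d⟩, ⟨i, .bar⟩] [⟨i, .maximum d⟩, ⟨i + 1, .bar⟩]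
  | isotopy_bar_minimum (i : ℕ) : Move [⟨i, .bar⟩, ⟨i, .minimum⟩] [⟨i + 1, .bar⟩, ⟨i, .minimum⟩]
  /-- R1 and V1: a kink with a classical or virtual crossing is removed. -/
  | kink (i : ℕ) (d : Bool) (c : Crossing) (hc : c ≠ .singular) :
      Move [⟨i + 1, .maximum d⟩, ⟨i, .crossing c⟩, ⟨i + 1, .minimum⟩] []
  /-- R2 and V2: a bigon with classical or virtual crossings is removed. -/
  | bigon (i : ℕ) (c : Crossing) (hc : c ≠ .singular) :
      Move [⟨i, .crossing c⟩, ⟨i, .crossing c.flip⟩] []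
  /-- R3 and S3: a strand that is over, or under, two other strands moves past a classical or
  singular crossing of these. -/
  | slide_real (i : ℕ) (m c : Crossing) (hm : m.Real) (hc : c ≠ .virtual) :
      Move [⟨i, .crossing m⟩, ⟨i + 1, .crossing m⟩, ⟨i, .crossing c⟩]
        [⟨i + 1, .crossing c⟩, ⟨i, .crossing m⟩, ⟨i + 1, .crossing m⟩]
  /-- V3, V4 and S1: a strand with virtual crossings moves past a virtual, classical or singular
  crossing. -/
  | slide_virtual (i : ℕ) (c : Crossing) :
      Move [⟨i, .crossing .virtual⟩, ⟨i + 1, .crossing .virtual⟩, ⟨i, .crossing c⟩]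
        [⟨i + 1, .crossing c⟩, ⟨i, .crossing .virtual⟩, ⟨i + 1, .crossing .virtual⟩]
  /-- S2: a classical and a singular crossing of the same two strands are interchanged. -/
  | real_singular (i : ℕ) (c : Crossing) (hc : c.Real) :
      Move [⟨i, .crossing c⟩, ⟨i, .crossing .singular⟩] [⟨i, .crossing .singular⟩, ⟨i, .crossing c⟩]
  /-- T1: a bar moves past a virtual crossing. -/
  | bar_virtual (i : ℕ) :
      Move [⟨i + 1, .bar⟩, ⟨i, .crossing .virtual⟩] [⟨i, .crossing .virtual⟩, ⟨i, .bar⟩]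
  /-- T2: two consecutive bars cancel. -/
  | bar_bar (i : ℕ) : Move [⟨i, .bar⟩, ⟨i, .bar⟩] []
  /-- T3 and S4: a classical or singular crossing between two virtual crossings is replaced by the
  same crossing with a bar on each of its four legs. -/
  | twist (i : ℕ) (c : Crossing) (hc : c ≠ .virtual) :
      Move [⟨i, .crossing .virtual⟩, ⟨i, .crossing c⟩, ⟨i, .crossing .virtual⟩]
        [⟨i + 1, .bar⟩, ⟨i, .bar⟩, ⟨i, .crossing c⟩, ⟨i, .bar⟩, ⟨i + 1, .bar⟩]

/-- Two diagrams differ by one local move. -/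
def LinkDiagram.Step (D E : LinkDiagram) : Prop :=
  ∃ A L R B : List Slice, Move L R ∧ D.1 = A ++ L ++ B ∧ E.1 = A ++ R ++ B

/-- Two diagrams are isotopic, that is, they represent the same oriented singular twisted link. -/
def LinkDiagram.Isotopic : LinkDiagram → LinkDiagram → Prop := Relation.EqvGen LinkDiagram.Step

/-! ## Closures -/

/-- All strands of a braid are directed downward; `σᵢ` is the positive crossing. -/
def Gen.slice {n : ℕ} : Gen n → Slice
  | .sigma true i _ => ⟨i, .crossing .slash⟩
  | .sigma false i _ => ⟨i, .crossing .backslash⟩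
  | .virt i _ => ⟨i, .crossing .virtual⟩
  | .sing i _ => ⟨i, .crossing .singular⟩
  | .bar i _ => ⟨i, .bar⟩

/-- `n` nested local maxima; from them, `n` strands go down on the left and `n` come up on the
right. -/
def maxima (n : ℕ) : List Slice := (List.range n).map fun i => ⟨i, .maximum true⟩

/-- `n` nested local minima. -/
def minima (n : ℕ) : List Slice := (List.range n).reverse.map fun i => ⟨i, .minimum⟩

theorem runs_maxima (n : ℕ) :
    Runs (maxima n) [] (List.replicate n true ++ List.replicate n false) := by
  induction n with
  | zero => exact .nil _
  | succ n ih =>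
    have h := Slice.Passes.maximum (List.replicate n true) (List.replicate n false) true
    simp only [List.length_replicate] at h
    have e : List.replicate (n + 1) true ++ List.replicate (n + 1) false =
        List.replicate n true ++ true :: (!true) :: List.replicate n false := by
      rw [List.replicate_succ', List.replicate_succ]; simp
    rw [e, maxima, List.range_succ, List.map_append]
    exact ih.append (.cons h (.nil _))

theorem runs_minima (n : ℕ) :
    Runs (minima n) (List.replicate n true ++ List.replicate n false) [] := by
  induction n with
  | zero => exact .nil _
  | succ n ih =>
    have h := Slice.Passes.minimum (List.replicate n true) (List.replicate n false) true
    simp only [List.length_replicate] at h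
    have e : List.replicate (n + 1) true ++ List.replicate (n + 1) false =
        List.replicate n true ++ true :: (!true) :: List.replicate n false := by
      rw [List.replicate_succ', List.replicate_succ]; simp
    rw [e, minima, List.range_succ, List.reverse_append, List.map_append]
    exact Runs.append (.cons h (.nil _)) ih

theorem passes_slice {n : ℕ} (g : Gen n) (r : List Bool) :
    g.slice.Passes (List.replicate n true ++ r) (List.replicate n true ++ r) := by
  have two : ∀ (i : ℕ), i + 1 < n → ∀ c : Crossing,
      Slice.Passes ⟨i, .crossing c⟩ (List.replicate n true ++ r)
        (List.replicate n true ++ r) := by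
    intro i hi c
    have h := Slice.Passes.crossing (List.replicate i true)
      (List.replicate (n - (i + 2)) true ++ r) c true true
    have e : List.replicate i true ++ true :: true :: (List.replicate (n - (i + 2)) true ++ r) =
        List.replicate n true ++ r := by
      have : n = i + ((n - (i + 2)) + 1 + 1) := by omega
      conv_rhs => rw [this, List.replicate_add, List.replicate_succ, List.replicate_succ]
      simp
    rw [List.length_replicate, e] at h
    exact h
  cases g with
  | sigma e i h => cases e <;> exact two i h _
  | virt i h => exact two i h _
  | sing i h => exact two i h _
  | bar i hi =>
    have h := Slice.Passes.bar (List.replicate i true)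
      (List.replicate (n - (i + 1)) true ++ r) true
    have e : List.replicate i true ++ true :: (List.replicate (n - (i + 1)) true ++ r) =
        List.replicate n true ++ r := by
      have : n = i + ((n - (i + 1)) + 1) := by omega
      conv_rhs => rw [this, List.replicate_add, List.replicate_succ]
      simp
    rw [List.length_replicate, e] at h
    exact h

theorem runs_word {n : ℕ} (w : List (Gen n)) (r : List Bool) :
    Runs (w.map Gen.slice) (List.replicate n true ++ r) (List.replicate n true ++ r) := by
  induction w with
  | nil => exact .nil _
  | cons g w ih => exact .cons (passes_slice g r) ih

/-- The closure of a braid diagram: its lower endpoints are joined to its upper endpoints by `n`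
parallel arcs without crossings that pass on the right of the braid. -/
def closure {n : ℕ} (w : Word n) : LinkDiagram :=
  ⟨maxima n ++ w.toList.map Gen.slice ++ minima n,
    ((runs_maxima n).append (runs_word _ _)).append (runs_minima n)⟩

end STV

/-! From isotopy to Markov equivalence. Give names to the strands of a braid. From top to bottom it
meets a word of non-virtual letters (who crosses whom, who carries a bar) and it permutes the names.
This reading determines the braid (`Reads.unique`): the `vᵢ` satisfy the Coxeter relations, so a
purely virtual braid is known from its permutation (`CoxeterRels.prod_eq_one`). Every other letter
is, up to virtual braids, a crossing or bar at the far left, which commutes with the virtual braids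
on the remaining strands. Closing the braid adds links from the end of a strand to the beginning of
the next one. A well-formed code, that is, a word with links, comes from exactly one braid, and
`Code.Sim` is Markov equivalence seen on codes. Conjugation makes the order of the links immaterial
and lets the word rotate (`WF.sim_rotate`). Virtual stabilization then allows a strand to be cut in
two (`WF.sim_cut`).

Every oriented diagram has such a code as well, whatever the directions of its strands. If a strand
gets a new name at each letter, no two letters share a name; the letters commute (`LEq.perm`) and
the height function is forgotten. A local move then changes only a few letters and links, which is
expressed by `Code.Local`. Planar isotopy only moves the places where strands are cut. Parallel
bigons, the braid-like slides and the twists are braid relations. One kink is a real stabilization,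
and the other follows by turning its crossing around with bars (`Local.kink'`). Antiparallel bigons
are under-threadings, and the antiparallel form of S2 is an `rs`-threading. The slide whose middle
arcs form an oriented cycle follows from a braid-like slide by inserting one antiparallel bigon and
removing another (`Local.slide_chain`). So isotopic diagrams have equivalent codes (`Move.sound`,
`Sound.sim`, `LinkDiagram.Isotopic.equi`), and the code of a closure is equivalent to a code of the
braid (`closure_reads`).

From Markov equivalence to isotopy. The relations of the monoid are local moves
(`isotopyCon_of_rel`). A generator travels from the top of the braid to its bottom along the closing
arcs (`isotopic_conj`). Stabilizations are kinks. In a right threading, `Derives.turn` moves the two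
outer crossings next to each other on the closing side, where they cancel or commute. Left
threadings are conjugate to right ones by the half turn, the reversal of all strands with a bar on
each (`halfTurn_iota`). -/

namespace STV

/-! ## Words in adjacent transpositions -/

/-- The adjacent transposition of the entries of index `i` and `i + 1` of a list. -/
def swapAt : ℕ → List ℕ → List ℕ
  | 0, a :: b :: r => b :: a :: r
  | i + 1, a :: r => a :: swapAt i r
  | _, r => r

theorem swapAt_append (l r : List ℕ) (a b : ℕ) :
    swapAt l.length (l ++ a :: b :: r) = l ++ b :: a :: r := by
  induction l with
  | nil => rfl
  | cons x l ih => simp [swapAt, ih]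

theorem swapAt_perm (i : ℕ) (x : List ℕ) : (swapAt i x).Perm x := by
  induction i generalizing x with
  | zero =>
    match x with
    | [] => exact .refl _
    | [a] => exact .refl _
    | a :: b :: r => exact .swap _ _ _
  | succ i ih =>
    cases x with
    | nil => exact .refl _
    | cons a r => exact (ih r).cons a

/-- This and the next three lemmas are the ways in which a transposition can meet a marked entry;
they match the four cases in `CoxeterRels.normalForm`. -/
theorem swapAt_insertIdx_lt (j k a : ℕ) (y : List ℕ) (h : j + 1 < k) (hk : k ≤ y.length) :
    swapAt j (y.insertIdx k a) = (swapAt j y).insertIdx k a := by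
  induction j generalizing k y with
  | zero =>
    match k, y with
    | k + 2, b :: c :: r => simp [swapAt]
    | k + 2, [_] => simp at hk
    | k + 2, [] => simp at hk
  | succ j ih =>
    match k, y with
    | k + 1, [] => simp at hk
    | k + 1, b :: r =>
      simp only [List.insertIdx_succ_cons, swapAt]
      rw [ih k r (by omega) (by simpa using hk)]

theorem swapAt_insertIdx_succ (j a : ℕ) (y : List ℕ) (hk : j < y.length) :
    swapAt j (y.insertIdx (j + 1) a) = y.insertIdx j a := by
  induction j generalizing y with
  | zero =>
    match y with
    | b :: r => simp [swapAt]
  | succ j ih =>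
    match y with
    | b :: r =>
      rw [List.insertIdx_succ_cons, swapAt, ih r (by simpa using hk), List.insertIdx_succ_cons]

theorem swapAt_insertIdx_self (j a : ℕ) (y : List ℕ) (hk : j < y.length) :
    swapAt j (y.insertIdx j a) = y.insertIdx (j + 1) a := by
  induction j generalizing y with
  | zero =>
    match y with
    | b :: r => simp [swapAt]
  | succ j ih =>
    match y with
    | b :: r =>
      rw [List.insertIdx_succ_cons, swapAt, ih r (by simpa using hk), List.insertIdx_succ_cons]

theorem swapAt_insertIdx_gt (j k a : ℕ) (y : List ℕ) (h : k ≤ j) (hk : j + 1 < y.length) :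
    swapAt (j + 1) (y.insertIdx k a) = (swapAt j y).insertIdx k a := by
  induction k generalizing j y with
  | zero => simp [swapAt]
  | succ k ih =>
    match j, y with
    | j + 1, b :: r =>
      simp only [List.insertIdx_succ_cons, swapAt]
      rw [ih j r (by omega) (by simpa using hk)]

/-- The effect of a word in the adjacent transpositions. -/
def swaps (L : List ℕ) (x : List ℕ) : List ℕ := L.foldl (fun y i => swapAt i y) x

theorem swaps_perm (L x : List ℕ) : (swaps L x).Perm x := by
  induction L generalizing x with
  | nil => exact .refl _
  | cons i L ih => exact (ih _).trans (swapAt_perm i x)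

theorem swaps_append_singleton (L x : List ℕ) (i : ℕ) :
    swaps (L ++ [i]) x = swapAt i (swaps L x) := by
  simp [swaps]

/-- The Coxeter relations of the symmetric group on `N` letters. -/
structure CoxeterRels {M : Type*} [Monoid M] (v : ℕ → M) (N : ℕ) : Prop where
  sq : ∀ i, i + 1 < N → v i * v i = 1
  far : ∀ i j, i + 1 < j → j + 1 < N → v i * v j = v j * v i
  braid : ∀ i, i + 2 < N → v i * v (i + 1) * v i = v (i + 1) * v i * v (i + 1)

variable {M : Type*} [Monoid M]

theorem CoxeterRels.shift {v : ℕ → M} {N : ℕ} (h : CoxeterRels v (N + 1)) :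
    CoxeterRels (fun i => v (i + 1)) N where
  sq i hi := h.sq _ (by omega)
  far i j hij hj := h.far _ _ (by omega) (by omega)
  braid i hi := h.braid _ (by omega)

/-- The product `v₀ ⋯ vₖ₋₁`. -/
def cycleProd (v : ℕ → M) : ℕ → M
  | 0 => 1
  | k + 1 => cycleProd v k * v k

theorem CoxeterRels.cycleProd_comm {v : ℕ → M} {N : ℕ} (h : CoxeterRels v N) (k j : ℕ)
    (hk : k < j) (hj : j + 1 < N) : cycleProd v k * v j = v j * cycleProd v k := by
  induction k with
  | zero => simp [cycleProd]
  | succ k ih =>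
    rw [cycleProd, mul_assoc, h.far k j hk hj, ← mul_assoc, ih (by omega), mul_assoc]

/-- Conjugation by a cycle shifts indices. The braid relation is needed once, where `v j` meets the
factors of index `j` and `j + 1`; the later factors commute with it. -/
theorem CoxeterRels.cycleProd_mul {v : ℕ → M} {N : ℕ} (h : CoxeterRels v N) (k j : ℕ)
    (hj : j + 1 < k) (hk : k < N) : cycleProd v k * v j = v (j + 1) * cycleProd v k := by
  induction k with
  | zero => omega
  | succ k ih =>
    rcases Nat.lt_or_ge (j + 1) k with hlt | hge
    · rw [cycleProd, mul_assoc, ← h.far j k hlt hk, ← mul_assoc, ih hlt (by omega), mul_assoc]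
    · obtain rfl : k = j + 1 := by omega
      have e := h.cycleProd_comm j (j + 1) (by omega) hk
      simp only [cycleProd]
      rw [mul_assoc, mul_assoc, ← mul_assoc (v j), h.braid j hk, mul_assoc, ← mul_assoc, e]
      simp only [mul_assoc]

/-- The cycles `v₀ ⋯ vₖ₋₁` represent the cosets of the subgroup that fixes the first letter, and `k`
is the place to which the first entry is moved. The proof multiplies a normal form by one more
generator on the right. -/
theorem CoxeterRels.normalForm {v : ℕ → M} {N : ℕ} (h : CoxeterRels v (N + 1)) (a : ℕ)
    (x : List ℕ) (hx : x.length = N) (L : List ℕ) (hL : ∀ i ∈ L, i < N) :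
    ∃ (u : List ℕ) (k : ℕ), (∀ i ∈ u, i + 1 < N) ∧ k ≤ N ∧
      (L.map v).prod = (u.map fun i => v (i + 1)).prod * cycleProd v k ∧
      swaps L (a :: x) = (swaps u x).insertIdx k a := by
  induction L using List.reverseRecOn with
  | nil => exact ⟨[], 0, by simp, by omega, by simp [cycleProd], by simp [swaps]⟩
  | append_singleton L j ih =>
    obtain ⟨u, k, hu, hk, e, s⟩ := ih fun i hi => hL i (by simp [hi])
    have hj : j < N := hL j (by simp)
    have hl : (swaps u x).length = N := by rw [(swaps_perm u x).length_eq, hx]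
    simp only [List.map_append, List.prod_append, List.map_cons, List.map_nil, List.prod_cons,
      List.prod_nil, mul_one, swaps_append_singleton, e, s, mul_assoc]
    -- The places `j` and `j + 1` are compared with the place `k` of the marked entry: the generator
    -- passes through the cycle, shortens it, commutes with it, or lengthens it.
    rcases Nat.lt_trichotomy (j + 1) k with hlt | heq | hgt
    · refine ⟨u ++ [j], k, ?_, hk, ?_, ?_⟩
      · intro i hi
        rcases List.mem_append.1 hi with hi | hi
        · exact hu i hi
        · simp at hi; omega
      · rw [h.cycleProd_mul k j hlt (by omega)]; simp [mul_assoc]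
      · rw [swapAt_insertIdx_lt _ _ _ _ hlt (by omega), swaps_append_singleton]
    · subst heq
      refine ⟨u, j, hu, by omega, ?_, swapAt_insertIdx_succ _ _ _ (by omega)⟩
      rw [cycleProd, mul_assoc, h.sq j (by omega), mul_one]
    · rcases Nat.lt_or_ge k j with hlt | hge
      · obtain ⟨j, rfl⟩ : ∃ i, j = i + 1 := ⟨j - 1, by omega⟩
        refine ⟨u ++ [j], k, ?_, hk, ?_, ?_⟩
        · intro i hi
          rcases List.mem_append.1 hi with hi | hi
          · exact hu i hi
          · simp at hi; omega
        · rw [h.cycleProd_comm k _ hlt (by omega)]; simp [mul_assoc]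
        · rw [swapAt_insertIdx_gt _ _ _ _ (by omega) (by omega), swaps_append_singleton]
      · obtain rfl : k = j := by omega
        exact ⟨u, k + 1, hu, by omega, rfl, swapAt_insertIdx_self _ _ _ (by omega)⟩

/-- Completeness of the Coxeter presentation. If the word fixes a list of distinct entries, the
first entry stays in front, so the cycle in the normal form is trivial and the rest acts on a
shorter list. -/
theorem CoxeterRels.prod_eq_one {v : ℕ → M} {N : ℕ} (h : CoxeterRels v N) (x : List ℕ)
    (hx : x.length = N) (hn : x.Nodup) (L : List ℕ) (hL : ∀ i ∈ L, i + 1 < N)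
    (hs : swaps L x = x) : (L.map v).prod = 1 := by
  induction N generalizing v x L with
  | zero =>
    cases L with
    | nil => rfl
    | cons i L => exact absurd (hL i (by simp)) (by omega)
  | succ N ih =>
    match x, hx with
    | a :: x, hx =>
      obtain ⟨ha, hn⟩ := List.nodup_cons.1 hn
      have hx : x.length = N := by simpa using hx
      obtain ⟨u, k, hu, hk, e, s⟩ := h.normalForm a x hx L fun i hi => by
        have := hL i hi; omega
      rw [hs] at s
      have hp := swaps_perm u x
      cases k with
      | zero =>
        simp only [List.insertIdx_zero, List.cons.injEq, true_and] at s
        rw [e, ih h.shift x hx hn u hu s.symm]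
        simp [cycleProd]
      | succ k =>
        exfalso
        match hy : swaps u x with
        | [] =>
          rw [hy] at hp
          have := hp.length_eq
          simp at this; omega
        | b :: y =>
          rw [hy] at s hp
          simp only [List.insertIdx_succ_cons, List.cons.injEq] at s
          exact ha (hp.subset (by simp [s.1]))

end STV

namespace STV

/-! ## Relations between the generators -/

/-- The defining relations are stated for `σᵢ` only; this and `conj_of_inverse` transfer them to
`σᵢ⁻¹`. -/
theorem comm_of_inverse {M : Type*} [Monoid M] {a b x y : M} (hab : a * b = 1) (hba : b * a = 1)
    (h : a * x = y * a) : b * y = x * b := by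
  calc b * y = b * (y * (a * b)) := by rw [hab, mul_one]
    _ = b * a * x * b := by rw [← mul_assoc y, ← h]; simp only [mul_assoc]
    _ = x * b := by rw [hba, one_mul]

theorem conj_of_inverse {M : Type*} [Monoid M] {a b a' b' x : M} (hba : b * a = 1)
    (hab : a' * b' = 1) (h : a * x = x * a') : x * b' = b * x := by
  calc x * b' = b * a * x * b' := by rw [hba, one_mul]
    _ = b * x * (a' * b') := by rw [mul_assoc b, h]; simp only [mul_assoc]
    _ = b * x := by rw [hab, mul_one]

/-- The braid with a single crossing. -/
def cr {n : ℕ} (c : Crossing) (i : ℕ) (h : i + 1 < n) : STVB n :=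
  match c with
  | .slash => sigma true i h
  | .backslash => sigma false i h
  | .virtual => virt i h
  | .singular => sing i h

section

variable {n : ℕ}

theorem braid_mul (u w : Word n) : braid (u * w) = braid u * braid w := rfl

theorem braid_eq {u w : Word n} (h : Rel n u w) : braid u = braid w :=
  PresentedMonoid.mk_eq_mk_of_rel h

theorem virt_sq (i : ℕ) (h : i + 1 < n) : virt i h * virt i h = 1 := braid_eq (.virt_sq i h)

theorem bar_sq (i : ℕ) (h : i < n) : bar i h * bar i h = 1 := braid_eq (.bar_sq i h)

theorem sigma_inv (e : Bool) (i : ℕ) (h : i + 1 < n) : sigma e i h * sigma (!e) i h = 1 :=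
  braid_eq (.sigma_inv e i h)

theorem cr_mul_flip (c : Crossing) (hc : c ≠ .singular) (i : ℕ) (h : i + 1 < n) :
    cr c i h * cr c.flip i h = 1 := by
  cases c with
  | slash => exact sigma_inv true i h
  | backslash => exact sigma_inv false i h
  | virtual => exact virt_sq i h
  | singular => exact absurd rfl hc

theorem slash_mul_backslash (i : ℕ) (h : i + 1 < n) :
    cr .slash i h * cr .backslash i h = 1 := sigma_inv true i h

theorem backslash_mul_slash (i : ℕ) (h : i + 1 < n) :
    cr .backslash i h * cr .slash i h = 1 := sigma_inv false i h

theorem virt_far (i j : ℕ) (hi : i + 1 < n) (hj : j + 1 < n) (hf : Far i j) :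
    virt i hi * virt j hj = virt j hj * virt i hi := braid_eq (.virt_virt_far i j hi hj hf)

theorem virt_braid (i : ℕ) (hi : i + 1 < n) (hj : i + 1 + 1 < n) :
    virt i hi * virt (i + 1) hj * virt i hi = virt (i + 1) hj * virt i hi * virt (i + 1) hj :=
  braid_eq (.virt_braid i hi hj)

theorem Far.symm {i j : ℕ} (h : Far i j) : Far j i := Or.symm h

theorem slash_cr_far (c : Crossing) (i j : ℕ) (hi : i + 1 < n) (hj : j + 1 < n) (hf : Far i j) :
    cr .slash i hi * cr c j hj = cr c j hj * cr .slash i hi := by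
  cases c with
  | slash => exact braid_eq (.sigma_sigma_far i j hi hj hf)
  | backslash =>
    exact (comm_of_inverse (slash_mul_backslash j hj) (backslash_mul_slash j hj)
      (braid_eq (.sigma_sigma_far j i hj hi hf.symm))).symm
  | virtual => exact braid_eq (.sigma_virt_far i j hi hj hf)
  | singular => exact braid_eq (.sigma_sing_far i j hi hj hf)

theorem cr_cr_far (c d : Crossing) (i j : ℕ) (hi : i + 1 < n) (hj : j + 1 < n) (hf : Far i j) :
    cr c i hi * cr d j hj = cr d j hj * cr c i hi := by
  have sl := slash_cr_far (n := n)
  have bs : ∀ (d : Crossing) (i j : ℕ) (hi : i + 1 < n) (hj : j + 1 < n), Far i j →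
      cr .backslash i hi * cr d j hj = cr d j hj * cr .backslash i hi :=
    fun d i j hi hj hf =>
      comm_of_inverse (slash_mul_backslash i hi) (backslash_mul_slash i hi) (sl d i j hi hj hf)
  cases c with
  | slash => exact sl _ _ _ _ _ hf
  | backslash => exact bs _ _ _ _ _ hf
  | virtual =>
    cases d with
    | slash => exact (sl _ _ _ _ _ hf.symm).symm
    | backslash => exact (bs _ _ _ _ _ hf.symm).symm
    | virtual => exact virt_far _ _ _ _ hf
    | singular => exact (braid_eq (.sing_virt_far j i hj hi hf.symm)).symm
  | singular =>
    cases d with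
    | slash => exact (sl _ _ _ _ _ hf.symm).symm
    | backslash => exact (bs _ _ _ _ _ hf.symm).symm
    | virtual => exact braid_eq (.sing_virt_far i j hi hj hf)
    | singular => exact braid_eq (.sing_sing_far i j hi hj hf)

theorem bar_bar (i j : ℕ) (hi : i < n) (hj : j < n) : bar i hi * bar j hj = bar j hj * bar i hi :=
  braid_eq (.bar_bar i j hi hj)

theorem cr_bar_far (c : Crossing) (i j : ℕ) (hi : i + 1 < n) (hj : j < n) (h₁ : j ≠ i)
    (h₂ : j ≠ i + 1) : cr c i hi * bar j hj = bar j hj * cr c i hi := by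
  cases c with
  | slash => exact braid_eq (.sigma_bar_far i j hi hj h₁ h₂)
  | backslash =>
    exact comm_of_inverse (slash_mul_backslash i hi) (backslash_mul_slash i hi)
      (braid_eq (.sigma_bar_far i j hi hj h₁ h₂))
  | virtual => exact (braid_eq (.bar_virt_far i j hi hj h₁ h₂)).symm
  | singular => exact braid_eq (.sing_bar_far i j hi hj h₁ h₂)

theorem bar_virt (i : ℕ) (hi : i < n) (hj : i + 1 < n) :
    bar (i + 1) hj * virt i hj = virt i hj * bar i hi := braid_eq (.bar_virt i hi hj)

theorem eq_of_inverses {M : Type*} [Monoid M] {a b a' b' : M} (h : a = b) (ha : a' * a = 1)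
    (hb : b * b' = 1) : a' = b' := left_inv_eq_right_inv (h ▸ ha) hb

theorem virt_cr_virt (c : Crossing) (i : ℕ) (hi : i + 1 < n) (hj : i + 1 + 1 < n) :
    virt i hi * cr c (i + 1) hj * virt i hi = virt (i + 1) hj * cr c i hi * virt (i + 1) hj := by
  cases c with
  | slash => exact braid_eq (.virt_sigma_virt i hi hj)
  | backslash =>
    refine eq_of_inverses (braid_eq (.virt_sigma_virt i hi hj)) ?_ ?_
    · change virt i hi * cr .backslash (i + 1) hj * virt i hi *
        (virt i hi * cr .slash (i + 1) hj * virt i hi) = 1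
      calc _ = virt i hi * cr .backslash (i + 1) hj * (virt i hi * virt i hi) *
            cr .slash (i + 1) hj * virt i hi := by simp only [mul_assoc]
        _ = virt i hi * (cr .backslash (i + 1) hj * cr .slash (i + 1) hj) * virt i hi := by
            rw [virt_sq]; simp only [mul_assoc, one_mul]
        _ = 1 := by rw [backslash_mul_slash, mul_one, virt_sq]
    · change virt (i + 1) hj * cr .slash i hi * virt (i + 1) hj *
        (virt (i + 1) hj * cr .backslash i hi * virt (i + 1) hj) = 1
      calc _ = virt (i + 1) hj * cr .slash i hi * (virt (i + 1) hj * virt (i + 1) hj) *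
            cr .backslash i hi * virt (i + 1) hj := by simp only [mul_assoc]
        _ = virt (i + 1) hj * (cr .slash i hi * cr .backslash i hi) * virt (i + 1) hj := by
            rw [virt_sq]; simp only [mul_assoc, one_mul]
        _ = 1 := by rw [slash_mul_backslash, mul_one, virt_sq]
  | virtual => exact virt_braid i hi hj
  | singular => exact braid_eq (.virt_sing_virt i hi hj)

/-- A crossing is conjugate to the one to the left of it. -/
theorem cr_succ (c : Crossing) (i : ℕ) (hi : i + 1 < n) (hj : i + 1 + 1 < n) :
    cr c (i + 1) hj = virt i hi * virt (i + 1) hj * cr c i hi * (virt (i + 1) hj * virt i hi) := by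
  calc cr c (i + 1) hj
      = virt i hi * virt i hi * cr c (i + 1) hj * (virt i hi * virt i hi) := by
        rw [virt_sq, one_mul, mul_one]
    _ = virt i hi * (virt i hi * cr c (i + 1) hj * virt i hi) * virt i hi := by
        simp only [mul_assoc]
    _ = _ := by rw [virt_cr_virt]; simp only [mul_assoc]

theorem bar_succ (i : ℕ) (hi : i < n) (hj : i + 1 < n) :
    bar (i + 1) hj = virt i hj * bar i hi * virt i hj := by
  rw [← bar_virt, mul_assoc, virt_sq, mul_one]

/-- For a negative crossing, the braid relation is read from right to left and solved for the
inverses of its two outer factors. -/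
theorem slide_element (c : Crossing) (hc : c ≠ .virtual) (i : ℕ) (hi : i + 1 < n)
    (hj : i + 1 + 1 < n) :
    cr .slash i hi * cr .slash (i + 1) hj * cr c i hi =
      cr c (i + 1) hj * cr .slash i hi * cr .slash (i + 1) hj := by
  cases c with
  | slash => exact braid_eq (.sigma_braid i hi hj)
  | backslash =>
    rw [mul_assoc (cr .backslash (i + 1) hj)]
    refine conj_of_inverse (backslash_mul_slash _ hj) (slash_mul_backslash _ hi) ?_
    rw [← mul_assoc]
    exact (braid_eq (.sigma_braid i hi hj)).symm
  | virtual => exact absurd rfl hc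
  | singular => exact braid_eq (.sigma_sigma_sing i hi hj)

/-- The bars on two adjacent strands. -/
def bars (i : ℕ) (h : i + 1 < n) : STVB n := bar i (by omega) * bar (i + 1) h

theorem bars_sq (i : ℕ) (h : i + 1 < n) : bars i h * bars i h = 1 := by
  have h' : i < n := by omega
  calc bars i h * bars i h = bar i h' * (bar (i + 1) h * bar i h') * bar (i + 1) h := by
        simp only [bars, mul_assoc]
    _ = (bar i h' * bar i h') * (bar (i + 1) h * bar (i + 1) h) := by
        rw [bar_bar]; simp only [mul_assoc]
    _ = 1 := by rw [bar_sq, bar_sq, one_mul]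

theorem twist_element (c : Crossing) (hc : c ≠ .virtual) (i : ℕ) (h : i + 1 < n) :
    virt i h * cr c i h * virt i h = bars i h * cr c i h * bars i h := by
  have key : ∀ x : STVB n, bar (i + 1) h * bar i (by omega) * x * bar i (by omega) * bar (i + 1) h =
      bars i h * x * bars i h := fun x => by
    rw [bar_bar (i + 1) i]; simp only [bars, mul_assoc]
  cases c with
  | slash => exact (braid_eq (.sigma_twist i (by omega) h)).trans (key (cr .slash i h))
  | backslash =>
    have e : virt i h * cr .slash i h * virt i h = bars i h * cr .slash i h * bars i h :=
      (braid_eq (.sigma_twist i (by omega) h)).trans (key (cr .slash i h))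
    refine eq_of_inverses e ?_ ?_
    · calc _ = virt i h * cr .backslash i h * (virt i h * virt i h) *
            cr .slash i h * virt i h := by simp only [mul_assoc]
        _ = virt i h * (cr .backslash i h * cr .slash i h) * virt i h := by
            rw [virt_sq]; simp only [mul_assoc, one_mul]
        _ = 1 := by rw [backslash_mul_slash, mul_one, virt_sq]
    · calc _ = bars i h * cr .slash i h * (bars i h * bars i h) *
            cr .backslash i h * bars i h := by simp only [mul_assoc]
        _ = bars i h * (cr .slash i h * cr .backslash i h) * bars i h := by
            rw [bars_sq]; simp only [mul_assoc, one_mul]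
        _ = 1 := by rw [slash_mul_backslash, mul_one, bars_sq]
  | virtual => exact absurd rfl hc
  | singular => exact (braid_eq (.sing_twist i (by omega) h)).trans (key (cr .singular i h))

theorem real_sing_comm (c : Crossing) (hc : c.Real) (i : ℕ) (h : i + 1 < n) :
    cr c i h * cr .singular i h = cr .singular i h * cr c i h := by
  rcases hc with rfl | rfl
  · exact braid_eq (.sigma_sing i h)
  · exact comm_of_inverse (slash_mul_backslash i h) (backslash_mul_slash i h)
      (braid_eq (.sigma_sing i h))

/-- The value `1` outside the range only makes the family total: the Coxeter relations speak of
indices in range. -/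
theorem coxeterRels_virt : CoxeterRels (fun i => if h : i + 1 < n then virt i h else 1) n where
  sq i hi := by simp only [hi, dif_pos]; exact virt_sq i hi
  far i j hij hj := by
    have hi : i + 1 < n := by omega
    simp only [hi, hj, dif_pos]; exact virt_far i j hi hj (.inl hij)
  braid i hj := by
    have hi : i + 1 < n := by omega
    have hj' : i + 1 + 1 < n := hj
    simp only [hi, hj', dif_pos]; exact virt_braid i hi hj

/-! ## Adding trivial strands -/

theorem iota_cr (s t : ℕ) (c : Crossing) (i : ℕ) (h : i + 1 < n) :
    iota s t (cr c i h) = cr c (i + s) (by omega) := by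
  cases c <;> rfl

theorem iota_virt (s t : ℕ) (i : ℕ) (h : i + 1 < n) :
    iota s t (virt i h) = virt (i + s) (by omega) := rfl

theorem iota_bar (s t : ℕ) (i : ℕ) (h : i < n) :
    iota s t (bar i h) = bar (i + s) (by omega) := rfl

theorem cr_virtual (i : ℕ) (h : i + 1 < n) : cr .virtual i h = virt i h := rfl

/-- Every braid is a product of crossings and bars. -/
theorem braid_induction {p : STVB n → Prop} (one : p 1)
    (cross : ∀ c i h α, p α → p (cr c i h * α)) (bars : ∀ i h α, p α → p (bar i h * α))
    (α : STVB n) : p α := by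
  induction α using PresentedMonoid.inductionOn with
  | h w =>
    induction w using FreeMonoid.recOn with
    | one => exact one
    | of_mul g w ih =>
      rw [map_mul]
      cases g with
      | sigma e i h => cases e; exacts [cross .backslash i h _ ih, cross .slash i h _ ih]
      | virt i h => exact cross .virtual i h _ ih
      | sing i h => exact cross .singular i h _ ih
      | bar i h => exact bars i h _ ih

end

end STV

namespace STV

/-! ## Reading a braid -/

/-- The letters of Gauss words: `X c a b` is a crossing of the strands named `a`, which enters on
the left, and `b`, which enters on the right; `B a` is a bar on the strand named `a`. -/
inductive Letter : Type
  | X (c : Crossing) (a b : ℕ)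
  | B (a : ℕ)

/-- Renaming the strands of a letter. -/
def Letter.map (f : ℕ → ℕ) : Letter → Letter
  | .X c a b => .X c (f a) (f b)
  | .B a => .B (f a)

/-- `Reads α x w z`: a diagram of the braid `α`, whose strands carry from left to right the names
`x` at the top, meets the non-virtual letters `w` from top to bottom, and carries the names `z` at
the bottom. -/
inductive Reads {n : ℕ} : STVB n → List ℕ → List Letter → List ℕ → Prop
  | one (x : List ℕ) (h : x.length = n) : Reads 1 x [] x
  | virt {l r : List ℕ} {a b : ℕ} {α : STVB n} {w : List Letter} {z : List ℕ}
      (h : l.length + 1 < n) : Reads α (l ++ b :: a :: r) w z →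
      Reads (virt l.length h * α) (l ++ a :: b :: r) w z
  | cross {l r : List ℕ} {a b : ℕ} {c : Crossing} {α : STVB n} {w : List Letter} {z : List ℕ}
      (hc : c ≠ .virtual) (h : l.length + 1 < n) : Reads α (l ++ b :: a :: r) w z →
      Reads (cr c l.length h * α) (l ++ a :: b :: r) (.X c a b :: w) z
  | bar {l r : List ℕ} {a : ℕ} {α : STVB n} {w : List Letter} {z : List ℕ}
      (h : l.length < n) : Reads α (l ++ a :: r) w z →
      Reads (bar l.length h * α) (l ++ a :: r) (.B a :: w) z

namespace Reads

variable {n : ℕ} {α β : STVB n} {x y z : List ℕ} {w w' : List Letter}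

theorem length (h : Reads α x w z) : x.length = n := by
  induction h with
  | one x h => exact h
  | virt _ _ ih => simpa using ih
  | cross _ _ _ ih => simpa using ih
  | bar _ _ ih => exact ih

theorem perm (h : Reads α x w z) : z.Perm x := by
  have sw : ∀ (l r : List ℕ) (a b : ℕ), (l ++ b :: a :: r).Perm (l ++ a :: b :: r) :=
    fun l r a b => (List.Perm.swap a b r).append_left l
  induction h with
  | one x h => exact .refl _
  | virt _ _ ih => exact ih.trans (sw _ _ _ _)
  | cross _ _ _ ih => exact ih.trans (sw _ _ _ _)
  | bar _ _ ih => exact ih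

theorem mul (h : Reads α x w y) (h' : Reads β y w' z) : Reads (α * β) x (w ++ w') z := by
  induction h with
  | one => simpa using h'
  | virt k _ ih => rw [mul_assoc]; exact .virt k (ih h')
  | cross hc k _ ih => rw [mul_assoc]; exact .cross hc k (ih h')
  | bar k _ ih => rw [mul_assoc]; exact .bar k (ih h')

theorem virt_one {l r : List ℕ} {a b i : ℕ} (h : i + 1 < n) (hi : l.length = i)
    (hn : (l ++ a :: b :: r).length = n) :
    Reads (STV.virt i h) (l ++ a :: b :: r) [] (l ++ b :: a :: r) := by
  subst hi
  rw [← mul_one (STV.virt _ h)]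
  exact .virt h (.one _ (by simpa using hn))

theorem cross_one {l r : List ℕ} {a b i : ℕ} {c : Crossing} (hc : c ≠ .virtual) (h : i + 1 < n)
    (hi : l.length = i) (hn : (l ++ a :: b :: r).length = n) :
    Reads (cr c i h) (l ++ a :: b :: r) [.X c a b] (l ++ b :: a :: r) := by
  subst hi
  rw [← mul_one (cr c _ h)]
  exact .cross hc h (.one _ (by simpa using hn))

theorem bar_one {l r : List ℕ} {a i : ℕ} (h : i < n) (hi : l.length = i)
    (hn : (l ++ a :: r).length = n) :
    Reads (STV.bar i h) (l ++ a :: r) [.B a] (l ++ a :: r) := by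
  subst hi
  rw [← mul_one (STV.bar _ h)]
  exact .bar h (.one _ hn)

theorem exists_split {i : ℕ} {x : List ℕ} (h : i + 1 < x.length) :
    ∃ l a b r, x = l ++ a :: b :: r ∧ l.length = i := by
  refine ⟨x.take i, x[i], x[i + 1], x.drop (i + 2), ?_, by simp; omega⟩
  conv_lhs => rw [← List.take_append_drop i x, List.drop_eq_getElem_cons (by omega),
    List.drop_eq_getElem_cons h]

theorem exists_split_one {i : ℕ} {x : List ℕ} (h : i < x.length) :
    ∃ l a r, x = l ++ a :: r ∧ l.length = i := by
  refine ⟨x.take i, x[i], x.drop (i + 1), ?_, by simp; omega⟩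
  conv_lhs => rw [← List.take_append_drop i x, List.drop_eq_getElem_cons h]

theorem iota_right (h : Reads α x w z) (s : ℕ) :
    Reads (iota 0 1 α) (x ++ [s]) w (z ++ [s]) := by
  induction h with
  | one x h => rw [map_one]; exact .one _ (by simp [h])
  | virt k _ ih => rw [map_mul]; simp only [List.append_assoc] at *; exact .virt _ ih
  | cross hc k _ ih =>
    rw [map_mul, iota_cr]; simp only [List.append_assoc] at *; exact .cross hc _ ih
  | bar k _ ih => rw [map_mul]; simp only [List.append_assoc] at *; exact .bar _ ih

theorem iota_left (h : Reads α x w z) (s : ℕ) :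
    Reads (iota 1 0 α) (s :: x) w (s :: z) := by
  induction h with
  | one x h => rw [map_one]; exact .one _ (by simp [h])
  | @virt l _ _ _ _ _ _ k _ ih => rw [map_mul]; exact .virt (l := s :: l) (by simpa using k) ih
  | @cross l _ _ _ _ _ _ _ hc k _ ih =>
    rw [map_mul, iota_cr]; exact .cross (l := s :: l) hc (by simpa using k) ih
  | @bar l _ _ _ _ _ k _ ih => rw [map_mul]; exact .bar (l := s :: l) (by simpa using k) ih

/-- A reading without letters uses virtual crossings only, which brings it into the setting of
`CoxeterRels`. -/
theorem eq_prod (h : Reads α x [] z) : ∃ L : List ℕ, (∀ i ∈ L, i + 1 < n) ∧ z = swaps L x ∧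
    α = (L.map fun i => if h : i + 1 < n then STV.virt i h else 1).prod := by
  generalize hw : ([] : List Letter) = w at h
  induction h with
  | one => exact ⟨[], by simp, rfl, rfl⟩
  | @virt l r a b _ _ _ k _ ih =>
    obtain ⟨L, hL, e, e'⟩ := ih hw
    refine ⟨l.length :: L, ?_, ?_, ?_⟩
    · intro i hi
      rcases List.mem_cons.1 hi with rfl | hi
      exacts [k, hL i hi]
    · rw [e, swaps, swaps, List.foldl_cons, swapAt_append]
    · simp [k, e']
  | cross => simp at hw
  | bar => simp at hw

theorem of_perm {x z : List ℕ} (hp : x.Perm z) : ∀ {n : ℕ}, x.length = n →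
    ∃ α : STVB n, Reads α x [] z := by
  induction hp with
  | nil => intro n hn; exact ⟨1, .one _ hn⟩
  | cons a _ ih =>
    intro n hn
    obtain ⟨m, rfl⟩ : ∃ m, n = m + 1 := ⟨n - 1, by simp at hn; omega⟩
    obtain ⟨α, h⟩ := ih (n := m) (by simpa using hn)
    exact ⟨iota 1 0 α, h.iota_left a⟩
  | swap a b r =>
    intro n hn
    exact ⟨STV.virt 0 (by simp at hn; omega), virt_one (l := []) _ rfl hn⟩
  | trans h₁ _ ih₁ ih₂ =>
    intro n hn
    obtain ⟨α, h⟩ := ih₁ hn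
    obtain ⟨β, h'⟩ := ih₂ (h₁.length_eq ▸ hn)
    exact ⟨α * β, h.mul h'⟩

/-- Distinct names detect the permutation, and the Coxeter presentation does the rest. -/
theorem nil_eq_one (h : Reads α x [] x) (hx : x.Nodup) : α = 1 := by
  obtain ⟨L, hL, e, rfl⟩ := h.eq_prod
  exact coxeterRels_virt.prod_eq_one x h.length hx L hL e.symm

/-- A virtual braid back from `z` to `x` is a right inverse of the first braid and a left inverse of
the second. -/
theorem nil_unique (h : Reads α x [] z) (h' : Reads β x [] z) (hx : x.Nodup) : α = β := by
  obtain ⟨γ, hγ⟩ := of_perm h.perm (h.perm.length_eq.trans h.length)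
  exact left_inv_eq_right_inv ((h.mul hγ).nil_eq_one hx)
    ((hγ.mul h').nil_eq_one (h.perm.nodup_iff.2 hx))

theorem nil_inv (h : Reads α x [] z) (hx : x.Nodup) :
    ∃ β, Reads β z [] x ∧ α * β = 1 ∧ β * α = 1 := by
  obtain ⟨γ, hγ⟩ := of_perm h.perm (h.perm.length_eq.trans h.length)
  exact ⟨γ, hγ, (h.mul hγ).nil_eq_one hx, (hγ.mul h).nil_eq_one (h.perm.nodup_iff.2 hx)⟩

/-- The renaming need not be injective: a reading carries names along and never compares them. Cuts
and rotations of codes depend on this. -/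
theorem map (h : Reads α x w z) (f : ℕ → ℕ) :
    Reads α (x.map f) (w.map (Letter.map f)) (z.map f) := by
  induction h with
  | one x hx => exact .one _ (by simpa using hx)
  | virt k _ ih =>
    have k' := k
    rw [← List.length_map f] at k'
    simp only [List.map_append, List.map_cons] at ih ⊢
    simpa only [List.length_map] using Reads.virt k' ih
  | cross hc k _ ih =>
    have k' := k
    rw [← List.length_map f] at k'
    simp only [List.map_append, List.map_cons] at ih ⊢
    simpa only [List.length_map, Letter.map] using Reads.cross hc k' ih
  | bar k _ ih =>
    have k' := k
    rw [← List.length_map f] at k'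
    simp only [List.map_append, List.map_cons] at ih ⊢
    simpa only [List.length_map, Letter.map] using Reads.bar k' ih

end Reads

end STV

/-! ### Single letters, and the uniqueness of the braid with a given reading. -/

namespace STV

namespace Reads

/-- `Single x l E`: the braid `E` reads only the letter `l` and is conjugate by a permutation of the
strands `x` to a braid with one crossing or bar on the left. -/
def Single {n : ℕ} (x : List ℕ) (E : STVB n) : Letter → Prop
  | .X c a b => c ≠ .virtual ∧ ∃ (p q : STVB n) (r : List ℕ) (h : 0 + 1 < n),
      Reads p x [] (a :: b :: r) ∧ Reads q (b :: a :: r) [] x ∧ E = p * cr c 0 h * q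
  | .B a => ∃ (p q : STVB n) (r : List ℕ) (h : 0 < n),
      Reads p x [] (a :: r) ∧ Reads q (a :: r) [] x ∧ E = p * STV.bar 0 h * q

variable {n : ℕ} {α β : STVB n} {x y z : List ℕ} {w w' : List Letter} {E E' : STVB n}
  {l : Letter}

/-- The crossing uses the first two strands and the virtual braid the others, so they commute by the
far relations. -/
theorem iota_comm_cr {m : ℕ} {β : STVB m} {r r' : List ℕ} (h : Reads β r [] r') (c : Crossing)
    (k : 0 + 1 < m + 2) :
    cr c 0 k * iota 1 0 (iota 1 0 β) = iota 1 0 (iota 1 0 β) * cr c 0 k := by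
  generalize hw : ([] : List Letter) = w at h
  induction h with
  | one => simp only [map_one, mul_one, one_mul]
  | virt k' _ ih =>
    simp only [map_mul, iota_virt]
    rw [← mul_assoc]
    erw [← cr_virtual, cr_cr_far c .virtual 0 _ _ _ (Or.inl (by omega))]
    rw [mul_assoc]
    erw [ih hw]
    rw [mul_assoc]
  | cross => simp at hw
  | bar => simp at hw

theorem iota_comm_bar {m : ℕ} {β : STVB m} {r r' : List ℕ} (h : Reads β r [] r')
    (k : 0 < m + 1) :
    STV.bar 0 k * iota 1 0 β = iota 1 0 β * STV.bar 0 k := by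
  generalize hw : ([] : List Letter) = w at h
  induction h with
  | one => simp only [map_one, mul_one, one_mul]
  | virt k' _ ih =>
    simp only [map_mul, iota_virt]
    rw [← mul_assoc]
    erw [← cr_virtual, ← cr_bar_far .virtual _ 0 _ _ (by omega) (by omega)]
    rw [mul_assoc]
    erw [ih hw]
    rw [mul_assoc]
  | cross => simp at hw
  | bar => simp at hw

/-- The rows in which the letter is brought to the left differ only in the order of the remaining
strands. A virtual braid `β` on these relates both pairs of outer factors, and it commutes with the
letter in the middle. -/
theorem Single.unique (hx : x.Nodup) (h : Single x E l) (h' : Single x E' l) : E = E' := by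
  cases l with
  | X c a b =>
    obtain ⟨-, p, q, r, k, hp, hq, rfl⟩ := h
    obtain ⟨-, p', q', r', k', hp', hq', rfl⟩ := h'
    have hl := hp.perm.length_eq.trans hp.length
    obtain ⟨m, rfl⟩ : ∃ m, n = m + 2 := ⟨n - 2, by omega⟩
    have hr : r.Perm r' := ((hp.perm.trans hp'.perm.symm).cons_inv).cons_inv
    obtain ⟨β, hβ⟩ := of_perm hr (n := m) (by simpa using hl)
    -- Both identities compare purely virtual braids with the same effect on names.
    have e₁ : p' = p * iota 1 0 (iota 1 0 β) :=
      hp'.nil_unique (hp.mul ((hβ.iota_left b).iota_left a)) hx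
    have e₂ : q = iota 1 0 (iota 1 0 β) * q' :=
      hq.nil_unique (((hβ.iota_left a).iota_left b).mul hq') (hq.perm.nodup_iff.1 hx)
    rw [e₁, e₂, ← mul_assoc, mul_assoc p, mul_assoc p, hβ.iota_comm_cr]
    simp only [mul_assoc]
  | B a =>
    obtain ⟨p, q, r, k, hp, hq, rfl⟩ := h
    obtain ⟨p', q', r', k', hp', hq', rfl⟩ := h'
    have hl := hp.perm.length_eq.trans hp.length
    obtain ⟨m, rfl⟩ : ∃ m, n = m + 1 := ⟨n - 1, by omega⟩
    have hr : r.Perm r' := (hp.perm.trans hp'.perm.symm).cons_inv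
    obtain ⟨β, hβ⟩ := of_perm hr (n := m) (by simpa using hl)
    have e₁ : p' = p * iota 1 0 β := hp'.nil_unique (hp.mul (hβ.iota_left a)) hx
    have e₂ : q = iota 1 0 β * q' := hq.nil_unique ((hβ.iota_left a).mul hq')
      (hq.perm.nodup_iff.1 hx)
    rw [e₁, e₂, ← mul_assoc, mul_assoc p, mul_assoc p, hβ.iota_comm_bar]
    simp only [mul_assoc]

/-- The virtual crossing behind `cr c i` restores the order of the strands. A crossing further to
the right is conjugated by virtual crossings one place to the left. -/
theorem single_cross {l r : List ℕ} {a b i : ℕ} {c : Crossing} (hc : c ≠ .virtual)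
    (h : i + 1 < n) (hi : l.length = i) (hn : (l ++ a :: b :: r).length = n) :
    Single (l ++ a :: b :: r) (cr c i h * STV.virt i h) (.X c a b) := by
  refine ⟨hc, ?_⟩
  induction i generalizing l r with
  | zero =>
    obtain rfl := List.length_eq_zero_iff.1 hi
    exact ⟨1, STV.virt 0 h, r, h, .one _ hn, virt_one (l := []) h rfl (by simpa using hn),
      by rw [one_mul]⟩
  | succ i ih =>
    obtain ⟨l, d, rfl⟩ : ∃ l' d, l = l' ++ [d] :=
      ⟨_, _, (List.dropLast_append_getLast (by rintro rfl; simp at hi)).symm⟩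
    simp only [List.append_assoc, List.singleton_append] at hn ⊢
    have h0 : i + 1 < n := by omega
    have hi' : l.length = i := by simpa using hi
    have hn' : (l ++ a :: b :: d :: r).length = n := by simpa using hn
    obtain ⟨p, q, s, k, hp, hq, e⟩ := ih h0 hi' hn'
    have h₁ : Reads (STV.virt i h0) (l ++ d :: a :: b :: r) [] (l ++ a :: d :: b :: r) :=
      virt_one _ hi' (by simpa using hn)
    have h₂ : Reads (STV.virt (i + 1) h) ((l ++ [a]) ++ d :: b :: r) []
        ((l ++ [a]) ++ b :: d :: r) := virt_one _ (by simp [hi']) (by simpa using hn)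
    have h₃ : Reads (STV.virt (i + 1) h) ((l ++ [a]) ++ b :: d :: r) []
        ((l ++ [a]) ++ d :: b :: r) := virt_one _ (by simp [hi']) (by simpa using hn)
    have h₄ : Reads (STV.virt i h0) (l ++ a :: d :: b :: r) [] (l ++ d :: a :: b :: r) :=
      virt_one _ hi' (by simpa using hn)
    simp only [List.append_assoc, List.singleton_append] at h₂ h₃
    refine ⟨_, _, s, k, (h₁.mul h₂).mul hp, hq.mul (h₃.mul h₄), ?_⟩
    have e' : cr c i h0 = p * cr c 0 k * q * STV.virt i h0 := by
      rw [← e, mul_assoc, virt_sq, mul_one]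
    have b := virt_braid i h0 h
    have e'' : STV.virt (i + 1) h * STV.virt i h0 * STV.virt (i + 1) h =
        STV.virt i h0 * STV.virt (i + 1) h * STV.virt i h0 := b.symm
    calc cr c (i + 1) h * STV.virt (i + 1) h
        = STV.virt i h0 * STV.virt (i + 1) h * cr c i h0 *
          (STV.virt (i + 1) h * STV.virt i h0 * STV.virt (i + 1) h) := by
          rw [cr_succ c i h0 h]; simp only [mul_assoc]
      _ = STV.virt i h0 * STV.virt (i + 1) h * (p * cr c 0 k * q) *
          (STV.virt i h0 * STV.virt i h0) * (STV.virt (i + 1) h *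
            STV.virt i h0) := by rw [e'', e']; simp only [mul_assoc]
      _ = _ := by rw [virt_sq, mul_one]; simp only [mul_assoc]

theorem single_bar {l r : List ℕ} {a i : ℕ} (h : i < n) (hi : l.length = i)
    (hn : (l ++ a :: r).length = n) :
    Single (l ++ a :: r) (STV.bar i h) (.B a) := by
  induction i generalizing l r with
  | zero =>
    obtain rfl := List.length_eq_zero_iff.1 hi
    exact ⟨1, 1, r, h, .one _ hn, .one _ hn, by rw [one_mul, mul_one]⟩
  | succ i ih =>
    obtain ⟨l, d, rfl⟩ : ∃ l' d, l = l' ++ [d] :=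
      ⟨_, _, (List.dropLast_append_getLast (by rintro rfl; simp at hi)).symm⟩
    simp only [List.append_assoc, List.singleton_append] at hn ⊢
    have hi' : l.length = i := by simpa using hi
    have hn' : (l ++ a :: d :: r).length = n := by simpa using hn
    obtain ⟨p, q, s, k, hp, hq, e⟩ := ih (by omega) hi' hn'
    have h₁ : Reads (STV.virt i h) (l ++ d :: a :: r) [] (l ++ a :: d :: r) :=
      virt_one _ hi' hn
    have h₂ : Reads (STV.virt i h) (l ++ a :: d :: r) [] (l ++ d :: a :: r) :=
      virt_one _ hi' hn'
    refine ⟨_, _, s, k, h₁.mul hp, hq.mul h₂, ?_⟩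
    rw [bar_succ i (by omega) h, e]
    simp only [mul_assoc]

/-- The first letter can be pulled out of any braid that reads it, at the cost of virtual crossings
only. The factor so obtained leaves the row unchanged, and the remainder starts from the same row.
-/
theorem cons_split (h : Reads α x (l :: w) z) :
    ∃ E β, Single x E l ∧ Reads β x w z ∧ α = E * β := by
  generalize hv : l :: w = v at h
  induction h with
  | one => simp at hv
  | @virt m r a b α v z k hα ih =>
    obtain ⟨E, β, hE, hβ, rfl⟩ := ih hv
    have hn := hα.length
    have h₁ : Reads (STV.virt m.length k) (m ++ a :: b :: r) [] (m ++ b :: a :: r) :=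
      virt_one k rfl (by simpa using hn)
    have h₂ : Reads (STV.virt m.length k) (m ++ b :: a :: r) [] (m ++ a :: b :: r) :=
      virt_one k rfl hn
    -- The leading virtual crossing conjugates the factor; its second copy is absorbed by the
    -- remainder because its square is trivial.
    refine ⟨STV.virt m.length k * E * STV.virt m.length k, STV.virt m.length k * β, ?_,
      h₁.mul hβ, ?_⟩
    · cases l with
      | X c d e =>
        obtain ⟨hc, p, q, s, k', hp, hq, rfl⟩ := hE
        exact ⟨hc, _, _, s, k', h₁.mul hp, hq.mul h₂, by simp only [mul_assoc]⟩
      | B d =>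
        obtain ⟨p, q, s, k', hp, hq, rfl⟩ := hE
        exact ⟨_, _, s, k', h₁.mul hp, hq.mul h₂, by simp only [mul_assoc]⟩
    · calc STV.virt m.length k * (E * β)
          = STV.virt m.length k * E * 1 * β := by simp only [mul_assoc, one_mul]
        _ = _ := by rw [← virt_sq _ k]; simp only [mul_assoc]
  | @cross m r a b c α v z hc k hα ih =>
    obtain ⟨rfl, rfl⟩ := List.cons.inj hv
    have hn := hα.length
    have h₁ : Reads (STV.virt m.length k) (m ++ a :: b :: r) [] (m ++ b :: a :: r) :=
      virt_one k rfl (by simpa using hn)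
    refine ⟨_, _, single_cross hc k rfl (by simpa using hn), h₁.mul hα, ?_⟩
    rw [mul_assoc, ← mul_assoc (STV.virt _ _), virt_sq, one_mul]
  | @bar m r a α v z k hα ih =>
    obtain ⟨rfl, rfl⟩ := List.cons.inj hv
    exact ⟨_, _, single_bar k rfl hα.length, hα, rfl⟩

/-- A braid is determined by its reading. -/
theorem unique (h : Reads α x w z) (h' : Reads β x w z) (hx : x.Nodup) : α = β := by
  induction w generalizing α β with
  | nil => exact h.nil_unique h' hx
  | cons l w ih =>
    obtain ⟨E, γ, hE, hγ, rfl⟩ := h.cons_split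
    obtain ⟨E', γ', hE', hγ', rfl⟩ := h'.cons_split
    rw [hE.unique hx hE', ih hγ hγ']

theorem Single.reads (h : Single x E l) : Reads E x [l] x := by
  cases l with
  | X c a b =>
    obtain ⟨hc, p, q, r, k, hp, hq, rfl⟩ := h
    exact (hp.mul (cross_one (l := []) hc k rfl (hp.perm.length_eq.trans hp.length))).mul hq
  | B a =>
    obtain ⟨p, q, r, k, hp, hq, rfl⟩ := h
    exact (hp.mul (bar_one (l := []) k rfl (hp.perm.length_eq.trans hp.length))).mul hq

theorem append_split (h : Reads α x (w ++ w') z) :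
    ∃ β γ, Reads β x w x ∧ Reads γ x w' z ∧ α = β * γ := by
  induction w generalizing α with
  | nil => exact ⟨1, α, .one _ h.length, h, (one_mul _).symm⟩
  | cons l w ih =>
    obtain ⟨E, γ, hE, hγ, rfl⟩ := h.cons_split
    obtain ⟨β, δ, hβ, hδ, rfl⟩ := ih hγ
    exact ⟨E * β, δ, hE.reads.mul hβ, hδ, (mul_assoc _ _ _).symm⟩

/-- A letter that makes sense on the strands `x`. -/
def _root_.STV.Letter.Good (x : List ℕ) : Letter → Prop
  | .X c a b => c ≠ .virtual ∧ a ≠ b ∧ a ∈ x ∧ b ∈ x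
  | .B a => a ∈ x

theorem exists_single (hn : x.length = n) (hl : l.Good x) :
    ∃ E : STVB n, Single x E l := by
  have h2 : ∀ a b, a ≠ b → a ∈ x → b ∈ x → x.Perm (a :: b :: (x.erase a).erase b) :=
    fun a b hab ha hb => (List.perm_cons_erase ha).trans
      ((List.perm_cons_erase ((List.mem_erase_of_ne hab.symm).2 hb)).cons a)
  cases l with
  | X c a b =>
    obtain ⟨hc, hab, ha, hb⟩ := hl
    have hp := h2 a b hab ha hb
    obtain ⟨p, hp'⟩ := of_perm hp hn
    obtain ⟨q, hq⟩ := of_perm (hp.trans (.swap b a _)).symm (n := n)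
      (by rw [← hn, hp.length_eq]; simp)
    have := hp.length_eq
    exact ⟨_, hc, p, q, _, by simp at this; omega, hp', hq, rfl⟩
  | B a =>
    have hp := List.perm_cons_erase hl
    obtain ⟨p, hp'⟩ := of_perm hp hn
    obtain ⟨q, hq⟩ := of_perm hp.symm (n := n) (by rw [← hn, hp.length_eq])
    have := hp.length_eq
    exact ⟨_, p, q, _, by simp at this; omega, hp', hq, rfl⟩

/-- For each letter, virtual crossings bring its strands to the far left and back again. -/
theorem exists_of_good (hn : x.length = n) (hz : x.Perm z)
    (hw : ∀ l ∈ w, Letter.Good x l) : ∃ α : STVB n, Reads α x w z := by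
  induction w with
  | nil => exact of_perm hz hn
  | cons l w ih =>
    obtain ⟨E, hE⟩ := exists_single (n := n) hn (hw l (by simp))
    obtain ⟨β, hβ⟩ := ih fun m hm => hw m (by simp [hm])
    exact ⟨_, hE.reads.mul hβ⟩

end Reads

end STV

namespace STV

/-! ## Gauss codes -/

theorem MarkovEquiv.symm {p q : STVBInfty} (h : MarkovEquiv p q) : MarkovEquiv q p :=
  Relation.EqvGen.symm _ _ h

theorem MarkovEquiv.trans {p q r : STVBInfty} (h : MarkovEquiv p q) (h' : MarkovEquiv q r) :
    MarkovEquiv p r := Relation.EqvGen.trans _ _ _ h h'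

theorem MarkovMove.equiv {p q : STVBInfty} (h : MarkovMove p q) : MarkovEquiv p q := .rel _ _ h

theorem MarkovEquiv.conj {n : ℕ} (g α : STVB (n + 1)) :
    MarkovEquiv ⟨n, g * α⟩ ⟨n, α * g⟩ := by
  induction g using braid_induction generalizing α with
  | one => rw [one_mul, mul_one]; exact .refl _
  | cross c i h g ih =>
    have k : MarkovEquiv ⟨n, cr c i h * (g * α)⟩ ⟨n, g * α * cr c i h⟩ := by
      cases c with
      | slash => exact (MarkovMove.real_conj true i h _).equiv
      | backslash => exact (MarkovMove.real_conj false i h _).equiv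
      | virtual => exact (MarkovMove.virt_conj i h _).equiv
      | singular => exact (MarkovMove.sing_conj i h _).equiv
    rw [← mul_assoc, mul_assoc g] at k
    rw [← mul_assoc α]
    exact k.trans (ih _)
  | bars i h g ih =>
    have k := (MarkovMove.twist_conj i h (g * α)).equiv
    rw [← mul_assoc, mul_assoc g] at k
    rw [← mul_assoc α]
    exact k.trans (ih _)

/-- A Gauss code: a Gauss word, and the links, that is, the pairs `(a, b)` such that the end of the
strand `a` is joined to the beginning of the strand `b`. -/
abbrev Code : Type := List Letter × List (ℕ × ℕ)

namespace Code

/-- `C.Rep q`: the closure of the braid `q` has the Gauss code `C`. -/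
def Rep (C : Code) (q : STVBInfty) : Prop :=
  Reads q.2 (C.2.map Prod.snd) C.1 (C.2.map Prod.fst)

/-- The codes of non-empty closed diagrams. -/
structure WF (C : Code) : Prop where
  ne : C.2 ≠ []
  nodup : (C.2.map Prod.fst).Nodup
  perm : (C.2.map Prod.fst).Perm (C.2.map Prod.snd)
  good : ∀ l ∈ C.1, l.Good (C.2.map Prod.fst)

theorem _root_.STV.Letter.Good.mono {l : Letter} {x y : List ℕ} (h : l.Good x) (hs : x ⊆ y) :
    l.Good y := by
  cases l with
  | X c a b => exact ⟨h.1, h.2.1, hs h.2.2.1, hs h.2.2.2⟩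
  | B a => exact hs h

theorem WF.nodup_snd {C : Code} (h : C.WF) : (C.2.map Prod.snd).Nodup :=
  h.perm.nodup_iff.1 h.nodup

theorem WF.exists_rep {C : Code} (h : C.WF) : ∃ q, C.Rep q := by
  obtain ⟨n, hn⟩ : ∃ n, (C.2.map Prod.snd).length = n + 1 :=
    ⟨C.2.length - 1, by have := List.length_pos_iff.2 h.ne; simp; omega⟩
  obtain ⟨α, hα⟩ := Reads.exists_of_good hn h.perm.symm fun l hl =>
    (h.good l hl).mono h.perm.subset
  exact ⟨⟨n, α⟩, hα⟩

/-- The degree is the number of links, and the braid is then determined by its reading because the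
names at the top are distinct. -/
theorem WF.rep_unique {C : Code} (h : C.WF) {p q : STVBInfty} (hp : C.Rep p) (hq : C.Rep q) :
    p = q := by
  obtain ⟨m, α⟩ := p
  obtain ⟨n, β⟩ := q
  have hm := Reads.length hp
  have hn := Reads.length hq
  obtain rfl : m = n := by simp only at hm hn; omega
  have e : α = β := Reads.unique hp hq h.nodup_snd
  rw [e]

/-- The codes `C` and `D` are codes of closures of Markov equivalent braids. -/
def Sim (C D : Code) : Prop :=
  C.WF ∧ D.WF ∧ ∃ p q, C.Rep p ∧ D.Rep q ∧ MarkovEquiv p q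

theorem Sim.symm {C D : Code} (h : C.Sim D) : D.Sim C := by
  obtain ⟨h₁, h₂, p, q, hp, hq, e⟩ := h
  exact ⟨h₂, h₁, q, p, hq, hp, e.symm⟩

/-- The two braids given for the middle code coincide, because a code determines its braid. -/
theorem Sim.trans {C D E : Code} (h : C.Sim D) (h' : D.Sim E) : C.Sim E := by
  obtain ⟨h₁, h₂, p, q, hp, hq, e⟩ := h
  obtain ⟨-, h₃, p', q', hp', hq', e'⟩ := h'
  obtain rfl := h₂.rep_unique hq hp'
  exact ⟨h₁, h₃, p, q', hp, hq', e.trans e'⟩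

theorem Sim.equiv {C D : Code} (h : C.Sim D) {p q : STVBInfty} (hp : C.Rep p) (hq : D.Rep q) :
    MarkovEquiv p q := by
  obtain ⟨h₁, h₂, p', q', hp', hq', e⟩ := h
  obtain rfl := h₁.rep_unique hp hp'
  obtain rfl := h₂.rep_unique hq hq'
  exact e

theorem WF.sim {C : Code} (h : C.WF) : C.Sim C := by
  obtain ⟨q, hq⟩ := h.exists_rep
  exact ⟨h, h, q, q, hq, hq, .refl _⟩

instance : Trans Sim Sim Sim := ⟨Sim.trans⟩

/-- One virtual braid has to permute the beginnings and the ends of the links in the same way, so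
the labels `f` are chosen after the braid. -/
theorem reads_of_perm {ℓ ℓ' : List (ℕ × ℕ)} (hp : ℓ.Perm ℓ') : ∀ {n : ℕ}, ℓ.length = n →
    ∃ α : STVB n, ∀ f : ℕ × ℕ → ℕ, Reads α (ℓ.map f) [] (ℓ'.map f) := by
  induction hp with
  | nil => intro n hn; exact ⟨1, fun f => .one _ hn⟩
  | cons a _ ih =>
    intro n hn
    obtain ⟨m, rfl⟩ : ∃ m, n = m + 1 := ⟨n - 1, by simp at hn; omega⟩
    obtain ⟨α, h⟩ := ih (n := m) (by simpa using hn)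
    exact ⟨iota 1 0 α, fun f => (h f).iota_left (f a)⟩
  | swap a b r =>
    intro n hn
    exact ⟨STV.virt 0 (by simp at hn; omega), fun f =>
      Reads.virt_one (l := []) _ rfl (by simpa using hn)⟩
  | trans h₁ _ ih₁ ih₂ =>
    intro n hn
    obtain ⟨α, h⟩ := ih₁ hn
    obtain ⟨β, h'⟩ := ih₂ (h₁.length_eq ▸ hn)
    exact ⟨α * β, fun f => (h f).mul (h' f)⟩

theorem WF.of_perm {w : List Letter} {ℓ ℓ' : List (ℕ × ℕ)} (hp : ℓ.Perm ℓ') (h : WF (w, ℓ)) :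
    WF (w, ℓ') where
  ne e := h.ne (by simp only at e; subst e; exact hp.eq_nil)
  nodup := (hp.map _).nodup_iff.1 h.nodup
  perm := (hp.map _).symm.trans (h.perm.trans (hp.map _))
  good l hl := (h.good l hl).mono (hp.map _).subset

/-- The order of the links is immaterial. -/
theorem WF.sim_perm {w : List Letter} {ℓ ℓ' : List (ℕ × ℕ)} (h : WF (w, ℓ)) (hp : ℓ.Perm ℓ') :
    Sim (w, ℓ) (w, ℓ') := by
  have h' := h.of_perm hp
  obtain ⟨⟨n, α⟩, hq⟩ := h.exists_rep
  have hn : ℓ.length = n + 1 := by simpa using hq.length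
  obtain ⟨β, hβ⟩ := reads_of_perm hp hn
  obtain ⟨γ, hγ, e₁, e₂⟩ := (hβ Prod.snd).nil_inv h.nodup_snd
  -- The braid of the permuted code is the conjugate of `α` by the virtual braid `β`.
  refine ⟨h, h', ⟨n, α⟩, ⟨n, γ * (α * β)⟩, hq, ?_, ?_⟩
  · have := hγ.mul (hq.mul (hβ Prod.fst))
    simpa [Rep] using this
  · have := MarkovEquiv.conj γ (α * β)
    rw [mul_assoc α, e₁, mul_one] at this
    exact this.symm

theorem sim_of_perm {C : Code} {w : List Letter} {ℓ ℓ' : List (ℕ × ℕ)} (hp : ℓ.Perm ℓ')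
    (h : C.Sim (w, ℓ)) : C.Sim (w, ℓ') := h.trans (h.2.1.sim_perm hp)

/-- Two Gauss words on the strands `x` are read from the same braids. -/
def _root_.STV.LEq (x : List ℕ) (u v : List Letter) : Prop :=
  ∀ ⦃n : ℕ⦄ (α : STVB n) (z : List ℕ), Reads α x u z ↔ Reads α x v z

theorem _root_.STV.LEq.refl (x : List ℕ) (u : List Letter) : LEq x u u := fun _ _ _ => .rfl

theorem _root_.STV.LEq.symm {x : List ℕ} {u v : List Letter} (h : LEq x u v) : LEq x v u :=
  fun _ α z => (h α z).symm

theorem _root_.STV.LEq.trans {x : List ℕ} {u v w : List Letter} (h : LEq x u v)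
    (h' : LEq x v w) : LEq x u w := fun _ α z => (h α z).trans (h' α z)

theorem _root_.STV.LEq.append {x : List ℕ} {u v u' v' : List Letter} (h : LEq x u v)
    (h' : LEq x u' v') : LEq x (u ++ u') (v ++ v') := by
  intro n α z
  constructor
  · intro k
    obtain ⟨β, γ, hβ, hγ, rfl⟩ := k.append_split
    exact ((h _ _).1 hβ).mul ((h' _ _).1 hγ)
  · intro k
    obtain ⟨β, γ, hβ, hγ, rfl⟩ := k.append_split
    exact ((h _ _).2 hβ).mul ((h' _ _).2 hγ)

theorem _root_.STV.LEq.left (w : List Letter) {x : List ℕ} {u v : List Letter} (h : LEq x u v) :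
    LEq x (w ++ u) (w ++ v) := (LEq.refl x w).append h

theorem _root_.STV.LEq.right (w : List Letter) {x : List ℕ} {u v : List Letter} (h : LEq x u v) :
    LEq x (u ++ w) (v ++ w) := h.append (LEq.refl x w)

/-- A relation between words can be verified on one braid with the strands concerned in a convenient
order: by `Reads.unique`, every other braid that reads one of the words differs from it by virtual
factors on both sides. -/
theorem _root_.STV.LEq.of_reads {n : ℕ} {α : STVB n} {x y z : List ℕ} {u v : List Letter}
    (hx : x.Nodup) (hp : x.Perm y) (hu : Reads α y u z) (hv : Reads α y v z) : LEq x u v := by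
  have key : ∀ (u v : List Letter), Reads α y u z → Reads α y v z → ∀ ⦃m : ℕ⦄ (β : STVB m) t,
      Reads β x u t → Reads β x v t := by
    intro u v hu hv m β t hβ
    obtain rfl : m = n := by rw [← hβ.length, ← hu.length, hp.length_eq]
    obtain ⟨p, hp'⟩ := Reads.of_perm hp hβ.length
    obtain ⟨q, hq⟩ := Reads.of_perm ((hu.perm.trans hp.symm).trans hβ.perm.symm)
      (hu.perm.length_eq.trans hu.length)
    have e : β = p * α * q := hβ.unique (by simpa using (hp'.mul hu).mul hq) hx
    rw [e]
    simpa using (hp'.mul hv).mul hq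
  exact fun m β t => ⟨key u v hu hv β t, key v u hv hu β t⟩

theorem _root_.STV.Reads.good {n : ℕ} {α : STVB n} {x z : List ℕ} {w : List Letter}
    (h : Reads α x w z) (hx : x.Nodup) : ∀ l ∈ w, l.Good x := by
  induction w generalizing α with
  | nil => simp
  | cons l w ih =>
    obtain ⟨E, β, hE, hβ, rfl⟩ := h.cons_split
    intro m hm
    rcases List.mem_cons.1 hm with rfl | hm
    · cases m with
      | X c a b =>
        obtain ⟨hc, p, q, r, k, hp, hq, rfl⟩ := hE
        have hn := hp.perm.nodup_iff.2 hx
        have hs := hp.perm.subset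
        exact ⟨hc, by simp at hn; tauto, hs (by simp), hs (by simp)⟩
      | B a =>
        obtain ⟨p, q, r, k, hp, hq, rfl⟩ := hE
        exact hp.perm.subset (by simp)
    · exact ih hβ m hm

theorem WF.sim_letters {w w' : List Letter} {ℓ : List (ℕ × ℕ)} (h : WF (w, ℓ))
    (e : LEq (ℓ.map Prod.snd) w w') : Sim (w, ℓ) (w', ℓ) := by
  obtain ⟨q, hq⟩ := h.exists_rep
  have hq' : Rep (w', ℓ) q := (e _ _).1 hq
  exact ⟨h, ⟨h.ne, h.nodup, h.perm, fun l hl =>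
    (Reads.good hq' h.nodup_snd l hl).mono h.perm.symm.subset⟩, q, q, hq, hq', .refl _⟩

theorem WF.of_rep {w w' : List Letter} {ℓ : List (ℕ × ℕ)} (h : WF (w, ℓ)) {q : STVBInfty}
    (hq : Rep (w', ℓ) q) : WF (w', ℓ) :=
  ⟨h.ne, h.nodup, h.perm, fun l hl =>
    (Reads.good hq h.nodup_snd l hl).mono h.perm.symm.subset⟩

/-- A final part of the word can be moved to the beginning. -/
theorem WF.sim_rotate {w w' : List Letter} {ℓ : List (ℕ × ℕ)} (h : WF (w ++ w', ℓ)) {f : ℕ → ℕ}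
    (hf : ∀ p ∈ ℓ, f p.1 = p.2) : Sim (w ++ w', ℓ) (w'.map (Letter.map f) ++ w, ℓ) := by
  obtain ⟨⟨n, α⟩, hq⟩ := h.exists_rep
  have hq : Reads α (ℓ.map Prod.snd) (w ++ w') (ℓ.map Prod.fst) := hq
  obtain ⟨β, γ, hβ, hγ, rfl⟩ := hq.append_split
  -- With `p` from the top names to the bottom names, `β * γ` is the product of `β * p` and `p' *
  -- γ`, where `p'` is the inverse of `p`. Exchanging the factors is a conjugation, and the second
  -- factor, which starts from the bottom names, is renamed along the links.
  obtain ⟨p, hp⟩ := Reads.of_perm h.perm.symm hγ.length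
  obtain ⟨p', hp', e, -⟩ := hp.nil_inv h.nodup_snd
  have e' : (ℓ.map Prod.fst).map f = ℓ.map Prod.snd := by
    rw [List.map_map]; exact List.map_congr_left hf
  have h₁ := hβ.mul hp
  have h₂ := (hp'.mul hγ).map f
  rw [e'] at h₂
  have h₃ := h₂.mul h₁
  simp only [List.append_nil, List.nil_append] at h₃
  refine ⟨h, h.of_rep (q := ⟨n, _⟩) h₃, ⟨n, β * γ⟩, ⟨n, _⟩, hq, h₃, ?_⟩
  have := MarkovEquiv.conj (p' * γ) (β * p)
  rw [mul_assoc β, ← mul_assoc p, e, one_mul] at this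
  exact this.symm

/-- The names that occur in a letter. -/
def _root_.STV.Letter.names : Letter → List ℕ
  | .X _ a b => [a, b]
  | .B a => [a]

/-- The names that occur in a word. -/
def _root_.STV.names (w : List Letter) : List ℕ := w.flatMap Letter.names

theorem _root_.STV.names_append (w w' : List Letter) : names (w ++ w') = names w ++ names w' :=
  List.flatMap_append

@[simp]
theorem _root_.STV.names_nil : names [] = [] := rfl

@[simp]
theorem _root_.STV.names_cons (l : Letter) (w : List Letter) :
    names (l :: w) = l.names ++ names w := rfl

theorem _root_.STV.Letter.map_congr {l : Letter} {f g : ℕ → ℕ} (h : ∀ a ∈ l.names, f a = g a) :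
    l.map f = l.map g := by
  cases l <;> simp [Letter.names, Letter.map] at h ⊢
  exacts [h, h]

theorem _root_.STV.map_letters_congr {w : List Letter} {f g : ℕ → ℕ}
    (h : ∀ a ∈ names w, f a = g a) : w.map (Letter.map f) = w.map (Letter.map g) :=
  List.map_congr_left fun l hl => Letter.map_congr fun a ha =>
    h a (List.mem_flatMap.2 ⟨l, hl, ha⟩)

theorem WF.names_subset {w : List Letter} {ℓ : List (ℕ × ℕ)} (h : WF (w, ℓ)) :
    names w ⊆ ℓ.map Prod.fst := by
  intro a ha
  obtain ⟨l, hl, ha⟩ := List.mem_flatMap.1 ha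
  have := h.good l hl
  cases l with
  | X c b d =>
    simp only [Letter.names, List.mem_cons, List.not_mem_nil, or_false] at ha
    rcases ha with rfl | rfl
    exacts [this.2.2.1, this.2.2.2]
  | B b =>
    simp only [Letter.names, List.mem_cons, List.not_mem_nil, or_false] at ha
    subst ha; exact this

theorem WF.stab {w : List Letter} {ℓ : List (ℕ × ℕ)} {a y s : ℕ} (h : WF (w, (a, y) :: ℓ))
    (hs : s ∉ ((a, y) :: ℓ).map Prod.fst) : WF (w, (a, s) :: (s, y) :: ℓ) where
  ne := by simp
  nodup := by
    have := h.nodup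
    simp only [List.map_cons, List.nodup_cons, List.mem_cons, not_or] at this hs ⊢
    exact ⟨⟨fun e => hs.1 e.symm, this.1⟩, hs.2, this.2⟩
  perm := by
    have := h.perm
    simp only [List.map_cons] at this ⊢
    exact (List.Perm.swap _ _ _).trans (this.cons s)
  good l hl := (h.good l hl).mono (by intro b; simp; tauto)

/-- The letters that are read at a crossing. -/
def _root_.STV.crWord : Crossing → ℕ → ℕ → List Letter
  | .virtual, _, _ => []
  | c, a, b => [.X c a b]

theorem _root_.STV.crWord_of_ne {c : Crossing} (hc : c ≠ .virtual) (a b : ℕ) :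
    crWord c a b = [.X c a b] := by
  cases c <;> first | rfl | exact absurd rfl hc

theorem _root_.STV.Reads.cr_one {n : ℕ} {l r : List ℕ} {a b i : ℕ} (c : Crossing) (h : i + 1 < n)
    (hi : l.length = i) (hn : (l ++ a :: b :: r).length = n) :
    Reads (cr c i h) (l ++ a :: b :: r) (crWord c a b) (l ++ b :: a :: r) := by
  cases c with
  | virtual => exact Reads.virt_one h hi hn
  | _ => exact Reads.cross_one (by simp) h hi hn

/-- Virtual and real stabilization. -/
theorem WF.sim_stab {w : List Letter} {ℓ : List (ℕ × ℕ)} {a y s : ℕ} (h : WF (w, (a, y) :: ℓ))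
    (hs : s ∉ ((a, y) :: ℓ).map Prod.fst) (c : Crossing) (hc : c ≠ .singular) :
    Sim (w, (a, y) :: ℓ) (w ++ crWord c a s, (a, s) :: (s, y) :: ℓ) := by
  -- The link is put last, since the stabilization moves act on the last strand.
  have hp : ((a, y) :: ℓ).Perm (ℓ ++ [(a, y)]) := (List.perm_append_singleton _ _).symm
  refine (h.sim_perm hp).trans ?_
  have h' := h.of_perm hp
  obtain ⟨⟨n, α⟩, hq⟩ := h'.exists_rep
  have hp' : (ℓ ++ [(s, y), (a, s)]).Perm ((a, s) :: (s, y) :: ℓ) :=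
    List.perm_append_comm.trans (.swap _ _ _)
  refine sim_of_perm hp' ?_
  have hq' : Reads α (ℓ.map Prod.snd ++ [y]) w (ℓ.map Prod.fst ++ [a]) := by
    simpa [Rep] using hq
  have hn : (ℓ.map Prod.fst).length = n := by
    have := hq'.length; simp at this; simpa using this
  have h₁ := hq'.iota_right s
  have k : n + 1 < n + 1 + 0 + 1 := by omega
  have h₂ : Reads (cr c n k) (ℓ.map Prod.fst ++ a :: s :: [])
      (crWord c a s) (ℓ.map Prod.fst ++ s :: a :: []) :=
    Reads.cr_one c k hn (by simp at hn ⊢; omega)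
  simp only [List.append_assoc, List.singleton_append] at h₁
  have h₃ : Rep (w ++ crWord c a s, ℓ ++ [(s, y), (a, s)])
      ⟨n + 1, iota 0 1 α * cr c n k⟩ := by
    simpa [Rep] using h₁.mul h₂
  refine ⟨h', ((h.stab hs).of_perm hp'.symm).of_rep h₃, _, _, hq, h₃, ?_⟩
  cases c with
  | slash => exact (MarkovMove.real_stab true α).equiv
  | backslash => exact (MarkovMove.real_stab false α).equiv
  | virtual => exact (MarkovMove.virt_stab α).equiv
  | singular => exact absurd rfl hc

/-- Below the braid the new strand `s` is crossed by `a` and then virtually by `b`, and finally `b`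
crosses `a`. The new links show that `b` is continued by `s`, while `a` meets `s` before it meets
`b`: the two strands are antiparallel. -/
theorem Rep.right {w : List Letter} {ℓ : List (ℕ × ℕ)} {a b u y n : ℕ} {α : STVB (n + 2)}
    (h : Rep (w, ℓ ++ [(b, y), (a, u)]) ⟨n + 1, α⟩) (s : ℕ) (c d : Crossing) :
    Rep (w ++ (crWord c a s ++ crWord d b a), ℓ ++ [(s, y), (a, u), (b, s)])
      ⟨n + 2, iota 0 1 α * cr c (n + 1) (by omega) * STV.virt n (by omega) *
        cr d (n + 1) (by omega)⟩ := by
  have hq : Reads α (ℓ.map Prod.snd ++ [y, u]) w (ℓ.map Prod.fst ++ [b, a]) := by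
    simpa [Rep] using h
  have hn : (ℓ.map Prod.fst).length = n := by
    have := hq.length; simp at this; simpa using this
  have h₁ := hq.iota_right s
  have k : n + 1 + 1 < n + 1 + 1 + 0 + 1 := by omega
  have k' : n + 1 < n + 1 + 1 + 0 + 1 := by omega
  have h₂ : Reads (cr c (n + 1) k) ((ℓ.map Prod.fst ++ [b]) ++ a :: s :: [])
      (crWord c a s) ((ℓ.map Prod.fst ++ [b]) ++ s :: a :: []) :=
    Reads.cr_one c k (by simp at hn ⊢; omega) (by simp at hn ⊢; omega)
  have h₃ : Reads (STV.virt n k') (ℓ.map Prod.fst ++ b :: s :: [a]) []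
      (ℓ.map Prod.fst ++ s :: b :: [a]) :=
    Reads.virt_one k' hn (by simp at hn ⊢; omega)
  have h₄ : Reads (cr d (n + 1) k) ((ℓ.map Prod.fst ++ [s]) ++ b :: a :: [])
      (crWord d b a) ((ℓ.map Prod.fst ++ [s]) ++ a :: b :: []) :=
    Reads.cr_one d k (by simp at hn ⊢; omega) (by simp at hn ⊢; omega)
  simp only [List.append_assoc, List.cons_append, List.nil_append] at h₁ h₂ h₃ h₄
  simpa [Rep] using ((h₁.mul h₂).mul h₃).mul h₄

/-- The same with the new strand on the left. -/
theorem Rep.left {w : List Letter} {ℓ : List (ℕ × ℕ)} {a b u y n : ℕ} {α : STVB (n + 2)}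
    (h : Rep (w, (a, u) :: (b, y) :: ℓ) ⟨n + 1, α⟩) (s : ℕ) (c d : Crossing) :
    Rep (w ++ (crWord c s a ++ crWord d a b), (b, s) :: (a, u) :: (s, y) :: ℓ)
      ⟨n + 2, iota 1 0 α * cr c 0 (by omega) * STV.virt 1 (by omega) * cr d 0 (by omega)⟩ := by
  have hq : Reads α (u :: y :: ℓ.map Prod.snd) w (a :: b :: ℓ.map Prod.fst) := by
    simpa [Rep] using h
  have hn : (ℓ.map Prod.fst).length = n := by
    have := hq.length; simp at this; simpa using this
  have h₁ := hq.iota_left s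
  have h₂ : Reads (cr c 0 (by omega : 0 + 1 < n + 1 + 1 + 1 + 0))
      ([] ++ s :: a :: b :: ℓ.map Prod.fst)
      (crWord c s a) ([] ++ a :: s :: b :: ℓ.map Prod.fst) :=
    Reads.cr_one c _ rfl (by simp at hn ⊢; omega)
  have h₃ : Reads (STV.virt 1 (by omega : 1 + 1 < n + 1 + 1 + 1 + 0))
      ([a] ++ s :: b :: ℓ.map Prod.fst) [] ([a] ++ b :: s :: ℓ.map Prod.fst) :=
    Reads.virt_one _ rfl (by simp at hn ⊢; omega)
  have h₄ : Reads (cr d 0 (by omega : 0 + 1 < n + 1 + 1 + 1 + 0))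
      ([] ++ a :: b :: s :: ℓ.map Prod.fst)
      (crWord d a b) ([] ++ b :: a :: s :: ℓ.map Prod.fst) :=
    Reads.cr_one d _ rfl (by simp at hn ⊢; omega)
  simpa [Rep] using ((h₁.mul h₂).mul h₃).mul h₄

/-- Right algebraic threading. -/
theorem WF.sim_right {w : List Letter} {ℓ : List (ℕ × ℕ)} {a b u y s : ℕ}
    (h : WF (w, (b, y) :: (a, u) :: ℓ)) (hs : s ∉ ((b, y) :: (a, u) :: ℓ).map Prod.fst)
    (c : Crossing) (hc : c.Real) :
    Sim (w, (b, y) :: (a, u) :: ℓ)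
      (w ++ [.X c a s, .X c.flip b a], (b, s) :: (s, y) :: (a, u) :: ℓ) ∧
    Sim (w ++ [.X .singular a s, .X c b a], (b, s) :: (s, y) :: (a, u) :: ℓ)
      (w ++ [.X c a s, .X .singular b a], (b, s) :: (s, y) :: (a, u) :: ℓ) := by
  have hp : ((b, y) :: (a, u) :: ℓ).Perm (ℓ ++ [(b, y), (a, u)]) :=
    List.perm_append_comm (l₁ := [(b, y), (a, u)])
  have hp' : (ℓ ++ [(s, y), (a, u), (b, s)]).Perm ((b, s) :: (s, y) :: (a, u) :: ℓ) :=
    (List.perm_append_comm (l₂ := [(s, y), (a, u), (b, s)])).trans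
      (List.perm_append_comm (l₁ := [(s, y), (a, u)]) (l₂ := [(b, s)]) |>.append_right ℓ)
  have h' := h.of_perm hp
  obtain ⟨⟨m, α⟩, hq⟩ := h'.exists_rep
  obtain ⟨n, rfl⟩ : ∃ n, m = n + 1 := ⟨m - 1, by have := Reads.length hq; simp at this; omega⟩
  have hw : ∀ {v : List Letter} {q}, Rep (v, ℓ ++ [(s, y), (a, u), (b, s)]) q →
      WF (v, ℓ ++ [(s, y), (a, u), (b, s)]) := fun hv =>
    ((h.stab hs).of_perm hp'.symm).of_rep hv
  rcases hc with rfl | rfl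
  · constructor
    · have h₁ := hq.right s .slash .backslash
      exact (h.sim_perm hp).trans (sim_of_perm hp' ⟨h', hw h₁, _, _, hq, h₁,
        (MarkovMove.right_under true α).equiv⟩)
    · have h₁ := hq.right s .singular .slash
      have h₂ := hq.right s .slash .singular
      exact ((hw h₁).sim_perm hp').symm.trans (sim_of_perm hp' ⟨hw h₁, hw h₂, _, _, h₁, h₂,
        (MarkovMove.right_rs true α).equiv⟩)
  · constructor
    · have h₁ := hq.right s .backslash .slash
      exact (h.sim_perm hp).trans (sim_of_perm hp' ⟨h', hw h₁, _, _, hq, h₁,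
        (MarkovMove.right_under false α).equiv⟩)
    · have h₁ := hq.right s .singular .backslash
      have h₂ := hq.right s .backslash .singular
      exact ((hw h₁).sim_perm hp').symm.trans (sim_of_perm hp' ⟨hw h₁, hw h₂, _, _, h₁, h₂,
        (MarkovMove.right_rs false α).equiv⟩)

/-- Left algebraic threading. -/
theorem WF.sim_left {w : List Letter} {ℓ : List (ℕ × ℕ)} {a b u y s : ℕ}
    (h : WF (w, (b, y) :: (a, u) :: ℓ)) (hs : s ∉ ((b, y) :: (a, u) :: ℓ).map Prod.fst)
    (c : Crossing) (hc : c.Real) :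
    Sim (w, (b, y) :: (a, u) :: ℓ)
      (w ++ [.X c s a, .X c.flip a b], (b, s) :: (s, y) :: (a, u) :: ℓ) ∧
    Sim (w ++ [.X .singular s a, .X c a b], (b, s) :: (s, y) :: (a, u) :: ℓ)
      (w ++ [.X c s a, .X .singular a b], (b, s) :: (s, y) :: (a, u) :: ℓ) := by
  have hp : ((b, y) :: (a, u) :: ℓ).Perm ((a, u) :: (b, y) :: ℓ) := .swap _ _ _
  have hp' : ((b, s) :: (a, u) :: (s, y) :: ℓ).Perm ((b, s) :: (s, y) :: (a, u) :: ℓ) :=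
    (List.Perm.swap _ _ _).cons _
  have h' := h.of_perm hp
  obtain ⟨⟨m, α⟩, hq⟩ := h'.exists_rep
  obtain ⟨n, rfl⟩ : ∃ n, m = n + 1 := ⟨m - 1, by have := Reads.length hq; simp at this; omega⟩
  have hw : ∀ {v : List Letter} {q}, Rep (v, (b, s) :: (a, u) :: (s, y) :: ℓ) q →
      WF (v, (b, s) :: (a, u) :: (s, y) :: ℓ) := fun hv =>
    ((h.stab hs).of_perm hp'.symm).of_rep hv
  rcases hc with rfl | rfl
  · constructor
    · have h₁ := hq.left s .slash .backslash
      exact (h.sim_perm hp).trans (sim_of_perm hp' ⟨h', hw h₁, _, _, hq, h₁,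
        (MarkovMove.left_under true α).equiv⟩)
    · have h₁ := hq.left s .singular .slash
      have h₂ := hq.left s .slash .singular
      exact ((hw h₁).sim_perm hp').symm.trans (sim_of_perm hp' ⟨hw h₁, hw h₂, _, _, h₁, h₂,
        (MarkovMove.left_rs true α).equiv⟩)
  · constructor
    · have h₁ := hq.left s .backslash .slash
      exact (h.sim_perm hp).trans (sim_of_perm hp' ⟨h', hw h₁, _, _, hq, h₁,
        (MarkovMove.left_under false α).equiv⟩)
    · have h₁ := hq.left s .singular .backslash
      have h₂ := hq.left s .backslash .singular
      exact ((hw h₁).sim_perm hp').symm.trans (sim_of_perm hp' ⟨hw h₁, hw h₂, _, _, h₁, h₂,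
        (MarkovMove.left_rs false α).equiv⟩)

end Code

end STV

namespace STV

/-! ## Cutting strands -/

/-- The renaming of `s` to `a`. -/
def ren (a s : ℕ) : ℕ → ℕ := fun n => if n = s then a else n

theorem ren_self (a s : ℕ) : ren a s s = a := if_pos rfl

theorem ren_of_ne {a s n : ℕ} (h : n ≠ s) : ren a s n = n := if_neg h

theorem Letter.map_id {l : Letter} {f : ℕ → ℕ} (h : ∀ a ∈ l.names, f a = a) : l.map f = l := by
  cases l <;> simp [Letter.names, Letter.map] at h ⊢
  exacts [h, h]

theorem map_letters_id {w : List Letter} {f : ℕ → ℕ} (h : ∀ a ∈ names w, f a = a) :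
    w.map (Letter.map f) = w := by
  conv_rhs => rw [← List.map_id w]
  exact List.map_congr_left fun l hl => Letter.map_id fun a ha =>
    h a (List.mem_flatMap.2 ⟨l, hl, ha⟩)

theorem map_ren_letters {w : List Letter} {a s : ℕ} (h : s ∉ names w) :
    w.map (Letter.map (ren a s)) = w :=
  map_letters_id fun b hb => ren_of_ne (by rintro rfl; exact h hb)

/-- Renaming the strands of links. -/
def mapLinks (f : ℕ → ℕ) (ℓ : List (ℕ × ℕ)) : List (ℕ × ℕ) := ℓ.map (Prod.map f f)

theorem mapLinks_id {ℓ : List (ℕ × ℕ)} {f : ℕ → ℕ} (h : ∀ p ∈ ℓ, f p.1 = p.1 ∧ f p.2 = p.2) :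
    mapLinks f ℓ = ℓ := by
  conv_rhs => rw [← List.map_id ℓ]
  exact List.map_congr_left fun p hp => Prod.ext (h p hp).1 (h p hp).2

theorem mapLinks_perm {ℓ ℓ' : List (ℕ × ℕ)} {f : ℕ → ℕ} (h : ℓ.Perm ℓ') :
    (mapLinks f ℓ).Perm (mapLinks f ℓ') := h.map _

/-- The successor of each strand, in the form in which rotation uses it. -/
theorem exists_link_fun {ℓ : List (ℕ × ℕ)} (h : (ℓ.map Prod.fst).Nodup) :
    ∃ f : ℕ → ℕ, ∀ p ∈ ℓ, f p.1 = p.2 := by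
  induction ℓ with
  | nil => exact ⟨id, by simp⟩
  | cons p ℓ ih =>
    obtain ⟨hp, hn⟩ := List.nodup_cons.1 h
    obtain ⟨f, hf⟩ := ih hn
    refine ⟨fun n => if n = p.1 then p.2 else f n, fun q hq => ?_⟩
    rcases List.mem_cons.1 hq with rfl | hq
    · simp
    · have : q.1 ≠ p.1 := fun e => hp (e ▸ List.mem_map_of_mem hq)
      simp [this, hf q hq]

namespace Code

theorem WF.names_left {w w' : List Letter} {ℓ : List (ℕ × ℕ)} (h : WF (w ++ w', ℓ)) :
    WF (w, ℓ) := ⟨h.ne, h.nodup, h.perm, fun l hl => h.good l (by simp [hl])⟩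

/-- A strand may be cut in two. -/
theorem WF.sim_cut {w w' : List Letter} {ℓ : List (ℕ × ℕ)} {a s : ℕ}
    (h : WF (w ++ w', (a, s) :: ℓ)) (has : a ≠ s) (hw : s ∉ names w) (hw' : a ∉ names w') :
    Sim (w ++ w', (a, s) :: ℓ) (w ++ w'.map (Letter.map (ren a s)), mapLinks (ren a s) ℓ) := by
  have hs : s ∈ ((a, s) :: ℓ).map Prod.fst := h.perm.symm.subset (by simp)
  obtain ⟨y, hy⟩ : ∃ y, (s, y) ∈ ℓ := by
    simp only [List.map_cons, List.mem_cons, List.mem_map] at hs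
    rcases hs with hs | ⟨⟨s', y⟩, hp, rfl⟩
    exacts [absurd hs.symm has, ⟨y, hp⟩]
  obtain ⟨ℓ₁, hp⟩ : ∃ ℓ₁, ℓ.Perm ((s, y) :: ℓ₁) := ⟨_, List.perm_cons_erase hy⟩
  have h₁ := h.of_perm (hp.cons (a, s))
  have hn := h₁.nodup
  have hn' := h₁.nodup_snd
  simp only [List.map_cons, List.nodup_cons, List.mem_cons, not_or] at hn hn'
  have hsy : y ≠ s := fun e => hn'.1.1 e.symm
  have hfix : mapLinks (ren a s) ℓ₁ = ℓ₁ := mapLinks_id fun p hp =>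
    ⟨ren_of_ne fun e => hn.2.1 (e ▸ List.mem_map_of_mem hp),
      ren_of_ne fun e => hn'.1.2 (e ▸ List.mem_map_of_mem hp)⟩
  have hq : (mapLinks (ren a s) ℓ).Perm ((a, y) :: ℓ₁) := by
    refine (mapLinks_perm hp).trans ?_
    change ((ren a s s, ren a s y) :: mapLinks (ren a s) ℓ₁).Perm _
    rw [hfix, ren_self, ren_of_ne hsy]
  -- the contracted code is well formed
  have hsub : ∀ n ∈ ((a, s) :: (s, y) :: ℓ₁).map Prod.fst,
      ren a s n ∈ ((a, y) :: ℓ₁).map Prod.fst := by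
    intro n hn
    simp only [List.map_cons, List.mem_cons] at hn ⊢
    rcases hn with rfl | rfl | hn
    · exact .inl (ren_of_ne has)
    · exact .inl (ren_self _ _)
    · by_cases e : n = s
      · subst e; exact .inl (ren_self _ _)
      · rw [ren_of_ne e]; exact .inr hn
  have hperm : (((a, y) :: ℓ₁).map Prod.fst).Perm (((a, y) :: ℓ₁).map Prod.snd) := by
    have := h₁.perm
    simp only [List.map_cons] at this ⊢
    exact ((List.Perm.swap _ _ _).trans this).cons_inv
  have key : ∀ l : Letter, l.Good (((a, s) :: (s, y) :: ℓ₁).map Prod.fst) →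
      (a ∉ l.names ∨ s ∉ l.names) → (l.map (ren a s)).Good (((a, y) :: ℓ₁).map Prod.fst) := by
    intro l hl hd
    cases l with
    | X c b d =>
      refine ⟨hl.1, ?_, hsub b hl.2.2.1, hsub d hl.2.2.2⟩
      have hbd := hl.2.1
      simp only [Letter.names, List.mem_cons, List.not_mem_nil, or_false, not_or] at hd
      simp only [ren]
      split_ifs with e₁ e₂ e₂
      · exact absurd (e₁.trans e₂.symm) hbd
      · rcases hd with hd | hd
        exacts [hd.2, absurd e₁.symm hd.1]
      · rcases hd with hd | hd
        exacts [fun e => hd.1 e.symm, absurd e₂.symm hd.2]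
      · exact hbd
    | B b => exact hsub b hl
  have h₂ : WF (w ++ w'.map (Letter.map (ren a s)), (a, y) :: ℓ₁) := by
    refine ⟨by simp, ?_, hperm, ?_⟩
    · simp only [List.map_cons, List.nodup_cons]
      exact ⟨hn.1.2, hn.2.2⟩
    · intro l hl
      rcases List.mem_append.1 hl with hl | hl
      · have hs : s ∉ l.names := fun e => hw (List.mem_flatMap.2 ⟨l, hl, e⟩)
        have := key l (h₁.good l (by simp [hl])) (.inr hs)
        rwa [Letter.map_id fun b hb => ren_of_ne (by rintro rfl; exact hs hb)] at this
      · obtain ⟨m, hm, rfl⟩ := List.mem_map.1 hl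
        exact key m (h₁.good m (by simp [hm])) (.inl fun e =>
          hw' (List.mem_flatMap.2 ⟨m, hm, e⟩))
  obtain ⟨g, hg⟩ := exists_link_fun h₁.nodup
  have hgs : g s = y := hg (s, y) (by simp)
  -- In the contracted code `a` is followed by the successor of `s`; so its link function goes
  -- through `s`.
  have hf : ∀ p ∈ (a, y) :: ℓ₁, (g ∘ ren s a) p.1 = p.2 := by
    intro p hp
    rcases List.mem_cons.1 hp with rfl | hp
    · simp [ren_self, hgs]
    · have : p.1 ≠ a := fun e => hn.1.2 (e ▸ List.mem_map_of_mem hp)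
      simp [ren_of_ne this, hg p (by simp [hp])]
  have hsv : ∀ v : List Letter, WF (v, (a, y) :: ℓ₁) → Sim (v, (a, y) :: ℓ₁)
      (v, (a, s) :: (s, y) :: ℓ₁) := fun v hv => by
    simpa [crWord] using hv.sim_stab (s := s) (by
      simp only [List.map_cons, List.mem_cons, not_or]
      exact ⟨fun e => has e.symm, hn.2.1⟩) .virtual (by simp)
  -- The letters of `w'` avoid `a`, so rotation gives them the same names in the cut code and in the
  -- contracted one.
  have e : (w'.map (Letter.map (ren a s))).map (Letter.map (g ∘ ren s a)) =
      w'.map (Letter.map g) := by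
    rw [List.map_map]
    refine List.map_congr_left fun l hl => ?_
    have ha : a ∉ l.names := fun e => hw' (List.mem_flatMap.2 ⟨l, hl, e⟩)
    have hh : ∀ n, n ≠ a → g (ren s a (ren a s n)) = g n := by
      intro n hn
      by_cases en : n = s
      · subst en; rw [ren_self, ren_self]
      · rw [ren_of_ne en, ren_of_ne hn]
    cases l with
    | X c b d =>
      simp only [Letter.names, List.mem_cons, List.not_mem_nil, or_false, not_or] at ha
      simp [Letter.map, hh b (fun e => ha.1 e.symm), hh d (fun e => ha.2 e.symm)]
    | B b =>
      simp only [Letter.names, List.mem_cons, List.not_mem_nil, or_false] at ha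
      simp [Letter.map, hh b (fun e => ha e.symm)]
  -- Virtual stabilization cuts a strand only at the end of the word. So `w'` is rotated to the
  -- front, the cut, which is now at the end, is undone, and `w'` is rotated back.
  calc Sim (w ++ w', (a, s) :: ℓ) (w ++ w', (a, s) :: (s, y) :: ℓ₁) := h.sim_perm (hp.cons _)
    Sim _ (w'.map (Letter.map g) ++ w, (a, s) :: (s, y) :: ℓ₁) := h₁.sim_rotate hg
    Sim _ (w'.map (Letter.map g) ++ w, (a, y) :: ℓ₁) := by
      rw [← e]
      exact (hsv _ (h₂.sim_rotate hf).2.1).symm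
    Sim _ (w ++ w'.map (Letter.map (ren a s)), (a, y) :: ℓ₁) := by
      rw [← e]
      exact (h₂.sim_rotate hf).symm
    Sim _ (w ++ w'.map (Letter.map (ren a s)), mapLinks (ren a s) ℓ) := h₂.sim_perm hq.symm

end Code

end STV

namespace STV

/-! ## Relations between Gauss words -/

namespace LEq

variable {x : List ℕ}

theorem exists_perm {x L : List ℕ} (hL : L.Nodup) (h : L ⊆ x) : ∃ r, x.Perm (L ++ r) := by
  obtain ⟨t, ht, hs⟩ := List.subperm_of_subset hL h
  obtain ⟨r, hr⟩ := hs.exists_perm_append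
  exact ⟨r, hr.trans (ht.append_right r)⟩

theorem cancel_left {u u' v w : List Letter} (hu : LEq x (u' ++ u) [])
    (h : LEq x (u ++ v) (u ++ w)) : LEq x v w := by
  have h₁ := (hu.right v).symm
  have h₂ := h.left u'
  have h₃ := hu.right w
  simp only [List.append_assoc, List.nil_append] at h₁ h₂ h₃
  exact h₁.trans (h₂.trans h₃)

/-- The analogue for words of `conj_of_inverse`; it yields slides with inverse crossings from given
ones. -/
theorem conj {a b a' b' v v' : List Letter} (hba : LEq x (b ++ a) []) (hab : LEq x (a' ++ b') [])
    (h : LEq x (a ++ v) (v' ++ a')) : LEq x (v ++ b') (b ++ v') := by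
  have h₁ := (hba.right (v ++ b')).symm
  have h₂ := (h.left b).right b'
  have h₃ := hab.left (b ++ v')
  simp only [List.append_assoc, List.nil_append, List.append_nil] at h₁ h₂ h₃
  exact h₁.trans (h₂.trans h₃)

theorem bar_bar (hx : x.Nodup) {a b : ℕ} (ha : a ∈ x) (hb : b ∈ x) :
    LEq x [.B a, .B b] [.B b, .B a] := by
  by_cases hab : a = b
  · subst hab; exact .refl _ _
  obtain ⟨r, hr⟩ := exists_perm (x := x) (L := [a, b]) (by simpa using hab) (by simp [ha, hb])
  have k : 0 + 1 < x.length := by rw [hr.length_eq]; simp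
  have h₀ : Reads (STV.bar 0 (by omega : 0 < x.length)) ([] ++ a :: b :: r) [.B a]
      ([] ++ a :: b :: r) := Reads.bar_one _ rfl hr.length_eq.symm
  have h₁ : Reads (STV.bar 1 k) ([a] ++ b :: r) [.B b] ([a] ++ b :: r) :=
    Reads.bar_one _ rfl hr.length_eq.symm
  refine LEq.of_reads hx hr (h₀.mul h₁) ?_
  rw [STV.bar_bar]
  exact h₁.mul h₀

theorem bar_bar_cancel (hx : x.Nodup) {a : ℕ} (ha : a ∈ x) : LEq x [.B a, .B a] [] := by
  obtain ⟨r, hr⟩ := exists_perm (x := x) (L := [a]) (by simp) (by simp [ha])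
  have k : 0 < x.length := by rw [hr.length_eq]; simp
  have h₀ : Reads (STV.bar 0 k) ([] ++ a :: r) [.B a] ([] ++ a :: r) :=
    Reads.bar_one _ rfl hr.length_eq.symm
  refine LEq.of_reads hx hr (h₀.mul h₀) ?_
  rw [STV.bar_sq]
  exact .one _ hr.length_eq.symm

theorem cross_bar (hx : x.Nodup) {c : Crossing} {a b d : ℕ} (h : (Letter.X c a b).Good x)
    (hd : d ∈ x) (hda : d ≠ a) (hdb : d ≠ b) :
    LEq x [.X c a b, .B d] [.B d, .X c a b] := by
  obtain ⟨hc, hab, ha, hb⟩ := h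
  obtain ⟨r, hr⟩ := exists_perm (x := x) (L := [a, b, d]) (by simp [hab, hda.symm, hdb.symm])
    (by simp [ha, hb, hd])
  have hl : 0 + 2 < x.length := by rw [hr.length_eq]; simp
  have k : 0 + 1 < x.length := by omega
  have h₀ : Reads (cr c 0 k) ([] ++ a :: b :: d :: r) [.X c a b] ([] ++ b :: a :: d :: r) :=
    Reads.cross_one hc k rfl hr.length_eq.symm
  have h₁ : Reads (STV.bar 2 hl) ([a, b] ++ d :: r) [.B d] ([a, b] ++ d :: r) :=
    Reads.bar_one _ rfl hr.length_eq.symm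
  have h₂ : Reads (STV.bar 2 hl) ([b, a] ++ d :: r) [.B d] ([b, a] ++ d :: r) :=
    Reads.bar_one _ rfl hr.length_eq.symm
  refine LEq.of_reads hx hr (h₀.mul h₂) ?_
  rw [cr_bar_far c 0 2 _ _ (by omega) (by omega)]
  exact h₁.mul h₀

theorem cross_cross (hx : x.Nodup) {c c' : Crossing} {a b d e : ℕ} (h : (Letter.X c a b).Good x)
    (h' : (Letter.X c' d e).Good x) (hda : d ≠ a) (hdb : d ≠ b) (hea : e ≠ a) (heb : e ≠ b) :
    LEq x [.X c a b, .X c' d e] [.X c' d e, .X c a b] := by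
  obtain ⟨hc, hab, ha, hb⟩ := h
  obtain ⟨hc', hde, hd, he⟩ := h'
  obtain ⟨r, hr⟩ := exists_perm (x := x) (L := [a, b, d, e])
    (by simp [hab, hda.symm, hdb.symm, hea.symm, heb.symm, hde]) (by simp [ha, hb, hd, he])
  have hl : 2 + 1 < x.length := by rw [hr.length_eq]; simp
  have k : 0 + 1 < x.length := by omega
  have h₀ : ∀ r', r'.length = r.length + 2 →
      Reads (cr c 0 k) ([] ++ a :: b :: r') [.X c a b] ([] ++ b :: a :: r') :=
    fun r' h => Reads.cross_one hc k rfl (by rw [hr.length_eq]; simp [h])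
  have h₁ : ∀ l, l.length = 2 →
      Reads (cr c' 2 hl) (l ++ d :: e :: r) [.X c' d e] (l ++ e :: d :: r) :=
    fun l h => Reads.cross_one hc' hl h (by rw [hr.length_eq]; simp [h]; omega)
  refine LEq.of_reads hx hr ((h₀ (d :: e :: r) (by simp)).mul (h₁ [b, a] rfl)) ?_
  rw [cr_cr_far c c' 0 2 _ _ (.inl (by omega))]
  exact (h₁ [a, b] rfl).mul (h₀ (e :: d :: r) (by simp))

/-- Letters on different strands commute. -/
theorem comm (hx : x.Nodup) {l m : Letter} (hl : l.Good x) (hm : m.Good x)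
    (h : ∀ a ∈ l.names, a ∉ m.names) : LEq x [l, m] [m, l] := by
  cases l with
  | X c a b =>
    cases m with
    | X c' d e =>
      simp [Letter.names] at h
      exact cross_cross hx hl hm (Ne.symm h.1.1) (Ne.symm h.2.1) (Ne.symm h.1.2) (Ne.symm h.2.2)
    | B d =>
      simp [Letter.names] at h
      exact cross_bar hx hl hm (Ne.symm h.1) (Ne.symm h.2)
  | B a =>
    cases m with
    | X c' d e =>
      simp [Letter.names] at h
      exact (cross_bar hx hm hl h.1 h.2).symm
    | B d => exact bar_bar hx hl hm

theorem inverse (hx : x.Nodup) {c : Crossing} {a b : ℕ} (h : (Letter.X c a b).Good x)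
    (hs : c ≠ .singular) : LEq x [.X c a b, .X c.flip b a] [] := by
  obtain ⟨hc, hab, ha, hb⟩ := h
  obtain ⟨r, hr⟩ := exists_perm (x := x) (L := [a, b]) (by simp [hab]) (by simp [ha, hb])
  have k : 0 + 1 < x.length := by rw [hr.length_eq]; simp
  have hc' : c.flip ≠ .virtual := by cases c <;> simp_all [Crossing.flip]
  have h₀ : Reads (cr c 0 k) ([] ++ a :: b :: r) [.X c a b] ([] ++ b :: a :: r) :=
    Reads.cross_one hc k rfl hr.length_eq.symm
  have h₁ : Reads (cr c.flip 0 k) ([] ++ b :: a :: r) [.X c.flip b a] ([] ++ a :: b :: r) :=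
    Reads.cross_one hc' k rfl hr.length_eq.symm
  refine LEq.of_reads hx hr (h₀.mul h₁) ?_
  rw [cr_mul_flip c hs]
  exact .one _ hr.length_eq.symm

theorem real_singular (hx : x.Nodup) {c : Crossing} (hc : c.Real) {a b : ℕ}
    (h : (Letter.X c a b).Good x) :
    LEq x [.X c a b, .X .singular b a] [.X .singular a b, .X c b a] := by
  obtain ⟨hc', hab, ha, hb⟩ := h
  obtain ⟨r, hr⟩ := exists_perm (x := x) (L := [a, b]) (by simp [hab]) (by simp [ha, hb])
  have k : 0 + 1 < x.length := by rw [hr.length_eq]; simp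
  have h₀ : ∀ c, c ≠ .virtual → Reads (cr c 0 k) ([] ++ a :: b :: r) [.X c a b]
      ([] ++ b :: a :: r) := fun c hc => Reads.cross_one hc k rfl hr.length_eq.symm
  have h₁ : ∀ c, c ≠ .virtual → Reads (cr c 0 k) ([] ++ b :: a :: r) [.X c b a]
      ([] ++ a :: b :: r) := fun c hc => Reads.cross_one hc k rfl hr.length_eq.symm
  refine LEq.of_reads hx hr ((h₀ c hc').mul (h₁ .singular (by simp))) ?_
  rw [real_sing_comm c hc]
  exact (h₀ .singular (by simp)).mul (h₁ c hc')

/-- Both sides of the twist relation of the monoid are read on `a` and `b`. The virtual crossings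
leave no letter but let the strands enter the crossing in the opposite order. -/
theorem twist (hx : x.Nodup) {c : Crossing} {a b : ℕ} (h : (Letter.X c a b).Good x) :
    LEq x [.X c b a] [.B a, .B b, .X c a b, .B b, .B a] := by
  obtain ⟨hc, hab, ha, hb⟩ := h
  obtain ⟨r, hr⟩ := exists_perm (x := x) (L := [a, b]) (by simp [hab]) (by simp [ha, hb])
  have k : 0 + 1 < x.length := by rw [hr.length_eq]; simp
  have h₀ : ∀ a b, (a :: b :: r).length = x.length → Reads (cr c 0 k) ([] ++ a :: b :: r) [.X c a b]
      ([] ++ b :: a :: r) := fun a b h => Reads.cross_one hc k rfl h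
  have h₁ : ∀ a b, (a :: b :: r).length = x.length → Reads (STV.virt 0 k) ([] ++ a :: b :: r) []
      ([] ++ b :: a :: r) := fun a b h => Reads.virt_one k rfl h
  have h₂ : ∀ a b, (a :: b :: r).length = x.length → Reads (bars 0 k) (a :: b :: r) [.B a, .B b]
      (a :: b :: r) := fun a b h =>
    (Reads.bar_one (l := []) (r := b :: r) (Nat.lt_of_succ_lt k) rfl h).mul
      (Reads.bar_one (l := [a]) k rfl h)
  have hl : (a :: b :: r).length = x.length := hr.length_eq.symm
  refine LEq.of_reads hx hr (((h₁ a b hl).mul (h₀ b a hl)).mul (h₁ a b hl)) ?_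
  rw [twist_element c hc]
  exact ((h₂ a b hl).mul (h₀ a b hl)).mul (h₂ b a hl)

theorem slide_slash (hx : x.Nodup) {c : Crossing} (hc : c ≠ .virtual) {a b d : ℕ} (hab : a ≠ b)
    (had : a ≠ d) (hbd : b ≠ d) (ha : a ∈ x) (hb : b ∈ x) (hd : d ∈ x) :
    LEq x [.X .slash a b, .X .slash a d, .X c b d] [.X c b d, .X .slash a d, .X .slash a b] := by
  obtain ⟨r, hr⟩ := exists_perm (x := x) (L := [a, b, d]) (by simp [hab, had, hbd])
    (by simp [ha, hb, hd])
  have hl : 1 + 1 < x.length := by rw [hr.length_eq]; simp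
  have k : 0 + 1 < x.length := by omega
  have h₀ : ∀ c, c ≠ .virtual → ∀ a b d, (a :: b :: d :: r).length = x.length →
      Reads (cr c 0 k) ([] ++ a :: b :: d :: r) [.X c a b] ([] ++ b :: a :: d :: r) :=
    fun c hc a b d h => Reads.cross_one hc k rfl h
  have h₁ : ∀ c, c ≠ .virtual → ∀ a b d, (a :: b :: d :: r).length = x.length →
      Reads (cr c 1 hl) ([a] ++ b :: d :: r) [.X c b d] ([a] ++ d :: b :: r) :=
    fun c hc a b d h => Reads.cross_one hc hl rfl h
  have hn := hr.length_eq.symm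
  have hs : Crossing.slash ≠ .virtual := by simp
  refine LEq.of_reads hx hr (((h₀ _ hs a b d hn).mul (h₁ _ hs b a d hn)).mul (h₀ c hc b d a hn)) ?_
  rw [slide_element c hc]
  exact ((h₁ c hc a b d hn).mul (h₀ _ hs a d b hn)).mul (h₁ _ hs d a b hn)

end LEq

end STV

/-! ### Bars turn crossings around; slides in all positions of the moving strand. -/

namespace STV

namespace LEq

variable {x : List ℕ}

theorem bars_perm (hx : x.Nodup) {L L' : List ℕ} (hp : L.Perm L') (hL : L ⊆ x) :
    LEq x (L.map .B) (L'.map .B) := by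
  induction hp with
  | nil => exact .refl _ _
  | cons a _ ih => exact (ih fun b hb => hL (by simp [hb])).left [.B a]
  | swap a b l => exact (bar_bar hx (hL (by simp)) (hL (by simp))).right (l.map .B)
  | trans h₁ _ ih₁ ih₂ => exact (ih₁ hL).trans (ih₂ fun b hb => hL (h₁.symm.subset hb))

theorem bars_inverse (hx : x.Nodup) {L : List ℕ} (hL : L ⊆ x) :
    LEq x (L.reverse.map .B ++ L.map .B) [] := by
  induction L with
  | nil => exact .refl _ _
  | cons a L ih =>
    have h := bar_bar_cancel hx (hL (by simp : a ∈ a :: L))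
    have h' := (h.right (L.map .B)).left (L.reverse.map .B)
    simp only [List.reverse_cons, List.map_append, List.map_cons, List.map_nil, List.append_assoc,
      List.cons_append, List.nil_append] at h' ⊢
    exact h'.trans (ih fun b hb => hL (by simp [hb]))

/-- Bars on all strands move past a crossing and turn it around. -/
theorem bars_cross (hx : x.Nodup) {L : List ℕ} (hn : L.Nodup) (hL : L ⊆ x) {c : Crossing}
    {a b : ℕ} (hc : c ≠ .virtual) (hab : a ≠ b) (ha : a ∈ L) (hb : b ∈ L) :
    LEq x (L.map .B ++ [.X c a b]) (.X c b a :: L.map .B) := by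
  have hg : (Letter.X c a b).Good x := ⟨hc, hab, hL ha, hL hb⟩
  obtain ⟨r, hr⟩ := exists_perm (x := L) (L := [a, b]) (by simpa using hab) (by simp [ha, hb])
  have hrn : ([a, b] ++ r).Nodup := hr.nodup_iff.1 hn
  have hrL : ∀ d ∈ r, d ∈ x := fun d hd => hL (hr.symm.subset (by simp [hd]))
  -- The bars on strands other than `a` and `b` simply pass; only the bars on these two turn the
  -- crossing.
  have hr2 : ∀ s : List ℕ, s ⊆ r → LEq x (s.map .B ++ [.X c a b]) (.X c a b :: s.map .B) := by
    intro s hs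
    induction s with
    | nil => exact .refl _ _
    | cons d s ih =>
      have hd : d ∈ r := hs (by simp)
      have hne : d ≠ a ∧ d ≠ b := by
        simp only [List.cons_append, List.nil_append, List.nodup_cons, List.mem_cons,
          not_or] at hrn
        exact ⟨fun e => hrn.1.2 (e ▸ hd), fun e => hrn.2.1 (e ▸ hd)⟩
      have h₁ := (ih fun e he => hs (by simp [he])).left [.B d]
      have h₂ := ((cross_bar hx hg (hrL d hd) hne.1 hne.2).symm).right (s.map .B)
      exact h₁.trans h₂
  have h₁ := (bars_perm hx hr hL).right [.X c a b]
  have h₂ := (hr2 r fun _ h => h).left [.B a, .B b]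
  have hi : LEq x [.B b, .B a, .B a, .B b] [] := bars_inverse hx (L := [a, b]) (by
    simp [hL ha, hL hb])
  have h₃ : LEq x [.B a, .B b, .X c a b] [.X c b a, .B a, .B b] :=
    ((twist hx hg).right [.B a, .B b] |>.trans (hi.left [.B a, .B b, .X c a b])).symm
  have h₄ := h₃.right (r.map .B)
  have h₅ := (bars_perm hx hr.symm (fun d hd => hL (hr.symm.subset hd))).left [.X c b a]
  simp only [List.map_cons, List.cons_append,
    List.nil_append] at h₁ h₂ h₄ h₅
  exact h₁.trans (h₂.trans (h₄.trans h₅))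

theorem real_ne_singular {c : Crossing} (hc : c.Real) : c ≠ .singular := by
  rcases hc with rfl | rfl <;> simp

theorem real_ne_virtual {c : Crossing} (hc : c.Real) : c ≠ .virtual := by
  rcases hc with rfl | rfl <;> simp

theorem real_flip {c : Crossing} (hc : c.Real) : c.flip.Real := by
  rcases hc with rfl | rfl <;> simp [Crossing.flip, Crossing.Real]

theorem flip_flip (c : Crossing) : c.flip.flip = c := by cases c <;> rfl

theorem flip_ne_virtual {c : Crossing} (hc : c ≠ .virtual) : c.flip ≠ .virtual := by
  cases c <;> simp_all [Crossing.flip]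

theorem inverse' (hx : x.Nodup) {c : Crossing} {a b : ℕ} (h : (Letter.X c a b).Good x)
    (hs : c ≠ .singular) : LEq x [.X c.flip b a, .X c a b] [] := by
  have := inverse hx (c := c.flip) (a := b) (b := a)
    ⟨flip_ne_virtual h.1, h.2.1.symm, h.2.2.2, h.2.2.1⟩ (by cases c <;> simp_all [Crossing.flip])
  rwa [flip_flip] at this

theorem inverse₂ (hx : x.Nodup) {c : Crossing} {a b d e : ℕ} (h : (Letter.X c a b).Good x)
    (h' : (Letter.X c d e).Good x)
    (hs : c ≠ .singular) : LEq x [.X c a b, .X c d e, .X c.flip e d, .X c.flip b a] [] :=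
  (((inverse hx h' hs).right [.X c.flip b a]).left [.X c a b]).trans (inverse hx h hs)

theorem inverse₂' (hx : x.Nodup) {c : Crossing} {a b d e : ℕ} (h : (Letter.X c a b).Good x)
    (h' : (Letter.X c d e).Good x)
    (hs : c ≠ .singular) : LEq x [.X c.flip b a, .X c.flip e d, .X c d e, .X c a b] [] :=
  (((inverse' hx h' hs).right [.X c a b]).left [.X c.flip b a]).trans (inverse' hx h hs)

variable {a b d : ℕ}

/-- The inverse of a slide. -/
theorem slide_inv (hx : x.Nodup) {m c : Crossing} (hm : m.Real) (hab : a ≠ b)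
    (had : a ≠ d) (ha : a ∈ x) (hb : b ∈ x) (hd : d ∈ x)
    (h : LEq x [.X m a b, .X m a d, .X c b d] [.X c b d, .X m a d, .X m a b]) :
    LEq x [.X m.flip d a, .X m.flip b a, .X c b d] [.X c b d, .X m.flip b a, .X m.flip d a] := by
  have g : ∀ b', a ≠ b' → b' ∈ x → (Letter.X m a b').Good x := fun b' h h' =>
    ⟨real_ne_virtual hm, h, ha, h'⟩
  exact (conj (a := [.X m a b, .X m a d]) (a' := [.X m a d, .X m a b]) (v := [.X c b d]) (v' :=
      [.X c b d])
    (b := [.X m.flip d a, .X m.flip b a]) (b' := [.X m.flip b a, .X m.flip d a])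
    (inverse₂' hx (g d had hd) (g b hab hb) (real_ne_singular hm))
    (inverse₂ hx (g d had hd) (g b hab hb) (real_ne_singular hm)) h).symm

/-- The defining relations move a strand only from the left. Bars on the three strands turn every
crossing around and reduce this slide to `slide_slash` with `b` and `d` exchanged. -/
theorem slide_slash' (hx : x.Nodup) {c : Crossing} (hc : c ≠ .virtual) (hab : a ≠ b)
    (had : a ≠ d) (hbd : b ≠ d) (ha : a ∈ x) (hb : b ∈ x) (hd : d ∈ x) :
    LEq x [.X .slash d a, .X .slash b a, .X c b d] [.X c b d, .X .slash b a, .X .slash d a] := by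
  have hL : [a, b, d] ⊆ x := by simp [ha, hb, hd]
  have hn : [a, b, d].Nodup := by simp [hab, had, hbd]
  have hs : Crossing.slash ≠ .virtual := by simp
  refine cancel_left (u := [a, b, d].map .B) (u' := [a, b, d].reverse.map .B)
    (bars_inverse hx hL) ?_
  have push : ∀ c p q, c ≠ .virtual → p ≠ q → p ∈ [a, b, d] → q ∈ [a, b, d] → ∀ w v,
      LEq x ([a, b, d].map .B ++ w) (v ++ [a, b, d].map .B) →
      LEq x ([a, b, d].map .B ++ .X c p q :: w) (.X c q p :: v ++ [a, b, d].map .B) := by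
    intro c p q hc hpq hp hq w v h
    have h₁ := (bars_cross hx hn hL hc hpq hp hq).right w
    have h₂ := h.left [.X c q p]
    simp only [List.append_assoc, List.cons_append, List.nil_append] at h₁ h₂ ⊢
    exact h₁.trans h₂
  have h₁ := push _ d a hs had.symm (by simp) (by simp) _ _ (push _ b a hs hab.symm (by simp)
    (by simp) _ _ (push c b d hc hbd (by simp) (by simp) [] [] (.refl _ _)))
  have h₂ := push c b d hc hbd (by simp) (by simp) _ _ (push _ b a hs hab.symm (by simp)
    (by simp) _ _ (push _ d a hs had.symm (by simp) (by simp) [] [] (.refl _ _)))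
  exact h₁.trans (((slide_slash hx hc had hab hbd.symm ha hd hb).right _).trans h₂.symm)

/-- A strand slides from the left to the right past a crossing. -/
theorem slide_left (hx : x.Nodup) {m c : Crossing} (hm : m.Real) (hc : c ≠ .virtual) (hab : a ≠ b)
    (had : a ≠ d) (hbd : b ≠ d) (ha : a ∈ x) (hb : b ∈ x) (hd : d ∈ x) :
    LEq x [.X m a b, .X m a d, .X c b d] [.X c b d, .X m a d, .X m a b] := by
  rcases hm with rfl | rfl
  · exact slide_slash hx hc hab had hbd ha hb hd
  · have g : ∀ b', a ≠ b' → b' ∈ x → (Letter.X .slash b' a).Good x := fun b' h h' =>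
      ⟨by simp, h.symm, h', ha⟩
    -- The inverse of a positive strand on the other side is a negative one, so `slide_slash'` is
    -- conjugated by its outer words.
    exact (conj (a := [.X .slash d a, .X .slash b a]) (a' := [.X .slash b a, .X .slash d a])
      (v := [.X c b d]) (v' := [.X c b d]) (b := [.X .backslash a b, .X .backslash a d])
      (b' := [.X .backslash a d, .X .backslash a b])
      (inverse₂' hx (g b hab hb) (g d had hd) (by simp))
      (inverse₂ hx (g b hab hb) (g d had hd) (by simp))
      (slide_slash' hx hc hab had hbd ha hb hd)).symm

/-- A strand slides from the right to the left past a crossing. -/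
theorem slide_right (hx : x.Nodup) {m c : Crossing} (hm : m.Real) (hc : c ≠ .virtual)
    (hab : a ≠ b) (had : a ≠ d) (hbd : b ≠ d) (ha : a ∈ x) (hb : b ∈ x) (hd : d ∈ x) :
    LEq x [.X m d a, .X m b a, .X c b d] [.X c b d, .X m b a, .X m d a] := by
  have := slide_inv hx (real_flip hm) hab had ha hb hd
    (slide_left hx (real_flip hm) hc hab had hbd ha hb hd)
  rwa [flip_flip] at this

/-- A strand slides past a crossing to its side. -/
theorem slide_mid (hx : x.Nodup) {m c : Crossing} (hm : m.Real) (hc : c ≠ .virtual) (hab : a ≠ b)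
    (had : a ≠ d) (hbd : b ≠ d) (ha : a ∈ x) (hb : b ∈ x) (hd : d ∈ x) :
    LEq x [.X m a d, .X c b d, .X m.flip b a] [.X m.flip b a, .X c b d, .X m a d] := by
  have g : (Letter.X m a b).Good x := ⟨real_ne_virtual hm, hab, ha, hb⟩
  exact conj (a := [.X m a b]) (a' := [.X m a b]) (b := [.X m.flip b a]) (b' := [.X m.flip b a])
    (v := [.X m a d, .X c b d]) (v' := [.X c b d, .X m a d]) (inverse' hx g (real_ne_singular hm))
    (inverse hx g (real_ne_singular hm)) (slide_left hx hm hc hab had hbd ha hb hd)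

end LEq

end STV

/-! ### Local replacements in codes, and their proof by contraction of links. -/

namespace STV

/-- Letters on different strands commute. Readings of diagrams will have no repeated name, so this
is what frees the code from the heights of the crossings. -/
theorem LEq.perm {x : List ℕ} (hx : x.Nodup) {w w' : List Letter} (hp : w.Perm w')
    (hg : ∀ l ∈ w, l.Good x) (hn : (names w).Nodup) : LEq x w w' := by
  induction hp with
  | nil => exact .refl _ _
  | cons l _ ih =>
    rw [names_cons, List.nodup_append] at hn
    exact (ih (fun m hm => hg m (by simp [hm])) hn.2.1).left [l]
  | swap l m w =>
    rw [names_cons, names_cons, ← List.append_assoc, List.nodup_append, List.nodup_append] at hn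
    exact (LEq.comm hx (hg _ (by simp)) (hg _ (by simp)) fun a ha ha' =>
      hn.1.2.2 a ha a ha' rfl).right w
  | trans h₁ _ ih₁ ih₂ =>
    exact (ih₁ hg hn).trans (ih₂ (fun l hl => hg l (h₁.symm.subset hl))
      ((h₁.flatMap_right _).nodup_iff.1 hn))

namespace Code

theorem WF.good_snd {w : List Letter} {ℓ : List (ℕ × ℕ)} (h : WF (w, ℓ)) :
    ∀ l ∈ w, l.Good (ℓ.map Prod.snd) := fun l hl => (h.good l hl).mono h.perm.subset

theorem WF.of_good {w w' : List Letter} {ℓ : List (ℕ × ℕ)} (h : WF (w, ℓ))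
    (hg : ∀ l ∈ w', l.Good (ℓ.map Prod.fst)) : WF (w', ℓ) := ⟨h.ne, h.nodup, h.perm, hg⟩

/-- The order of the letters is immaterial if they have no strands in common. -/
theorem WF.sim_perm_letters {w w' : List Letter} {ℓ : List (ℕ × ℕ)} (h : WF (w, ℓ))
    (hp : w.Perm w') (hn : (names w).Nodup) : Sim (w, ℓ) (w', ℓ) :=
  h.sim_letters (LEq.perm h.nodup_snd hp h.good_snd hn)

/-- `Contracts L u v`: the word `v` is obtained from `u` by joining the strands linked by `L`. -/
inductive Contracts : List (ℕ × ℕ) → List Letter → List Letter → Prop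
  | nil (u : List Letter) : Contracts [] u u
  | cons {L : List (ℕ × ℕ)} {a s : ℕ} {u v : List Letter} (k : ℕ) (has : a ≠ s)
      (hs : s ∉ names (u.take k)) (ha : a ∉ names (u.drop k)) (hL : ∀ p ∈ L, p.1 ≠ s ∧ p.2 ≠ s)
      (h : Contracts L (u.take k ++ (u.drop k).map (Letter.map (ren a s))) v) :
      Contracts ((a, s) :: L) u v

/-- The effect of the contraction of the links `L` on further links. -/
def contract (L ℓ : List (ℕ × ℕ)) : List (ℕ × ℕ) :=
  L.foldl (fun ℓ p => mapLinks (ren p.1 p.2) ℓ) ℓ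

/-- Each step is `WF.sim_cut`. The context `K` avoids the linked names and can therefore stand
behind the word without being renamed. -/
theorem Contracts.sim {L ℓ : List (ℕ × ℕ)} {u v K : List Letter} (hc : Contracts L u v)
    (h : WF (u ++ K, L ++ ℓ)) (hK : ∀ p ∈ L, p.1 ∉ names K ∧ p.2 ∉ names K) :
    Sim (u ++ K, L ++ ℓ) (v ++ K, contract L ℓ) := by
  induction hc generalizing ℓ with
  | nil u => exact h.sim
  | @cons L a s u v k has hs ha hL _ ih =>
    have hKa := hK (a, s) (by simp)
    have e : u ++ K = u.take k ++ (u.drop k ++ K) := by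
      rw [← List.append_assoc, List.take_append_drop]
    have hL' : mapLinks (ren a s) L = L :=
      mapLinks_id fun p hp => ⟨ren_of_ne (hL p hp).1, ren_of_ne (hL p hp).2⟩
    have h₁ := WF.sim_cut (w := u.take k) (w' := u.drop k ++ K) (ℓ := L ++ ℓ) (a := a) (s := s)
      (by rw [← e]; exact h) has hs (by
        rw [names_append, List.mem_append, not_or]; exact ⟨ha, hKa.1⟩)
    rw [← e, List.map_append, map_ren_letters hKa.2, mapLinks, List.map_append, ← mapLinks,
      ← mapLinks, hL', ← List.append_assoc] at h₁
    exact h₁.trans (ih h₁.2.1 fun p hp => hK p (by simp [hp]))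

/-- The part `u` of a word can be replaced by `v` in the presence of the links `L`. -/
def Local (L : List (ℕ × ℕ)) (u v : List Letter) : Prop :=
  ∀ (K : List Letter) (ℓ : List (ℕ × ℕ)), WF (u ++ K, L ++ ℓ) →
    (∀ p ∈ L, p.1 ∉ names K ∧ p.2 ∉ names K) → Sim (u ++ K, L ++ ℓ) (v ++ K, L ++ ℓ)

/-- The names that occur in links. -/
def linkNames (L : List (ℕ × ℕ)) : List ℕ := L.map Prod.fst ++ L.map Prod.snd

theorem WF.linkNames_subset {w : List Letter} {L ℓ : List (ℕ × ℕ)} (h : WF (w, L ++ ℓ)) :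
    linkNames L ⊆ (L ++ ℓ).map Prod.fst := by
  intro a ha
  rcases List.mem_append.1 ha with ha | ha
  · simp only [List.map_append, List.mem_append]; exact .inl ha
  · refine h.perm.symm.subset ?_
    simp only [List.map_append, List.mem_append]; exact .inl ha

theorem WF.replace {w K w' : List Letter} {L ℓ : List (ℕ × ℕ)} (h : WF (w ++ K, L ++ ℓ))
    (hg : ∀ l ∈ w', l.Good (linkNames L ++ names w)) : WF (w' ++ K, L ++ ℓ) := by
  refine h.of_good fun l hl => ?_
  rcases List.mem_append.1 hl with hl | hl
  · refine (hg l hl).mono (List.append_subset.2 ⟨h.linkNames_subset, fun a ha => h.names_subset ?_⟩)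
    rw [names_append]
    exact List.mem_append_left _ ha
  · exact h.good l (by simp [hl])

/-- The usual proof of a replacement: once the pieces of each strand are joined, both sides are
words on few strands, and a relation between braid words applies. -/
theorem Local.of_contracts {L : List (ℕ × ℕ)} {u v u₀ v₀ : List Letter}
    (hu : Contracts L u u₀) (hv : Contracts L v v₀) (hg : ∀ l ∈ v, l.Good (linkNames L ++ names u))
    (h : ∀ x : List ℕ, x.Nodup → (∀ l ∈ u₀, l.Good x) → (∀ l ∈ v₀, l.Good x) → LEq x u₀ v₀) :
    Local L u v := by
  intro K ℓ hw hK
  have h₁ := hu.sim hw hK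
  have h₂ := hv.sim (hw.replace hg) hK
  have h₃ := h₁.2.1.sim_letters ((h _ h₁.2.1.nodup_snd
    (fun l hl => h₁.2.1.good_snd l (by simp [hl]))
    (fun l hl => h₂.2.1.good_snd l (by simp [hl]))).right K)
  exact h₁.trans (h₃.trans h₂.symm)

theorem Local.symm {L : List (ℕ × ℕ)} {u v : List Letter} (h : Local L u v)
    (hg : ∀ l ∈ u, l.Good (linkNames L ++ names v)) : Local L v u :=
  fun K ℓ hw hK => (h K ℓ (hw.replace hg) hK).symm

theorem Local.trans {L : List (ℕ × ℕ)} {u v w : List Letter} (h : Local L u v)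
    (h' : Local L v w) : Local L u w :=
  fun K ℓ hw hK => (h K ℓ hw hK).trans (h' K ℓ (h K ℓ hw hK).2.1 hK)

theorem Local.links_perm {L L' : List (ℕ × ℕ)} {u v : List Letter} (h : Local L u v)
    (hp : L.Perm L') : Local L' u v := by
  intro K ℓ hw hK
  have hp' := hp.append_right ℓ
  have h₁ := hw.sim_perm hp'.symm
  have h₂ := h K ℓ h₁.2.1 fun p h => hK p (hp.subset h)
  exact h₁.trans (h₂.trans (h₂.2.1.sim_perm hp'))

/-- Used to bring the letters into an order in which links can be contracted. -/
theorem Local.perm_left {L : List (ℕ × ℕ)} {u u' v : List Letter} (h : Local L u v)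
    (hp : u.Perm u') (hn : (names u).Nodup) : Local L u' v := by
  intro K ℓ hw hK
  have hw' : WF (u ++ K, L ++ ℓ) := hw.of_good fun l hl =>
    hw.good l ((hp.append_right K).subset hl)
  refine Sim.trans (Sim.symm ?_) (h K ℓ hw' hK)
  exact hw'.sim_letters ((LEq.perm hw'.nodup_snd hp
    (fun l hl => hw'.good_snd l (by simp [hl])) hn).right K)

theorem Local.perm_right {L : List (ℕ × ℕ)} {u v v' : List Letter} (h : Local L u v)
    (hp : v.Perm v') (hn : (names v).Nodup) : Local L u v' := by
  intro K ℓ hw hK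
  have h' := h K ℓ hw hK
  have hw' := h'.2.1
  exact h'.trans (hw'.sim_letters ((LEq.perm hw'.nodup_snd hp
    (fun l hl => hw'.good_snd l (by simp [hl])) hn).right K))

theorem _root_.STV.Letter.Good.ren {l : Letter} {x : List ℕ} {a s : ℕ} (h : l.Good x)
    (ha : a ∈ x) (hl : a ∉ l.names) : (l.map (ren a s)).Good x := by
  cases l with
  | X c b d =>
    obtain ⟨hc, hbd, hb, hd⟩ := h
    simp only [Letter.names, List.mem_cons, List.not_mem_nil, or_false, not_or] at hl
    refine ⟨hc, ?_, ?_, ?_⟩ <;> simp only [STV.ren] <;> split_ifs <;> grind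
  | B b => simp only [Letter.map, STV.ren]; split_ifs; exacts [ha, h]

theorem _root_.STV.ren_ren {u : List Letter} {a s : ℕ} (hs : s ∉ names u) :
    (u.map (Letter.map (ren s a))).map (Letter.map (ren a s)) = u := by
  conv_rhs => rw [← List.map_id u]
  rw [List.map_map]
  refine List.map_congr_left fun l hl => ?_
  have hs : s ∉ l.names := fun e => hs (List.mem_flatMap.2 ⟨l, hl, e⟩)
  cases l <;> simp [Letter.names, Letter.map] at hs ⊢ <;> simp only [ren] <;> grind

theorem _root_.STV.not_mem_names_ren {u : List Letter} {a s : ℕ} (has : a ≠ s) :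
    s ∉ names (u.map (Letter.map (ren a s))) := by
  intro h
  obtain ⟨l, hl, h⟩ := List.mem_flatMap.1 h
  obtain ⟨m, hm, rfl⟩ := List.mem_map.1 hl
  cases m <;> simp [Letter.names, Letter.map, ren] at h <;> grind

/-- Letters can be moved to the other side of a cut. -/
theorem Local.shift {a s : ℕ} (has : a ≠ s) {u : List Letter} (ha : a ∉ names u) :
    Local [(a, s)] u (u.map (Letter.map (ren a s))) := by
  intro K ℓ hw hK
  have h₁ : Contracts [(a, s)] u ([] ++ u.map (Letter.map (ren a s))) :=
    .cons 0 has (by simp) (by simpa using ha) (by simp) (.nil _)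
  have h₂ : Contracts [(a, s)] (u.map (Letter.map (ren a s))) (u.map (Letter.map (ren a s))) := by
    have h := not_mem_names_ren (u := u) has
    generalize u.map (Letter.map (ren a s)) = v at h ⊢
    refine .cons v.length has ?_ (by simp) (by simp) ?_
    · rw [List.take_length]; exact h
    · simpa using Contracts.nil _
  refine (h₁.sim hw hK).trans (h₂.sim (hw.of_good fun l hl => ?_) hK).symm
  rcases List.mem_append.1 hl with hl | hl
  · obtain ⟨m, hm, rfl⟩ := List.mem_map.1 hl
    exact (hw.good m (by simp [hm])).ren (by simp) fun e => ha (List.mem_flatMap.2 ⟨m, hm, e⟩)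
  · exact hw.good l (by simp [hl])

/-- The inverse of `Local.shift`, applied to the renamed word; the word is recovered because it does
not contain `s`. -/
theorem Local.shift' {a s : ℕ} (has : a ≠ s) {u : List Letter} (hs : s ∉ names u) :
    Local [(a, s)] u (u.map (Letter.map (ren s a))) := by
  intro K ℓ hw hK
  have h := Local.shift has (u := u.map (Letter.map (ren s a)))
    (not_mem_names_ren has.symm)
  rw [ren_ren hs] at h
  refine (h K ℓ (hw.of_good fun l hl => ?_) hK).symm
  rcases List.mem_append.1 hl with hl | hl
  · obtain ⟨m, hm, rfl⟩ := List.mem_map.1 hl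
    exact (hw.good m (by simp [hm])).ren (WF.linkNames_subset hw (by simp [linkNames]))
      fun e => hs (List.mem_flatMap.2 ⟨m, hm, e⟩)
  · exact hw.good l (by simp [hl])

end Code

end STV

/-! ### Bijective renaming, and the replacements that come from braid relations. -/

namespace STV

/-- By this and `Local.map`, a replacement needs to be proved only for the names `0, 1, 2, …`, for
which the side conditions are decided by computation. -/
theorem exists_perm_getElem (L : List ℕ) (hn : L.Nodup) :
    ∃ g : Equiv.Perm ℕ, ∀ i (h : i < L.length), g i = L[i] := by
  induction L using List.reverseRecOn with
  | nil => exact ⟨1, by simp⟩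
  | append_singleton L a ih =>
    rw [List.nodup_append] at hn
    obtain ⟨g, hg⟩ := ih hn.1
    refine ⟨g.trans (Equiv.swap (g L.length) a), fun i hi => ?_⟩
    rcases Nat.lt_or_ge i L.length with h | h
    · rw [List.getElem_append_left h, Equiv.trans_apply, ← hg i h]
      refine Equiv.swap_apply_of_ne_of_ne (fun e => h.ne (g.injective e)) ?_
      rw [hg i h]
      exact hn.2.2 _ (List.getElem_mem _) a (by simp)
    · obtain rfl : i = L.length := by simp at hi; omega
      simp

theorem LEq.swap {x : List ℕ} (hx : x.Nodup) {u K : List Letter} (hu : ∀ l ∈ u, l.Good x)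
    (hK : ∀ l ∈ K, l.Good x) (h : ∀ a ∈ names u, a ∉ names K) : LEq x (u ++ K) (K ++ u) := by
  have one : ∀ l : Letter, l.Good x → (∀ a ∈ l.names, a ∉ names K) →
      LEq x (l :: K) (K ++ [l]) := by
    intro l hl hd
    clear h
    induction K with
    | nil => exact .refl _ _
    | cons m K ih =>
      have h₁ := LEq.comm hx hl (hK m (by simp)) fun a ha ha' => hd a ha (by simp [ha'])
      exact (h₁.right K).trans ((ih (fun l hl => hK l (by simp [hl])) fun a ha ha' =>
        hd a ha (by simp [ha'])).left [m])
  induction u with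
  | nil => rw [List.append_nil]; exact .refl _ _
  | cons l u ih =>
    have h₁ := (ih (fun l hl => hu l (by simp [hl])) fun a ha => h a (by simp [ha])).left [l]
    have h₂ := (one l (hu l (by simp)) fun a ha => h a (by simp [ha])).right u
    rw [List.append_assoc] at h₂
    exact h₁.trans h₂

namespace Code

theorem Rep.map {w : List Letter} {ℓ : List (ℕ × ℕ)} {q : STVBInfty} (h : Rep (w, ℓ) q)
    (f : ℕ → ℕ) : Rep (w.map (Letter.map f), mapLinks f ℓ) q := by
  have := Reads.map h f
  simpa [Rep, mapLinks, Function.comp_def] using this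

theorem WF.map {w : List Letter} {ℓ : List (ℕ × ℕ)} (h : WF (w, ℓ)) (g : Equiv.Perm ℕ) :
    WF (w.map (Letter.map g), mapLinks g ℓ) := by
  have e₁ : (mapLinks g ℓ).map Prod.fst = (ℓ.map Prod.fst).map g := by
    simp [mapLinks]
  have e₂ : (mapLinks g ℓ).map Prod.snd = (ℓ.map Prod.snd).map g := by
    simp [mapLinks]
  refine ⟨by simpa [mapLinks] using h.ne, ?_, ?_, ?_⟩
  · rw [e₁]; exact h.nodup.map g.injective
  · rw [e₁, e₂]; exact h.perm.map g
  · intro l hl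
    obtain ⟨m, hm, rfl⟩ := List.mem_map.1 hl
    have := h.good m hm
    rw [e₁]
    cases m with
    | X c a b =>
      exact ⟨this.1, fun e => this.2.1 (g.injective e), List.mem_map_of_mem this.2.2.1,
        List.mem_map_of_mem this.2.2.2⟩
    | B a => exact List.mem_map_of_mem this

theorem Sim.map {w w' : List Letter} {ℓ ℓ' : List (ℕ × ℕ)} (h : Sim (w, ℓ) (w', ℓ'))
    (g : Equiv.Perm ℕ) :
    Sim (w.map (Letter.map g), mapLinks g ℓ) (w'.map (Letter.map g), mapLinks g ℓ') := by
  obtain ⟨h₁, h₂, p, q, hp, hq, e⟩ := h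
  exact ⟨h₁.map g, h₂.map g, p, q, hp.map g, hq.map g, e⟩

theorem map_symm_letters (g : Equiv.Perm ℕ) (w : List Letter) :
    (w.map (Letter.map g.symm)).map (Letter.map g) = w := by
  rw [List.map_map]
  conv_rhs => rw [← List.map_id w]
  refine List.map_congr_left fun l _ => ?_
  cases l <;> simp [Letter.map]

theorem mapLinks_symm (g : Equiv.Perm ℕ) (ℓ : List (ℕ × ℕ)) :
    mapLinks g (mapLinks g.symm ℓ) = ℓ := by
  rw [mapLinks, mapLinks, List.map_map]
  conv_rhs => rw [← List.map_id ℓ]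
  exact List.map_congr_left fun p _ =>
    Prod.ext (g.apply_symm_apply _) (g.apply_symm_apply _)

theorem names_map (w : List Letter) (f : ℕ → ℕ) :
    names (w.map (Letter.map f)) = (names w).map f := by
  induction w with
  | nil => rfl
  | cons l w ih =>
    rw [List.map_cons, names_cons, names_cons, ih, List.map_append]
    cases l <;> rfl

/-- Context and remaining links are renamed back by the inverse bijection, so they may be arbitrary.
For this reason the renaming has to be a permutation of all names. -/
theorem Local.map {L : List (ℕ × ℕ)} {u v : List Letter} (h : Local L u v) (g : Equiv.Perm ℕ) :
    Local (mapLinks g L) (u.map (Letter.map g)) (v.map (Letter.map g)) := by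
  intro K ℓ hw hK
  have e : ∀ w, w.map (Letter.map g) ++ K =
      (w ++ K.map (Letter.map g.symm)).map (Letter.map g) := fun w => by
    rw [List.map_append, map_symm_letters]
  have e' : mapLinks g L ++ ℓ = mapLinks g (L ++ mapLinks g.symm ℓ) := by
    rw [mapLinks, mapLinks, List.map_append, ← mapLinks, ← mapLinks, mapLinks_symm]
  have hw' : WF (u ++ K.map (Letter.map g.symm), L ++ mapLinks g.symm ℓ) := by
    have := hw.map g.symm
    rw [e, e'] at this
    have e₁ := map_symm_letters g.symm (u ++ K.map (Letter.map g.symm))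
    have e₂ := mapLinks_symm g.symm (L ++ mapLinks g.symm ℓ)
    rw [Equiv.symm_symm] at e₁ e₂
    rwa [e₁, e₂] at this
  have k : ∀ a, g a ∉ names K → a ∉ names (K.map (Letter.map g.symm)) := by
    intro a ha h
    rw [names_map] at h
    obtain ⟨b, hb, rfl⟩ := List.mem_map.1 h
    exact ha (by simpa using hb)
  have := (h _ _ hw' fun p hp => by
    have := hK (g p.1, g p.2) (List.mem_map_of_mem (f := Prod.map g g) hp)
    exact ⟨k _ this.1, k _ this.2⟩).map g
  rwa [← e, ← e, ← e'] at this

variable {a₁ a₂ a₃ b₁ b₂ b₃ m₁ m₂ : ℕ} {c m : Crossing}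

theorem Local.bar_bar (hn : [a₁, a₂].Nodup) : Local [(a₁, a₂)] [.B a₁, .B a₂] [] := by
  obtain ⟨g, hg⟩ := exists_perm_getElem _ hn
  obtain rfl := hg 0 (by simp)
  obtain rfl := hg 1 (by simp)
  have hu : Contracts [(0, 1)] [.B 0, .B 1] [.B 0, .B 0] :=
    .cons 1 (by simp) (by simp [Letter.names]) (by simp [Letter.names]) (by simp) (.nil _)
  have hv : Contracts [(0, 1)] [] [] := .cons 0 (by simp) (by simp) (by simp) (by simp) (.nil _)
  exact Local.map (.of_contracts hu hv (by simp) fun x hx hg _ =>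
    LEq.bar_bar_cancel hx (hg (.B 0) (by simp))) g

theorem Local.bigon (hc : c.Real) (hn : [a₁, a₂, b₁, b₂].Nodup) :
    Local [(a₁, a₂), (b₁, b₂)] [.X c a₁ b₁, .X c.flip b₂ a₂] [] := by
  obtain ⟨g, hg⟩ := exists_perm_getElem _ hn
  obtain rfl := hg 0 (by simp)
  obtain rfl := hg 1 (by simp)
  obtain rfl := hg 2 (by simp)
  obtain rfl := hg 3 (by simp)
  have hu : Contracts [(0, 1), (2, 3)] [.X c 0 2, .X c.flip 3 1] [.X c 0 2, .X c.flip 2 0] :=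
    .cons 1 (by simp) (by simp [Letter.names]) (by simp [Letter.names]) (by simp)
      (.cons 1 (by simp) (by simp [Letter.names]) (by simp [Letter.names, Letter.map, ren])
        (by simp) (.nil _))
  have hv : Contracts [(0, 1), (2, 3)] [] [] :=
    .cons 0 (by simp) (by simp) (by simp) (by simp)
      (.cons 0 (by simp) (by simp) (by simp) (by simp) (.nil _))
  exact Local.map (.of_contracts hu hv (by simp) fun x hx hg _ =>
    LEq.inverse hx (hg _ (by simp)) (LEq.real_ne_singular hc)) g

theorem Local.real_singular (hc : c.Real) (hn : [a₁, a₂, b₁, b₂].Nodup) :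
    Local [(a₁, a₂), (b₁, b₂)] [.X c a₁ b₁, .X .singular b₂ a₂]
      [.X .singular a₁ b₁, .X c b₂ a₂] := by
  obtain ⟨g, hg⟩ := exists_perm_getElem _ hn
  obtain rfl := hg 0 (by simp)
  obtain rfl := hg 1 (by simp)
  obtain rfl := hg 2 (by simp)
  obtain rfl := hg 3 (by simp)
  have k : ∀ c d : Crossing, Contracts [(0, 1), (2, 3)] [.X c 0 2, .X d 3 1]
      [.X c 0 2, .X d 2 0] := fun c d =>
    .cons 1 (by simp) (by simp [Letter.names]) (by simp [Letter.names]) (by simp)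
      (.cons 1 (by simp) (by simp [Letter.names]) (by simp [Letter.names, Letter.map, ren])
        (by simp) (.nil _))
  refine Local.map (.of_contracts (k _ _) (k _ _) ?_ fun x hx hg _ =>
    LEq.real_singular hx hc (hg (.X c 0 2) (by simp))) g
  have := LEq.real_ne_virtual hc
  simp [Letter.Good, linkNames, this]

theorem Local.twist (hc : c ≠ .virtual) (hn : [a₁, a₂, a₃, b₁, b₂, b₃].Nodup) :
    Local [(a₂, a₃), (a₁, a₂), (b₂, b₃), (b₁, b₂)]
      [.B a₁, .B b₁, .X c a₂ b₂, .B b₃, .B a₃] [.X c b₂ a₂] := by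
  obtain ⟨g, hg⟩ := exists_perm_getElem _ hn
  obtain rfl := hg 0 (by simp)
  obtain rfl := hg 1 (by simp)
  obtain rfl := hg 2 (by simp)
  obtain rfl := hg 3 (by simp)
  obtain rfl := hg 4 (by simp)
  obtain rfl := hg 5 (by simp)
  have hu : Contracts [(1, 2), (0, 1), (4, 5), (3, 4)]
      [.B 0, .B 3, .X c 1 4, .B 5, .B 2] [.B 0, .B 3, .X c 0 3, .B 3, .B 0] :=
    .cons 4 (by simp) (by simp [Letter.names]) (by simp [Letter.names]) (by simp)
      (.cons 2 (by simp) (by simp [Letter.names])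
        (by simp [Letter.names, Letter.map, ren]) (by simp)
        (.cons 3 (by simp) (by simp [Letter.names, Letter.map, ren])
          (by simp [Letter.names, Letter.map, ren]) (by simp)
          (.cons 2 (by simp) (by simp [Letter.names, Letter.map, ren])
            (by simp [Letter.names, Letter.map, ren]) (by simp) (.nil _))))
  have hv : Contracts [(1, 2), (0, 1), (4, 5), (3, 4)] [.X c 4 1] [.X c 3 0] :=
    .cons 1 (by simp) (by simp [Letter.names]) (by simp) (by simp)
      (.cons 0 (by simp) (by simp)
        (by simp [Letter.names]) (by simp)
        (.cons 1 (by simp) (by simp [Letter.names, Letter.map, ren])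
          (by simp) (by simp)
          (.cons 0 (by simp) (by simp)
            (by simp [Letter.names, Letter.map, ren]) (by simp) (.nil _))))
  refine Local.map (.of_contracts hu hv ?_ fun x hx hg _ =>
    (LEq.twist hx (hg (.X c 0 3) (by simp))).symm) g
  simp [Letter.Good, linkNames, hc]

/-- The slide of a strand from the left to the right. -/
theorem Local.slide_left (hm : m.Real) (hc : c ≠ .virtual)
    (hn : [m₁, m₂, a₁, a₂, b₁, b₂].Nodup) :
    Local [(m₁, m₂), (a₁, a₂), (b₁, b₂)] [.X m m₁ a₁, .X m m₂ b₁, .X c a₂ b₂]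
      [.X c a₁ b₁, .X m m₁ b₂, .X m m₂ a₂] := by
  obtain ⟨g, hg⟩ := exists_perm_getElem _ hn
  obtain rfl := hg 0 (by simp)
  obtain rfl := hg 1 (by simp)
  obtain rfl := hg 2 (by simp)
  obtain rfl := hg 3 (by simp)
  obtain rfl := hg 4 (by simp)
  obtain rfl := hg 5 (by simp)
  have hu : Contracts [(0, 1), (2, 3), (4, 5)]
      [.X m 0 2, .X m 1 4, .X c 3 5] [.X m 0 2, .X m 0 4, .X c 2 4] :=
    .cons 1 (by simp) (by simp [Letter.names]) (by simp [Letter.names]) (by simp)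
      (.cons 1 (by simp) (by simp [Letter.names])
        (by simp [Letter.names, Letter.map, ren]) (by simp)
        (.cons 2 (by simp) (by simp [Letter.names, Letter.map, ren])
          (by simp [Letter.names, Letter.map, ren]) (by simp) (.nil _)))
  have hv : Contracts [(0, 1), (2, 3), (4, 5)]
      [.X c 2 4, .X m 0 5, .X m 1 3] [.X c 2 4, .X m 0 4, .X m 0 2] :=
    .cons 2 (by simp) (by simp [Letter.names]) (by simp [Letter.names]) (by simp)
      (.cons 1 (by simp) (by simp [Letter.names])
        (by simp [Letter.names, Letter.map, ren]) (by simp)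
        (.cons 1 (by simp) (by simp [Letter.names])
          (by simp [Letter.names, Letter.map, ren]) (by simp) (.nil _)))
  refine Local.map (.of_contracts hu hv ?_ fun x hx hg _ => ?_) g
  · simp [Letter.Good, linkNames, hc, LEq.real_ne_virtual hm]
  · have h₁ := hg (.X m 0 2) (by simp)
    have h₂ := hg (.X m 0 4) (by simp)
    exact LEq.slide_left hx hm hc (by simp) (by simp) (by simp) h₁.2.2.1 h₁.2.2.2 h₂.2.2.2

/-- The slide of a strand from the right to the left. -/
theorem Local.slide_right (hm : m.Real) (hc : c ≠ .virtual)
    (hn : [m₁, m₂, a₁, a₂, b₁, b₂].Nodup) :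
    Local [(m₁, m₂), (a₂, a₁), (b₂, b₁)] [.X m a₁ m₁, .X m b₁ m₂, .X c a₂ b₂]
      [.X c a₁ b₁, .X m b₂ m₁, .X m a₂ m₂] := by
  obtain ⟨g, hg⟩ := exists_perm_getElem _ hn
  obtain rfl := hg 0 (by simp)
  obtain rfl := hg 1 (by simp)
  obtain rfl := hg 2 (by simp)
  obtain rfl := hg 3 (by simp)
  obtain rfl := hg 4 (by simp)
  obtain rfl := hg 5 (by simp)
  have hu : Contracts [(0, 1), (3, 2), (5, 4)]
      [.X c 3 5, .X m 2 0, .X m 4 1] [.X c 3 5, .X m 3 0, .X m 5 0] :=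
    .cons 2 (by simp) (by simp [Letter.names]) (by simp [Letter.names]) (by simp)
      (.cons 1 (by simp) (by simp [Letter.names])
        (by simp [Letter.names, Letter.map, ren]) (by simp)
        (.cons 1 (by simp) (by simp [Letter.names, Letter.map, ren])
          (by simp [Letter.names, Letter.map, ren]) (by simp) (.nil _)))
  have hv : Contracts [(0, 1), (3, 2), (5, 4)]
      [.X m 5 0, .X m 3 1, .X c 2 4] [.X m 5 0, .X m 3 0, .X c 3 5] :=
    .cons 1 (by simp) (by simp [Letter.names]) (by simp [Letter.names]) (by simp)
      (.cons 2 (by simp) (by simp [Letter.names, Letter.map, ren])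
        (by simp [Letter.names, Letter.map, ren]) (by simp)
        (.cons 1 (by simp) (by simp [Letter.names])
          (by simp [Letter.names, Letter.map, ren]) (by simp) (.nil _)))
  have hv' := LEq.real_ne_virtual hm
  refine Local.map ?_ g (u := [.X m 2 0, .X m 4 1, .X c 3 5]) (v := [.X c 2 4, .X m 5 0, .X m 3 1])
    (L := [(0, 1), (3, 2), (5, 4)])
  -- Here two links run upward. Contraction requires that the letters of each strand stand in the
  -- order of its links, so the crossing `c` is first moved to the other end of the word.
  refine Local.perm_left (u := [.X c 3 5, .X m 2 0, .X m 4 1]) (Local.perm_right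
    (v := [.X m 5 0, .X m 3 1, .X c 2 4]) (.of_contracts hu hv ?_ fun x hx hg _ => ?_) ?_ ?_)
    ?_ ?_
  · simp [Letter.Good, linkNames, hc, hv']
  · have h₁ := hg (.X m 3 0) (by simp)
    have h₂ := hg (.X m 5 0) (by simp)
    exact (LEq.slide_right hx hm hc (by simp) (by simp) (by simp) h₁.2.2.2 h₁.2.2.1 h₂.2.2.1).symm
  · exact (List.perm_append_comm (l₁ := [_, _]) (l₂ := [_]))
  · simp [Letter.names]
  · exact (List.perm_append_comm (l₁ := [_]) (l₂ := [_, _]))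
  · simp [Letter.names]

/-- The slide of a strand past the side of a crossing. -/
theorem Local.slide_mid (hm : m.Real) (hc : c ≠ .virtual)
    (hn : [m₁, m₂, a₁, a₂, b₁, b₂].Nodup) :
    Local [(m₁, m₂), (a₁, a₂), (b₂, b₁)] [.X m m₁ a₁, .X m.flip b₁ m₂, .X c b₂ a₂]
      [.X c b₁ a₁, .X m.flip b₂ m₁, .X m m₂ a₂] := by
  obtain ⟨g, hg⟩ := exists_perm_getElem _ hn
  obtain rfl := hg 0 (by simp)
  obtain rfl := hg 1 (by simp)
  obtain rfl := hg 2 (by simp)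
  obtain rfl := hg 3 (by simp)
  obtain rfl := hg 4 (by simp)
  obtain rfl := hg 5 (by simp)
  have hu : Contracts [(0, 1), (2, 3), (5, 4)]
      [.X m 0 2, .X c 5 3, .X m.flip 4 1] [.X m 0 2, .X c 5 2, .X m.flip 5 0] :=
    .cons 2 (by simp) (by simp [Letter.names]) (by simp [Letter.names]) (by simp)
      (.cons 1 (by simp) (by simp [Letter.names])
        (by simp [Letter.names, Letter.map, ren]) (by simp)
        (.cons 2 (by simp) (by simp [Letter.names, Letter.map, ren])
          (by simp [Letter.names, Letter.map, ren]) (by simp) (.nil _)))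
  have hv : Contracts [(0, 1), (2, 3), (5, 4)]
      [.X m.flip 5 0, .X c 4 2, .X m 1 3] [.X m.flip 5 0, .X c 5 2, .X m 0 2] :=
    .cons 2 (by simp) (by simp [Letter.names]) (by simp [Letter.names]) (by simp)
      (.cons 2 (by simp) (by simp [Letter.names])
        (by simp [Letter.names, Letter.map, ren]) (by simp)
        (.cons 1 (by simp) (by simp [Letter.names])
          (by simp [Letter.names, Letter.map, ren]) (by simp) (.nil _)))
  have hv' := LEq.real_ne_virtual hm
  have hv'' := LEq.flip_ne_virtual hv'
  refine Local.map ?_ g (u := [.X m 0 2, .X m.flip 4 1, .X c 5 3])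
    (v := [.X c 4 2, .X m.flip 5 0, .X m 1 3]) (L := [(0, 1), (2, 3), (5, 4)])
  -- One link runs upward; in the new order `c` stands between the two other letters, as in
  -- `LEq.slide_mid`.
  refine Local.perm_left (u := [.X m 0 2, .X c 5 3, .X m.flip 4 1]) (Local.perm_right
    (v := [.X m.flip 5 0, .X c 4 2, .X m 1 3]) (.of_contracts hu hv ?_ fun x hx hg _ => ?_) ?_ ?_)
    ?_ ?_
  · simp [Letter.Good, linkNames, hc, hv', hv'']
  · have h₁ := hg (.X m 0 2) (by simp)
    have h₂ := hg (.X c 5 2) (by simp)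
    exact LEq.slide_mid hx hm hc (by simp) (by simp) (by simp) h₁.2.2.1 h₂.2.2.1 h₁.2.2.2
  · exact .swap _ _ _
  · simp [Letter.names]
  · exact (List.Perm.swap _ _ _).cons _
  · simp [Letter.names]

end Code

end STV

/-! ### Kinks and threadings at the end of the word. -/

namespace STV

namespace Code

variable {c m : Crossing} {w : List Letter} {ℓ : List (ℕ × ℕ)} {a b s y : ℕ}

/-- In a well-formed code the strand `s` also ends somewhere, and it is not linked to itself because
the only link into `s` comes from `a`. -/
theorem WF.exists_next (h : WF (w, (a, s) :: ℓ)) (has : a ≠ s) :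
    ∃ y ℓ', ℓ.Perm ((s, y) :: ℓ') ∧ y ≠ s := by
  have hs : s ∈ ((a, s) :: ℓ).map Prod.fst := h.perm.symm.subset (by simp)
  simp only [List.map_cons, List.mem_cons, List.mem_map] at hs
  rcases hs with hs | ⟨⟨s', y⟩, hp, rfl⟩
  · exact absurd hs.symm has
  · refine ⟨y, _, List.perm_cons_erase hp, ?_⟩
    rintro rfl
    have := h.nodup_snd
    simp only [List.map_cons, List.nodup_cons] at this
    exact this.1 (List.mem_map_of_mem (f := Prod.snd) hp)

/-- The code before a stabilization: `s` carries no letter and can be dropped. -/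
theorem WF.unstab (h : WF (w, (a, s) :: (s, y) :: ℓ)) (hs : s ∉ names w) :
    WF (w, (a, y) :: ℓ) ∧ s ∉ ((a, y) :: ℓ).map Prod.fst := by
  have hn := h.nodup
  simp only [List.map_cons, List.nodup_cons, List.mem_cons, not_or] at hn
  refine ⟨⟨by simp, ?_, ?_, fun l hl => ?_⟩, ?_⟩
  · simp only [List.map_cons, List.nodup_cons]
    exact ⟨hn.1.2, hn.2.2⟩
  · have := h.perm
    simp only [List.map_cons] at this ⊢
    exact ((List.Perm.swap _ _ _).trans this).cons_inv
  · have hl' := h.good l hl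
    have hs : s ∉ l.names := fun e => hs (List.mem_flatMap.2 ⟨l, hl, e⟩)
    cases l with
    | X c b d =>
      obtain ⟨hc, hbd, hb, hd⟩ := hl'
      simp only [Letter.names, List.mem_cons, List.not_mem_nil, or_false, not_or] at hs
      simp only [List.map_cons, List.mem_cons] at hb hd ⊢
      exact ⟨hc, hbd, by simp only [List.mem_cons]; tauto,
        by simp only [List.mem_cons]; tauto⟩
    | B b =>
      have hb : b ∈ _ := hl'
      simp only [Letter.names, List.mem_cons, List.not_mem_nil, or_false] at hs
      simp only [List.map_cons, List.mem_cons] at hb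
      change b ∈ _
      simp only [List.map_cons, List.mem_cons]
      tauto
  · simp only [List.map_cons, List.mem_cons, not_or]
    exact ⟨fun e => hn.1.1 e.symm, hn.2.1⟩

/-- A kink at the end of the braid. -/
theorem WF.kink (h : WF (w, (a, s) :: ℓ)) (has : a ≠ s) (hs : s ∉ names w) (hc : c.Real) :
    Sim (w ++ [.X c a s], (a, s) :: ℓ) (w, (a, s) :: ℓ) := by
  obtain ⟨y, ℓ', hp, hy⟩ := h.exists_next has
  have h' := h.of_perm (hp.cons _)
  obtain ⟨h₁, h₂⟩ := h'.unstab hs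
  -- Real and virtual stabilization produce the same links, one with the letter and one without it.
  -- Hence the letter can be added without changing the links.
  have k₁ := h₁.sim_stab h₂ c (LEq.real_ne_singular hc)
  have k₂ := h₁.sim_stab h₂ .virtual (by simp)
  rw [crWord_of_ne (LEq.real_ne_virtual hc)] at k₁
  simp only [crWord, List.append_nil] at k₂
  have k := k₁.symm.trans k₂
  exact ((k.1.sim_perm (hp.cons _).symm).symm).trans (k.trans (k.2.1.sim_perm (hp.cons _).symm))

theorem WF.exists_next_two (h : WF (w, (b, s) :: ℓ)) (hbs : b ≠ s) (hab : a ≠ b) (has : a ≠ s)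
    (ha : a ∈ ℓ.map Prod.fst) :
    ∃ y u ℓ', ℓ.Perm ((s, y) :: (a, u) :: ℓ') := by
  obtain ⟨y, ℓ', hp, hy⟩ := h.exists_next hbs
  have ha' := (hp.map _).subset ha
  simp only [List.map_cons, List.mem_cons, List.mem_map] at ha'
  rcases ha' with ha' | ⟨⟨a', u⟩, hu, rfl⟩
  · exact absurd ha' has
  · exact ⟨y, u, _, hp.trans ((List.perm_cons_erase hu).cons _)⟩

/-- Right threading at the end of the braid. -/
theorem WF.thread_right (h : WF (w, (b, s) :: ℓ)) (hbs : b ≠ s) (hab : a ≠ b) (has : a ≠ s)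
    (ha : a ∈ ℓ.map Prod.fst) (hs : s ∉ names w) (hc : c.Real) :
    Sim (w ++ [.X c a s, .X c.flip b a], (b, s) :: ℓ) (w, (b, s) :: ℓ) ∧
    Sim (w ++ [.X .singular a s, .X c b a], (b, s) :: ℓ)
      (w ++ [.X c a s, .X .singular b a], (b, s) :: ℓ) := by
  obtain ⟨y, u, ℓ', hp⟩ := h.exists_next_two hbs hab has ha
  have hp' := hp.cons (b, s)
  obtain ⟨h₁, h₂⟩ := (h.of_perm hp').unstab hs
  -- Again compared with a virtual stabilization, which has the same links and no letters.
  obtain ⟨k₁, k₂⟩ := h₁.sim_right h₂ c hc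
  have k₃ := h₁.sim_stab h₂ .virtual (by simp)
  simp only [crWord, List.append_nil] at k₃
  have k := k₁.symm.trans k₃
  exact ⟨(k.1.sim_perm hp'.symm).symm.trans (sim_of_perm hp'.symm k),
    (k₂.1.sim_perm hp'.symm).symm.trans (sim_of_perm hp'.symm k₂)⟩

/-- Left threading at the end of the braid. -/
theorem WF.thread_left (h : WF (w, (b, s) :: ℓ)) (hbs : b ≠ s) (hab : a ≠ b) (has : a ≠ s)
    (ha : a ∈ ℓ.map Prod.fst) (hs : s ∉ names w) (hc : c.Real) :
    Sim (w ++ [.X c s a, .X c.flip a b], (b, s) :: ℓ) (w, (b, s) :: ℓ) ∧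
    Sim (w ++ [.X .singular s a, .X c a b], (b, s) :: ℓ)
      (w ++ [.X c s a, .X .singular a b], (b, s) :: ℓ) := by
  obtain ⟨y, u, ℓ', hp⟩ := h.exists_next_two hbs hab has ha
  have hp' := hp.cons (b, s)
  obtain ⟨h₁, h₂⟩ := (h.of_perm hp').unstab hs
  obtain ⟨k₁, k₂⟩ := h₁.sim_left h₂ c hc
  have k₃ := h₁.sim_stab h₂ .virtual (by simp)
  simp only [crWord, List.append_nil] at k₃
  have k := k₁.symm.trans k₃
  exact ⟨(k.1.sim_perm hp'.symm).symm.trans (sim_of_perm hp'.symm k),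
    (k₂.1.sim_perm hp'.symm).symm.trans (sim_of_perm hp'.symm k₂)⟩

theorem WF.sim_swap {u K : List Letter} (h : WF (u ++ K, ℓ)) (hd : ∀ a ∈ names u, a ∉ names K) :
    Sim (u ++ K, ℓ) (K ++ u, ℓ) :=
  h.sim_letters (LEq.swap h.nodup_snd (fun l hl => h.good_snd l (by simp [hl]))
    (fun l hl => h.good_snd l (by simp [hl])) hd)

theorem WF.sub {u K : List Letter} (h : WF (u ++ K, ℓ)) : WF (K, ℓ) :=
  h.of_good fun l hl => h.good l (by simp [hl])

/-- The letter commutes with the context, which avoids both strands, and so reaches the end of the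
word. -/
theorem Local.kink (hc : c.Real) (has : a ≠ s) : Local [(a, s)] [.X c a s] [] := by
  intro K ℓ h hK
  have hK := hK (a, s) (by simp)
  exact (h.sim_swap (by simp [Letter.names, hK])).trans (h.sub.kink has hK.2 hc)

/-- The other kink. -/
theorem Local.kink' (hc : c.Real) (has : a ≠ s) : Local [(a, s)] [.X c s a] [] := by
  intro K ℓ h hK
  have hK := hK (a, s) (by simp)
  have hw : WF (K, (a, s) :: ℓ) := h.sub
  have hx := hw.nodup_snd
  have hs : s ∈ ((a, s) :: ℓ).map Prod.fst := hw.perm.symm.subset (by simp)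
  have ha : a ∈ ((a, s) :: ℓ).map Prod.fst := by simp
  have hv := LEq.real_ne_virtual hc
  obtain ⟨g, hg⟩ := exists_link_fun hw.nodup
  have hga : g a = s := hg (a, s) (by simp)
  obtain ⟨y, ℓ', hp, hy⟩ := hw.exists_next has
  have hgs : g s = y := hg (s, y) (List.mem_cons_of_mem _ (hp.symm.subset (by simp)))
  have good : ∀ {v : List Letter}, (∀ l ∈ v, l.Good (((a, s) :: ℓ).map Prod.fst)) →
      WF (v, (a, s) :: ℓ) := fun hv => hw.of_good hv
  have hy' : y ∈ ((a, s) :: ℓ).map Prod.fst := hw.perm.symm.subset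
    (List.mem_map.2 ⟨(s, y), List.mem_cons_of_mem _ (hp.symm.subset (by simp)), rfl⟩)
  have hKg := hw.good
  have mem : ∀ l : Letter, l ∈ K → l.Good (((a, s) :: ℓ).map Prod.fst) := hKg
  have hsx := hw.perm.subset hs
  have hax := hw.perm.subset ha
  -- turn the crossing around
  have e₁ : LEq (((a, s) :: ℓ).map Prod.snd) (K ++ [.X c s a])
      (K ++ [.B a, .B s, .X c a s, .B s, .B a]) :=
    (LEq.twist hx ⟨hv, has, hax, hsx⟩).left K
  have g₁ : WF (K ++ [.B a, .B s, .X c a s, .B s] ++ [.B a], (a, s) :: ℓ) := good (by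
    intro l hl
    simp only [List.append_assoc, List.cons_append, List.nil_append, List.mem_append,
      List.mem_cons, List.not_mem_nil, or_false] at hl
    rcases hl with hl | rfl | rfl | rfl | rfl | rfl
    exacts [mem l hl, ha, hs, ⟨hv, has, ha, hs⟩, hs, ha])
  -- The last bar on `a` returns at the front as a bar on `s`. It passes the context and cancels
  -- against the bar on `s` before the crossing.
  have r₁ := g₁.sim_rotate hg
  simp only [List.map_cons, List.map_nil, Letter.map, hga] at r₁
  have e₂ : LEq (((a, s) :: ℓ).map Prod.snd)
      ([.B s] ++ (K ++ [.B a, .B s, .X c a s, .B s])) (K ++ [.B a, .X c a s, .B s]) := by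
    have q₁ := (LEq.swap hx (u := [.B s]) (K := K ++ [.B a]) (by
      intro l hl; rw [List.mem_singleton.1 hl]; exact hsx) (by
      simp only [List.mem_append]
      rintro l (hl | hl)
      · exact (mem l hl).mono hw.perm.subset
      · simp at hl; subst hl; exact hax) (by
        simp [Letter.names, names_append, hK.2, has.symm])).right [.B s, .X c a s, .B s]
    have q₂ := ((LEq.bar_bar_cancel hx hsx).left (K ++ [.B a])).right [.X c a s, .B s]
    simp only [List.append_assoc, List.cons_append, List.nil_append] at q₁ q₂ ⊢
    exact q₁.trans q₂
  have r₂ := r₁.2.1.sim_letters e₂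
  have g₂ : WF (K ++ [.B a, .X c a s] ++ [.B s], (a, s) :: ℓ) := by
    simpa using r₂.2.1
  -- The bar behind the crossing is rotated away and becomes a bar on the successor `y` of `s`. Now
  -- the crossing stands at the end and no earlier letter contains `s`: this is the first kink.
  have r₃ := g₂.sim_rotate hg
  simp only [List.map_cons, List.map_nil, Letter.map, hgs] at r₃
  have g₃ : WF ([.B y] ++ (K ++ [.B a]), (a, s) :: ℓ) := good (by
    simp only [List.mem_append]
    rintro l (hl | hl | hl)
    · simp at hl; subst hl; exact hy'
    · exact mem l hl
    · simp at hl; subst hl; exact ha)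
  have r₄ := g₃.kink has (by
    simp [Letter.names, names_append, hK.2, hy.symm, has.symm]) hc
  have g₄ : WF ((K ++ [.B a]) ++ [.B s], (a, s) :: ℓ) := good (by
    simp only [List.mem_append]
    rintro l ((hl | hl) | hl)
    · exact mem l hl
    · simp at hl; subst hl; exact ha
    · simp at hl; subst hl; exact hs)
  -- After the removal of the crossing the bar is rotated back. The remaining bars on `a` and `s`
  -- are consecutive on one strand and cancel.
  have r₅ := g₄.sim_rotate hg
  simp only [List.map_cons, List.map_nil, Letter.map, hgs] at r₅
  have g₅ : WF ([.B a, .B s] ++ K, (a, s) :: ℓ) := good (by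
    simp only [List.mem_append]
    rintro l (hl | hl)
    · simp at hl; rcases hl with rfl | rfl; exacts [ha, hs]
    · exact mem l hl)
  have r₆ := Local.bar_bar (a₁ := a) (a₂ := s) (by simpa using has) K ℓ g₅ (by simpa using hK)
  have r₇ := g₅.sim_swap (by simp [Letter.names, hK])
  have r₀ := (h.sim_swap (by simp [Letter.names, hK])).trans
    ((h.sim_swap (by simp [Letter.names, hK])).2.1.sim_letters e₁)
  simp only [List.append_assoc, List.cons_append, List.nil_append] at *
  exact r₀.trans (r₁.trans (r₂.trans (r₃.trans (r₄.trans (r₅.symm.trans (r₇.symm.trans r₆))))))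

end Code

end STV

/-! ### Bigons and singular crossings of antiparallel strands. -/

namespace STV

namespace Code

variable {c m : Crossing} {a b s a₁ a₂ b₁ b₂ m₁ m₂ : ℕ}

theorem Local.extend {L : List (ℕ × ℕ)} {u v : List Letter} (h : Local L u v)
    (L' : List (ℕ × ℕ)) : Local (L ++ L') u v := by
  intro K ℓ hw hK
  rw [List.append_assoc] at hw ⊢
  exact h K _ hw fun p hp => hK p (by simp [hp])

theorem contract_append (L ℓ ℓ' : List (ℕ × ℕ)) :
    contract L (ℓ ++ ℓ') = contract L ℓ ++ contract L ℓ' := by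
  induction L generalizing ℓ ℓ' with
  | nil => rfl
  | cons p L ih =>
    simp only [contract, List.foldl_cons] at ih ⊢
    rw [mapLinks, List.map_append, ih]
    rfl

/-- The strands are joined only along `L`; a replacement known in the presence of the links `L'`
completes the argument. The links `L'` must not be renamed by the contraction. -/
theorem Local.of_contracts_append {L L' : List (ℕ × ℕ)} {u v u₀ v₀ : List Letter}
    (hu : Contracts L u u₀) (hv : Contracts L v v₀) (hL : contract L L' = L')
    (hg : ∀ l ∈ v, l.Good (linkNames (L ++ L') ++ names u)) (h : Local L' u₀ v₀) : Local
        (L ++ L') u v := by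
  intro K ℓ hw hK
  have hw' := hw.replace hg
  rw [List.append_assoc] at hw hw' ⊢
  have h₁ := hu.sim hw fun p hp => hK p (by simp [hp])
  have h₂ := hv.sim hw' fun p hp => hK p (by simp [hp])
  rw [contract_append, hL] at h₁ h₂
  exact h₁.trans ((h _ _ h₁.2.1 fun p hp => hK p (by simp [hp])).trans h₂.symm)

/-- A replacement that is possible at the end of a word is possible between the end of the strand
`b` and the beginning of the strand `s`. -/
theorem Local.of_end {u v : List Letter}
    (h : ∀ w ℓ, WF (w ++ u, (b, s) :: ℓ) → s ∉ names w →
      Sim (w ++ u, (b, s) :: ℓ) (w ++ v, (b, s) :: ℓ)) {p q : List Letter}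
    (hp : s ∉ names p) (hq : b ∉ names q) : Local [(b, s)] (p ++ u ++ q) (p ++ v ++ q) := by
  intro K ℓ hw hK
  obtain ⟨f, hf⟩ := exists_link_fun hw.nodup
  have hb := (hK (b, s) (by simp)).1
  rw [List.append_assoc] at hw ⊢
  rw [List.append_assoc (p ++ v)]
  have h₁ := hw.sim_rotate hf
  rw [← List.append_assoc (List.map _ (q ++ K))] at h₁
  -- Rotation turns a name into `s` only if it was `b`, because each strand has one predecessor; and
  -- `b` occurs neither in `q` nor in the context.
  have h₂ := h _ _ h₁.2.1 (by
    rw [names_append, List.mem_append, not_or, names_map]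
    refine ⟨fun e => ?_, hp⟩
    obtain ⟨x, hx, e⟩ := List.mem_map.1 e
    have hx' : x ∈ ((b, s) :: ℓ).map Prod.fst :=
      hw.names_subset (by rw [names_append]; exact List.mem_append_right _ hx)
    have hn : (((b, s) :: ℓ).map Prod.fst).map f = ((b, s) :: ℓ).map Prod.snd := by
      rw [List.map_map]; exact List.map_congr_left hf
    have := List.inj_on_of_nodup_map (hn ▸ hw.nodup_snd) hx' (y := b) (by simp)
      (e.trans (hf (b, s) (by simp)).symm)
    subst this
    rw [names_append, List.mem_append] at hx
    exact hx.elim hq hb)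
  have h₃ : WF ((p ++ v) ++ (q ++ K), (b, s) :: ℓ) := h₂.2.1.of_good fun l hl => by
    simp only [List.mem_append] at hl
    rcases hl with (hl | hl) | hl
    · exact h₂.2.1.good l (by simp [hl])
    · exact h₂.2.1.good l (by simp [hl])
    · exact hw.good l (by simp only [List.mem_append]; exact .inr hl)
  have h₄ := h₃.sim_rotate hf
  rw [← List.append_assoc (List.map _ (q ++ K))] at h₄
  exact h₁.trans (h₂.trans h₄.symm)

theorem mem_of_good {w : List Letter} {ℓ : List (ℕ × ℕ)} {d : ℕ} {l : Letter}
    (h : WF (w ++ l :: [.X c b a], (d, s) :: ℓ)) (hab : a ≠ d) : a ∈ ℓ.map Prod.fst := by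
  have := (h.good (.X c b a) (by simp)).2.2.2
  simpa [hab] using this

variable {p q : List Letter}

/-- Right under-threading at an arbitrary place between the end of `b` and the beginning of `s`. The
words `p` and `q` keep this place while `a` stays uncut. -/
theorem Local.bigon_right (hc : c.Real) (hn : [a, b, s].Nodup)
    (hp : s ∉ names p) (hq : b ∉ names q) :
    Local [(b, s)] (p ++ [.X c a s, .X c.flip b a] ++ q) (p ++ [] ++ q) := by
  simp only [List.nodup_cons, List.mem_cons, List.not_mem_nil, or_false, not_or] at hn
  refine .of_end (fun w ℓ h hs => ?_) hp hq
  rw [List.append_nil]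
  exact (h.names_left.thread_right hn.2.1 hn.1.1 hn.1.2 (mem_of_good h hn.1.1) hs hc).1

/-- Right `rs`-threading in the same form. -/
theorem Local.real_singular_right (hc : c.Real) (hn : [a, b, s].Nodup)
    (hp : s ∉ names p) (hq : b ∉ names q) :
    Local [(b, s)] (p ++ [.X .singular a s, .X c b a] ++ q)
      (p ++ [.X c a s, .X .singular b a] ++ q) := by
  simp only [List.nodup_cons, List.mem_cons, List.not_mem_nil, or_false, not_or] at hn
  refine .of_end (fun w ℓ h hs => ?_) hp hq
  exact (h.names_left.thread_right hn.2.1 hn.1.1 hn.1.2 (mem_of_good h hn.1.1) hs hc).2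

theorem mem_of_good' {w : List Letter} {ℓ : List (ℕ × ℕ)} {d : ℕ} {l : Letter}
    (h : WF (w ++ l :: [.X c a b], (d, s) :: ℓ)) (hab : a ≠ d) : a ∈ ℓ.map Prod.fst := by
  have := (h.good (.X c a b) (by simp)).2.2.1
  simpa [hab] using this

theorem Local.bigon_left (hc : c.Real) (hn : [a, b, s].Nodup)
    (hp : s ∉ names p) (hq : b ∉ names q) :
    Local [(b, s)] (p ++ [.X c s a, .X c.flip a b] ++ q) (p ++ [] ++ q) := by
  simp only [List.nodup_cons, List.mem_cons, List.not_mem_nil, or_false, not_or] at hn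
  refine .of_end (fun w ℓ h hs => ?_) hp hq
  rw [List.append_nil]
  exact (h.names_left.thread_left hn.2.1 hn.1.1 hn.1.2 (mem_of_good' h hn.1.1) hs hc).1

theorem Local.real_singular_left (hc : c.Real) (hn : [a, b, s].Nodup)
    (hp : s ∉ names p) (hq : b ∉ names q) :
    Local [(b, s)] (p ++ [.X .singular s a, .X c a b] ++ q)
      (p ++ [.X c s a, .X .singular a b] ++ q) := by
  simp only [List.nodup_cons, List.mem_cons, List.not_mem_nil, or_false, not_or] at hn
  refine .of_end (fun w ℓ h hs => ?_) hp hq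
  exact (h.names_left.thread_left hn.2.1 hn.1.1 hn.1.2 (mem_of_good' h hn.1.1) hs hc).2

/-- A bigon of antiparallel strands that wind around each other on the right. -/
theorem Local.bigon_anti_right (hc : c.Real) (hn : [a₁, a₂, b₁, b₂].Nodup) :
    Local [(a₁, a₂), (b₁, b₂)] [.X c a₁ b₂, .X c.flip b₁ a₂] [] := by
  obtain ⟨g, hg⟩ := exists_perm_getElem _ hn
  obtain rfl := hg 0 (by simp)
  obtain rfl := hg 1 (by simp)
  obtain rfl := hg 2 (by simp)
  obtain rfl := hg 3 (by simp)
  have hu : Contracts [(0, 1)] [.X c 0 3, .X c.flip 2 1] [.X c 0 3, .X c.flip 2 0] :=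
    .cons 1 (by simp) (by simp [Letter.names]) (by simp [Letter.names]) (by simp) (.nil _)
  have hv : Contracts [(0, 1)] [] [] := .cons 0 (by simp) (by simp) (by simp) (by simp) (.nil _)
  exact Local.map (.of_contracts_append (L' := [(2, 3)]) hu hv (by simp [contract, mapLinks, ren])
    (by simp) (.bigon_right (p := []) (q := []) hc (by simp) (by simp) (by simp))) g

/-- A bigon of antiparallel strands that wind around each other on the left. -/
theorem Local.bigon_anti_left (hc : c.Real) (hn : [a₁, a₂, b₁, b₂].Nodup) :
    Local [(a₁, a₂), (b₁, b₂)] [.X c b₂ a₁, .X c.flip a₂ b₁] [] := by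
  obtain ⟨g, hg⟩ := exists_perm_getElem _ hn
  obtain rfl := hg 0 (by simp)
  obtain rfl := hg 1 (by simp)
  obtain rfl := hg 2 (by simp)
  obtain rfl := hg 3 (by simp)
  have hu : Contracts [(0, 1)] [.X c 3 0, .X c.flip 1 2] [.X c 3 0, .X c.flip 0 2] :=
    .cons 1 (by simp) (by simp [Letter.names]) (by simp [Letter.names]) (by simp) (.nil _)
  have hv : Contracts [(0, 1)] [] [] := .cons 0 (by simp) (by simp) (by simp) (by simp) (.nil _)
  exact Local.map (.of_contracts_append (L' := [(2, 3)]) hu hv (by simp [contract, mapLinks, ren])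
    (by simp) (.bigon_left (p := []) (q := []) hc (by simp) (by simp) (by simp))) g

/-- The move S2 for antiparallel strands; joining the strand `a` reduces it to the right
`rs`-threading. -/
theorem Local.real_singular_anti_right (hc : c.Real) (hn : [a₁, a₂, b₁, b₂].Nodup) :
    Local [(a₁, a₂), (b₁, b₂)] [.X .singular a₁ b₂, .X c b₁ a₂]
      [.X c a₁ b₂, .X .singular b₁ a₂] := by
  obtain ⟨g, hg⟩ := exists_perm_getElem _ hn
  obtain rfl := hg 0 (by simp)
  obtain rfl := hg 1 (by simp)
  obtain rfl := hg 2 (by simp)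
  obtain rfl := hg 3 (by simp)
  have k : ∀ c d : Crossing, Contracts [(0, 1)] [.X c 0 3, .X d 2 1] [.X c 0 3, .X d 2 0] :=
    fun c d => .cons 1 (by simp) (by simp [Letter.names]) (by simp [Letter.names]) (by simp)
        (.nil _)
  refine Local.map (.of_contracts_append (L' := [(2, 3)]) (k _ _) (k _ _)
    (by simp [contract, mapLinks, ren]) ?_
    (.real_singular_right (p := []) (q := []) hc (by simp) (by simp) (by simp))) g
  simp [Letter.Good, linkNames, LEq.real_ne_virtual hc]

theorem Local.real_singular_anti_left (hc : c.Real) (hn : [a₁, a₂, b₁, b₂].Nodup) :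
    Local [(a₁, a₂), (b₁, b₂)] [.X .singular b₂ a₁, .X c a₂ b₁]
      [.X c b₂ a₁, .X .singular a₂ b₁] := by
  obtain ⟨g, hg⟩ := exists_perm_getElem _ hn
  obtain rfl := hg 0 (by simp)
  obtain rfl := hg 1 (by simp)
  obtain rfl := hg 2 (by simp)
  obtain rfl := hg 3 (by simp)
  have k : ∀ c d : Crossing, Contracts [(0, 1)] [.X c 3 0, .X d 1 2] [.X c 3 0, .X d 0 2] :=
    fun c d => .cons 1 (by simp) (by simp [Letter.names]) (by simp [Letter.names]) (by simp)
        (.nil _)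
  refine Local.map (.of_contracts_append (L' := [(2, 3)]) (k _ _) (k _ _)
    (by simp [contract, mapLinks, ren]) ?_
    (.real_singular_left (p := []) (q := []) hc (by simp) (by simp) (by simp))) g
  simp [Letter.Good, linkNames, LEq.real_ne_virtual hc]

/-! ### The cyclically oriented slide -/

theorem Local.comm (L : List (ℕ × ℕ)) (u r : List Letter) {l l' : Letter}
    (hd : ∀ a ∈ l.names, a ∉ l'.names) : Local L (u ++ [l, l'] ++ r) (u ++ [l', l] ++ r) := by
  intro K ℓ hw hK
  exact hw.sim_letters ((((LEq.comm hw.nodup_snd (hw.good_snd _ (by simp))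
    (hw.good_snd _ (by simp)) hd).left u).right r).right K)

theorem Local.perm_extend {L L' L'' : List (ℕ × ℕ)} {u v : List Letter} (h : Local L u v)
    (hp : (L ++ L').Perm L'') : Local L'' u v := (h.extend L').links_perm hp

/-- The moving strand consists of the consecutive pieces `0, 1, 2, 3`. An antiparallel bigon with
the strand `5` is inserted between `0` and `1`; the new crossing with `1`, together with the
crossings of `2` and `4` and of `5` and `4`, admits a braid-like slide. The crossing that remains
forms a bigon with the old one between `2` and `3`, which is removed. -/
theorem Local.slide_chain (hm : m.Real) (hc : c ≠ .virtual) :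
    Local [(0, 1), (1, 2), (2, 3)] [.X m 3 5, .X c 5 4, .X m.flip 4 0]
      [.X m.flip 4 3, .X c 5 4, .X m 0 5] := by
  have hv := LEq.real_ne_virtual hm
  have hv' := LEq.flip_ne_virtual hv
  have hf := LEq.real_flip hm
  have s₁ : Local [(0, 1)] [.X m 3 5, .X c 5 4, .X m.flip 4 0]
      [.X m 3 5, .X c 5 4, .X m.flip 4 1] := by
    have := Local.shift' (a := 0) (s := 1) (u := [.X m 3 5, .X c 5 4, .X m.flip 4 0]) (by simp)
      (by simp [Letter.names])
    simpa [Letter.map, ren] using this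
  have s₂ : Local [(1, 2)] [.X m 3 5, .X c 5 4, .X m.flip 4 1]
      [.X m 3 5, .X c 5 4, .X m.flip 4 2] := by
    have := Local.shift' (a := 1) (s := 2) (u := [.X m 3 5, .X c 5 4, .X m.flip 4 1]) (by simp)
      (by simp [Letter.names])
    simpa [Letter.map, ren] using this
  -- insert a bigon
  have s₃ := Local.bigon_right (p := [.X m 3 5, .X c 5 4]) (q := [.X m.flip 4 2]) (a := 5) (b := 0)
    (s := 1) hf (by simp) (by simp [Letter.names]) (by simp [Letter.names])
  have s₄ := Local.comm [(0, 1)] [.X m 3 5, .X c 5 4, .X m.flip 5 1] [] (l := .X m 0 5)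
    (l' := .X m.flip 4 2) (by simp [Letter.names])
  -- The slide proper: the pieces `1` and `2` pass the crossing of `5` and `4`.
  have s₅ : Local [(1, 2)] [.X m 3 5, .X c 5 4, .X m.flip 5 1, .X m.flip 4 2, .X m 0 5]
      [.X m 3 5, .X m.flip 4 1, .X m.flip 5 2, .X c 5 4, .X m 0 5] := by
    have hu : Contracts [(1, 2)] [.X m 3 5, .X c 5 4, .X m.flip 5 1, .X m.flip 4 2, .X m 0 5]
        [.X m 3 5, .X c 5 4, .X m.flip 5 1, .X m.flip 4 1, .X m 0 5] :=
      .cons 3 (by simp) (by simp [Letter.names]) (by simp [Letter.names]) (by simp) (.nil _)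
    have hv : Contracts [(1, 2)] [.X m 3 5, .X m.flip 4 1, .X m.flip 5 2, .X c 5 4, .X m 0 5]
        [.X m 3 5, .X m.flip 4 1, .X m.flip 5 1, .X c 5 4, .X m 0 5] :=
      .cons 2 (by simp) (by simp [Letter.names]) (by simp [Letter.names]) (by simp) (.nil _)
    refine .of_contracts hu hv ?_ fun x hx hg hg' => ?_
    · simp [Letter.Good, linkNames, Letter.names, *]
    · have g₁ := hg (.X c 5 4) (by simp)
      have g₂ := hg (.X m.flip 5 1) (by simp)
      exact (((LEq.slide_right hx hf hc (by simp) (by simp) (by simp) g₂.2.2.2 g₁.2.2.1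
        g₁.2.2.2).symm).right [.X m 0 5]).left [.X m 3 5]
  have s₆ := Local.comm [(0, 1)] [] [.X m.flip 5 2, .X c 5 4, .X m 0 5] (l := .X m 3 5)
    (l' := .X m.flip 4 1) (by simp [Letter.names])
  -- The old crossing of `5` with `3` and the one with `2` that results from the slide cancel.
  have s₇ := Local.bigon_left (p := [.X m.flip 4 1]) (q := [.X c 5 4, .X m 0 5]) (a := 5) (b := 2)
    (s := 3) hm (by simp) (by simp [Letter.names]) (by simp [Letter.names])
  have s₈ : Local [(1, 2)] [.X m.flip 4 1, .X c 5 4, .X m 0 5]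
      [.X m.flip 4 2, .X c 5 4, .X m 0 5] := by
    have := Local.shift' (a := 1) (s := 2) (u := [.X m.flip 4 1, .X c 5 4, .X m 0 5]) (by simp)
      (by simp [Letter.names])
    simpa [Letter.map, ren] using this
  have s₉ : Local [(2, 3)] [.X m.flip 4 2, .X c 5 4, .X m 0 5]
      [.X m.flip 4 3, .X c 5 4, .X m 0 5] := by
    have := Local.shift' (a := 2) (s := 3) (u := [.X m.flip 4 2, .X c 5 4, .X m 0 5]) (by simp)
      (by simp [Letter.names])
    simpa [Letter.map, ren] using this
  simp only [LEq.flip_flip] at s₃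
  have good : ∀ {L u v}, (∀ l ∈ u, l.Good (linkNames L ++ names v)) → Local L u v → Local L v u :=
    fun hg h => h.symm hg
  have e₁ : ∀ {u v}, Local [(0, 1)] u v → Local [(0, 1), (1, 2), (2, 3)] u v := fun h => h.extend _
  have e₂ : ∀ {u v}, Local [(1, 2)] u v → Local [(0, 1), (1, 2), (2, 3)] u v := fun h =>
    h.perm_extend (L' := [(0, 1), (2, 3)]) (by decide)
  have e₃ : ∀ {u v}, Local [(2, 3)] u v → Local [(0, 1), (1, 2), (2, 3)] u v := fun h =>
    h.perm_extend (L' := [(0, 1), (1, 2)]) (by decide)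
  refine (e₁ s₁).trans ((e₂ s₂).trans (((e₁ s₃).symm ?_).trans ((e₁ s₄).trans ((e₂ s₅).trans
    ((e₁ s₆).trans ((e₃ s₇).trans ((e₂ s₈).trans (e₃ s₉))))))))
  simp [Letter.Good, linkNames, Letter.names, *]

/-- Two virtual stabilizations supply the additional pieces that `Local.slide_chain` needs. -/
theorem WF.sim_chain {w : List Letter} {ℓ : List (ℕ × ℕ)} {y p q : ℕ} (h : WF (w, (a, y) :: ℓ))
    (hp : p ∉ ((a, y) :: ℓ).map Prod.fst) (hq : q ∉ p :: ((a, y) :: ℓ).map Prod.fst) :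
    Sim (w, (a, y) :: ℓ) (w, (a, p) :: (p, q) :: (q, y) :: ℓ) := by
  have h₁ := h.sim_stab hp .virtual (by simp)
  simp only [crWord, List.append_nil] at h₁
  have h₂ := sim_of_perm (.swap (p, y) (a, p) ℓ) h₁
  have h₃ := h₂.2.1.sim_stab (s := q) (by simpa using hq) .virtual (by simp)
  simp only [crWord, List.append_nil] at h₃
  exact sim_of_perm (((List.Perm.swap (a, p) (q, y) ℓ).cons _).trans (.swap _ _ _))
    (h₂.trans h₃)

/-- The link is subdivided by two names that are fresh for the whole code, and `Local.slide_chain`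
is transported to the six names by a bijection. -/
theorem Local.slide_uncut (hm : m.Real) (hc : c ≠ .virtual) (hn : [m₁, m₂, a, b].Nodup) :
    Local [(m₁, m₂)] [.X m m₂ b, .X c b a, .X m.flip a m₁]
      [.X m.flip a m₂, .X c b a, .X m m₁ b] := by
  intro K ℓ h hK
  obtain ⟨p, hp⟩ := Infinite.exists_notMem_finset (([(m₁, m₂)] ++ ℓ).map Prod.fst).toFinset
  obtain ⟨q, hq⟩ := Infinite.exists_notMem_finset (p :: ([(m₁, m₂)] ++ ℓ).map Prod.fst).toFinset
  rw [List.mem_toFinset] at hp hq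
  have h' : WF ([.X m.flip a m₂, .X c b a, .X m m₁ b] ++ K, [(m₁, m₂)] ++ ℓ) := by
    refine h.replace ?_
    simp only [List.nodup_cons, List.mem_cons, List.not_mem_nil, or_false, not_or] at hn
    have hv := LEq.real_ne_virtual hm
    have := LEq.flip_ne_virtual hv
    simp only [List.forall_mem_cons, Letter.Good]
    simp [linkNames, Letter.names]
    grind
  have r := h.sim_chain hp hq
  have r' := h'.sim_chain hp hq
  refine r.trans (Sim.trans ?_ r'.symm)
  have hn' : [m₁, p, q, m₂, a, b].Nodup := by
    have hs := h.names_subset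
    have hs' := h.linkNames_subset
    have k₁ := hs' (a := m₁) (by simp [linkNames])
    have k₂ := hs' (a := m₂) (by simp [linkNames])
    have k₃ := hs (a := a) (by simp [Letter.names])
    have k₄ := hs (a := b) (by simp [Letter.names])
    simp only [List.mem_cons, not_or] at hq
    have ne : ∀ x ∈ ([(m₁, m₂)] ++ ℓ).map Prod.fst, x ≠ p ∧ x ≠ q := fun x hx =>
      ⟨fun e => hp (e ▸ hx), fun e => hq.2 (e ▸ hx)⟩
    have := ne _ k₁
    have := ne _ k₂
    have := ne _ k₃
    have := ne _ k₄
    simp only [List.nodup_cons, List.mem_cons, List.not_mem_nil, or_false, not_or] at hn ⊢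
    grind
  obtain ⟨g, hg⟩ := exists_perm_getElem _ hn'
  have hk := (Local.slide_chain hm hc).map g
  have e := fun i h => hg i h
  have e₀ := hg 0 (by simp)
  have e₁ := hg 1 (by simp)
  have e₂ := hg 2 (by simp)
  have e₃ := hg 3 (by simp)
  have e₄ := hg 4 (by simp)
  have e₅ := hg 5 (by simp)
  simp only [List.getElem_cons_zero, List.getElem_cons_succ] at e₀ e₁ e₂ e₃ e₄ e₅
  simp only [mapLinks, List.map_cons, List.map_nil, Prod.map, Letter.map, e₀, e₁, e₂, e₃, e₄, e₅]
    at hk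
  have hKs : ∀ x ∈ names K, x ∈ ([(m₁, m₂)] ++ ℓ).map Prod.fst := fun x hx =>
    h.names_subset (by rw [names_append]; exact List.mem_append_right _ hx)
  have hKp : p ∉ names K := fun e => hp (hKs _ e)
  have hKq : q ∉ names K := fun e => hq (by simp only [List.mem_cons]; exact .inr (hKs _ e))
  have := hK _ (List.mem_singleton_self _)
  exact hk K ℓ r.2.1 (by simp [*])

/-- The slide in the case that the middle arcs form an oriented cycle. -/
theorem Local.slide_cyclic (hm : m.Real) (hc : c ≠ .virtual)
    (hn : [m₁, m₂, a₁, a₂, b₁, b₂].Nodup) :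
    Local [(m₁, m₂), (a₂, a₁), (b₁, b₂)] [.X m.flip a₁ m₁, .X m m₂ b₁, .X c b₂ a₂]
      [.X c b₁ a₁, .X m m₁ b₂, .X m.flip a₂ m₂] := by
  obtain ⟨g, hg⟩ := exists_perm_getElem _ hn
  obtain rfl := hg 0 (by simp)
  obtain rfl := hg 1 (by simp)
  obtain rfl := hg 2 (by simp)
  obtain rfl := hg 3 (by simp)
  obtain rfl := hg 4 (by simp)
  obtain rfl := hg 5 (by simp)
  have hv := LEq.real_ne_virtual hm
  have hv' := LEq.flip_ne_virtual hv
  have hu : Contracts [(3, 2), (4, 5)] [.X m 1 4, .X c 5 3, .X m.flip 2 0]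
      [.X m 1 4, .X c 4 3, .X m.flip 3 0] :=
    .cons 2 (by simp) (by simp [Letter.names]) (by simp [Letter.names]) (by simp)
      (.cons 1 (by simp) (by simp [Letter.names])
        (by simp [Letter.names, Letter.map, ren]) (by simp) (.nil _))
  have hw : Contracts [(3, 2), (4, 5)] [.X m.flip 3 1, .X c 4 2, .X m 0 5]
      [.X m.flip 3 1, .X c 4 3, .X m 0 4] :=
    .cons 1 (by simp) (by simp [Letter.names]) (by simp [Letter.names]) (by simp)
      (.cons 2 (by simp) (by simp [Letter.names, Letter.map, ren])
        (by simp [Letter.names, Letter.map, ren]) (by simp) (.nil _))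
  refine Local.map (u := [.X m.flip 2 0, .X m 1 4, .X c 5 3])
    (v := [.X c 4 2, .X m 0 5, .X m.flip 3 1]) (L := [(0, 1), (3, 2), (4, 5)]) ?_ g
  refine Local.perm_left (u := [.X m 1 4, .X c 5 3, .X m.flip 2 0]) (Local.perm_right
    (v := [.X m.flip 3 1, .X c 4 2, .X m 0 5]) (Local.links_perm (.of_contracts_append
      (L' := [(0, 1)]) hu hw (by simp [contract, mapLinks, ren]) ?_
      (.slide_uncut hm hc (by simp))) ?_) ?_ ?_) ?_ ?_
  · simp [Letter.Good, linkNames, *]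
  · decide
  · exact (List.perm_append_comm (l₁ := [_]) (l₂ := [_, _]))
  · simp [Letter.names]
  · exact (List.perm_append_comm (l₁ := [_, _]) (l₂ := [_]))
  · simp [Letter.names]

end Code

end STV

namespace STV

/-! ## Reading the Gauss code of a diagram

The strands in a row carry names. A strand gets a new name when it passes a crossing or a bar, so
that the letters of the Gauss word have no names in common. -/

/-- A row of named strands; `true` is downward. -/
abbrev Row : Type := List (Bool × ℕ)

/-- The link of two consecutive names `a` (above) and `b` (below) of a strand. -/
def lk (d : Bool) (a b : ℕ) : ℕ × ℕ := if d then (a, b) else (b, a)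

/-- The letter of a crossing of a strand from the upper left, with direction `d` and name `a`, and a
strand from the upper right, with direction `e` and name `b`. -/
def xl (c : Crossing) (d e : Bool) (a b : ℕ) : Letter :=
  if d = e then .X c a b else .X c.flip b a

/-- `PReads P t b F w ℓ`: the piece `P` between the rows `t` and `b` has the new names `F`, the
letters `w` and the links `ℓ`. -/
inductive PReads : Piece → Row → Row → List ℕ → List Letter → List (ℕ × ℕ) → Prop
  | virtual (x y : Bool × ℕ) : PReads (.crossing .virtual) [x, y] [y, x] [] [] []
  | crossing (c : Crossing) (hc : c ≠ .virtual) (d e : Bool) (a b a' b' : ℕ) :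
      PReads (.crossing c) [(d, a), (e, b)] [(e, b'), (d, a')] [a', b'] [xl c d e a' b']
        [lk d a a', lk e b b']
  | bar (d : Bool) (a a' : ℕ) : PReads .bar [(d, a)] [(d, a')] [a'] [.B a'] [lk d a a']
  | maximum (d : Bool) (s : ℕ) : PReads (.maximum d) [] [(d, s), (!d, s)] [s] [] []
  | minimum (d : Bool) (a b : ℕ) : PReads .minimum [(d, a), (!d, b)] [] [] [] [lk d a b]

/-- The same for a slice. -/
inductive SReads : Slice → Row → Row → List ℕ → List Letter → List (ℕ × ℕ) → Prop
  | intro {P : Piece} {t b : Row} {F : List ℕ} {w : List Letter} {ℓ : List (ℕ × ℕ)} (l r : Row)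
      {i : ℕ} (hi : l.length = i) (h : PReads P t b F w ℓ) :
      SReads ⟨i, P⟩ (l ++ t ++ r) (l ++ b ++ r) F w ℓ

/-- The same for a sequence of slices. A strand may also get a new name between two slices; the last
argument counts these cuts. -/
inductive DReads : List Slice → Row → Row → List ℕ → List Letter → List (ℕ × ℕ) → ℕ → Prop
  | nil (r : Row) : DReads [] r r [] [] [] 0
  | cons {S : Slice} {D : List Slice} {r r' r'' : Row} {F F' : List ℕ} {w w' : List Letter}
      {ℓ ℓ' : List (ℕ × ℕ)} {k : ℕ} (h : SReads S r r' F w ℓ) (h' : DReads D r' r'' F' w' ℓ' k) :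
      DReads (S :: D) r r'' (F ++ F') (w ++ w') (ℓ ++ ℓ') k
  | cut {D : List Slice} (l r : Row) {r' : Row} (d : Bool) (a a' : ℕ) {F : List ℕ}
      {w : List Letter} {ℓ : List (ℕ × ℕ)} {k : ℕ}
      (h : DReads D (l ++ (d, a') :: r) r' F w ℓ k) :
      DReads D (l ++ (d, a) :: r) r' (a' :: F) w (lk d a a' :: ℓ) (k + 1)

variable {P : Piece} {S : Slice} {D E : List Slice} {r r' r'' : Row} {F F' : List ℕ}
  {w w' : List Letter} {ℓ ℓ' : List (ℕ × ℕ)} {k k' : ℕ}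

theorem DReads.append (h : DReads D r r' F w ℓ k) (h' : DReads E r' r'' F' w' ℓ' k') :
    DReads (D ++ E) r r'' (F ++ F') (w ++ w') (ℓ ++ ℓ') (k + k') := by
  induction h with
  | nil r => simpa using h'
  | cons h _ ih =>
    simp only [List.append_assoc, List.cons_append]
    exact .cons h (ih h')
  | cut l r d a a' _ ih =>
    rw [show ∀ k, k + 1 + k' = k + k' + 1 from fun k => by omega]
    exact .cut l r d a a' (ih h')

theorem DReads.append_split (h : DReads (D ++ E) r r'' F w ℓ 0) :
    ∃ r' F₁ F₂ w₁ w₂ ℓ₁ ℓ₂, DReads D r r' F₁ w₁ ℓ₁ 0 ∧ DReads E r' r'' F₂ w₂ ℓ₂ 0 ∧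
      F = F₁ ++ F₂ ∧ w = w₁ ++ w₂ ∧ ℓ = ℓ₁ ++ ℓ₂ := by
  induction D generalizing r F w ℓ with
  | nil => exact ⟨r, [], F, [], w, [], ℓ, .nil _, h, rfl, rfl, rfl⟩
  | cons S D ih =>
    rw [List.cons_append] at h
    cases h with
    | cons h h' =>
      obtain ⟨r', F₁, F₂, w₁, w₂, ℓ₁, ℓ₂, h₁, h₂, rfl, rfl, rfl⟩ := ih h'
      exact ⟨r', _, _, _, _, _, _, .cons h h₁, h₂, by simp, by simp, by simp⟩

/-! ### Renaming -/

/-- Renaming the strands of a row. -/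
def Row.map (f : ℕ → ℕ) (r : Row) : Row := List.map (Prod.map id f) r

/-- The names in a row. -/
def Row.names (r : Row) : List ℕ := List.map Prod.snd r

@[simp]
theorem Row.map_append (f : ℕ → ℕ) (r r' : Row) : Row.map f (r ++ r') = r.map f ++ r'.map f :=
  List.map_append

@[simp]
theorem Row.map_cons (f : ℕ → ℕ) (d : Bool) (a : ℕ) (r : Row) :
    Row.map f ((d, a) :: r) = (d, f a) :: Row.map f r := rfl

@[simp]
theorem Row.map_nil (f : ℕ → ℕ) : Row.map f [] = [] := rfl

@[simp]
theorem Row.names_append (r r' : Row) : Row.names (r ++ r') = r.names ++ r'.names :=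
  List.map_append

@[simp]
theorem Row.names_cons (x : Bool × ℕ) (r : Row) : Row.names (x :: r) = x.2 :: r.names := rfl

@[simp]
theorem Row.names_nil : Row.names [] = [] := rfl

@[simp]
theorem Row.length_map (f : ℕ → ℕ) (r : Row) : (Row.map f r).length = r.length :=
  List.length_map _

theorem Row.map_congr {f g : ℕ → ℕ} {r : Row} (h : ∀ a ∈ r.names, f a = g a) :
    r.map f = r.map g :=
  List.map_congr_left fun _ hp => Prod.ext rfl (h _ (List.mem_map_of_mem hp))

theorem Row.map_id {f : ℕ → ℕ} {r : Row} (h : ∀ a ∈ r.names, f a = a) : r.map f = r := by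
  conv_rhs => rw [← List.map_id r]
  exact List.map_congr_left fun _ hp => Prod.ext rfl (h _ (List.mem_map_of_mem hp))

theorem map_lk (f : ℕ → ℕ) (d : Bool) (a b : ℕ) :
    Prod.map f f (lk d a b) = lk d (f a) (f b) := by cases d <;> rfl

theorem map_xl (f : ℕ → ℕ) (c : Crossing) (d e : Bool) (a b : ℕ) :
    (xl c d e a b).map f = xl c d e (f a) (f b) := by
  unfold xl; split_ifs <;> rfl

theorem lk_not (d : Bool) (a b : ℕ) : lk (!d) a b = lk d b a := by cases d <;> rfl

theorem PReads.map {t b : Row} (h : PReads P t b F w ℓ) (f : ℕ → ℕ) :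
    PReads P (t.map f) (b.map f) (F.map f) (w.map (Letter.map f)) (mapLinks f ℓ) := by
  cases h with
  | virtual x y => exact .virtual _ _
  | crossing c hc d e a b a' b' =>
    simp only [mapLinks, List.map_cons, List.map_nil, map_lk, map_xl]
    exact .crossing c hc _ _ _ _ _ _
  | bar d a a' =>
    simp only [mapLinks, List.map_cons, List.map_nil, map_lk]
    exact .bar d _ _
  | maximum d s => exact .maximum d _
  | minimum d a b =>
    simp only [mapLinks, List.map_cons, List.map_nil, map_lk]
    exact .minimum d _ _

theorem SReads.map (h : SReads S r r' F w ℓ) (f : ℕ → ℕ) :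
    SReads S (r.map f) (r'.map f) (F.map f) (w.map (Letter.map f)) (mapLinks f ℓ) := by
  obtain ⟨l, r, hi, h⟩ := h
  simp only [Row.map_append]
  exact .intro _ _ (by simpa using hi) (h.map f)

theorem DReads.map (h : DReads D r r' F w ℓ k) (f : ℕ → ℕ) :
    DReads D (r.map f) (r'.map f) (F.map f) (w.map (Letter.map f)) (mapLinks f ℓ) k := by
  induction h with
  | nil r => exact .nil _
  | cons h _ ih =>
    simp only [mapLinks, List.map_append]
    exact .cons (h.map f) ih
  | cut l r d a a' _ ih =>
    simp only [mapLinks, List.map_cons, Row.map_append, map_lk]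
    rw [Row.map_append] at ih
    exact .cut _ _ d (f a) (f a') ih

/-! ### Names -/

theorem mem_linkNames_lk {d : Bool} {a b x : ℕ} (L : List (ℕ × ℕ)) :
    x ∈ Code.linkNames (lk d a b :: L) ↔ x = a ∨ x = b ∨ x ∈ Code.linkNames L := by
  cases d <;> simp [Code.linkNames, lk] <;> tauto

theorem names_xl (c : Crossing) (d e : Bool) (a b : ℕ) :
    (xl c d e a b).names.Perm [a, b] := by
  unfold xl; split_ifs
  exacts [.refl _, .swap _ _ _]

theorem SReads.names_subset (h : SReads S r r' F w ℓ) : r'.names ⊆ r.names ++ F := by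
  obtain ⟨l, r, hi, h⟩ := h
  intro x hx
  cases h <;> simp at hx ⊢ <;> tauto

theorem SReads.linkNames_subset (h : SReads S r r' F w ℓ) :
    Code.linkNames ℓ ⊆ r.names ++ F := by
  obtain ⟨l, r, hi, h⟩ := h
  intro x hx
  cases h with
  | virtual x y => simp [Code.linkNames] at hx
  | maximum d s => simp [Code.linkNames] at hx
  | _ =>
    simp only [mem_linkNames_lk] at hx
    simp [Code.linkNames] at hx ⊢
    tauto

theorem SReads.names_subperm (h : SReads S r r' F w ℓ) : (names w).Subperm F := by
  obtain ⟨l, r, hi, h⟩ := h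
  cases h with
  | crossing c hc d e a b a' b' => simpa using (names_xl c d e a' b').subperm
  | bar d a a' => exact List.Subperm.refl _
  | _ => exact List.nil_subperm

theorem DReads.names_subset (h : DReads D r r' F w ℓ k) : r'.names ⊆ r.names ++ F := by
  induction h with
  | nil r => simp
  | cons h _ ih =>
    intro x hx
    have := ih hx
    have := h.names_subset (a := x)
    simp at *
    tauto
  | cut l r d a a' _ ih =>
    intro x hx
    have := ih hx
    simp at *
    tauto

/-- Every new name occurs at most once in the letters. With distinct new names this makes all
letters of a reading disjoint. -/
theorem DReads.names_subperm (h : DReads D r r' F w ℓ k) : (names w).Subperm F := by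
  induction h with
  | nil r => exact List.nil_subperm
  | cons h _ ih => rw [STV.names_append]; exact h.names_subperm.append ih
  | cut l r d a a' _ ih => exact ih.trans (List.sublist_cons_self _ _).subperm

/-- The names of the downward (`d = true`) or upward (`d = false`) strands in a row. -/
def Row.side (d : Bool) (r : Row) : List ℕ := (r.filter fun p => p.1 = d).map Prod.snd

theorem Row.side_append (d : Bool) (r r' : Row) :
    Row.side d (r ++ r') = r.side d ++ r'.side d := by simp [Row.side]

theorem Row.side_cons (d e : Bool) (a : ℕ) (r : Row) :
    Row.side d ((e, a) :: r) = if e = d then a :: r.side d else r.side d := by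
  simp only [Row.side, List.filter_cons]
  split_ifs <;> simp_all

theorem perm_of_count {α : Type*} [BEq α] [LawfulBEq α] {x y : List α}
    (h : ∀ a, x.count a = y.count a) : x.Perm y :=
  List.perm_iff_count.2 h

/-- A count of ends and beginnings. The name on a downward strand still has its end below; passing a
slice, it either receives an outgoing link or is handed on, and new names behave alike. For upward
strands the same holds with beginnings. In a closed diagram it follows that each name begins and
ends exactly once. -/
theorem SReads.balance (h : SReads S r r' F w ℓ) :
    (ℓ.map Prod.fst ++ r'.side true).Perm (r.side true ++ F) ∧
      (ℓ.map Prod.snd ++ r'.side false).Perm (r.side false ++ F) := by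
  obtain ⟨l, r, hi, h⟩ := h
  have nil : ∀ d, Row.side d [] = [] := fun _ => rfl
  constructor
  all_goals
    refine perm_of_count fun x => ?_
    simp only [Row.side_append, List.count_append]
    cases h with
    | virtual x y =>
      obtain ⟨d, a⟩ := x
      obtain ⟨e, b⟩ := y
      cases d <;> cases e <;> simp [Row.side_cons, nil, List.count_cons] <;> omega
    | crossing c hc d e a b a' b' =>
      cases d <;> cases e <;> simp [Row.side_cons, nil, lk, List.count_cons] <;> omega
    | bar d a a' => cases d <;> simp [Row.side_cons, nil, lk, List.count_cons] <;> omega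
    | maximum d s => cases d <;> simp [Row.side_cons, nil, List.count_cons] <;> omega
    | minimum d a b => cases d <;> simp [Row.side_cons, nil, lk, List.count_cons] <;> omega

theorem DReads.balance (h : DReads D r r' F w ℓ k) :
    (ℓ.map Prod.fst ++ r'.side true).Perm (r.side true ++ F) ∧
      (ℓ.map Prod.snd ++ r'.side false).Perm (r.side false ++ F) := by
  induction h with
  | nil r => simp
  | cons h _ ih =>
    obtain ⟨h₁, h₂⟩ := h.balance
    obtain ⟨i₁, i₂⟩ := ih
    constructor <;> refine perm_of_count fun x => ?_
    · have := h₁.count_eq x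
      have := i₁.count_eq x
      simp only [List.map_append, List.count_append] at *
      omega
    · have := h₂.count_eq x
      have := i₂.count_eq x
      simp only [List.map_append, List.count_append] at *
      omega
  | cut l r d a a' _ ih =>
    obtain ⟨i₁, i₂⟩ := ih
    constructor <;> refine perm_of_count fun x => ?_
    · have := i₁.count_eq x
      cases d <;> simp [lk, Row.side_append, Row.side_cons, List.count_cons] at * <;> omega
    · have := i₂.count_eq x
      cases d <;> simp [lk, Row.side_append, Row.side_cons, List.count_cons] at * <;> omega

theorem SReads.good (h : SReads S r r' F w ℓ) (hF : F.Nodup) : ∀ l ∈ w, l.Good F := by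
  obtain ⟨l, r, hi, h⟩ := h
  cases h with
  | crossing c hc d e a b a' b' =>
    have hn : a' ≠ b' := by simpa using hF
    simp only [List.mem_singleton, forall_eq, xl]
    split_ifs
    · exact ⟨hc, hn, by simp, by simp⟩
    · exact ⟨LEq.flip_ne_virtual hc, hn.symm, by simp, by simp⟩
  | bar d a a' => simp [Letter.Good]
  | _ => simp

theorem DReads.good (h : DReads D r r' F w ℓ k) (hF : F.Nodup) : ∀ l ∈ w, l.Good F := by
  induction h with
  | nil r => simp
  | cons h _ ih =>
    intro l hl
    rw [List.nodup_append] at hF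
    rcases List.mem_append.1 hl with hl | hl
    · exact (h.good hF.1 l hl).mono (by simp)
    · exact (ih hF.2.1 l hl).mono (by simp)
  | cut l r d a a' _ ih =>
    exact fun l hl => (ih hF.of_cons l hl).mono (by simp)

theorem DReads.ne_nil (h : DReads D r r' F w ℓ k) (hr : r = []) (hD : D ≠ []) : F ≠ [] := by
  cases h with
  | nil => exact absurd rfl hD
  | cons h _ =>
    obtain ⟨l, m, hi, h⟩ := h
    cases h <;> simp_all
  | cut => simp

/-- The Gauss code of a non-empty closed diagram is well formed. -/
theorem DReads.wf (h : DReads D [] [] F w ℓ k) (hF : F.Nodup) (hD : D ≠ []) :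
    Code.WF (w, ℓ) := by
  obtain ⟨h₁, h₂⟩ := h.balance
  simp only [Row.side, List.filter_nil, List.map_nil, List.append_nil, List.nil_append] at h₁ h₂
  refine ⟨?_, h₁.nodup_iff.2 hF, h₁.trans h₂.symm, fun l hl =>
    (h.good hF l hl).mono h₁.symm.subset⟩
  rintro (rfl : ℓ = [])
  exact h.ne_nil rfl hD (by simpa using h₁)

/-! ### Existence -/

theorem exists_fresh (A : List ℕ) : ∃ a, a ∉ A := by
  obtain ⟨a, ha⟩ := Infinite.exists_notMem_finset A.toFinset
  exact ⟨a, by simpa using ha⟩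

/-- The directions of the strands in a row. -/
def Row.dirs (r : Row) : List Bool := List.map Prod.fst r

@[simp]
theorem Row.dirs_append (r r' : Row) : Row.dirs (r ++ r') = r.dirs ++ r'.dirs := List.map_append

@[simp]
theorem Row.dirs_cons (x : Bool × ℕ) (r : Row) : Row.dirs (x :: r) = x.1 :: r.dirs := rfl

theorem Row.dirs_eq_append {l r : List Bool} {x : Row} (h : x.dirs = l ++ r) :
    ∃ y z : Row, x = y ++ z ∧ y.dirs = l ∧ z.dirs = r := List.map_eq_append_iff.1 h

theorem Row.dirs_eq_cons {d : Bool} {r : List Bool} {x : Row} (h : x.dirs = d :: r) :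
    ∃ (a : ℕ) (y : Row), x = (d, a) :: y ∧ y.dirs = r := by
  obtain ⟨⟨d', a⟩, y, e, h₁, h₂⟩ := List.map_eq_cons_iff.1 h
  obtain rfl : d' = d := h₁
  exact ⟨a, y, e, h₂⟩

theorem Row.length_of_dirs {l : List Bool} {x : Row} (h : x.dirs = l) : x.length = l.length := by
  rw [← h, Row.dirs, List.length_map]

theorem SReads.exists {x y : List Bool} (h : S.Passes x y) {r : Row} (hr : r.dirs = x)
    (A : List ℕ) : ∃ r' F w ℓ, SReads S r r' F w ℓ ∧ r'.dirs = y ∧ F.Nodup ∧ ∀ a ∈ F, a ∉ A := by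
  cases h with
  | crossing l m c d e =>
    obtain ⟨u, v, rfl, hu, hv⟩ := Row.dirs_eq_append hr
    obtain ⟨a, v₁, rfl, hv₁⟩ := Row.dirs_eq_cons hv
    obtain ⟨b, v, rfl, hv₂⟩ := Row.dirs_eq_cons hv₁
    have hi := Row.length_of_dirs hu
    by_cases hc : c = .virtual
    · subst hc
      have := SReads.intro u v hi (.virtual (d, a) (e, b))
      simp only [List.append_assoc, List.cons_append, List.nil_append] at this
      exact ⟨_, _, _, _, this, by simp [hu, hv₂], by simp, by simp⟩
    · obtain ⟨a', ha⟩ := exists_fresh A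
      obtain ⟨b', hb⟩ := exists_fresh (a' :: A)
      have := SReads.intro u v hi (.crossing c hc d e a b a' b')
      simp only [List.append_assoc, List.cons_append, List.nil_append] at this
      simp only [List.mem_cons, not_or] at hb
      exact ⟨_, _, _, _, this, by simp [hu, hv₂], by simpa using fun e => hb.1 e.symm,
        by simp [ha, hb]⟩
  | bar l m d =>
    obtain ⟨u, v, rfl, hu, hv⟩ := Row.dirs_eq_append hr
    obtain ⟨a, v, rfl, hv₁⟩ := Row.dirs_eq_cons hv
    obtain ⟨a', ha⟩ := exists_fresh A
    have := SReads.intro u v (Row.length_of_dirs hu) (.bar d a a')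
    simp only [List.append_assoc, List.cons_append, List.nil_append] at this
    exact ⟨_, _, _, _, this, by simp [hu, hv₁], by simp, by simp [ha]⟩
  | maximum l m d =>
    obtain ⟨u, v, rfl, hu, hv⟩ := Row.dirs_eq_append hr
    obtain ⟨s, hs⟩ := exists_fresh A
    have := SReads.intro u v (Row.length_of_dirs hu) (.maximum d s)
    simp only [List.append_assoc, List.cons_append, List.nil_append] at this
    exact ⟨_, _, _, _, this, by simp [hu, hv], by simp, by simp [hs]⟩
  | minimum l m d =>
    obtain ⟨u, v, rfl, hu, hv⟩ := Row.dirs_eq_append hr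
    obtain ⟨a, v₁, rfl, hv₁⟩ := Row.dirs_eq_cons hv
    obtain ⟨b, v, rfl, hv₂⟩ := Row.dirs_eq_cons hv₁
    have := SReads.intro u v (Row.length_of_dirs hu) (.minimum d a b)
    simp only [List.append_assoc, List.cons_append, List.nil_append] at this
    exact ⟨_, _, _, _, this, by simp [hu, hv₂], by simp, by simp⟩

theorem DReads.exists {x y : List Bool} (h : Runs D x y) {r : Row} (hr : r.dirs = x)
    (A : List ℕ) :
    ∃ r' F w ℓ, DReads D r r' F w ℓ 0 ∧ r'.dirs = y ∧ F.Nodup ∧ ∀ a ∈ F, a ∉ A := by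
  induction h generalizing r A with
  | nil x => exact ⟨r, [], [], [], .nil _, hr, by simp, by simp⟩
  | cons p _ ih =>
    obtain ⟨r₁, F₁, w₁, ℓ₁, h₁, hr₁, hF₁, hA₁⟩ := SReads.exists p hr A
    obtain ⟨r₂, F₂, w₂, ℓ₂, h₂, hr₂, hF₂, hA₂⟩ := ih hr₁ (A ++ F₁)
    refine ⟨r₂, _, _, _, .cons h₁ h₂, hr₂, List.nodup_append.2 ⟨hF₁, hF₂, ?_⟩, ?_⟩
    · rintro a ha b hb rfl
      exact hA₂ a hb (by simp [ha])
    · intro a ha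
      rcases List.mem_append.1 ha with ha | ha
      exacts [hA₁ a ha, fun h => hA₂ a ha (by simp [h])]

/-! ### Uniqueness -/

/-- The renaming is prescribed on the old names and extended to the new ones. This is consistent
because the new names are distinct and do not occur above. -/
theorem PReads.unique {t b b₁ : Row} (h : PReads P t b F w ℓ) {f : ℕ → ℕ} {t₁ : Row}
    (h₁ : PReads P t₁ b₁ F' w' ℓ') (ht : t₁ = t.map f) (hF : F.Nodup)
    (hd : ∀ a ∈ F, a ∉ t.names) : ∃ g : ℕ → ℕ, (∀ a, a ∉ F → g a = f a) ∧ b₁ = b.map g ∧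
      F' = F.map g ∧ w' = w.map (Letter.map g) ∧ ℓ' = mapLinks g ℓ := by
  cases h with
  | virtual x y =>
    cases h₁ with
    | virtual x' y' =>
      obtain ⟨d, a⟩ := x
      obtain ⟨e, b⟩ := y
      simp only [Row.map_cons, Row.map_nil, List.cons.injEq, and_true] at ht
      obtain ⟨rfl, rfl⟩ := ht
      exact ⟨f, fun _ _ => rfl, rfl, rfl, rfl, rfl⟩
    | crossing _ hc => exact absurd rfl hc
  | crossing c hc d e a b a' b' =>
    cases h₁ with
    | virtual => exact absurd rfl hc
    | crossing _ _ d₁ e₁ a₁ b₁ a₁' b₁' =>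
      simp only [Row.map_cons, Row.map_nil, List.cons.injEq, and_true, Prod.mk.injEq] at ht
      obtain ⟨⟨rfl, rfl⟩, rfl, rfl⟩ := ht
      have hn : a' ≠ b' := by simpa using hF
      simp at hd
      refine ⟨fun x => if x = a' then a₁' else if x = b' then b₁' else f x, ?_, ?_, ?_, ?_, ?_⟩
      · intro x hx; simp at hx; simp [hx]
      · simp [hn.symm]
      · simp [hn.symm]
      · simp [map_xl, hn.symm]
      · simp [mapLinks, map_lk, hn.symm, Ne.symm hd.1.1, Ne.symm hd.1.2, Ne.symm hd.2.1,
          Ne.symm hd.2.2]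
  | bar d a a' =>
    cases h₁ with
    | bar d₁ a₁ a₁' =>
      simp only [Row.map_cons, Row.map_nil, List.cons.injEq, and_true, Prod.mk.injEq] at ht
      obtain ⟨rfl, rfl⟩ := ht
      simp at hd
      refine ⟨fun x => if x = a' then a₁' else f x, ?_, ?_, ?_, ?_, ?_⟩
      · intro x hx; simp at hx; simp [hx]
      · simp
      · simp
      · simp [Letter.map]
      · simp [mapLinks, map_lk, Ne.symm hd]
  | maximum d s =>
    cases h₁ with
    | maximum _ s₁ =>
      refine ⟨fun x => if x = s then s₁ else f x, ?_, ?_, ?_, ?_, ?_⟩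
      · intro x hx; simp at hx; simp [hx]
      · simp
      · simp
      · simp
      · rfl
  | minimum d a b =>
    cases h₁ with
    | minimum d₁ a₁ b₁ =>
      simp only [Row.map_cons, Row.map_nil, List.cons.injEq, and_true, Prod.mk.injEq] at ht
      obtain ⟨⟨rfl, rfl⟩, -, rfl⟩ := ht
      exact ⟨f, fun _ _ => rfl, rfl, rfl, rfl, by simp [mapLinks, map_lk]⟩

theorem SReads.unique (h : SReads S r r' F w ℓ) {f : ℕ → ℕ} {r₁ r₁' : Row}
    (h₁ : SReads S r₁ r₁' F' w' ℓ') (hr : r₁ = r.map f) (hF : F.Nodup)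
    (hd : ∀ a ∈ F, a ∉ r.names) : ∃ g : ℕ → ℕ, (∀ a, a ∉ F → g a = f a) ∧ r₁' = r'.map g ∧
      F' = F.map g ∧ w' = w.map (Letter.map g) ∧ ℓ' = mapLinks g ℓ := by
  obtain ⟨l, r, hi, h⟩ := h
  rename_i P t b i
  generalize hS : (⟨i, P⟩ : Slice) = S at h₁
  obtain ⟨l₁, m₁, hi₁, h₁⟩ := h₁
  rename_i P₁ t₁ b₁ i₁
  obtain ⟨rfl, rfl⟩ : i = i₁ ∧ P = P₁ := by simpa using hS
  have ht : t.length = t₁.length := by cases h <;> cases h₁ <;> rfl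
  simp only [Row.map_append, List.append_assoc] at hr
  obtain ⟨rfl, hr₁⟩ := List.append_inj hr (by simp [hi, hi₁])
  obtain ⟨e, rfl⟩ := List.append_inj hr₁ (by rw [Row.length_map, ht])
  obtain ⟨g, hg, rfl, h₂⟩ := h.unique h₁ e hF fun a ha hb => hd a ha (by simp [hb])
  refine ⟨g, hg, ?_, h₂⟩
  simp only [Row.map_append]
  have k : ∀ x : Row, (∀ a ∈ x.names, a ∈ (l ++ t ++ r).names) → x.map f = x.map g :=
    fun x hx => Row.map_congr fun a ha => (hg a fun h => hd a h (hx a ha)).symm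
  rw [k l fun a ha => by simp [ha], k r fun a ha => by simp [ha]]

/-- Names are the only choice in a reading without cuts. The renaming `g` of the first reading may
fail to be injective. -/
theorem DReads.unique (h : DReads D r r' F w ℓ k) (hk : k = 0) {f : ℕ → ℕ} {r₁ r₁' : Row}
    (h₁ : DReads D r₁ r₁' F' w' ℓ' 0) (hr : r₁ = r.map f) (hF : F.Nodup)
    (hd : ∀ a ∈ F, a ∉ r.names) : ∃ g : ℕ → ℕ, (∀ a, a ∉ F → g a = f a) ∧
      w' = w.map (Letter.map g) ∧ ℓ' = mapLinks g ℓ := by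
  induction h generalizing f r₁ F' w' ℓ' with
  | nil r =>
    cases h₁
    exact ⟨f, fun _ _ => rfl, rfl, rfl⟩
  | @cons _ _ _ _ _ F₀ F₁ w₀ _ ℓ₀ _ _ h _ ih =>
    cases h₁ with
    | cons h₁ h₂ =>
      rw [List.nodup_append] at hF
      have hd₀ : ∀ a ∈ F₀, a ∉ _ := fun a ha => hd a (by simp [ha])
      obtain ⟨g, hg, hr', rfl, rfl, rfl⟩ := h.unique h₁ hr hF.1 hd₀
      have hd₁ : ∀ a ∈ F₁, a ∉ _ := fun a ha hb => by
        rcases List.mem_append.1 (h.names_subset hb) with hb | hb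
        · exact hd a (by simp [ha]) hb
        · exact hF.2.2 a hb a ha rfl
      obtain ⟨g', hg', rfl, rfl⟩ := ih hk h₂ hr' hF.2.1 hd₁
      refine ⟨g', fun a ha => ?_, ?_, ?_⟩
      · simp only [List.mem_append, not_or] at ha
        rw [hg' a ha.2, hg a ha.1]
      · rw [List.map_append]
        congr 1
        refine map_letters_congr fun a ha => (hg' a fun hb => ?_).symm
        exact hF.2.2 a (h.names_subperm.subset ha) a hb rfl
      · rw [mapLinks, mapLinks, mapLinks, List.map_append]
        congr 1
        -- The later extension of the renaming does not affect names that occur above, since the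
        -- names introduced later are different from them.
        have key : ∀ a ∈ Code.linkNames ℓ₀, g a = g' a := fun a ha =>
          (hg' a fun hb => by
            rcases List.mem_append.1 (h.linkNames_subset ha) with hb' | hb'
            · exact hd a (by simp [hb]) hb'
            · exact hF.2.2 a hb' a hb rfl).symm
        exact List.map_congr_left fun p hp => Prod.ext
          (key _ (List.mem_append_left _ (List.mem_map_of_mem hp)))
          (key _ (List.mem_append_right _ (List.mem_map_of_mem hp)))
  | cut => omega

/-! ### Elimination of cuts -/

theorem map_ren_names {x : List ℕ} {a s : ℕ} (h : s ∉ x) : x.map (ren a s) = x := by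
  conv_rhs => rw [← List.map_id x]
  exact List.map_congr_left fun b hb => ren_of_ne (by rintro rfl; exact h hb)

theorem Row.map_ren {r : Row} {a s : ℕ} (h : s ∉ r.names) : r.map (ren a s) = r :=
  Row.map_id fun b hb => ren_of_ne (by rintro rfl; exact h hb)

theorem mapLinks_ren {ℓ : List (ℕ × ℕ)} {a s : ℕ} (h : s ∉ Code.linkNames ℓ) :
    mapLinks (ren a s) ℓ = ℓ :=
  mapLinks_id fun _ hp =>
    ⟨ren_of_ne (by rintro rfl; exact h (List.mem_append_left _ (List.mem_map_of_mem hp))),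
      ren_of_ne (by rintro rfl; exact h (List.mem_append_right _ (List.mem_map_of_mem hp)))⟩

/-- The name `s` given at a cut is replaced by the old name `a` everywhere below. No letter contains
`s`, because letters use only the names created with them. -/
theorem DReads.exists_uncut (h : DReads D r r' F w ℓ (k + 1)) (hF : F.Nodup)
    (hd : ∀ a ∈ F, a ∉ r.names) : ∃ d a s F' ℓ', a ≠ s ∧ F.Perm (s :: F') ∧
      ℓ.Perm (lk d a s :: ℓ') ∧ s ∉ names w ∧
      DReads D r (r'.map (ren a s)) F' w (mapLinks (ren a s) ℓ') k := by
  generalize hk : k + 1 = k' at h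
  induction h with
  | nil => omega
  | @cons _ _ r₀ _ _ F₀ F₁ w₀ _ ℓ₀ _ _ h _ ih =>
    rw [List.nodup_append] at hF
    have hd₁ : ∀ a ∈ F₁, a ∉ r₀.names ++ F₀ := fun a ha hb => by
      rcases List.mem_append.1 hb with hb | hb
      · exact hd a (by simp [ha]) hb
      · exact hF.2.2 a hb a ha rfl
    obtain ⟨d, a, s, F', ℓ', has, hp, hp', hs, h'⟩ := ih hF.2.1
      (fun a ha hb => hd₁ a ha (h.names_subset hb)) hk
    have hs' := hd₁ s (hp.symm.subset (by simp))
    refine ⟨d, a, s, F₀ ++ F', ℓ₀ ++ ℓ', has, ?_, ?_, ?_, ?_⟩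
    · exact (hp.append_left F₀).trans List.perm_middle
    · exact (hp'.append_left ℓ₀).trans List.perm_middle
    · rw [STV.names_append, List.mem_append, not_or]
      exact ⟨fun e => hs' (List.mem_append_right _ (h.names_subperm.subset e)), hs⟩
    · have := DReads.cons h h'
      rwa [mapLinks, List.map_append, ← mapLinks, ← mapLinks,
        mapLinks_ren fun e => hs' (h.linkNames_subset e)]
  | @cut _ l m _ d a s F₀ w₀ ℓ₀ _ h _ =>
    obtain rfl : k = _ := Nat.succ_injective hk
    have hs := hd s (by simp)
    simp only [Row.names_append, Row.names_cons, List.mem_append, List.mem_cons, not_or] at hs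
    have hs' := (List.nodup_cons.1 hF).1
    refine ⟨d, a, s, F₀, ℓ₀, fun e => hs.2.1 e.symm, .refl _, .refl _,
      fun e => hs' (h.names_subperm.subset e), ?_⟩
    have := h.map (ren a s)
    rwa [Row.map_append, Row.map_cons, ren_self, Row.map_ren hs.1, Row.map_ren hs.2.2,
      map_ren_names hs', map_ren_letters fun e => hs' (h.names_subperm.subset e)] at this

/-- The same braid represents both codes. -/
theorem Code.WF.sim_map (h : Code.WF (w, ℓ)) {f : ℕ → ℕ}
    (h' : Code.WF (w.map (Letter.map f), mapLinks f ℓ)) :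
    Code.Sim (w, ℓ) (w.map (Letter.map f), mapLinks f ℓ) := by
  obtain ⟨q, hq⟩ := h.exists_rep
  exact ⟨h, h', q, q, hq, hq.map f, .refl _⟩

theorem DReads.exists_zero (h : DReads D [] [] F w ℓ k) (hF : F.Nodup) (hD : D ≠ []) :
    ∃ F' w' ℓ', DReads D [] [] F' w' ℓ' 0 ∧ F'.Nodup ∧ Code.Sim (w, ℓ) (w', ℓ') := by
  induction k generalizing F w ℓ with
  | zero => exact ⟨_, _, _, h, hF, (h.wf hF hD).sim⟩
  | succ k ih =>
    obtain ⟨d, a, s, F', ℓ', has, hp, hp', hs, h'⟩ := h.exists_uncut hF (by simp)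
    have hF' : F'.Nodup := (hp.nodup_iff.1 hF).of_cons
    have h' : DReads D [] [] F' w (mapLinks (ren a s) ℓ') k := h'
    obtain ⟨F₂, w₂, ℓ₂, h₂, hF₂, e⟩ := ih h' hF'
    refine ⟨F₂, w₂, ℓ₂, h₂, hF₂, Code.Sim.trans ?_ e⟩
    have hw := h.wf hF hD
    have hw' := h'.wf hF' hD
    refine (hw.sim_perm hp').trans ?_
    have hwp := hw.of_perm hp'
    cases d with
    | true =>
      have := Code.WF.sim_cut (w := w) (w' := []) (ℓ := ℓ') (a := a) (s := s)
        (by rw [List.append_nil]; exact hwp) has hs (by simp)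
      rw [List.append_nil, List.map_nil, List.append_nil] at this
      exact this
    -- On an upward strand the link leads from `s` to `a`, and `WF.sim_cut` keeps the name `s`. A
    -- renaming afterwards restores `a`.
    | false =>
      have r₁ := Code.WF.sim_cut (w := []) (w' := w) (ℓ := ℓ') (a := s) (s := a)
        hwp has.symm (by simp) hs
      have e₁ : (w.map (Letter.map (ren s a))).map (Letter.map (ren a s)) = w := ren_ren hs
      have e₂ : mapLinks (ren a s) (mapLinks (ren s a) ℓ') = mapLinks (ren a s) ℓ' := by
        have hx : ∀ x, ren a s (ren s a x) = ren a s x := fun x => by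
          simp only [ren]; grind
        rw [mapLinks, mapLinks, mapLinks, List.map_map]
        exact List.map_congr_left fun p _ => Prod.ext (hx _) (hx _)
      have r₂ := r₁.2.1.sim_map (f := ren a s) (by
        rw [List.nil_append, e₁, e₂]; exact hw')
      rw [List.nil_append, e₁, e₂] at r₂
      exact r₁.trans r₂

/-- All readings of a diagram are equivalent. -/
theorem DReads.sim (h : DReads D [] [] F w ℓ k) (hF : F.Nodup) (hD : D ≠ [])
    (h' : DReads D [] [] F' w' ℓ' k') (hF' : F'.Nodup) : Code.Sim (w, ℓ) (w', ℓ') := by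
  obtain ⟨F₁, w₁, ℓ₁, h₁, hF₁, e₁⟩ := h.exists_zero hF hD
  obtain ⟨F₂, w₂, ℓ₂, h₂, hF₂, e₂⟩ := h'.exists_zero hF' hD
  refine e₁.trans (Code.Sim.trans ?_ e₂.symm)
  obtain ⟨g, -, rfl, rfl⟩ := h₁.unique rfl (f := id) h₂ rfl hF₁ (by simp)
  exact e₁.2.1.sim_map e₂.2.1

end STV

namespace STV

variable {P : Piece} {S : Slice} {D E : List Slice} {r r' : Row} {F F' : List ℕ}
  {w w' : List Letter} {ℓ ℓ' : List (ℕ × ℕ)} {k i : ℕ} {c : Crossing}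

/-! ### Reading slices -/

theorem SReads.zero_iff : SReads ⟨0, P⟩ r r' F w ℓ ↔
    ∃ t b m, PReads P t b F w ℓ ∧ r = t ++ m ∧ r' = b ++ m := by
  constructor
  · generalize hS : (⟨0, P⟩ : Slice) = S
    rintro ⟨l, m, hi, h⟩
    simp only [Slice.mk.injEq] at hS
    obtain ⟨rfl, rfl⟩ := hS
    obtain rfl := List.length_eq_zero_iff.1 hi
    exact ⟨_, _, m, h, rfl, rfl⟩
  · rintro ⟨t, b, m, h, rfl, rfl⟩
    exact .intro [] m rfl h

/-- Strands on the left are stripped one at a time, so that the inversion lemmas and the moves need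
to be treated only at the left margin. -/
theorem SReads.succ_iff : SReads ⟨i + 1, P⟩ r r' F w ℓ ↔
    ∃ x s s', SReads ⟨i, P⟩ s s' F w ℓ ∧ r = x :: s ∧ r' = x :: s' := by
  constructor
  · generalize hS : (⟨i + 1, P⟩ : Slice) = S
    rintro ⟨l, m, hi, h⟩
    simp only [Slice.mk.injEq] at hS
    obtain ⟨rfl, rfl⟩ := hS
    cases l with
    | nil => simp at hi
    | cons x l => exact ⟨x, _, _, .intro l m (by simpa using hi) h, by simp, by simp⟩
  · rintro ⟨x, s, s', h, rfl, rfl⟩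
    generalize hS : (⟨i, P⟩ : Slice) = S at h
    obtain ⟨l, m, hi, h⟩ := h
    simp only [Slice.mk.injEq] at hS
    obtain ⟨rfl, rfl⟩ := hS
    exact .intro (x :: l) m (by simpa using hi) h

theorem SReads.succ (x : Bool × ℕ) (h : SReads ⟨i, P⟩ r r' F w ℓ) :
    SReads ⟨i + 1, P⟩ (x :: r) (x :: r') F w ℓ := SReads.succ_iff.2 ⟨x, r, r', h, rfl, rfl⟩

theorem SReads.crossing_zero (hc : c ≠ .virtual) (d e : Bool) (a b a' b' : ℕ) (m : Row) :
    SReads ⟨0, .crossing c⟩ ((d, a) :: (e, b) :: m) ((e, b') :: (d, a') :: m) [a', b']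
      [xl c d e a' b'] [lk d a a', lk e b b'] := .intro [] m rfl (.crossing c hc d e a b a' b')

theorem SReads.virtual_zero (x y : Bool × ℕ) (m : Row) :
    SReads ⟨0, .crossing .virtual⟩ (x :: y :: m) (y :: x :: m) [] [] [] :=
  .intro [] m rfl (.virtual x y)

theorem SReads.bar_zero (d : Bool) (a a' : ℕ) (m : Row) :
    SReads ⟨0, .bar⟩ ((d, a) :: m) ((d, a') :: m) [a'] [.B a'] [lk d a a'] :=
  .intro [] m rfl (.bar d a a')

theorem SReads.maximum_zero (d : Bool) (s : ℕ) (m : Row) :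
    SReads ⟨0, .maximum d⟩ m ((d, s) :: (!d, s) :: m) [s] [] [] :=
  .intro [] m rfl (.maximum d s)

theorem SReads.minimum_zero (d : Bool) (a b : ℕ) (m : Row) :
    SReads ⟨0, .minimum⟩ ((d, a) :: (!d, b) :: m) m [] [] [lk d a b] :=
  .intro [] m rfl (.minimum d a b)

theorem SReads.crossing_inv (h : SReads ⟨0, .crossing c⟩ r r' F w ℓ) (hc : c ≠ .virtual) :
    ∃ d e a b a' b' m, r = (d, a) :: (e, b) :: m ∧ r' = (e, b') :: (d, a') :: m ∧
      F = [a', b'] ∧ w = [xl c d e a' b'] ∧ ℓ = [lk d a a', lk e b b'] := by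
  obtain ⟨t, b, m, p, rfl, rfl⟩ := SReads.zero_iff.1 h
  cases p with
  | virtual => exact absurd rfl hc
  | crossing c hc d e a b a' b' => exact ⟨d, e, a, b, a', b', m, rfl, rfl, rfl, rfl, rfl⟩

theorem SReads.virtual_inv (h : SReads ⟨0, .crossing .virtual⟩ r r' F w ℓ) :
    ∃ d e a b m, r = (d, a) :: (e, b) :: m ∧ r' = (e, b) :: (d, a) :: m ∧
      F = [] ∧ w = [] ∧ ℓ = [] := by
  obtain ⟨t, b, m, p, rfl, rfl⟩ := SReads.zero_iff.1 h
  cases p with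
  | virtual x y => exact ⟨x.1, y.1, x.2, y.2, m, rfl, rfl, rfl, rfl, rfl⟩
  | crossing c hc => exact absurd rfl hc

theorem SReads.bar_inv (h : SReads ⟨0, .bar⟩ r r' F w ℓ) :
    ∃ d a a' m, r = (d, a) :: m ∧ r' = (d, a') :: m ∧ F = [a'] ∧ w = [.B a'] ∧
      ℓ = [lk d a a'] := by
  obtain ⟨t, b, m, p, rfl, rfl⟩ := SReads.zero_iff.1 h
  cases p with
  | bar d a a' => exact ⟨d, a, a', m, rfl, rfl, rfl, rfl, rfl⟩

theorem SReads.maximum_inv {d : Bool} (h : SReads ⟨0, .maximum d⟩ r r' F w ℓ) :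
    ∃ s, r' = (d, s) :: (!d, s) :: r ∧ F = [s] ∧ w = [] ∧ ℓ = [] := by
  obtain ⟨t, b, m, p, rfl, rfl⟩ := SReads.zero_iff.1 h
  cases p with
  | maximum d s => exact ⟨s, rfl, rfl, rfl, rfl⟩

theorem SReads.minimum_inv (h : SReads ⟨0, .minimum⟩ r r' F w ℓ) :
    ∃ d a b, r = (d, a) :: (!d, b) :: r' ∧ F = [] ∧ w = [] ∧ ℓ = [lk d a b] := by
  obtain ⟨t, b, m, p, rfl, rfl⟩ := SReads.zero_iff.1 h
  cases p with
  | minimum d a b => exact ⟨d, a, b, rfl, rfl, rfl, rfl⟩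

theorem DReads.nil_inv (h : DReads [] r r' F w ℓ 0) : r' = r ∧ F = [] ∧ w = [] ∧ ℓ = [] := by
  cases h
  exact ⟨rfl, rfl, rfl, rfl⟩

theorem DReads.cons_inv (h : DReads (S :: D) r r' F w ℓ 0) :
    ∃ r₁ F₁ F₂ w₁ w₂ ℓ₁ ℓ₂, SReads S r r₁ F₁ w₁ ℓ₁ ∧ DReads D r₁ r' F₂ w₂ ℓ₂ 0 ∧
      F = F₁ ++ F₂ ∧ w = w₁ ++ w₂ ∧ ℓ = ℓ₁ ++ ℓ₂ := by
  cases h with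
  | cons h h' => exact ⟨_, _, _, _, _, _, _, h, h', rfl, rfl, rfl⟩

/-! ### Replacing a part of a diagram -/

/-- A reading of `R` that can replace a reading of another part with the same rows. -/
def Matches (R : List Slice) (r r' : Row) (F : List ℕ) (w : List Letter) (ℓ : List (ℕ × ℕ)) :
    Prop :=
  ∃ F' w' ℓ' k L L', DReads R r r' F' w' ℓ' k ∧ F.Perm F' ∧ ℓ.Perm (L ++ L') ∧
    ℓ'.Perm (L ++ L') ∧ (∀ p ∈ L, p.1 ∈ F ∧ p.2 ∈ F) ∧ Code.Local L w w'

theorem Code.Local.refl (L : List (ℕ × ℕ)) (w : List Letter) : Code.Local L w w :=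
  fun _ _ h _ => h.sim

theorem DReads.matches (h : DReads D r r' F' w ℓ' k) (hF : F.Perm F') (hℓ : ℓ.Perm ℓ') :
    Matches D r r' F w ℓ :=
  ⟨F', w, ℓ', k, [], ℓ', h, hF, hℓ, .refl _, by simp, .refl _ _⟩

theorem DReads.matches_local (h : DReads D r r' F' w' ℓ' k) (hF : F.Perm F')
    (L L' : List (ℕ × ℕ)) (hℓ : ℓ.Perm (L ++ L')) (hℓ' : ℓ'.Perm (L ++ L'))
    (hL : ∀ p ∈ L, p.1 ∈ F ∧ p.2 ∈ F) (e : Code.Local L w w') : Matches D r r' F w ℓ :=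
  ⟨F', w', ℓ', k, L, L', h, hF, hℓ, hℓ', hL, e⟩

/-- The part `L` of a diagram can be replaced by `R`. -/
def Sound (L R : List Slice) : Prop :=
  ∀ ⦃r r' F w ℓ⦄, DReads L r r' F w ℓ 0 → F.Nodup → (∀ a ∈ F, a ∉ r.names) →
    Matches R r r' F w ℓ

/-- Adding a strand on the left. -/
def Slice.up (S : Slice) : Slice := ⟨S.pos + 1, S.piece⟩

theorem DReads.up (x : Bool × ℕ) (h : DReads D r r' F w ℓ k) :
    DReads (D.map Slice.up) (x :: r) (x :: r') F w ℓ k := by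
  induction h with
  | nil r => exact .nil _
  | cons h _ ih => exact .cons (SReads.succ x h) ih
  | cut l m d a a' _ ih => exact .cut (x :: l) m d a a' ih

theorem DReads.up_inv (h : DReads (D.map Slice.up) r r' F w ℓ 0) (hD : D ≠ []) :
    ∃ x s s', r = x :: s ∧ r' = x :: s' ∧ DReads D s s' F w ℓ 0 := by
  induction D generalizing r F w ℓ with
  | nil => exact absurd rfl hD
  | cons S D ih =>
    obtain ⟨r₁, _, _, _, _, _, _, h₁, h₂, rfl, rfl, rfl⟩ := h.cons_inv
    obtain ⟨x, s, s', p, rfl, rfl⟩ := SReads.succ_iff.1 h₁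
    by_cases hD : D = []
    · subst hD
      obtain ⟨rfl, rfl, rfl, rfl⟩ := h₂.nil_inv
      exact ⟨x, s, s', rfl, rfl, .cons p (.nil _)⟩
    · obtain ⟨y, t, t', e, rfl, q⟩ := ih h₂ hD
      simp only [List.cons.injEq] at e
      obtain ⟨rfl, rfl⟩ := e
      exact ⟨_, _, _, rfl, rfl, .cons p q⟩

/-- Non-emptiness is needed: the empty word also fits between empty rows, where there is no strand
to be stripped. -/
theorem Sound.up {L R : List Slice} (h : Sound L R) (hL : L ≠ []) :
    Sound (L.map Slice.up) (R.map Slice.up) := by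
  intro r r' F w ℓ hr hF hd
  obtain ⟨x, s, s', rfl, rfl, hs⟩ := hr.up_inv hL
  obtain ⟨F', w', ℓ', k, L, L', h', rest⟩ := h hs hF fun a ha hb => hd a ha (by simp [hb])
  exact ⟨F', w', ℓ', k, L, L', h'.up x, rest⟩

/-- The letters of a reading without cuts are disjoint. Hence the letters of the part `L` may be
gathered at the front of the word, where the local replacement applies, and the letters of `R` may
be put back in their place. -/
theorem Sound.sim {A L R B : List Slice} (h : Sound L R)
    (hD : DReads (A ++ L ++ B) [] [] F w ℓ 0) (hF : F.Nodup) (hne : A ++ L ++ B ≠ []) :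
    ∃ F' w' ℓ' k, DReads (A ++ R ++ B) [] [] F' w' ℓ' k ∧ F'.Nodup ∧
      Code.Sim (w, ℓ) (w', ℓ') := by
  obtain ⟨r₂, F₁₂, F₃, w₁₂, w₃, ℓ₁₂, ℓ₃, h₁₂, h₃, rfl, rfl, rfl⟩ := hD.append_split
  obtain ⟨r₁, F₁, F₂, w₁, w₂, ℓ₁, ℓ₂, h₁, h₂, rfl, rfl, rfl⟩ := h₁₂.append_split
  have hF' := hF
  rw [List.nodup_append, List.nodup_append] at hF'
  obtain ⟨⟨hF₁, hF₂, hF₁₂⟩, hF₃, hF₁₂₃⟩ := hF'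
  have hd : ∀ a ∈ F₂, a ∉ r₁.names := fun a ha hb =>
    hF₁₂ a (by simpa using h₁.names_subset hb) a ha rfl
  obtain ⟨F₂', w₂', ℓ₂', k, L, L', hR, hp, hℓ, hℓ', hL, hloc⟩ := h h₂ hF₂ hd
  have hE := (h₁.append hR).append h₃
  have hw := hD.wf hF hne
  have hFp : (F₁ ++ F₂ ++ F₃).Perm (F₁ ++ F₂' ++ F₃) := (hp.append_left F₁).append_right F₃
  refine ⟨_, _, _, _, hE, hFp.nodup_iff.1 hF, ?_⟩
  have hn : (names (w₁ ++ w₂ ++ w₃)).Nodup := by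
    obtain ⟨x, hx, hs⟩ := hD.names_subperm
    exact hx.nodup_iff.1 (hs.nodup hF)
  have hn' : (names (w₁ ++ w₂' ++ w₃)).Nodup := by
    obtain ⟨x, hx, hs⟩ := hE.names_subperm
    exact hx.nodup_iff.1 (hs.nodup (hFp.nodup_iff.1 hF))
  have q : ∀ w : List Letter, (w₁ ++ w ++ w₃).Perm (w ++ (w₁ ++ w₃)) := fun w => by
    rw [List.append_assoc]; exact List.perm_append_comm_assoc _ _ _
  have q' : ∀ x : List (ℕ × ℕ), x.Perm (L ++ L') →
      (ℓ₁ ++ x ++ ℓ₃).Perm (L ++ (L' ++ (ℓ₁ ++ ℓ₃))) := fun x hx => by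
    rw [List.append_assoc, ← List.append_assoc L]
    exact (List.perm_append_comm_assoc _ _ _).trans (hx.append_right _)
  have s₁ := hw.sim_perm_letters (q w₂) hn
  have s₂ := s₁.2.1.sim_perm (q' _ hℓ)
  -- The links used by the replacement join names created inside the part, and such names do not
  -- occur in letters outside it.
  have s₃ := hloc _ _ s₂.2.1 fun p hp => by
    have key : ∀ a ∈ F₂, a ∉ names (w₁ ++ w₃) := fun a ha hb => by
      rw [names_append, List.mem_append] at hb
      rcases hb with hb | hb
      · exact hF₁₂ a (h₁.names_subperm.subset hb) a ha rfl
      · exact hF₁₂₃ a (by simp [ha]) a (h₃.names_subperm.subset hb) rfl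
    exact ⟨key _ (hL p hp).1, key _ (hL p hp).2⟩
  have s₄ := s₃.2.1.sim_perm (q' _ hℓ').symm
  have s₅ := s₄.2.1.sim_perm_letters (q w₂').symm ((hq' (q w₂')).1 hn')
  exact s₁.trans (s₂.trans (s₃.trans (s₄.trans s₅)))
where
  hq' {u v : List Letter} (h : u.Perm v) : (names u).Nodup ↔ (names v).Nodup :=
    (h.flatMap_right _).nodup_iff

end STV

namespace STV

variable {r r' : Row} {F F' : List ℕ} {w w' : List Letter} {ℓ ℓ' : List (ℕ × ℕ)} {k i : ℕ}
  {c m : Crossing}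

/-! ### Planar isotopy -/

theorem PReads.length {P : Piece} {t b : Row} (h : PReads P t b F w ℓ) :
    t.length = P.top ∧ b.length = P.bot := by cases h <;> exact ⟨rfl, rfl⟩

theorem SReads.inv {P : Piece} (h : SReads ⟨i, P⟩ r r' F w ℓ) :
    ∃ l t b m, PReads P t b F w ℓ ∧ l.length = i ∧ r = l ++ (t ++ m) ∧ r' = l ++ (b ++ m) := by
  generalize hS : (⟨i, P⟩ : Slice) = S at h
  obtain ⟨l, m, hi, h⟩ := h
  simp only [Slice.mk.injEq] at hS
  obtain ⟨rfl, rfl⟩ := hS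
  exact ⟨l, _, _, m, h, hi, by simp, by simp⟩

theorem PReads.slice {P : Piece} {t b : Row} (h : PReads P t b F w ℓ) (l m : Row)
    (hi : l.length = i) : SReads ⟨i, P⟩ (l ++ (t ++ m)) (l ++ (b ++ m)) F w ℓ := by
  have := SReads.intro l m hi h
  simpa using this

theorem Code.Local.swap {u v : List Letter} (h : ∀ a ∈ names u, a ∉ names v) :
    Code.Local [] (u ++ v) (v ++ u) := fun K ℓ hw _ =>
  hw.sim_letters ((LEq.swap hw.nodup_snd (fun l hl => hw.good_snd l (by simp [hl]))
    (fun l hl => hw.good_snd l (by simp [hl])) h).right K)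

/-- The code is unchanged except for the order of the letters, which are disjoint. -/
theorem Sound.heights (P Q : Piece) (i d : ℕ) :
    Sound [⟨i, P⟩, ⟨i + P.bot + d, Q⟩] [⟨i + P.top + d, Q⟩, ⟨i, P⟩] := by
  intro r r' F w ℓ h hF hd
  obtain ⟨r₁, F₁, _, w₁, _, ℓ₁, _, h₁, k1, rfl, rfl, rfl⟩ := h.cons_inv
  obtain ⟨r₂, F₂, _, w₂, _, ℓ₂, _, h₂, k2, rfl, rfl, rfl⟩ := k1.cons_inv
  obtain ⟨rfl, rfl, rfl, rfl⟩ := k2.nil_inv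
  obtain ⟨l, t, b, n, p, hl, rfl, rfl⟩ := h₁.inv
  obtain ⟨l', t', b', n', q, hl', e, rfl⟩ := h₂.inv
  have hp := p.length
  -- The row between the slices is split in two ways; the position of `Q` puts it to the right of
  -- the lower end of `P`, with the strands `s` between them.
  obtain ⟨s, rfl, rfl⟩ : ∃ s, l' = (l ++ b) ++ s ∧ n = s ++ (t' ++ n') := by
    rw [← List.append_assoc, List.append_eq_append_iff] at e
    rcases e with ⟨s, e₁, e₂⟩ | ⟨s, e₁, e₂⟩
    · exact ⟨s, e₁, e₂⟩
    · have : s = [] := by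
        have := congrArg List.length e₁
        simp only [List.length_append] at this
        exact List.length_eq_zero_iff.1 (by omega)
      subst this
      exact ⟨[], by simpa using e₁.symm, by simpa using e₂.symm⟩
  simp only [List.length_append] at hl'
  have s₁ := q.slice (l ++ (t ++ s)) n' (i := i + P.top + d) (by
    simp only [List.length_append]; omega)
  have s₂ := p.slice l (s ++ (b' ++ n')) hl
  simp only [List.append_assoc] at s₁ s₂
  have := DReads.cons s₁ (.cons s₂ (.nil _))
  simp only [List.append_nil, List.append_assoc] at *
  refine this.matches_local List.perm_append_comm [] (ℓ₁ ++ ℓ₂) (.refl _) List.perm_append_comm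
    (by simp) (.swap fun a ha hb => ?_)
  exact (List.nodup_append.1 hF).2.2 a (h₁.names_subperm.subset ha) a
    (h₂.names_subperm.subset hb) rfl

/-- On the straightened strand the name of the maximum survives as the new name of a cut, so both
sides have the same code. Cuts are admitted in readings for this purpose. -/
theorem Sound.zigzag_left (d : Bool) : Sound [⟨0, .maximum d⟩, ⟨1, .minimum⟩] [] := by
  intro r r' F w ℓ h hF hd
  obtain ⟨_, _, _, _, _, _, _, h₁, k1, rfl, rfl, rfl⟩ := h.cons_inv
  obtain ⟨_, _, _, _, _, _, _, h₂, k2, rfl, rfl, rfl⟩ := k1.cons_inv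
  obtain ⟨rfl, rfl, rfl, rfl⟩ := k2.nil_inv
  obtain ⟨s, rfl, rfl, rfl, rfl⟩ := h₁.maximum_inv
  obtain ⟨x, y, z, j₂, e, rfl⟩ := SReads.succ_iff.1 h₂
  obtain ⟨d', a, b, rfl, rfl, rfl, rfl⟩ := j₂.minimum_inv
  simp only [List.cons.injEq, Prod.mk.injEq] at e
  obtain ⟨rfl, ⟨rfl, rfl⟩, rfl⟩ := e
  rw [Bool.not_not, lk_not]
  exact (DReads.cut [] z d b s (.nil _)).matches (.refl _) (.refl _)

theorem Sound.zigzag_right (d : Bool) : Sound [⟨1, .maximum d⟩, ⟨0, .minimum⟩] [] := by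
  intro r r' F w ℓ h hF hd
  obtain ⟨_, _, _, _, _, _, _, h₁, k1, rfl, rfl, rfl⟩ := h.cons_inv
  obtain ⟨_, _, _, _, _, _, _, h₂, k2, rfl, rfl, rfl⟩ := k1.cons_inv
  obtain ⟨rfl, rfl, rfl, rfl⟩ := k2.nil_inv
  obtain ⟨x, y, z, j₁, rfl, rfl⟩ := SReads.succ_iff.1 h₁
  obtain ⟨s, rfl, rfl, rfl, rfl⟩ := j₁.maximum_inv
  obtain ⟨d', a, b, e, rfl, rfl, rfl⟩ := h₂.minimum_inv
  simp only [List.cons.injEq, Prod.mk.injEq] at e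
  obtain ⟨rfl, ⟨rfl, rfl⟩, rfl⟩ := e
  rw [Bool.not_not]
  exact (DReads.cut [] y d' a s (.nil _)).matches (.refl _) (.refl _)

theorem Code.Local.shift_lk {d : Bool} {a s : ℕ} (has : a ≠ s) {u : List Letter}
    (h : a ∉ names u) : Code.Local [lk d a s] u (u.map (Letter.map (ren a s))) := by
  cases d with
  | true => exact .shift has h
  | false => exact .shift' has.symm h

/-- The crossing passes from one end of a link to the other. The quarter turn `flip` compensates the
reversed direction of the leg, and the renaming is that of `Local.shift`. -/
theorem Sound.crossing_maximum (d : Bool) (c : Crossing) :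
    Sound [⟨1, .maximum d⟩, ⟨0, .crossing c⟩] [⟨0, .maximum d⟩, ⟨1, .crossing c.flip⟩] := by
  intro r r' F w ℓ h hF hd
  obtain ⟨_, _, _, _, _, _, _, h₁, k1, rfl, rfl, rfl⟩ := h.cons_inv
  obtain ⟨_, _, _, _, _, _, _, h₂, k2, rfl, rfl, rfl⟩ := k1.cons_inv
  obtain ⟨rfl, rfl, rfl, rfl⟩ := k2.nil_inv
  obtain ⟨x, y, z, j₁, rfl, rfl⟩ := SReads.succ_iff.1 h₁
  obtain ⟨s, rfl, rfl, rfl, rfl⟩ := j₁.maximum_inv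
  by_cases hc : c = .virtual
  · subst hc
    obtain ⟨d', e', a, b, n, e, rfl, rfl, rfl, rfl⟩ := h₂.virtual_inv
    simp only [List.cons.injEq, Prod.mk.injEq] at e
    obtain ⟨rfl, ⟨rfl, rfl⟩, rfl⟩ := e
    exact (DReads.cons (.maximum_zero d s _)
      (.cons (.succ _ (.virtual_zero _ _ _)) (.nil _))).matches (.refl _) (.refl _)
  · obtain ⟨d', e', a, b, a', b', n, e, rfl, rfl, rfl, rfl⟩ := h₂.crossing_inv hc
    simp only [List.cons.injEq, Prod.mk.injEq] at e
    obtain ⟨rfl, ⟨rfl, rfl⟩, rfl⟩ := e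
    have hn : s ≠ a' ∧ s ≠ b' ∧ a' ≠ b' := by simp at hF; tauto
    -- The maximum is now called `b'` and the name `s` arises below the crossing: the row at the
    -- bottom has to be the same as before.
    have hR := DReads.cons (.maximum_zero d b' _) (.cons (.succ _ (.crossing_zero
      (LEq.flip_ne_virtual hc) (!d) d' b' a s a' y)) (.nil _))
    refine hR.matches_local ?_ [lk d s b'] [lk d' a a'] ?_ ?_ ?_ ?_
    · exact perm_of_count fun x => by
        simp only [List.count_append, List.count_cons, List.count_nil]; omega
    · exact List.Perm.swap _ _ _
    · rw [lk_not]
      exact .refl _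
    · simp only [List.mem_singleton, forall_eq]
      cases d <;> simp [lk]
    · have := Code.Local.shift_lk (d := d) (a := s) (s := b') hn.2.1 (u := [xl c d' d a' b'])
        (by cases d <;> cases d' <;> simp [xl, Letter.names, hn])
      cases d <;> cases d' <;>
        simpa [xl, Letter.map, ren, hn, LEq.flip_flip] using this

/-- With suitable names both sides have the same letter, and the links agree up to order. -/
theorem Sound.crossing_minimum (c : Crossing) :
    Sound [⟨0, .crossing c⟩, ⟨1, .minimum⟩] [⟨1, .crossing c.flip⟩, ⟨0, .minimum⟩] := by
  intro r r' F w ℓ h hF hd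
  obtain ⟨_, _, _, _, _, _, _, h₁, k1, rfl, rfl, rfl⟩ := h.cons_inv
  obtain ⟨_, _, _, _, _, _, _, h₂, k2, rfl, rfl, rfl⟩ := k1.cons_inv
  obtain ⟨rfl, rfl, rfl, rfl⟩ := k2.nil_inv
  obtain ⟨x, y, z, j₂, e₁, rfl⟩ := SReads.succ_iff.1 h₂
  obtain ⟨d₁, a₁, b₁, rfl, rfl, rfl, rfl⟩ := j₂.minimum_inv
  by_cases hc : c = .virtual
  · subst hc
    obtain ⟨d', e', a, b, n, rfl, rfl, rfl, rfl, rfl⟩ := h₁.virtual_inv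
    simp only [List.cons.injEq, Prod.mk.injEq] at e₁
    obtain ⟨rfl, ⟨rfl, rfl⟩, rfl⟩ := e₁
    exact (DReads.cons (.succ _ (.virtual_zero _ _ _))
      (.cons (.minimum_zero _ _ _ _) (.nil _))).matches (.refl _) (.refl _)
  · obtain ⟨d', e', a, b, a', b', n, rfl, rfl, rfl, rfl, rfl⟩ := h₁.crossing_inv hc
    simp only [List.cons.injEq, Prod.mk.injEq] at e₁
    obtain ⟨rfl, ⟨rfl, rfl⟩, rfl⟩ := e₁
    have hR := DReads.cons (.succ (d', a) (.crossing_zero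
      (LEq.flip_ne_virtual hc) e' (!d') b b₁ b' a' z))
      (.cons (.minimum_zero d' a a' ((e', b') :: z)) (.nil _))
    have e : [xl c.flip e' (!d') b' a'] = [xl c d' e' a' b'] := by
      cases d' <;> cases e' <;> simp [xl, LEq.flip_flip]
    rw [e, lk_not] at hR
    refine hR.matches (.swap _ _ _) ?_
    exact perm_of_count fun x => by
      simp only [List.count_append, List.count_cons, List.count_nil]; omega

theorem Sound.bar_maximum (d : Bool) :
    Sound [⟨0, .maximum d⟩, ⟨0, .bar⟩] [⟨0, .maximum d⟩, ⟨1, .bar⟩] := by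
  intro r r' F w ℓ h hF hd
  obtain ⟨_, _, _, _, _, _, _, h₁, k1, rfl, rfl, rfl⟩ := h.cons_inv
  obtain ⟨_, _, _, _, _, _, _, h₂, k2, rfl, rfl, rfl⟩ := k1.cons_inv
  obtain ⟨rfl, rfl, rfl, rfl⟩ := k2.nil_inv
  obtain ⟨s, rfl, rfl, rfl, rfl⟩ := h₁.maximum_inv
  obtain ⟨d', a, a', n, e, rfl, rfl, rfl, rfl⟩ := h₂.bar_inv
  simp only [List.cons.injEq, Prod.mk.injEq] at e
  obtain ⟨⟨rfl, rfl⟩, rfl⟩ := e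
  have hn : s ≠ a' := by simpa using hF
  have hR := DReads.cons (.maximum_zero d a' r) (.cons (.succ _ (.bar_zero (!d) a' s r)) (.nil _))
  rw [lk_not] at hR
  refine hR.matches_local (.swap _ _ _) [lk d s a'] [] (.refl _) (.refl _) ?_ ?_
  · simp only [List.mem_singleton, forall_eq]
    cases d <;> simp [lk]
  · have := Code.Local.shift_lk (d := d) (a := s) (s := a') hn (u := [.B a'])
      (by simpa [Letter.names] using hn)
    simpa [Letter.map, ren] using this

theorem Sound.bar_minimum : Sound [⟨0, .bar⟩, ⟨0, .minimum⟩] [⟨1, .bar⟩, ⟨0, .minimum⟩] := by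
  intro r r' F w ℓ h hF hd
  obtain ⟨_, _, _, _, _, _, _, h₁, k1, rfl, rfl, rfl⟩ := h.cons_inv
  obtain ⟨_, _, _, _, _, _, _, h₂, k2, rfl, rfl, rfl⟩ := k1.cons_inv
  obtain ⟨rfl, rfl, rfl, rfl⟩ := k2.nil_inv
  obtain ⟨d', a, a', n, rfl, rfl, rfl, rfl, rfl⟩ := h₁.bar_inv
  obtain ⟨d₁, a₁, b₁, e, rfl, rfl, rfl⟩ := h₂.minimum_inv
  simp only [List.cons.injEq, Prod.mk.injEq] at e
  obtain ⟨⟨rfl, rfl⟩, rfl⟩ := e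
  have hR := DReads.cons (.succ (d', a) (.bar_zero (!d') b₁ a' r'))
    (.cons (.minimum_zero d' a a' r') (.nil _))
  rw [lk_not] at hR
  exact hR.matches (.refl _) (.swap _ _ _)

/-! ### Generalized Reidemeister moves -/

theorem Sound.kink (d : Bool) (c : Crossing) (hs : c ≠ .singular) :
    Sound [⟨1, .maximum d⟩, ⟨0, .crossing c⟩, ⟨1, .minimum⟩] [] := by
  intro r r' F w ℓ h hF hd
  obtain ⟨_, _, _, _, _, _, _, h₁, k1, rfl, rfl, rfl⟩ := h.cons_inv
  obtain ⟨_, _, _, _, _, _, _, h₂, k2, rfl, rfl, rfl⟩ := k1.cons_inv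
  obtain ⟨_, _, _, _, _, _, _, h₃, k3, rfl, rfl, rfl⟩ := k2.cons_inv
  obtain ⟨rfl, rfl, rfl, rfl⟩ := k3.nil_inv
  obtain ⟨x, y, z, j₁, rfl, rfl⟩ := SReads.succ_iff.1 h₁
  obtain ⟨s, rfl, rfl, rfl, rfl⟩ := j₁.maximum_inv
  obtain ⟨x', y', z', j₃, e₁, rfl⟩ := SReads.succ_iff.1 h₃
  obtain ⟨d₁, a₁, b₁, rfl, rfl, rfl, rfl⟩ := j₃.minimum_inv
  by_cases hc : c = .virtual
  · subst hc
    obtain ⟨d', e', a, b, n, e, rfl, rfl, rfl, rfl⟩ := h₂.virtual_inv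
    simp only [List.cons.injEq, Prod.mk.injEq] at e
    obtain ⟨rfl, ⟨rfl, rfl⟩, rfl⟩ := e
    simp only [List.cons.injEq, Prod.mk.injEq] at e₁
    obtain ⟨rfl, ⟨rfl, rfl⟩, ⟨e, rfl⟩, rfl⟩ := e₁
    obtain rfl : d = d' := by simpa using e
    exact (DReads.cut [] y d a s (.nil _)).matches (.refl _) (.refl _)
  · have hr : c.Real := by cases c <;> simp_all [Crossing.Real]
    obtain ⟨d', e', a, b, a', b', n, e, rfl, rfl, rfl, rfl⟩ := h₂.crossing_inv hc
    simp only [List.cons.injEq, Prod.mk.injEq] at e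
    obtain ⟨rfl, ⟨rfl, rfl⟩, rfl⟩ := e
    simp only [List.cons.injEq, Prod.mk.injEq] at e₁
    obtain ⟨rfl, ⟨rfl, rfl⟩, ⟨e, rfl⟩, rfl⟩ := e₁
    obtain rfl : d = d' := by simpa using e
    have hn : s ≠ a' ∧ s ≠ b' ∧ a' ≠ b' := by simp at hF; tauto
    -- Three cuts of the straight strand reproduce all names and links of the kink.
    have hR := DReads.cut [] y d a a' (.cut [] y d a' s (.cut [] y d s b' (.nil _)))
    have hp : [lk d s b', lk d a' s, lk d a a'].Perm [lk d a a', lk d a' s, lk d s b'] :=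
      perm_of_count fun x => by simp only [List.count_cons, List.count_nil]; omega
    refine hR.matches_local ?_ [lk d s b', lk d a' s] [lk d a a'] ?_ hp.symm ?_ ?_
    · exact List.Perm.swap _ _ _
    · exact perm_of_count fun x => by
        simp only [List.count_append, List.count_cons, List.count_nil]; omega
    · intro p hp
      simp only [List.mem_cons, List.not_mem_nil, or_false] at hp
      rcases hp with rfl | rfl <;> cases d <;> simp [lk]
    -- The letter is first moved from `b'` to `s`. It then crosses the two ends of one link, and the
    -- direction decides which of the two kinks it is.
    · have s₁ := (Code.Local.shift_lk (d := d) hn.2.1 (u := [.X c a' b'])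
        (by simp [Letter.names, hn])).extend [lk d a' s]
      have s₂ : Code.Local [lk d s b', lk d a' s] [.X c a' s] [] := by
        refine Code.Local.perm_extend (L := [lk d a' s]) (L' := [lk d s b']) ?_ (.swap _ _ _)
        cases d with
        | true => exact .kink hr hn.1.symm
        | false => exact .kink' hr hn.1
      have e : [Letter.X c a' b'].map (Letter.map (ren s b')) = [.X c a' s] := by
        simp [Letter.map, ren, hn]
      rw [e] at s₁
      have e' : xl c d d a' b' = .X c a' b' := by simp [xl]
      rw [e']
      exact s₁.trans s₂

end STV

/-! ### Replacements and Reidemeister moves for all directions of the strands. -/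

namespace STV

variable {r r' : Row} {F F' : List ℕ} {w w' : List Letter} {ℓ ℓ' : List (ℕ × ℕ)} {k i : ℕ}
  {c m : Crossing} {a₁ a₂ a₃ b₁ b₂ b₃ m₁ m₂ : ℕ}

namespace Code

theorem perm_two {α : Type*} (x y : α) : [x, y].Perm [y, x] := .swap _ _ _

/-- Strands with the same direction give a braid relation, and strands with opposite directions one
of the two threadings. -/
theorem Local.bigon_lk (hc : c.Real) (d e : Bool) (hn : [a₁, a₂, b₁, b₂].Nodup) :
    Local [lk d a₁ a₂, lk e b₁ b₂] [xl c d e a₁ b₁, xl c.flip e d b₂ a₂] [] := by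
  simp only [List.nodup_cons, List.mem_cons, List.not_mem_nil, or_false, not_or] at hn
  cases d <;> cases e <;>
    simp only [lk, xl, if_true, if_false, Bool.true_eq_false, Bool.false_eq_true,
      LEq.flip_flip]
  · have := Local.bigon (a₁ := b₂) (a₂ := b₁) (b₁ := a₂) (b₂ := a₁) (LEq.real_flip hc)
      (by simp; grind)
    rw [LEq.flip_flip] at this
    exact (this.perm_left (perm_two _ _) (by simp [Letter.names]; grind)).links_perm
      (perm_two _ _)
  · have := Local.bigon_anti_right (a₁ := a₂) (a₂ := a₁) (b₁ := b₁) (b₂ := b₂) hc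
      (by simp; grind)
    exact this.perm_left (perm_two _ _) (by simp [Letter.names]; grind)
  · have := Local.bigon_anti_left (a₁ := a₁) (a₂ := a₂) (b₁ := b₂) (b₂ := b₁)
      (LEq.real_flip hc) (by simp; grind)
    rwa [LEq.flip_flip] at this
  · exact Local.bigon hc (by simp; grind)

/-- As for the bigon, with S2 and the two `rs`-threadings. -/
theorem Local.real_singular_lk (hc : c.Real) (d e : Bool) (hn : [a₁, a₂, b₁, b₂].Nodup) :
    Local [lk d a₁ a₂, lk e b₁ b₂] [xl c d e a₁ b₁, xl .singular e d b₂ a₂]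
      [xl .singular d e a₁ b₁, xl c e d b₂ a₂] := by
  have hv := LEq.real_ne_virtual hc
  have hv' := LEq.flip_ne_virtual hv
  have hc' := LEq.real_flip hc
  have hs : Crossing.flip .singular = .singular := rfl
  simp only [List.nodup_cons, List.mem_cons, List.not_mem_nil, or_false, not_or] at hn
  have p : ∀ {L x y z t}, (names [x, y]).Nodup → (names [z, t]).Nodup → Local L [x, y] [z, t] →
      Local L [y, x] [t, z] := fun h h' e =>
    (e.perm_left (perm_two _ _) h).perm_right (perm_two _ _) h'
  have sw : ∀ {p q u v}, Local [p, q] u v → Local [q, p] u v := fun h =>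
    h.links_perm (perm_two _ _)
  cases d <;> cases e <;>
    simp only [lk, xl, if_true, if_false, Bool.true_eq_false, Bool.false_eq_true, hs]
  · have := Local.real_singular (a₁ := b₂) (a₂ := b₁) (b₁ := a₂) (b₂ := a₁) hc (by simp; grind)
    refine sw (p ?_ ?_ (this.symm ?_)) <;> simp [Letter.names, Letter.Good, linkNames] <;> grind
  · have := Local.real_singular_anti_right (a₁ := a₂) (a₂ := a₁) (b₁ := b₁) (b₂ := b₂) hc'
      (by simp; grind)
    refine p ?_ ?_ this <;> simp [Letter.names] <;> grind
  · have := Local.real_singular_anti_left (a₁ := a₁) (a₂ := a₂) (b₁ := b₂) (b₂ := b₁) hc'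
      (by simp; grind)
    refine this.symm ?_
    simp [Letter.names, Letter.Good, linkNames]; grind
  · exact Local.real_singular hc (by simp; grind)

/-- If the moving strand runs downward, the directions of the other two distinguish the slides from
the left, from the right, past the side, and the cyclic one. -/
theorem Local.slide_lk_true (hm : m.Real) (hc : c ≠ .virtual) (d e : Bool)
    (hn : [m₁, m₂, a₁, a₂, b₁, b₂].Nodup) :
    Local [(m₁, m₂), lk d a₁ a₂, lk e b₁ b₂]
      [xl m true d m₁ a₁, xl m true e m₂ b₁, xl c d e a₂ b₂]
      [xl c d e a₁ b₁, xl m true e m₁ b₂, xl m true d m₂ a₂] := by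
  have hc' := LEq.flip_ne_virtual hc
  cases d <;> cases e <;>
    simp only [lk, xl, if_true, if_false, Bool.true_eq_false, Bool.false_eq_true]
  · exact Local.slide_right (LEq.real_flip hm) hc hn
  · exact Local.slide_cyclic hm hc' hn
  · exact Local.slide_mid hm hc' hn
  · exact Local.slide_left hm hc hn

theorem good_xl {x : List ℕ} {d e : Bool} {a b : ℕ} (hc : c ≠ .virtual) (h : a ≠ b) (ha : a ∈ x)
    (hb : b ∈ x) : (xl c d e a b).Good x := by
  unfold xl
  split_ifs
  exacts [⟨hc, h, ha, hb⟩, ⟨LEq.flip_ne_virtual hc, h.symm, hb, ha⟩]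

theorem xl_not (c : Crossing) (d e : Bool) (a b : ℕ) : xl c (!d) (!e) a b = xl c d e a b := by
  cases d <;> cases e <;> rfl

open scoped Classical in
-- If the moving strand runs upward, the picture is turned upside down: all directions and the order
-- of the letters are reversed, and the two sides of the slide change places.
theorem Local.slide_lk (hm : m.Real) (hc : c ≠ .virtual) (d₁ d e : Bool)
    (hn : [m₁, m₂, a₁, a₂, b₁, b₂].Nodup) :
    Local [lk d₁ m₁ m₂, lk d a₁ a₂, lk e b₁ b₂]
      [xl m d₁ d m₁ a₁, xl m d₁ e m₂ b₁, xl c d e a₂ b₂]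
      [xl c d e a₁ b₁, xl m d₁ e m₁ b₂, xl m d₁ d m₂ a₂] := by
  cases d₁ with
  | true => exact Local.slide_lk_true hm hc d e hn
  | false =>
    have hn' : [m₂, m₁, a₂, a₁, b₂, b₁].Nodup := by
      simp only [List.nodup_cons, List.mem_cons, List.not_mem_nil, or_false, not_or] at hn ⊢
      grind
    have h := Local.slide_lk_true hm hc (!d) (!e) hn'
    have hx : ∀ f a b, xl m true (!f) a b = xl m false f a b := fun f a b =>
      xl_not m false f a b
    simp only [lk_not, xl_not, hx] at h
    have hv := LEq.real_ne_virtual hm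
    have names_nodup : ∀ (x y z : Letter), (names [x, y, z]).Perm (names [z, y, x]) := by
      intro x y z
      exact perm_of_count fun a => by simp only [names_cons, names_nil, List.count_append]; omega
    have three : ∀ (x y z : Letter), [x, y, z].Perm [z, y, x] := fun x y z =>
      perm_of_count fun a => by simp only [List.count_cons, List.count_nil]; omega
    have nd : ∀ {c₁ c₂ c₃ : Crossing} {f₁ f₂ f₃ g₁ g₂ g₃ : Bool} {u₁ u₂ u₃ v₁ v₂ v₃ : ℕ},
        [u₁, v₁, u₂, v₂, u₃, v₃].Nodup →
        (names [xl c₁ f₁ g₁ u₁ v₁, xl c₂ f₂ g₂ u₂ v₂, xl c₃ f₃ g₃ u₃ v₃]).Nodup := by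
      intro c₁ c₂ c₃ f₁ f₂ f₃ g₁ g₂ g₃ u₁ u₂ u₃ v₁ v₂ v₃ h
      simp only [names_cons, names_nil, List.append_nil]
      refine (List.Perm.nodup_iff ?_).1 h
      exact (names_xl _ _ _ _ _).symm.append
        ((names_xl _ _ _ _ _).symm.append (names_xl _ _ _ _ _).symm)
    simp only [List.nodup_cons, List.mem_cons, List.not_mem_nil, or_false, not_or] at hn
    have k := h.symm (by
      simp only [List.forall_mem_cons, lk, linkNames]
      refine ⟨good_xl hv ?_ ?_ ?_, good_xl hv ?_ ?_ ?_, good_xl hc ?_ ?_ ?_, by simp⟩ <;>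
        (cases d <;> cases e <;> simp [xl, Letter.names] <;> grind))
    exact (k.perm_left (three _ _ _) (nd (by simp; grind))).perm_right (three _ _ _)
      (nd (by simp; grind))

open scoped Classical in
theorem Local.twist_lk (hc : c ≠ .virtual) (d e : Bool) (hn : [a₁, a₂, a₃, b₁, b₂, b₃].Nodup) :
    Local [lk d a₁ a₂, lk d a₂ a₃, lk e b₁ b₂, lk e b₂ b₃]
      [.B b₁, .B a₁, xl c d e a₂ b₂, .B b₃, .B a₃] [xl c e d b₂ a₂] := by
  simp only [List.nodup_cons, List.mem_cons, List.not_mem_nil, or_false, not_or] at hn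
  have key : ∀ {c : Crossing} {x₁ x₂ x₃ y₁ y₂ y₃ : ℕ} {L w}, c ≠ .virtual →
      [x₁, x₂, x₃, y₁, y₂, y₃].Nodup →
      L.Perm [(x₂, x₃), (x₁, x₂), (y₂, y₃), (y₁, y₂)] →
      [Letter.B x₁, .B y₁, .X c x₂ y₂, .B y₃, .B x₃].Perm w → Local L w [.X c y₂ x₂] := by
    intro c x₁ x₂ x₃ y₁ y₂ y₃ L w hc hn hL hw
    refine ((Local.twist hc hn).links_perm hL.symm).perm_left hw ?_
    simp only [List.nodup_cons, List.mem_cons, List.not_mem_nil, or_false, not_or] at hn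
    simp [Letter.names]
    grind
  have hc' := LEq.flip_ne_virtual hc
  cases d <;> cases e <;>
    simp only [lk, xl, if_true, if_false, Bool.true_eq_false, Bool.false_eq_true]
  · exact key (x₁ := a₃) (x₂ := a₂) (x₃ := a₁) (y₁ := b₃) (y₂ := b₂) (y₃ := b₁) hc
      (by simp; grind)
      (perm_of_count fun x => by simp only [List.count_cons, List.count_nil])
      (perm_of_count fun x => by simp only [List.count_cons, List.count_nil]; omega)
  · have := key (x₁ := b₁) (x₂ := b₂) (x₃ := b₃) (y₁ := a₃) (y₂ := a₂) (y₃ := a₁)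
      (L := [(a₂, a₁), (a₃, a₂), (b₁, b₂), (b₂, b₃)])
      (w := [.B b₁, .B a₁, .X c.flip b₂ a₂, .B b₃, .B a₃]) hc' (by simp; grind)
      (perm_of_count fun x => by simp only [List.count_cons, List.count_nil]; omega)
      (perm_of_count fun x => by simp only [List.count_cons, List.count_nil]; omega)
    exact this
  · have := key (x₁ := b₃) (x₂ := b₂) (x₃ := b₁) (y₁ := a₁) (y₂ := a₂) (y₃ := a₃)
      (L := [(a₁, a₂), (a₂, a₃), (b₂, b₁), (b₃, b₂)])
      (w := [.B b₁, .B a₁, .X c.flip b₂ a₂, .B b₃, .B a₃]) hc' (by simp; grind)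
      (perm_of_count fun x => by simp only [List.count_cons, List.count_nil]; omega)
      (perm_of_count fun x => by simp only [List.count_cons, List.count_nil]; omega)
    exact this
  · exact key (x₁ := a₁) (x₂ := a₂) (x₃ := a₃) (y₁ := b₁) (y₂ := b₂) (y₃ := b₃) hc
      (by simp; grind)
      (perm_of_count fun x => by simp only [List.count_cons, List.count_nil]; omega)
      (perm_of_count fun x => by simp only [List.count_cons, List.count_nil]; omega)

end Code

theorem lk_mem {d : Bool} {a b : ℕ} {F : List ℕ} (ha : a ∈ F) (hb : b ∈ F) :
    (lk d a b).1 ∈ F ∧ (lk d a b).2 ∈ F := by cases d <;> exact ⟨by assumption, by assumption⟩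

theorem Sound.bigon (c : Crossing) (hs : c ≠ .singular) :
    Sound [⟨0, .crossing c⟩, ⟨0, .crossing c.flip⟩] [] := by
  intro r r' F w ℓ h hF hd
  obtain ⟨_, _, _, _, _, _, _, h₁, k1, rfl, rfl, rfl⟩ := h.cons_inv
  obtain ⟨_, _, _, _, _, _, _, h₂, k2, rfl, rfl, rfl⟩ := k1.cons_inv
  obtain ⟨rfl, rfl, rfl, rfl⟩ := k2.nil_inv
  by_cases hc : c = .virtual
  · subst hc
    obtain ⟨d, e, a, b, n, rfl, rfl, rfl, rfl, rfl⟩ := h₁.virtual_inv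
    obtain ⟨d', e', a', b', n', q, rfl, rfl, rfl, rfl⟩ := h₂.virtual_inv
    simp only [List.cons.injEq, Prod.mk.injEq] at q
    obtain ⟨⟨rfl, rfl⟩, ⟨rfl, rfl⟩, rfl⟩ := q
    exact (DReads.nil _).matches (.refl _) (.refl _)
  · have hr : c.Real := by cases c <;> simp_all [Crossing.Real]
    obtain ⟨d, e, a, b, a₁, b₁, n, rfl, rfl, rfl, rfl, rfl⟩ := h₁.crossing_inv hc
    obtain ⟨d', e', a', b', b₂, a₂, n', q, rfl, rfl, rfl, rfl⟩ :=
      h₂.crossing_inv (LEq.flip_ne_virtual hc)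
    simp only [List.cons.injEq, Prod.mk.injEq] at q
    obtain ⟨⟨rfl, rfl⟩, ⟨rfl, rfl⟩, rfl⟩ := q
    -- Two cuts on each strand take the place of the new names at the removed crossings.
    have hR := DReads.cut [] ((e, b) :: n) d a a₁ (.cut [] ((e, b) :: n) d a₁ a₂
      (.cut [(d, a₂)] n e b b₁ (.cut [(d, a₂)] n e b₁ b₂ (.nil _))))
    refine hR.matches_local ?_ [lk d a₁ a₂, lk e b₁ b₂] [lk d a a₁, lk e b b₁] ?_ ?_ ?_
      (Code.Local.bigon_lk hr d e ?_)
    · exact perm_of_count fun x => by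
        simp only [List.count_append, List.count_cons, List.count_nil]; omega
    · exact perm_of_count fun x => by
        simp only [List.count_append, List.count_cons, List.count_nil]; omega
    · exact perm_of_count fun x => by
        simp only [List.count_append, List.count_cons, List.count_nil]; omega
    · simp only [List.forall_mem_cons]
      exact ⟨lk_mem (by simp) (by simp), lk_mem (by simp) (by simp), by simp⟩
    · simp at hF ⊢
      grind

theorem Sound.real_singular (c : Crossing) (hr : c.Real) :
    Sound [⟨0, .crossing c⟩, ⟨0, .crossing .singular⟩]
      [⟨0, .crossing .singular⟩, ⟨0, .crossing c⟩] := by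
  intro r r' F w ℓ h hF hd
  obtain ⟨_, _, _, _, _, _, _, h₁, k1, rfl, rfl, rfl⟩ := h.cons_inv
  obtain ⟨_, _, _, _, _, _, _, h₂, k2, rfl, rfl, rfl⟩ := k1.cons_inv
  obtain ⟨rfl, rfl, rfl, rfl⟩ := k2.nil_inv
  have hc := LEq.real_ne_virtual hr
  obtain ⟨d, e, a, b, a₁, b₁, n, rfl, rfl, rfl, rfl, rfl⟩ := h₁.crossing_inv hc
  obtain ⟨d', e', a', b', b₂, a₂, n', q, rfl, rfl, rfl, rfl⟩ := h₂.crossing_inv (by simp)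
  simp only [List.cons.injEq, Prod.mk.injEq] at q
  obtain ⟨⟨rfl, rfl⟩, ⟨rfl, rfl⟩, rfl⟩ := q
  have hR := DReads.cons (.crossing_zero (c := .singular) (by simp) d e a b a₁ b₁ n)
    (.cons (.crossing_zero hc e d b₁ a₁ b₂ a₂ n) (.nil _))
  refine hR.matches_local (.refl _) [lk d a₁ a₂, lk e b₁ b₂] [lk d a a₁, lk e b b₁] ?_ ?_ ?_
    (Code.Local.real_singular_lk hr d e ?_)
  · exact perm_of_count fun x => by
      simp only [List.count_append, List.count_cons, List.count_nil]; omega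
  · exact perm_of_count fun x => by
      simp only [List.count_append, List.count_cons, List.count_nil]; omega
  · simp only [List.forall_mem_cons]
    exact ⟨lk_mem (by simp) (by simp), lk_mem (by simp) (by simp), by simp⟩
  · simp at hF ⊢
    grind

/-- The new names on the right-hand side are chosen so that the bottom row and all links agree with
those on the left; only the letters differ. -/
theorem Sound.slide_real (m c : Crossing) (hr : m.Real) (hc : c ≠ .virtual) :
    Sound [⟨0, .crossing m⟩, ⟨1, .crossing m⟩, ⟨0, .crossing c⟩]
      [⟨1, .crossing c⟩, ⟨0, .crossing m⟩, ⟨1, .crossing m⟩] := by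
  intro r r' F w ℓ h hF hd
  obtain ⟨_, _, _, _, _, _, _, h₁, k1, rfl, rfl, rfl⟩ := h.cons_inv
  obtain ⟨_, _, _, _, _, _, _, h₂, k2, rfl, rfl, rfl⟩ := k1.cons_inv
  obtain ⟨_, _, _, _, _, _, _, h₃, k3, rfl, rfl, rfl⟩ := k2.cons_inv
  obtain ⟨rfl, rfl, rfl, rfl⟩ := k3.nil_inv
  have hm := LEq.real_ne_virtual hr
  obtain ⟨d₁, d, x, a, m₁, a₁, n, rfl, rfl, rfl, rfl, rfl⟩ := h₁.crossing_inv hm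
  obtain ⟨x', y, z, j₂, q, rfl⟩ := SReads.succ_iff.1 h₂
  obtain ⟨d', e, y', b, m₂, b₁, n', rfl, rfl, rfl, rfl, rfl⟩ := j₂.crossing_inv hm
  simp only [List.cons.injEq, Prod.mk.injEq] at q
  obtain ⟨rfl, ⟨rfl, rfl⟩, rfl⟩ := q
  obtain ⟨d'', e', y', z', a₂, b₂, n, q, rfl, rfl, rfl, rfl⟩ := h₃.crossing_inv hc
  simp only [List.cons.injEq, Prod.mk.injEq] at q
  obtain ⟨⟨rfl, rfl⟩, ⟨rfl, rfl⟩, rfl⟩ := q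
  have hR := DReads.cons (.succ (d₁, x) (.crossing_zero hc d e a b a₁ b₁ n'))
    (.cons (.crossing_zero hm d₁ e x b₁ m₁ b₂ ((d, a₁) :: n'))
      (.cons (.succ (e, b₂) (.crossing_zero hm d₁ d m₁ a₁ m₂ a₂ n')) (.nil _)))
  refine hR.matches_local ?_ [lk d₁ m₁ m₂, lk d a₁ a₂, lk e b₁ b₂]
    [lk d₁ x m₁, lk d a a₁, lk e b b₁] ?_ ?_ ?_ (Code.Local.slide_lk hr hc d₁ d e ?_)
  · exact perm_of_count fun x => by
      simp only [List.count_append, List.count_cons, List.count_nil]; omega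
  · exact perm_of_count fun x => by
      simp only [List.count_append, List.count_cons, List.count_nil]; omega
  · exact perm_of_count fun x => by
      simp only [List.count_append, List.count_cons, List.count_nil]; omega
  · simp only [List.forall_mem_cons]
    exact ⟨lk_mem (by simp) (by simp), lk_mem (by simp) (by simp), lk_mem (by simp) (by simp),
      by simp⟩
  · simp at hF ⊢
    grind

/-- Virtual crossings leave no trace in the code, so both sides can be given the same one. -/
theorem Sound.slide_virtual (c : Crossing) :
    Sound [⟨0, .crossing .virtual⟩, ⟨1, .crossing .virtual⟩, ⟨0, .crossing c⟩]
      [⟨1, .crossing c⟩, ⟨0, .crossing .virtual⟩, ⟨1, .crossing .virtual⟩] := by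
  intro r r' F w ℓ h hF hd
  obtain ⟨_, _, _, _, _, _, _, h₁, k1, rfl, rfl, rfl⟩ := h.cons_inv
  obtain ⟨_, _, _, _, _, _, _, h₂, k2, rfl, rfl, rfl⟩ := k1.cons_inv
  obtain ⟨_, _, _, _, _, _, _, h₃, k3, rfl, rfl, rfl⟩ := k2.cons_inv
  obtain ⟨rfl, rfl, rfl, rfl⟩ := k3.nil_inv
  obtain ⟨d₁, d, x, a, n, rfl, rfl, rfl, rfl, rfl⟩ := h₁.virtual_inv
  obtain ⟨x', y, z, j₂, q, rfl⟩ := SReads.succ_iff.1 h₂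
  obtain ⟨d', e, y', b, n', rfl, rfl, rfl, rfl, rfl⟩ := j₂.virtual_inv
  simp only [List.cons.injEq, Prod.mk.injEq] at q
  obtain ⟨rfl, ⟨rfl, rfl⟩, rfl⟩ := q
  by_cases hc : c = .virtual
  · subst hc
    obtain ⟨d'', e', y', z', n, q, rfl, rfl, rfl, rfl⟩ := h₃.virtual_inv
    simp only [List.cons.injEq, Prod.mk.injEq] at q
    obtain ⟨⟨rfl, rfl⟩, ⟨rfl, rfl⟩, rfl⟩ := q
    exact (DReads.cons (.succ _ (.virtual_zero _ _ _)) (.cons (.virtual_zero _ _ _)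
      (.cons (.succ _ (.virtual_zero _ _ _)) (.nil _)))).matches (.refl _) (.refl _)
  · obtain ⟨d'', e', y', z', a₂, b₂, n, q, rfl, rfl, rfl, rfl⟩ := h₃.crossing_inv hc
    simp only [List.cons.injEq, Prod.mk.injEq] at q
    obtain ⟨⟨rfl, rfl⟩, ⟨rfl, rfl⟩, rfl⟩ := q
    exact (DReads.cons (.succ _ (.crossing_zero hc _ _ _ _ _ _ _)) (.cons (.virtual_zero _ _ _)
      (.cons (.succ _ (.virtual_zero _ _ _)) (.nil _)))).matches (.refl _) (.refl _)

theorem Sound.bar_virtual :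
    Sound [⟨1, .bar⟩, ⟨0, .crossing .virtual⟩] [⟨0, .crossing .virtual⟩, ⟨0, .bar⟩] := by
  intro r r' F w ℓ h hF hd
  obtain ⟨_, _, _, _, _, _, _, h₁, k1, rfl, rfl, rfl⟩ := h.cons_inv
  obtain ⟨_, _, _, _, _, _, _, h₂, k2, rfl, rfl, rfl⟩ := k1.cons_inv
  obtain ⟨rfl, rfl, rfl, rfl⟩ := k2.nil_inv
  obtain ⟨x', y, z, j₁, rfl, rfl⟩ := SReads.succ_iff.1 h₁
  obtain ⟨d, a, a', n, rfl, rfl, rfl, rfl, rfl⟩ := j₁.bar_inv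
  obtain ⟨d', e, y', b, n', q, rfl, rfl, rfl, rfl⟩ := h₂.virtual_inv
  simp only [List.cons.injEq, Prod.mk.injEq] at q
  obtain ⟨rfl, ⟨rfl, rfl⟩, rfl⟩ := q
  exact (DReads.cons (.virtual_zero _ _ _) (.cons (.bar_zero _ _ _ _) (.nil _))).matches
    (.refl _) (.refl _)

theorem Sound.bar_bar : Sound [⟨0, .bar⟩, ⟨0, .bar⟩] [] := by
  intro r r' F w ℓ h hF hd
  obtain ⟨_, _, _, _, _, _, _, h₁, k1, rfl, rfl, rfl⟩ := h.cons_inv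
  obtain ⟨_, _, _, _, _, _, _, h₂, k2, rfl, rfl, rfl⟩ := k1.cons_inv
  obtain ⟨rfl, rfl, rfl, rfl⟩ := k2.nil_inv
  obtain ⟨d, a, a₁, n, rfl, rfl, rfl, rfl, rfl⟩ := h₁.bar_inv
  obtain ⟨d', a', a₂, n', q, rfl, rfl, rfl, rfl⟩ := h₂.bar_inv
  simp only [List.cons.injEq, Prod.mk.injEq] at q
  obtain ⟨⟨rfl, rfl⟩, rfl⟩ := q
  have hn : a₁ ≠ a₂ := by simpa using hF
  have hR := DReads.cut [] n d a a₁ (.cut [] n d a₁ a₂ (.nil _))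
  refine hR.matches_local (.refl _) [lk d a₁ a₂] [lk d a a₁] (.swap _ _ _) (.swap _ _ _) ?_ ?_
  · simp only [List.forall_mem_cons]
    exact ⟨lk_mem (by simp) (by simp), by simp⟩
  · cases d with
    | true => exact Code.Local.bar_bar (by simpa using hn)
    | false =>
      exact (Code.Local.bar_bar (a₁ := a₂) (a₂ := a₁) (by simpa using hn.symm)).perm_left
        (.swap _ _ _) (by simpa [Letter.names] using hn.symm)

/-- The twist is read from the right-hand side, which has more letters. -/
theorem Sound.twist (c : Crossing) (hc : c ≠ .virtual) :
    Sound [⟨1, .bar⟩, ⟨0, .bar⟩, ⟨0, .crossing c⟩, ⟨0, .bar⟩, ⟨1, .bar⟩]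
      [⟨0, .crossing .virtual⟩, ⟨0, .crossing c⟩, ⟨0, .crossing .virtual⟩] := by
  intro r r' F w ℓ h hF hd
  obtain ⟨_, _, _, _, _, _, _, h₁, k1, rfl, rfl, rfl⟩ := h.cons_inv
  obtain ⟨_, _, _, _, _, _, _, h₂, k2, rfl, rfl, rfl⟩ := k1.cons_inv
  obtain ⟨_, _, _, _, _, _, _, h₃, k3, rfl, rfl, rfl⟩ := k2.cons_inv
  obtain ⟨_, _, _, _, _, _, _, h₄, k4, rfl, rfl, rfl⟩ := k3.cons_inv
  obtain ⟨_, _, _, _, _, _, _, h₅, k5, rfl, rfl, rfl⟩ := k4.cons_inv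
  obtain ⟨rfl, rfl, rfl, rfl⟩ := k5.nil_inv
  obtain ⟨x', y, z, j₁, rfl, rfl⟩ := SReads.succ_iff.1 h₁
  obtain ⟨e, b, b₁, n, rfl, rfl, rfl, rfl, rfl⟩ := j₁.bar_inv
  obtain ⟨d, a, a₁, n', q, rfl, rfl, rfl, rfl⟩ := h₂.bar_inv
  simp only [List.cons.injEq] at q
  obtain ⟨rfl, rfl⟩ := q
  obtain ⟨d', e', a', b', a₂, b₂, n', q, rfl, rfl, rfl, rfl⟩ := h₃.crossing_inv hc
  simp only [List.cons.injEq, Prod.mk.injEq] at q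
  obtain ⟨⟨rfl, rfl⟩, ⟨rfl, rfl⟩, rfl⟩ := q
  obtain ⟨e', b', b₃, n', q, rfl, rfl, rfl, rfl⟩ := h₄.bar_inv
  simp only [List.cons.injEq, Prod.mk.injEq] at q
  obtain ⟨⟨rfl, rfl⟩, rfl⟩ := q
  obtain ⟨x, y, z, j₅, q, rfl⟩ := SReads.succ_iff.1 h₅
  obtain ⟨d', a', a₃, n', rfl, rfl, rfl, rfl, rfl⟩ := j₅.bar_inv
  simp only [List.cons.injEq, Prod.mk.injEq] at q
  obtain ⟨rfl, ⟨rfl, rfl⟩, rfl⟩ := q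
  have hR := DReads.cut [] ((e, b) :: n) d a a₁ (.cut [(d, a₁)] n e b b₁
    (.cons (.virtual_zero (d, a₁) (e, b₁) n) (.cons (.crossing_zero hc e d b₁ a₁ b₂ a₂ n)
      (.cons (.virtual_zero (d, a₂) (e, b₂) n) (.cut [] ((d, a₂) :: n) e b₂ b₃
        (.cut [(e, b₃)] n d a₂ a₃ (.nil _)))))))
  refine hR.matches_local ?_ [lk d a₁ a₂, lk d a₂ a₃, lk e b₁ b₂, lk e b₂ b₃]
    [lk d a a₁, lk e b b₁] ?_ ?_ ?_ (Code.Local.twist_lk hc d e ?_)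
  · exact perm_of_count fun x => by
      simp only [List.count_append, List.count_cons, List.count_nil]; omega
  · exact perm_of_count fun x => by
      simp only [List.count_append, List.count_cons, List.count_nil]; omega
  · exact perm_of_count fun x => by
      simp only [List.count_append, List.count_cons, List.count_nil]; omega
  · simp only [List.forall_mem_cons]
    exact ⟨lk_mem (by simp) (by simp), lk_mem (by simp) (by simp), lk_mem (by simp) (by simp),
      lk_mem (by simp) (by simp), by simp⟩
  · simp at hF ⊢
    grind

theorem Sound.up_iter {f : ℕ → List Slice} {g : ℕ → List Slice} (h : Sound (f 0) (g 0))
    (hf : ∀ i, f (i + 1) = (f i).map Slice.up) (hg : ∀ i, g (i + 1) = (g i).map Slice.up)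
    (hne : f 0 ≠ []) (i : ℕ) : Sound (f i) (g i) := by
  have key : Sound (f i) (g i) ∧ f i ≠ [] := by
    induction i with
    | zero => exact ⟨h, hne⟩
    | succ i ih =>
      rw [hf, hg]
      exact ⟨ih.1.up ih.2, by simpa using ih.2⟩
  exact key.1

/-- Soundness needs only one direction, since the resulting relation between diagrams is symmetric.
In it the side with more names is read first and cuts make up for names missing on the other side.
For the twist this is the right-hand side, which is recognized by its five slices. -/
theorem Move.sound {L R : List Slice} (h : Move L R) : L ≠ [] ∧ Sound L R ∨ R.length = 5 ∧ Sound
    R L := by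
  cases h with
  | isotopy_heights P Q i d => exact .inl ⟨by simp, .heights P Q i d⟩
  | isotopy_zigzag_left i d =>
    refine .inl ⟨by simp, ?_⟩
    exact Sound.up_iter (f := fun i => [⟨i, .maximum d⟩, ⟨i + 1, .minimum⟩])
      (g := fun _ => []) (.zigzag_left d) (fun _ => rfl) (fun _ => rfl) (by simp) i
  | isotopy_zigzag_right i d =>
    refine .inl ⟨by simp, ?_⟩
    exact Sound.up_iter (f := fun i => [⟨i + 1, .maximum d⟩, ⟨i, .minimum⟩])
      (g := fun _ => []) (.zigzag_right d) (fun _ => rfl) (fun _ => rfl) (by simp) i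
  | isotopy_crossing_maximum i d c =>
    refine .inl ⟨by simp, ?_⟩
    exact Sound.up_iter (f := fun i => [⟨i + 1, .maximum d⟩, ⟨i, .crossing c⟩])
      (g := fun i => [⟨i, .maximum d⟩, ⟨i + 1, .crossing c.flip⟩])
      (.crossing_maximum d c) (fun _ => rfl) (fun _ => rfl) (by simp) i
  | isotopy_crossing_minimum i c =>
    refine .inl ⟨by simp, ?_⟩
    exact Sound.up_iter (f := fun i => [⟨i, .crossing c⟩, ⟨i + 1, .minimum⟩])
      (g := fun i => [⟨i + 1, .crossing c.flip⟩, ⟨i, .minimum⟩])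
      (.crossing_minimum c) (fun _ => rfl) (fun _ => rfl) (by simp) i
  | isotopy_bar_maximum i d =>
    refine .inl ⟨by simp, ?_⟩
    exact Sound.up_iter (f := fun i => [⟨i, .maximum d⟩, ⟨i, .bar⟩])
      (g := fun i => [⟨i, .maximum d⟩, ⟨i + 1, .bar⟩])
      (.bar_maximum d) (fun _ => rfl) (fun _ => rfl) (by simp) i
  | isotopy_bar_minimum i =>
    refine .inl ⟨by simp, ?_⟩
    exact Sound.up_iter (f := fun i => [⟨i, .bar⟩, ⟨i, .minimum⟩])
      (g := fun i => [⟨i + 1, .bar⟩, ⟨i, .minimum⟩])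
      .bar_minimum (fun _ => rfl) (fun _ => rfl) (by simp) i
  | kink i d c hc =>
    refine .inl ⟨by simp, ?_⟩
    exact Sound.up_iter
      (f := fun i => [⟨i + 1, .maximum d⟩, ⟨i, .crossing c⟩, ⟨i + 1, .minimum⟩])
      (g := fun _ => []) (.kink d c hc) (fun _ => rfl) (fun _ => rfl) (by simp) i
  | bigon i c hc =>
    refine .inl ⟨by simp, ?_⟩
    exact Sound.up_iter (f := fun i => [⟨i, .crossing c⟩, ⟨i, .crossing c.flip⟩])
      (g := fun _ => []) (.bigon c hc) (fun _ => rfl) (fun _ => rfl) (by simp) i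
  | slide_real i m c hm hc =>
    refine .inl ⟨by simp, ?_⟩
    exact Sound.up_iter
      (f := fun i => [⟨i, .crossing m⟩, ⟨i + 1, .crossing m⟩, ⟨i, .crossing c⟩])
      (g := fun i => [⟨i + 1, .crossing c⟩, ⟨i, .crossing m⟩, ⟨i + 1, .crossing m⟩])
      (.slide_real m c hm hc) (fun _ => rfl) (fun _ => rfl) (by simp) i
  | slide_virtual i c =>
    refine .inl ⟨by simp, ?_⟩
    exact Sound.up_iter
      (f := fun i => [⟨i, .crossing .virtual⟩, ⟨i + 1, .crossing .virtual⟩, ⟨i, .crossing c⟩])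
      (g := fun i => [⟨i + 1, .crossing c⟩, ⟨i, .crossing .virtual⟩, ⟨i + 1, .crossing .virtual⟩])
      (.slide_virtual c) (fun _ => rfl) (fun _ => rfl) (by simp) i
  | real_singular i c hc =>
    refine .inl ⟨by simp, ?_⟩
    exact Sound.up_iter (f := fun i => [⟨i, .crossing c⟩, ⟨i, .crossing .singular⟩])
      (g := fun i => [⟨i, .crossing .singular⟩, ⟨i, .crossing c⟩])
      (.real_singular c hc) (fun _ => rfl) (fun _ => rfl) (by simp) i
  | bar_virtual i =>
    refine .inl ⟨by simp, ?_⟩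
    exact Sound.up_iter (f := fun i => [⟨i + 1, .bar⟩, ⟨i, .crossing .virtual⟩])
      (g := fun i => [⟨i, .crossing .virtual⟩, ⟨i, .bar⟩])
      .bar_virtual (fun _ => rfl) (fun _ => rfl) (by simp) i
  | bar_bar i =>
    refine .inl ⟨by simp, ?_⟩
    exact Sound.up_iter (f := fun i => [⟨i, .bar⟩, ⟨i, .bar⟩])
      (g := fun _ => []) .bar_bar (fun _ => rfl) (fun _ => rfl) (by simp) i
  | twist i c hc =>
    refine .inr ⟨rfl, ?_⟩
    exact Sound.up_iter
      (f := fun i => [⟨i + 1, .bar⟩, ⟨i, .bar⟩, ⟨i, .crossing c⟩, ⟨i, .bar⟩, ⟨i + 1, .bar⟩])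
      (g := fun i => [⟨i, .crossing .virtual⟩, ⟨i, .crossing c⟩, ⟨i, .crossing .virtual⟩])
      (.twist c hc) (fun _ => rfl) (fun _ => rfl) (by simp) i

end STV

namespace STV

/-! ### Reading closures -/

theorem Gen.cases {n : ℕ} (g : Gen n) :
    (∃ c i h, g.slice = ⟨i, .crossing c⟩ ∧ braid (FreeMonoid.of g) = cr c i h) ∨
      ∃ i h, g.slice = ⟨i, .bar⟩ ∧ braid (FreeMonoid.of g) = STV.bar i h := by
  cases g with
  | sigma e i h => cases e; exacts [.inl ⟨.backslash, i, h, rfl, rfl⟩, .inl ⟨.slash, i, h, rfl,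
      rfl⟩]
  | virt i h => exact .inl ⟨.virtual, i, h, rfl, rfl⟩
  | sing i h => exact .inl ⟨.singular, i, h, rfl, rfl⟩
  | bar i h => exact .inr ⟨i, h, rfl, rfl⟩

/-- A row of strands with the same direction. -/
def Row.const (d : Bool) (z : List ℕ) : Row := z.map (Prod.mk d)

theorem Row.const_append (d : Bool) (y z : List ℕ) :
    Row.const d (y ++ z) = Row.const d y ++ Row.const d z := List.map_append

theorem Row.const_cons (d : Bool) (a : ℕ) (z : List ℕ) :
    Row.const d (a :: z) = (d, a) :: Row.const d z := rfl

theorem Row.length_const (d : Bool) (z : List ℕ) : (Row.const d z).length = z.length :=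
  List.length_map _

theorem DReads.maxima (n : ℕ) : DReads (maxima n) [] (Row.const true (List.range n) ++
    Row.const false (List.range n).reverse) (List.range n) [] [] 0 := by
  induction n with
  | zero => exact .nil _
  | succ n ih =>
    have h := SReads.intro (Row.const true (List.range n))
      (Row.const false (List.range n).reverse)
      (i := n) (by simp [Row.length_const]) (.maximum true n)
    have := ih.append (.cons (by simpa using h) (.nil _))
    rw [STV.maxima, List.range_succ, List.map_append, List.reverse_append, Row.const_append,
      Row.const_append]
    simpa [Row.const, STV.maxima] using this

theorem DReads.minima {n : ℕ} {z y : List ℕ} (hz : z.length = n) (hy : y.length = n) :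
    DReads (minima n) (Row.const true z ++ Row.const false y.reverse) [] [] [] (z.zip y).reverse
      0 := by
  induction n generalizing z y with
  | zero =>
    obtain rfl := List.length_eq_zero_iff.1 hz
    obtain rfl := List.length_eq_zero_iff.1 hy
    exact .nil _
  | succ n ih =>
    obtain ⟨z, a, rfl⟩ := (List.eq_nil_or_concat' _).resolve_left
        (List.ne_nil_of_length_eq_add_one hz)
    obtain ⟨y, b, rfl⟩ := (List.eq_nil_or_concat' _).resolve_left
        (List.ne_nil_of_length_eq_add_one hy)
    simp only [List.length_append, List.length_singleton, Nat.add_right_cancel_iff] at hz hy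
    have h := SReads.intro (Row.const true z) (Row.const false y.reverse) (i := n)
      (by simp [Row.length_const, hz]) (.minimum true a b)
    rw [STV.minima, List.range_succ, List.reverse_append, List.map_append]
    rw [List.zip_append (hz.trans hy.symm), List.reverse_append, List.reverse_append,
      Row.const_append, Row.const_append]
    have := DReads.cons (by simpa using h) (ih hz hy)
    simpa [Row.const, lk, STV.minima] using this

/-- The word `w`, read with new names after each letter and down to the row `z`, is equivalent to
the word `w₁`, read down to the row `z₁`. -/
def Reduces (F : List ℕ) (w : List Letter) (ℓ : List (ℕ × ℕ)) (z : List ℕ) (w₁ : List Letter)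
    (z₁ : List ℕ) : Prop :=
  ∀ ⦃w₀ Λ x⦄, Code.WF (w₀ ++ w, Λ ++ ℓ ++ z.zip x) → x.length = z.length →
    (∀ a ∈ F, a ∉ names w₀ ∧ a ∉ Code.linkNames Λ ∧ a ∉ x) →
    Code.Sim (w₀ ++ w, Λ ++ ℓ ++ z.zip x) (w₀ ++ w₁, Λ ++ z₁.zip x)

theorem mapLinks_zip (f : ℕ → ℕ) {z x : List ℕ} (hx : x.map f = x) :
    mapLinks f (z.zip x) = (z.map f).zip x := by
  conv_rhs => rw [← hx]
  exact List.zip_map.symm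

variable {F : List ℕ} {w w₁ : List Letter} {ℓ : List (ℕ × ℕ)} {z z₁ y : List ℕ} {n : ℕ}
  {α : STVB n} {a s : ℕ}

theorem names_subset_of_good {x : List ℕ} (h : ∀ l ∈ w, l.Good x) : names w ⊆ x := by
  intro a ha
  obtain ⟨l, hl, ha⟩ := List.mem_flatMap.1 ha
  have := h l hl
  cases l with
  | X c b d =>
    simp only [Letter.names, List.mem_cons, List.not_mem_nil, or_false] at ha
    rcases ha with rfl | rfl
    exacts [this.2.2.1, this.2.2.2]
  | B b =>
    simp only [Letter.names, List.mem_cons, List.not_mem_nil, or_false] at ha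
    exact ha ▸ this

/-- A further new name `s` below `a` is merged into `a`. The condition on `w₁` says that all letters
of the rest that concern this strand use the new name. -/
theorem Reduces.cut (h : Reduces F w ℓ z w₁ z₁) (hw : a ∉ names w₁) (has : a ≠ s) (hF : a ∉ F)
    (hs : s ∉ F) :
    Reduces (s :: F) w ((a, s) :: ℓ) z (w₁.map (Letter.map (ren a s))) (z₁.map (ren a s)) := by
  intro w₀ Λ x hwf hx hd
  have p : (Λ ++ (a, s) :: ℓ ++ z.zip x).Perm ((a, s) :: Λ ++ ℓ ++ z.zip x) := by
    simp only [List.append_assoc, List.cons_append]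
    exact List.perm_middle
  have hs' := hd s (by simp)
  have k := h (hwf.of_perm p) hx fun b hb => by
    obtain ⟨h₁, h₂, h₃⟩ := hd b (by simp [hb])
    refine ⟨h₁, ?_, h₃⟩
    have := mem_linkNames_lk (d := true) (a := a) (b := s) (x := b) Λ
    simp only [lk, if_true] at this
    rw [this]
    rintro (rfl | rfl | h)
    exacts [hF hb, hs hb, h₂ h]
  refine (hwf.sim_perm p).trans (k.trans ?_)
  have := Code.WF.sim_cut (ℓ := Λ ++ z₁.zip x) k.2.1 has hs'.1 hw
  rwa [mapLinks, List.map_append, ← mapLinks, ← mapLinks, mapLinks_ren hs'.2.1,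
    mapLinks_zip _ (map_ren_names hs'.2.2)] at this

theorem Reduces.cons {l : Letter} (h : Reduces F w ℓ z w₁ z₁) (hl : ∀ a ∈ F, a ∉ l.names) :
    Reduces F (l :: w) ℓ z (l :: w₁) z₁ := by
  intro w₀ Λ x hwf hx hd
  rw [List.append_cons] at hwf ⊢
  rw [List.append_cons w₀ l w₁]
  refine h hwf hx fun a ha => ⟨?_, (hd a ha).2⟩
  rw [STV.names_append, List.mem_append, not_or]
  exact ⟨(hd a ha).1, by simpa using hl a ha⟩

theorem Reduces.cut_reads (h : Reduces F w ℓ z w₁ z₁) (hr : Reads α y w₁ z₁) (hy : y.Nodup)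
    (ha : a ∉ y) (has : a ≠ s) (hF : a ∉ F) (hs : s ∉ F) :
    Reduces (s :: F) w ((a, s) :: ℓ) z (w₁.map (Letter.map (ren a s))) (z₁.map (ren a s)) :=
  h.cut (fun e => ha (names_subset_of_good (hr.good hy) e)) has hF hs

/-- The diagram renames a strand at each letter while the reading of the braid keeps its name. By
induction on the letters below, the rest is read from the row with the new names; then the links
above these names are contracted. -/
theorem DReads.exists_reduces (g : List (Gen n)) {z : List ℕ} (hz : z.length = n) (hn : z.Nodup)
    (T : Row) (A : List ℕ) : ∃ z' F w ℓ w₁ z₁,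
      DReads (g.map Gen.slice) (Row.const true z ++ T) (Row.const true z' ++ T) F w ℓ 0 ∧
      F.Nodup ∧ (∀ a ∈ F, a ∉ A) ∧ z'.length = n ∧ Reads (braid (FreeMonoid.ofList g)) z w₁ z₁ ∧
      Reduces F w ℓ z' w₁ z₁ := by
  induction g generalizing z A with
  | nil =>
    exact ⟨z, [], [], [], [], z, .nil _, by simp, by simp, hz, .one _ hz, fun w₀ Λ x hwf _ _ => by
      simpa using hwf.sim⟩
  | cons g gs ih =>
    have hb : braid (FreeMonoid.ofList (g :: gs)) =
      braid (FreeMonoid.of g) * braid (FreeMonoid.ofList gs) := rfl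
    rw [hb, List.map_cons]
    rcases g.cases with ⟨c, i, h, hg, e⟩ | ⟨i, h, hg, e⟩
    · rw [hg, e]
      obtain ⟨l, a, b, r, rfl, hl⟩ := Reads.exists_split (hz ▸ h)
      have hL : (Row.const true l).length = i := by rw [Row.length_const, hl]
      by_cases hc : c = .virtual
      · subst hc
        obtain ⟨z', F, w, ℓ, w₁, z₁, h₁, h₂, h₃, h₄, h₅, h₆⟩ := ih (z := l ++ b :: a :: r)
          (by simpa using hz) (((List.Perm.swap a b r).append_left l).nodup_iff.2 hn) A
        have hv := SReads.intro (Row.const true l) (Row.const true r ++ T) hL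
          (.virtual (true, a) (true, b))
        simp only [Row.const_append, Row.const_cons, List.append_assoc, List.cons_append,
          List.nil_append] at hv h₁ ⊢
        subst hl
        exact ⟨z', _, _, _, w₁, z₁, .cons hv h₁, h₂, h₃, h₄, .virt h h₅, h₆⟩
      -- The new names avoid the entire present row, and the names used further below will avoid all
      -- four names at this crossing.
      · obtain ⟨a', ha⟩ := exists_fresh (A ++ (l ++ a :: b :: r))
        obtain ⟨b', hb⟩ := exists_fresh (a' :: A ++ (l ++ a :: b :: r))
        simp only [List.mem_append, List.mem_cons, not_or] at ha hb
        rw [List.nodup_append] at hn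
        simp only [List.nodup_cons, List.mem_cons, not_or] at hn
        obtain ⟨z', F, w, ℓ, w₁, z₁, h₁, h₂, h₃, h₄, h₅, h₆⟩ := ih (z := l ++ b' :: a' :: r)
          (by simpa using hz) (by
            rw [List.nodup_append]
            simp only [List.nodup_cons, List.mem_cons, not_or]
            grind) (A ++ [a, b, a', b'])
        have hv := SReads.intro (Row.const true l) (Row.const true r ++ T) hL
          (.crossing c hc true true a b a' b')
        simp only [Row.const_append, Row.const_cons, List.append_assoc, List.cons_append,
          List.nil_append] at hv h₁ ⊢
        subst hl
        have hr : Reads (cr c l.length h * braid (FreeMonoid.ofList gs)) (l ++ a' :: b' :: r)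
          (.X c a' b' :: w₁) z₁ := .cross hc h h₅
        have hr₁ := hr.map (ren b b')
        have hr₂ := hr₁.map (ren a a')
        have e₁ : (l ++ a' :: b' :: r).map (ren b b') = l ++ a' :: b :: r := by
          rw [List.map_append, List.map_cons, List.map_cons, ren_self,
            map_ren_names (by grind), map_ren_names (by grind), ren_of_ne (by grind)]
        have e₂ : (l ++ a' :: b :: r).map (ren a a') = l ++ a :: b :: r := by
          rw [List.map_append, List.map_cons, List.map_cons, ren_self,
            map_ren_names (by grind), map_ren_names (by grind), ren_of_ne (by grind)]
        rw [e₁] at hr₁ hr₂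
        rw [e₂] at hr₂
        have hF : ∀ x ∈ F, x ≠ a ∧ x ≠ b ∧ x ≠ a' ∧ x ≠ b' := fun x hx => by
          have := h₃ x hx
          simp at this
          tauto
        -- The new names are merged one after the other, first on the strand from the right; the row
        -- in between is `l ++ a' :: b :: r`.
        have k₁ := (h₆.cons (l := .X c a' b') fun x hx => by
          have := hF x hx
          simp [Letter.names]
          tauto).cut_reads hr (a := b) (s := b') (by
            rw [List.nodup_append]
            simp only [List.nodup_cons, List.mem_cons, not_or]
            grind) (by simp only [List.mem_append, List.mem_cons, not_or]; grind) (by grind)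
            (fun hx => (hF b hx).2.1 rfl) (fun hx => (hF b' hx).2.2.2 rfl)
        have k₂ := k₁.cut_reads hr₁ (a := a) (s := a') (by
            rw [List.nodup_append]
            simp only [List.nodup_cons, List.mem_cons, not_or]
            grind)
            (by simp only [List.mem_append, List.mem_cons, not_or]; grind) (by grind)
            (by grind) (by grind)
        refine ⟨z', _, _, _, _, _, .cons hv h₁, ?_, ?_, h₄, hr₂, k₂⟩
        · simp only [List.cons_append, List.nil_append, List.nodup_cons, List.mem_cons, not_or]
          grind
        · simp only [List.cons_append, List.nil_append, List.forall_mem_cons]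
          exact ⟨ha.1, hb.1.2, fun x hx => fun hx' => h₃ x hx (by simp [hx'])⟩
    · rw [hg, e]
      obtain ⟨l, a, r, rfl, hl⟩ := Reads.exists_split_one (hz ▸ h)
      have hL : (Row.const true l).length = i := by rw [Row.length_const, hl]
      obtain ⟨a', ha⟩ := exists_fresh (A ++ (l ++ a :: r))
      simp only [List.mem_append, List.mem_cons, not_or] at ha
      rw [List.nodup_append] at hn
      simp only [List.nodup_cons, List.mem_cons] at hn
      have hn' : (l ++ a' :: r).Nodup := by
        rw [List.nodup_append]
        simp only [List.nodup_cons, List.mem_cons]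
        grind
      obtain ⟨z', F, w, ℓ, w₁, z₁, h₁, h₂, h₃, h₄, h₅, h₆⟩ := ih (z := l ++ a' :: r)
        (by simpa using hz) hn' (A ++ [a, a'])
      have hv := SReads.intro (Row.const true l) (Row.const true r ++ T) hL (.bar true a a')
      simp only [Row.const_append, Row.const_cons, List.append_assoc, List.cons_append,
        List.nil_append] at hv h₁ ⊢
      subst hl
      have hr : Reads (STV.bar l.length h * braid (FreeMonoid.ofList gs)) (l ++ a' :: r)
        (.B a' :: w₁) z₁ := .bar h h₅
      have hr₁ := hr.map (ren a a')
      rw [List.map_append, List.map_cons, ren_self, map_ren_names (by grind),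
        map_ren_names (by grind)] at hr₁
      have hF : ∀ x ∈ F, x ≠ a ∧ x ≠ a' := fun x hx => by
        have := h₃ x hx
        simp at this
        tauto
      have k₁ := (h₆.cons (l := .B a') fun x hx => by
        have := hF x hx
        simp [Letter.names]
        tauto).cut_reads hr (a := a) (s := a') hn'
          (by simp only [List.mem_append, List.mem_cons, not_or]; grind) (by grind)
          (fun hx => (hF a hx).1 rfl) (fun hx => (hF a' hx).2 rfl)
      refine ⟨z', _, _, _, _, _, .cons hv h₁, ?_, ?_, h₄, hr₁, k₁⟩
      · simp only [List.cons_append, List.nil_append, List.nodup_cons]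
        grind
      · simp only [List.cons_append, List.nil_append, List.forall_mem_cons]
        exact ⟨ha.1, fun x hx => fun hx' => h₃ x hx (by simp [hx'])⟩

theorem closure_ne_nil (u : Word (n + 1)) : (closure u).1 ≠ [] := by
  simp [closure, maxima]

/-- The closure of a braid has a reading that is equivalent to a code of the braid. -/
theorem closure_reads (u : Word (n + 1)) : ∃ F w ℓ C, DReads (closure u).1 [] [] F w ℓ 0 ∧
    F.Nodup ∧ Code.Sim (w, ℓ) C ∧ C.Rep ⟨n, braid u⟩ := by
  obtain ⟨z', F, w, ℓ, w₁, z₁, h₁, h₂, h₃, h₄, h₅, h₆⟩ := DReads.exists_reduces u.toList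
    (z := List.range (n + 1)) List.length_range List.nodup_range
    (Row.const false (List.range (n + 1)).reverse) (List.range (n + 1))
  have hD := ((DReads.maxima (n + 1)).append h₁).append (DReads.minima h₄ List.length_range)
  have hF : (List.range (n + 1) ++ F ++ []).Nodup := by
    rw [List.append_nil]
    exact List.nodup_append.2 ⟨List.nodup_range, h₂, fun a ha b hb e => h₃ b hb (e ▸ ha)⟩
  have hD' : DReads (closure u).1 [] [] _ _ _ _ := hD
  have hwf := hD'.wf hF (closure_ne_nil u)
  simp only [List.nil_append, List.append_nil] at hwf
  have p : (ℓ ++ (z'.zip (List.range (n + 1))).reverse).Perm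
      ([] ++ ℓ ++ z'.zip (List.range (n + 1))) := (List.reverse_perm _).append_left _
  have s := h₆ (w₀ := []) (hwf.of_perm p) (by simp [h₄]) fun a ha => by
    refine ⟨by simp, by simp [Code.linkNames], h₃ a ha⟩
  have hl : z₁.length = (List.range (n + 1)).length := by
    rw [h₅.perm.length_eq]
  refine ⟨_, _, _, (w₁, z₁.zip (List.range (n + 1))), hD', hF, ?_, ?_⟩
  · simp only [List.nil_append, List.append_nil] at s p ⊢
    exact (hwf.sim_perm p).trans s
  · simp only [Code.Rep]
    rw [List.map_snd_zip hl.ge, List.map_fst_zip hl.le]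
    exact h₅

end STV

/-! ### Invariance of the code under isotopy. -/

namespace STV

/-- All readings of the two diagrams are equivalent. -/
def LinkDiagram.Equi (D E : LinkDiagram) : Prop :=
  (D.1 ≠ [] ↔ E.1 ≠ []) ∧ ∀ ⦃F w ℓ k F' w' ℓ' k'⦄, D.1 ≠ [] → DReads D.1 [] [] F w ℓ k →
    DReads E.1 [] [] F' w' ℓ' k' → F.Nodup → F'.Nodup → Code.Sim (w, ℓ) (w', ℓ')

theorem LinkDiagram.Equi.symm {D E : LinkDiagram} (h : D.Equi E) : E.Equi D :=
  ⟨h.1.symm, fun _ _ _ _ _ _ _ _ n hE hD u v => (h.2 (h.1.2 n) hD hE v u).symm⟩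

theorem LinkDiagram.exists_reads (D : LinkDiagram) :
    ∃ F w ℓ, DReads D.1 [] [] F w ℓ 0 ∧ F.Nodup := by
  obtain ⟨r, F, w, ℓ, h, hr, hF, -⟩ := DReads.exists D.2 (r := []) rfl []
  obtain rfl : r = [] := List.map_eq_nil_iff.1 hr
  exact ⟨F, w, ℓ, h, hF⟩

theorem LinkDiagram.Equi.trans {D E G : LinkDiagram} (h : D.Equi E) (h' : E.Equi G) :
    D.Equi G := by
  refine ⟨h.1.trans h'.1, fun F w ℓ k F' w' ℓ' k' n hD hG u v => ?_⟩
  -- The relation quantifies over all readings, so some reading of the middle diagram has to be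
  -- supplied.
  obtain ⟨F₁, w₁, ℓ₁, hE, hF⟩ := E.exists_reads
  exact (h.2 n hD hE u hF).trans (h'.2 (h.1.1 n) hE hG hF v)

theorem DReads.links_eq_nil {F : List ℕ} {w : List Letter} {ℓ : List (ℕ × ℕ)} {k : ℕ} {r : Row}
    (h : DReads [] [] r F w ℓ k) : ℓ = [] := by
  generalize hD : ([] : List Slice) = D at h
  generalize hr : ([] : Row) = s at h
  cases h with
  | nil => rfl
  | cons => simp at hD
  | cut => simp at hr

/-- One reading of each diagram is compared through the move, and `DReads.sim` extends this to all
readings. -/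
theorem Sound.equi {A B L R : List Slice} (h : Sound L R) (hL : L ≠ []) {D E : LinkDiagram}
    (hD : D.1 = A ++ L ++ B) (hE : E.1 = A ++ R ++ B) : D.Equi E := by
  have hne : A ++ L ++ B ≠ [] := by simp [hL]
  have hR : ∃ F w ℓ, DReads D.1 [] [] F w ℓ 0 ∧ F.Nodup := D.exists_reads
  rw [hD] at hR
  obtain ⟨F₁, w₁, ℓ₁, h₁, hF₁⟩ := hR
  obtain ⟨F₂, w₂, ℓ₂, k₂, h₂, hF₂, e⟩ := h.sim h₁ hF₁ hne
  -- The code of the new diagram is well formed and so has a link; the empty diagram has none.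
  have hne' : A ++ R ++ B ≠ [] := fun n => e.2.1.ne (by rw [n] at h₂; exact h₂.links_eq_nil)
  refine ⟨by simp only [hD, hE, hne, hne', ne_eq, not_false_iff], ?_⟩
  intro F w ℓ k F' w' ℓ' k' _ i j u v
  rw [hD] at i
  rw [hE] at j
  exact (i.sim u hne h₁ hF₁).trans (e.trans (h₂.sim hF₂ hne' j v))

theorem LinkDiagram.Isotopic.equi {D E : LinkDiagram} (h : D.Isotopic E) : D.Equi E := by
  induction h with
  | rel D E h =>
    obtain ⟨A, L, R, B, hm, hD, hE⟩ := h
    rcases hm.sound with ⟨hL, hs⟩ | ⟨hR, hs⟩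
    exacts [hs.equi hL hD hE, (hs.equi (List.ne_nil_of_length_eq_add_one hR) hE hD).symm]
  | refl D => exact ⟨.rfl, fun _ _ _ _ _ _ _ _ n h h' u v => h.sim u n h' v⟩
  | symm D E _ ih => exact ih.symm
  | trans D E G _ _ ih ih' => exact ih.trans ih'

/-- Braids with isotopic closures are equivalent. -/
theorem markovEquiv_of_isotopic {m n : ℕ} {u : Word (m + 1)} {w : Word (n + 1)}
    (h : (closure u).Isotopic (closure w)) : MarkovEquiv ⟨m, braid u⟩ ⟨n, braid w⟩ := by
  obtain ⟨F, v, ℓ, C, h₁, hF, hC, hu⟩ := closure_reads u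
  obtain ⟨F', v', ℓ', C', h₁', hF', hC', hw⟩ := closure_reads w
  have e := h.equi.2 (closure_ne_nil u) h₁ h₁' hF hF'
  exact (hC.symm.trans (e.trans hC')).equiv hu hw

end STV

namespace STV

/-! ## Isotopies of closures -/

/-- `P.Fits t b`: the piece `P` fits between the rows `t` and `b`. -/
inductive Piece.Fits : Piece → List Bool → List Bool → Prop
  | crossing (c : Crossing) (x y : Bool) : Piece.Fits (.crossing c) [x, y] [y, x]
  | bar (x : Bool) : Piece.Fits .bar [x] [x]
  | maximum (d : Bool) : Piece.Fits (.maximum d) [] [d, !d]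
  | minimum (d : Bool) : Piece.Fits .minimum [d, !d] []

variable {P Q : Piece} {i d k : ℕ} {a b t s : List Bool} {c : Crossing} {x y : Bool}

theorem Piece.Fits.length_top (h : P.Fits t s) : t.length = P.top := by cases h <;> rfl

theorem Piece.Fits.length_bot (h : P.Fits t s) : s.length = P.bot := by cases h <;> rfl

theorem passes_iff : Slice.Passes ⟨i, P⟩ a b ↔
    ∃ l t s r, P.Fits t s ∧ l.length = i ∧ a = l ++ (t ++ r) ∧ b = l ++ (s ++ r) := by
  constructor
  · intro h
    cases h with
    | crossing l r c x y => exact ⟨l, _, _, r, .crossing c x y, rfl, rfl, rfl⟩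
    | bar l r x => exact ⟨l, _, _, r, .bar x, rfl, rfl, rfl⟩
    | maximum l r d => exact ⟨l, _, _, r, .maximum d, rfl, rfl, rfl⟩
    | minimum l r d => exact ⟨l, _, _, r, .minimum d, rfl, rfl, rfl⟩
  · rintro ⟨l, t, s, r, h, rfl, rfl, rfl⟩
    cases h with
    | crossing c x y => exact .crossing l r c x y
    | bar x => exact .bar l r x
    | maximum d => exact .maximum l r d
    | minimum d => exact .minimum l r d

theorem passes_succ : Slice.Passes ⟨i + 1, P⟩ a b ↔
    ∃ x a' b', Slice.Passes ⟨i, P⟩ a' b' ∧ a = x :: a' ∧ b = x :: b' := by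
  simp only [passes_iff]
  constructor
  · rintro ⟨l, t, s, r, h, hl, rfl, rfl⟩
    cases l with
    | nil => simp at hl
    | cons x l => exact ⟨x, _, _, ⟨l, t, s, r, h, by simpa using hl, rfl, rfl⟩, rfl, rfl⟩
  · rintro ⟨x, _, _, ⟨l, t, s, r, h, rfl, rfl, rfl⟩, rfl, rfl⟩
    exact ⟨x :: l, t, s, r, h, rfl, rfl, rfl⟩

theorem passes_add {l : List Bool} (hl : l.length = k) :
    Slice.Passes ⟨k + i, P⟩ (l ++ a) b ↔ ∃ b', Slice.Passes ⟨i, P⟩ a b' ∧ b = l ++ b' := by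
  subst hl
  induction l generalizing b with
  | nil => simp
  | cons x l ih =>
    rw [List.length_cons, Nat.add_right_comm, passes_succ]
    constructor
    · rintro ⟨x, _, b, h, e, rfl⟩
      simp only [List.cons_append, List.cons.injEq] at e
      obtain ⟨rfl, rfl⟩ := e
      obtain ⟨b, h', rfl⟩ := ih.1 h
      exact ⟨b, h', rfl⟩
    · rintro ⟨b, h, rfl⟩
      exact ⟨x, _, _, ih.2 ⟨b, h, rfl⟩, rfl, rfl⟩

theorem runs_nil : Runs [] a b ↔ a = b :=
  ⟨fun h => by cases h; rfl, fun h => h ▸ .nil _⟩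

theorem runs_cons {S : Slice} {D : List Slice} :
    Runs (S :: D) a b ↔ ∃ m, S.Passes a m ∧ Runs D m b :=
  ⟨fun h => by cases h with | cons p h => exact ⟨_, p, h⟩, fun ⟨_, p, h⟩ => .cons p h⟩

theorem runs_append {D E : List Slice} :
    Runs (D ++ E) a b ↔ ∃ m, Runs D a m ∧ Runs E m b := by
  constructor
  · intro h
    induction D generalizing a with
    | nil => exact ⟨a, .nil _, h⟩
    | cons S D ih =>
      cases h with
      | cons p h =>
        obtain ⟨m, h₁, h₂⟩ := ih h
        exact ⟨m, .cons p h₁, h₂⟩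
  · rintro ⟨m, h, h'⟩
    exact h.append h'

theorem runs_heights : Runs [⟨i, P⟩, ⟨i + P.bot + d, Q⟩] a b ↔
    Runs [⟨i + P.top + d, Q⟩, ⟨i, P⟩] a b := by
  simp only [runs_cons, runs_nil]
  constructor
  · rintro ⟨m, h, _, h', rfl⟩
    obtain ⟨l, t, s, r, hP, rfl, rfl, rfl⟩ := passes_iff.1 h
    rw [Nat.add_assoc, passes_add rfl] at h'
    obtain ⟨_, h', rfl⟩ := h'
    rw [passes_add hP.length_bot] at h'
    obtain ⟨r', h', rfl⟩ := h'
    refine ⟨l ++ (t ++ r'), ?_, _, passes_iff.2 ⟨l, t, s, r', hP, rfl, rfl, rfl⟩, rfl⟩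
    rw [Nat.add_assoc, passes_add rfl]
    exact ⟨_, (passes_add hP.length_top).2 ⟨r', h', rfl⟩, rfl⟩
  · rintro ⟨m, h, _, h', rfl⟩
    obtain ⟨l, t, s, r, hQ, hl, rfl, rfl⟩ := passes_iff.1 h
    obtain ⟨l', t', s', r', hP, hl', e, rfl⟩ := passes_iff.1 h'
    have ht := hP.length_top
    obtain ⟨l₁, rfl⟩ : ∃ l₁, l = l' ++ (t' ++ l₁) := by
      rw [← List.append_assoc l'] at e
      have := List.prefix_of_prefix_length_le (l₁ := l' ++ t') (l₂ := l) ⟨r', e.symm⟩ ⟨s ++ r, rfl⟩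
        (by rw [List.length_append]; omega)
      obtain ⟨l₁, h⟩ := this
      exact ⟨l₁, by rw [← h, List.append_assoc]⟩
    simp only [List.append_assoc, List.append_cancel_left_eq] at e
    subst e
    have hl₁ : l₁.length = d := by simp at hl; omega
    refine ⟨l' ++ (s' ++ (l₁ ++ (t ++ r))), passes_iff.2 ⟨l', t', s', _, hP, hl', by simp, rfl⟩,
      _, ?_, rfl⟩
    rw [Nat.add_assoc, passes_add hl', ]
    exact ⟨_, (passes_add hP.length_bot).2 ⟨_, passes_iff.2 ⟨l₁, t, s, r, hQ, hl₁, rfl, rfl⟩, rfl⟩,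
      rfl⟩

theorem DReads.runs {D : List Slice} {r r' : Row} {F : List ℕ} {w : List Letter}
    {ℓ : List (ℕ × ℕ)} {k : ℕ} (h : DReads D r r' F w ℓ k) : Runs D r.dirs r'.dirs := by
  induction h with
  | nil r => exact .nil _
  | cons h _ ih =>
    refine .cons ?_ ih
    obtain @⟨P, t, b, F, w, ℓ, l, m, i, rfl, h⟩ := h
    rw [passes_iff]
    refine ⟨l.dirs, t.dirs, b.dirs, m.dirs, ?_, List.length_map _, by
      rw [Row.dirs_append, Row.dirs_append, List.append_assoc], by
      rw [Row.dirs_append, Row.dirs_append, List.append_assoc]⟩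
    cases h with
    | virtual x y => exact .crossing _ _ _
    | crossing => exact .crossing _ _ _
    | bar => exact .bar _
    | maximum => exact .maximum _
    | minimum => exact .minimum _
  | cut l r d a a' _ ih => simpa using ih

/-- A reading of `R` certifies that `R` fits between the rows. The names are irrelevant, so all
given strands are called `0` and the new names avoid it. -/
theorem Sound.runs {L R : List Slice} (h : Sound L R) (hL : Runs L a b) : Runs R a b := by
  have hr : Row.dirs (a.map fun d => (d, 0)) = a := by
    rw [Row.dirs, List.map_map]; exact List.map_id a
  obtain ⟨r', F, w, ℓ, h₁, rfl, hF, hA⟩ := DReads.exists hL hr [0]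
  obtain ⟨_, _, _, _, _, _, h₂, -⟩ := h h₁ hF fun x hx hx' => by
    refine hA x hx ?_
    simp [Row.names] at hx' ⊢
    exact hx'.2.symm
  rw [← hr]
  exact h₂.runs

/-- A sequence of local moves each of which is possible whenever its first diagram fits between the
rows above and below. -/
def Derives : List Slice → List Slice → Prop :=
  Relation.ReflTransGen fun D E => ∃ A L R B, (Move L R ∨ Move R L) ∧
    (∀ a b, Runs L a b → Runs R a b) ∧ D = A ++ L ++ B ∧ E = A ++ R ++ B

namespace Derives

variable {D E G A B : List Slice}

theorem refl (D : List Slice) : Derives D D := Relation.ReflTransGen.refl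

theorem trans (h : Derives D E) (h' : Derives E G) : Derives D G := Relation.ReflTransGen.trans h h'

theorem context (A B : List Slice) (h : Derives D E) : Derives (A ++ D ++ B) (A ++ E ++ B) := by
  refine Relation.ReflTransGen.lift (fun D => A ++ D ++ B) ?_ _ _ h
  rintro D E ⟨A', L, R, B', hm, hr, rfl, rfl⟩
  exact ⟨A ++ A', L, R, B' ++ B, hm, hr, by simp, by simp⟩

theorem left (A : List Slice) (h : Derives D E) : Derives (A ++ D) (A ++ E) := by
  simpa using h.context A []

theorem right (B : List Slice) (h : Derives D E) : Derives (D ++ B) (E ++ B) := by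
  simpa using h.context [] B

theorem of_move (h : Move D E) (hr : ∀ a b, Runs D a b → Runs E a b) : Derives D E :=
  .single ⟨[], D, E, [], .inl h, hr, by simp, by simp⟩

theorem of_move_symm (h : Move E D) (hr : ∀ a b, Runs D a b → Runs E a b) : Derives D E :=
  .single ⟨[], D, E, [], .inr h, hr, by simp, by simp⟩

theorem runs (h : Derives D E) (hD : Runs D a b) : Runs E a b := by
  induction h with
  | refl => exact hD
  | tail _ h ih =>
    obtain ⟨A, L, R, B, -, hr, rfl, rfl⟩ := h
    simp only [runs_append] at ih ⊢
    obtain ⟨m, ⟨m', h₁, h₂⟩, h₃⟩ := ih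
    exact ⟨m, ⟨m', h₁, hr _ _ h₂⟩, h₃⟩

/-- The intermediate diagrams have to be link diagrams too; this is ensured by the condition on
`Runs` in every step. -/
theorem isotopic {D E : LinkDiagram} (h : Derives D.1 E.1) : D.Isotopic E := by
  obtain ⟨D, hD⟩ := D
  obtain ⟨E, hE⟩ := E
  simp only at h
  induction h using Relation.ReflTransGen.head_induction_on with
  | refl => exact .refl _
  | @head D G h _ ih =>
    have hG : Runs G [] [] := runs (.single h) hD
    obtain ⟨A, L, R, B, hm, hr, rfl, rfl⟩ := h
    refine .trans _ _ _ ?_ (ih hG)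
    rcases hm with hm | hm
    · exact .rel _ _ ⟨A, L, R, B, hm, rfl, rfl⟩
    · exact .symm _ _ (.rel _ _ ⟨A, R, L, B, hm, rfl, rfl⟩)

theorem heights (P Q : Piece) (i d : ℕ) :
    Derives [⟨i, P⟩, ⟨i + P.bot + d, Q⟩] [⟨i + P.top + d, Q⟩, ⟨i, P⟩] :=
  of_move (.isotopy_heights P Q i d) fun _ _ => runs_heights.1

theorem heights_symm (P Q : Piece) (i d : ℕ) :
    Derives [⟨i + P.top + d, Q⟩, ⟨i, P⟩] [⟨i, P⟩, ⟨i + P.bot + d, Q⟩] :=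
  of_move_symm (.isotopy_heights P Q i d) fun _ _ => runs_heights.2

/-- `Move.sound` gives the fit from left to right for every move except the twist, which the length
excludes. -/
theorem of_sound (h : Move D E) (hE : E.length ≠ 5) : Derives D E := by
  rcases h.sound with ⟨-, hs⟩ | ⟨h₅, -⟩
  exacts [of_move h fun _ _ => hs.runs, absurd h₅ hE]

theorem crossing_maximum (i : ℕ) (d : Bool) (c : Crossing) :
    Derives [⟨i + 1, .maximum d⟩, ⟨i, .crossing c⟩]
      [⟨i, .maximum d⟩, ⟨i + 1, .crossing c.flip⟩] :=
  of_sound (.isotopy_crossing_maximum i d c) (by simp)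

theorem crossing_minimum (i : ℕ) (c : Crossing) :
    Derives [⟨i, .crossing c⟩, ⟨i + 1, .minimum⟩] [⟨i + 1, .crossing c.flip⟩, ⟨i, .minimum⟩] :=
  of_sound (.isotopy_crossing_minimum i c) (by simp)

theorem bar_maximum (i : ℕ) (d : Bool) :
    Derives [⟨i, .maximum d⟩, ⟨i, .bar⟩] [⟨i, .maximum d⟩, ⟨i + 1, .bar⟩] :=
  of_sound (.isotopy_bar_maximum i d) (by simp)

theorem bar_minimum (i : ℕ) :
    Derives [⟨i, .bar⟩, ⟨i, .minimum⟩] [⟨i + 1, .bar⟩, ⟨i, .minimum⟩] :=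
  of_sound (.isotopy_bar_minimum i) (by simp)

theorem kink (i : ℕ) (d : Bool) (c : Crossing) (hc : c ≠ .singular) :
    Derives [⟨i + 1, .maximum d⟩, ⟨i, .crossing c⟩, ⟨i + 1, .minimum⟩] [] :=
  of_sound (.kink i d c hc) (by simp)

theorem bigon (i : ℕ) (c : Crossing) (hc : c ≠ .singular) :
    Derives [⟨i, .crossing c⟩, ⟨i, .crossing c.flip⟩] [] := of_sound (.bigon i c hc) (by simp)

theorem real_singular (i : ℕ) (c : Crossing) (hc : c.Real) :
    Derives [⟨i, .crossing c⟩, ⟨i, .crossing .singular⟩]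
      [⟨i, .crossing .singular⟩, ⟨i, .crossing c⟩] := of_sound (.real_singular i c hc) (by simp)

/-- Heights are interchanged, in terms of the positions. -/
theorem swap_of_le (P Q : Piece) {i j k : ℕ} (hj : i + P.bot ≤ j) (hk : k + P.bot = j + P.top) :
    Derives [⟨i, P⟩, ⟨j, Q⟩] [⟨k, Q⟩, ⟨i, P⟩] := by
  have := heights P Q i (j - (i + P.bot))
  rwa [show i + P.bot + (j - (i + P.bot)) = j by omega,
    show i + P.top + (j - (i + P.bot)) = k by omega] at this

theorem swap_of_ge (P Q : Piece) {i j k : ℕ} (hk : i + P.top ≤ k) (hj : j + P.top = k + P.bot) :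
    Derives [⟨k, Q⟩, ⟨i, P⟩] [⟨i, P⟩, ⟨j, Q⟩] := by
  have := heights_symm P Q i (k - (i + P.top))
  rwa [show i + P.top + (k - (i + P.top)) = k by omega,
    show i + P.bot + (k - (i + P.top)) = j by omega] at this

end Derives

end STV

/-! ### Conjugation: pieces travel along the closing arcs. -/

namespace STV

theorem maxima_succ (n : ℕ) : maxima (n + 1) = maxima n ++ [⟨n, .maximum true⟩] := by
  rw [maxima, List.range_succ, List.map_append]; rfl

theorem minima_succ (n : ℕ) : minima (n + 1) = ⟨n, .minimum⟩ :: minima n := by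
  rw [minima, List.range_succ, List.reverse_append, List.map_append]; rfl

namespace Derives

/-- A crossing moves along the nested maxima to the other legs. -/
theorem maxima_crossing (c : Crossing) {i n : ℕ} (h : i + 1 < n) :
    Derives (maxima n ++ [⟨i, .crossing c⟩]) (maxima n ++ [⟨2 * n - 2 - i, .crossing c⟩]) := by
  induction n with
  | zero => omega
  | succ n ih =>
    rcases Nat.lt_succ_iff_lt_or_eq.1 h with h | h
    · rw [maxima_succ, List.append_assoc, List.append_assoc]
      refine ((swap_of_ge (.crossing c) (.maximum true) (i := i) (j := n) (k := n) ?_ rfl).left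
        _).trans ?_
      · simp only [Piece.top]; omega
      · have k := (ih h).right [⟨n, .maximum true⟩]
        rw [List.append_assoc, List.append_assoc] at k
        refine k.trans (.left _ (swap_of_ge (.maximum true) (.crossing c) ?_ ?_)) <;>
          simp only [Piece.top, Piece.bot] <;> omega
    · subst h
      rw [maxima_succ, maxima_succ]
      simp only [List.append_assoc]
      refine .left _ ?_
      -- The two arcs of the crossing are now the innermost ones. The crossing passes the inner
      -- maximum, the two maxima exchange their heights, and it passes the other one; the two
      -- quarter turns cancel.
      have k₁ := (crossing_maximum i true c).left [⟨i, .maximum true⟩]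
      have k₂ := (swap_of_ge (.maximum true) (.maximum true) (i := i) (j := i + 2) (k := i)
        le_rfl rfl).right [⟨i + 1, .crossing c.flip⟩]
      have k₃ := (crossing_maximum (i + 1) true c.flip).left [⟨i, .maximum true⟩]
      have hc : c.flip.flip = c := by cases c <;> rfl
      rw [hc] at k₃
      rw [show 2 * (i + 1 + 1) - 2 - i = i + 1 + 1 by omega]
      exact k₁.trans (k₂.trans k₃)

/-- A crossing moves along the nested minima to the other legs. -/
theorem crossing_minima (c : Crossing) {i n : ℕ} (h : i + 1 < n) :
    Derives (⟨i, .crossing c⟩ :: minima n) (⟨2 * n - 2 - i, .crossing c⟩ :: minima n) := by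
  induction n with
  | zero => omega
  | succ n ih =>
    rcases Nat.lt_succ_iff_lt_or_eq.1 h with h | h
    · rw [minima_succ]
      refine ((swap_of_le (.crossing c) .minimum (i := i) (j := n) (k := n) ?_ rfl).right
        (minima n)).trans (((ih h).left [⟨n, .minimum⟩]).trans
          ((swap_of_le .minimum (.crossing c) ?_ ?_).right (minima n))) <;>
        simp only [Piece.top, Piece.bot] <;> omega
    · subst h
      rw [minima_succ, minima_succ]
      -- The same at the two innermost minima.
      have k₁ := (crossing_minimum i c).right [⟨i, .minimum⟩]
      have k₂ := (swap_of_le .minimum .minimum (i := i) (j := i) (k := i + 2)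
        le_rfl rfl).left [⟨i + 1, .crossing c.flip⟩]
      have k₃ := (crossing_minimum (i + 1) c.flip).right [⟨i, .minimum⟩]
      have hc : c.flip.flip = c := by cases c <;> rfl
      rw [hc] at k₃
      rw [show 2 * (i + 1 + 1) - 2 - i = i + 1 + 1 by omega]
      exact (k₁.trans (k₂.trans k₃)).right (minima i)

theorem maxima_bar {i n : ℕ} (h : i < n) :
    Derives (maxima n ++ [⟨i, .bar⟩]) (maxima n ++ [⟨2 * n - 1 - i, .bar⟩]) := by
  induction n with
  | zero => omega
  | succ n ih =>
    rw [maxima_succ, List.append_assoc, List.append_assoc]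
    rcases Nat.lt_succ_iff_lt_or_eq.1 h with h | h
    · refine ((swap_of_ge .bar (.maximum true) (i := i) (j := n) (k := n) ?_ rfl).left
        _).trans ?_
      · simp only [Piece.top]; omega
      · have k := (ih h).right [⟨n, .maximum true⟩]
        rw [List.append_assoc, List.append_assoc] at k
        refine k.trans (.left _ (swap_of_ge (.maximum true) .bar ?_ ?_)) <;>
          simp only [Piece.top, Piece.bot] <;> omega
    · subst h
      rw [show 2 * (i + 1) - 1 - i = i + 1 by omega]
      exact (bar_maximum i true).left _

theorem bar_minima {i n : ℕ} (h : i < n) :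
    Derives (⟨i, .bar⟩ :: minima n) (⟨2 * n - 1 - i, .bar⟩ :: minima n) := by
  induction n with
  | zero => omega
  | succ n ih =>
    rw [minima_succ]
    rcases Nat.lt_succ_iff_lt_or_eq.1 h with h | h
    · refine ((swap_of_le .bar .minimum (i := i) (j := n) (k := n) ?_ rfl).right
        (minima n)).trans (((ih h).left [⟨n, .minimum⟩]).trans
          ((swap_of_le .minimum .bar ?_ ?_).right (minima n))) <;>
        simp only [Piece.top, Piece.bot] <;> omega
    · subst h
      rw [show 2 * (i + 1) - 1 - i = i + 1 by omega]
      exact (bar_minimum i).right _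

/-- A piece on the right of a braid moves past it. -/
theorem braid_right {n k : ℕ} (u : List (Gen n)) (P : Piece) (hk : n ≤ k) :
    Derives (⟨k, P⟩ :: u.map Gen.slice) (u.map Gen.slice ++ [⟨k, P⟩]) := by
  induction u with
  | nil => exact refl _
  | cons g u ih =>
    refine Derives.trans ?_ (ih.left [g.slice])
    rcases g.cases with ⟨c, i, h, hg, -⟩ | ⟨i, h, hg, -⟩
    · rw [List.map_cons, hg]
      exact (swap_of_ge (.crossing c) P (i := i) (j := k) (k := k) (by simp only [Piece.top]; omega)
        rfl).right (u.map Gen.slice)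
    · rw [List.map_cons, hg]
      exact (swap_of_ge .bar P (i := i) (j := k) (k := k) (by simp only [Piece.top]; omega)
        rfl).right (u.map Gen.slice)

end Derives

variable {n : ℕ}

theorem closure_coe (u : Word n) :
    (closure u).1 = maxima n ++ u.toList.map Gen.slice ++ minima n := rfl

theorem closure_mul (u w : Word n) : (closure (u * w)).1 =
    maxima n ++ (u.toList.map Gen.slice ++ w.toList.map Gen.slice) ++ minima n := by
  rw [closure_coe, FreeMonoid.toList_mul, List.map_append]

theorem LinkDiagram.Isotopic.of_derives {D E : LinkDiagram} {M : List Slice} (h : Derives D.1 M)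
    (h' : Derives E.1 M) : D.Isotopic E := by
  have hM : Runs M [] [] := Derives.runs h D.2
  exact .trans _ ⟨M, hM⟩ _ (Derives.isotopic h) (.symm _ _ (Derives.isotopic h'))

/-- Both closures become the diagram with the piece below the braid word but on the closing strands:
from the top it is pulled through the maxima and down along the braid, from the bottom through the
minima. -/
theorem isotopic_conj (g : Gen n) (u : Word n) :
    (closure (FreeMonoid.of g * u)).Isotopic (closure (u * FreeMonoid.of g)) := by
  obtain ⟨k, P, hk, h₁, h₂⟩ : ∃ k P, n ≤ k ∧
      Derives (maxima n ++ [g.slice]) (maxima n ++ [⟨k, P⟩]) ∧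
      Derives (g.slice :: minima n) (⟨k, P⟩ :: minima n) := by
    rcases g.cases with ⟨c, i, h, hg, -⟩ | ⟨i, h, hg, -⟩ <;> rw [hg]
    · exact ⟨_, _, by omega, .maxima_crossing c h, .crossing_minima c h⟩
    · exact ⟨_, _, by omega, .maxima_bar h, .bar_minima h⟩
  refine .of_derives (M := maxima n ++ (u.toList.map Gen.slice ++ [⟨k, P⟩]) ++ minima n) ?_ ?_
  · rw [closure_mul]
    refine Derives.trans ?_ ((Derives.braid_right u.toList P hk).context _ _)
    simpa using h₁.right (u.toList.map Gen.slice ++ minima n)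
  · rw [closure_mul]
    simpa using h₂.left (maxima n ++ u.toList.map Gen.slice)

end STV

/-! ### The relations of the monoid are isotopies of closures. -/

namespace STV

variable {n : ℕ}

/-- Converts the move of a strand past a crossing into the form in which the monoid states it, with
an involution on both sides of the crossing. -/
theorem conj_eq_conj {M : Type*} [Monoid M] {a b x y : M} (hx : x * x = 1) (hy : y * y = 1)
    (h : x * y * a = b * x * y) : x * b * x = y * a * y := by
  calc x * b * x = x * (b * x * y) * y := by simp only [mul_assoc, hy, mul_one]
    _ = x * x * (y * a * y) := by rw [← h]; simp only [mul_assoc]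
    _ = y * a * y := by rw [hx, one_mul]

/-- Words that can be interchanged in a braid diagram, up to isotopy of the closure. -/
def isotopyCon (n : ℕ) : Con (Word n) where
  r u w := ∀ x y, (closure (x * u * y)).Isotopic (closure (x * w * y))
  iseqv := ⟨fun _ _ _ => .refl _, fun h x y => .symm _ _ (h x y),
    fun h h' x y => .trans _ _ _ (h x y) (h' x y)⟩
  mul' {u u' w w'} h h' x y := by
    refine .trans _ (closure (x * (u' * w) * y)) _ ?_ ?_
    · change (closure _).Isotopic (closure _)
      simpa only [mul_assoc] using h x (w * y)
    · change (closure _).Isotopic (closure _)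
      simpa only [mul_assoc] using h' (x * u') y

theorem isotopyCon_of_move {u w : Word n}
    (h : Move (u.toList.map Gen.slice) (w.toList.map Gen.slice)) : isotopyCon n u w := by
  intro x y
  refine .rel _ _ ⟨maxima n ++ x.toList.map Gen.slice, _, _,
    y.toList.map Gen.slice ++ minima n, h, ?_, ?_⟩ <;>
  simp only [closure_coe, FreeMonoid.toList_mul, List.map_append, List.append_assoc]

open Word in
-- Each relation is a single move or its inverse, apart from the trivial case of a bar with itself
-- and the mixed relations `vᵢ xᵢ₊₁ vᵢ = vᵢ₊₁ xᵢ vᵢ₊₁`, which combine a virtual slide with V2.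
theorem isotopyCon_of_rel {u w : Word n} (h : Rel n u w) : isotopyCon n u w := by
  have heights : ∀ {g g' : Gen n} {P Q : Piece} {i j : ℕ}, g.slice = ⟨i, P⟩ → g'.slice = ⟨j, Q⟩ →
      P.bot = P.top → Q.bot = Q.top → i + P.top ≤ j ∨ j + Q.top ≤ i →
      isotopyCon n (FreeMonoid.of g * FreeMonoid.of g') (FreeMonoid.of g' * FreeMonoid.of g) := by
    have key : ∀ {g g' : Gen n} {P Q : Piece} {i j : ℕ}, g.slice = ⟨i, P⟩ → g'.slice = ⟨j, Q⟩ →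
      P.bot = P.top → i + P.top ≤ j →
      isotopyCon n (FreeMonoid.of g * FreeMonoid.of g') (FreeMonoid.of g' * FreeMonoid.of g) := by
      intro g g' P Q i j hg hg' hP hj
      obtain ⟨d, rfl⟩ := Nat.exists_eq_add_of_le hj
      refine isotopyCon_of_move ?_
      have := Move.isotopy_heights P Q i d
      rw [hP] at this
      simpa [hg, hg'] using this
    intro g g' P Q i j hg hg' hP hQ hj
    rcases hj with hj | hj
    · exact key hg hg' hP hj
    · exact (isotopyCon n).symm (key hg' hg hQ hj)
  have slide : ∀ (c : Crossing) (g g' : Gen n) (i : ℕ) (hi : i + 1 < n) (hj : i + 1 + 1 < n),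
      g.slice = ⟨i, .crossing c⟩ → g'.slice = ⟨i + 1, .crossing c⟩ →
      isotopyCon n (v i hi * FreeMonoid.of g' * v i hi)
        (v (i + 1) hj * FreeMonoid.of g * v (i + 1) hj) := by
    intro c g g' i hi hj hg hg'
    have h₁ : isotopyCon n (v i hi * v (i + 1) hj * FreeMonoid.of g)
        (FreeMonoid.of g' * v i hi * v (i + 1) hj) := isotopyCon_of_move (by
      have := Move.slide_virtual i c
      rw [← hg, ← hg'] at this
      exact this)
    have sq : ∀ j (hj : j + 1 < n), isotopyCon n (v j hj * v j hj) 1 := fun j hj =>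
      isotopyCon_of_move (.bigon j .virtual (by simp))
    rw [← Con.eq] at h₁ ⊢
    have hx := (Con.eq _).2 (sq i hi)
    have hy := (Con.eq _).2 (sq (i + 1) hj)
    simp only [Con.coe_mul, Con.coe_one] at *
    exact conj_eq_conj hx hy h₁
  have far : ∀ {i j : ℕ}, Far i j → i + 2 ≤ j ∨ j + 2 ≤ i := fun h => h.imp (by omega) (by omega)
  cases h with
  | sigma_sigma_far i j hi hj hf => exact heights rfl rfl rfl rfl (far hf)
  | sigma_braid i hi hj =>
    exact isotopyCon_of_move (.slide_real i .slash .slash (.inl rfl) (by simp))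
  | virt_sq i hi => exact isotopyCon_of_move (.bigon i .virtual (by simp))
  | virt_virt_far i j hi hj hf => exact heights rfl rfl rfl rfl (far hf)
  | virt_braid i hi hj => exact isotopyCon_of_move (.slide_virtual i .virtual)
  | sigma_virt_far i j hi hj hf => exact heights rfl rfl rfl rfl (far hf)
  | virt_sigma_virt i hi hj => exact slide .slash _ _ i hi hj rfl rfl
  | bar_sq i hi => exact isotopyCon_of_move (.bar_bar i)
  | bar_bar i j hi hj =>
    rcases lt_trichotomy i j with h | rfl | h
    · exact heights rfl rfl rfl rfl (.inl h)
    · exact (isotopyCon n).refl _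
    · exact heights rfl rfl rfl rfl (.inr h)
  | bar_virt_far i j hi hj h₁ h₂ =>
    exact heights rfl rfl rfl rfl (by simp only [Piece.top]; omega)
  | sigma_bar_far i j hi hj h₁ h₂ =>
    exact heights rfl rfl rfl rfl (by simp only [Piece.top]; omega)
  | bar_virt i hi hj => exact isotopyCon_of_move (.bar_virtual i)
  | sigma_twist i hi hj => exact isotopyCon_of_move (.twist i .slash (by simp))
  | sigma_inv e i hi =>
    cases e
    · exact isotopyCon_of_move (.bigon i .backslash (by simp))
    · exact isotopyCon_of_move (.bigon i .slash (by simp))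
  | sing_sing_far i j hi hj hf => exact heights rfl rfl rfl rfl (far hf)
  | sigma_sing_far i j hi hj hf => exact heights rfl rfl rfl rfl (far hf)
  | sigma_sing i hi => exact isotopyCon_of_move (.real_singular i .slash (.inl rfl))
  | sigma_sigma_sing i hi hj =>
    exact isotopyCon_of_move (.slide_real i .slash .singular (.inl rfl) (by simp))
  | sing_virt_far i j hi hj hf => exact heights rfl rfl rfl rfl (far hf)
  | virt_sing_virt i hi hj => exact slide .singular _ _ i hi hj rfl rfl
  | sing_bar_far i j hi hj h₁ h₂ =>
    exact heights rfl rfl rfl rfl (by simp only [Piece.top]; omega)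
  | sing_twist i hi hj => exact isotopyCon_of_move (.twist i .singular (by simp))

/-- Words of the same braid have isotopic closures. -/
theorem isotopic_of_braid_eq {u w : Word n} (h : braid u = braid w) :
    (closure u).Isotopic (closure w) := by
  have k : conGen (Rel n) u w := Con.eq _ |>.1 h
  have := (Con.conGen_le (c := isotopyCon n)).2 (fun _ _ => isotopyCon_of_rel) k 1 1
  simpa using this

end STV

/-! ### Stabilization and right threading are isotopies. -/

namespace STV

variable {n : ℕ}

theorem iota_braid (s t : ℕ) (u : Word n) :
    iota s t (braid u) = braid (FreeMonoid.map (Gen.shift s t) u) := by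
  induction u using FreeMonoid.recOn with
  | one => rfl
  | of_mul g u ih =>
    rw [braid_mul, map_mul, ih, map_mul, braid_mul]
    rfl

theorem exists_braid_eq (α : STVB n) : ∃ u, braid u = α := by
  induction α using PresentedMonoid.inductionOn with
  | h u => exact ⟨u, rfl⟩

theorem slices_shift (t : ℕ) (u : Word n) :
    (FreeMonoid.map (Gen.shift 0 t) u).toList.map Gen.slice = u.toList.map Gen.slice := by
  rw [FreeMonoid.toList_map, List.map_map]
  refine List.map_congr_left fun g _ => ?_
  cases g with
  | sigma e i h => cases e <;> rfl
  | _ => rfl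

/-- The part of a closure on the right of a word that does not use the last strand. -/
theorem Derives.last_strand (u : Word (n + 1)) {T E : List Slice}
    (h : Derives (⟨n + 1, .maximum true⟩ :: (T ++ [⟨n + 1, .minimum⟩])) E) :
    Derives (maxima (n + 2) ++ (u.toList.map Gen.slice ++ T) ++ minima (n + 2))
      (maxima (n + 1) ++ (u.toList.map Gen.slice ++ E) ++ minima (n + 1)) := by
  rw [maxima_succ (n + 1), minima_succ (n + 1)]
  have k₁ := (Derives.braid_right u.toList (.maximum true) le_rfl).context (maxima (n + 1))
    (T ++ ⟨n + 1, .minimum⟩ :: minima (n + 1))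
  have k₂ := h.context (maxima (n + 1) ++ u.toList.map Gen.slice) (minima (n + 1))
  simp only [List.append_assoc, List.cons_append, List.nil_append] at k₁ k₂ ⊢
  exact k₁.trans k₂

/-- The last strand crosses the one before the last, which is then turned to the other leg of
the outermost arc. -/
theorem Derives.turn (i : ℕ) (c d : Crossing) :
    Derives (⟨i + 2, .maximum true⟩ :: ([⟨i + 1, .crossing c⟩, ⟨i, .crossing .virtual⟩,
        ⟨i + 1, .crossing d⟩] ++ [⟨i + 2, .minimum⟩]))
      [⟨i + 1, .maximum true⟩, ⟨i, .crossing .virtual⟩, ⟨i + 2, .crossing c.flip⟩,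
        ⟨i + 2, .crossing d.flip⟩, ⟨i + 1, .minimum⟩] := by
  have k₁ := (crossing_maximum (i + 1) true c).right [⟨i, .crossing .virtual⟩,
    ⟨i + 1, .crossing d⟩, ⟨i + 2, .minimum⟩]
  have k₂ := (crossing_minimum (i + 1) d).left [⟨i + 1, .maximum true⟩,
    ⟨i + 2, .crossing c.flip⟩, ⟨i, .crossing .virtual⟩]
  have k₃ := (swap_of_ge (.crossing .virtual) (.crossing c.flip) (i := i) (j := i + 2) (k := i + 2)
    le_rfl rfl).context [⟨i + 1, .maximum true⟩] [⟨i + 2, .crossing d.flip⟩, ⟨i + 1, .minimum⟩]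
  exact k₁.trans (k₂.trans k₃)

/-- Braids have isotopic closures. -/
def IsotopicClosures (p q : STVBInfty) : Prop :=
  ∀ (u : Word (p.1 + 1)) (w : Word (q.1 + 1)), braid u = p.2 → braid w = q.2 →
    (closure u).Isotopic (closure w)

namespace IsotopicClosures

variable {p q r : STVBInfty} {m : ℕ}

theorem of_words {u : Word (m + 1)} {w : Word (n + 1)} {α : STVB (m + 1)} {β : STVB (n + 1)}
    (hu : braid u = α) (hw : braid w = β)
    (h : (closure u).Isotopic (closure w)) : IsotopicClosures ⟨m, α⟩ ⟨n, β⟩ :=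
  fun _ _ hu' hw' => .trans _ _ _ (isotopic_of_braid_eq (hu'.trans hu.symm))
    (.trans _ _ _ h (isotopic_of_braid_eq (hw.trans hw'.symm)))

theorem of_eq (h : p = q) : IsotopicClosures p q := by
  subst h
  exact fun u w hu hw => isotopic_of_braid_eq (hu.trans hw.symm)

theorem symm (h : IsotopicClosures p q) : IsotopicClosures q p :=
  fun u w hu hw => .symm _ _ (h w u hw hu)

theorem trans (h : IsotopicClosures p q) (h' : IsotopicClosures q r) : IsotopicClosures p r := by
  intro u w hu hw
  obtain ⟨v, hv⟩ := exists_braid_eq q.2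
  exact .trans _ _ _ (h u v hu hv) (h' v w hv hw)

theorem conj_gen (g : Gen (n + 1)) (α : STVB (n + 1)) :
    IsotopicClosures ⟨n, braid (FreeMonoid.of g) * α⟩ ⟨n, α * braid (FreeMonoid.of g)⟩ := by
  obtain ⟨u, rfl⟩ := exists_braid_eq α
  exact of_words (braid_mul _ _) (braid_mul _ _) (isotopic_conj g u)

theorem conj (α β : STVB (n + 1)) : IsotopicClosures ⟨n, α * β⟩ ⟨n, β * α⟩ := by
  obtain ⟨u, rfl⟩ := exists_braid_eq α
  induction u using FreeMonoid.recOn generalizing β with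
  | one => exact of_eq (by rw [show braid (1 : Word (n + 1)) = 1 from rfl, one_mul, mul_one])
  | of_mul g u ih =>
    rw [braid_mul, mul_assoc]
    refine (conj_gen g _).trans ?_
    rw [mul_assoc]
    refine (ih _).trans (of_eq ?_)
    rw [mul_assoc]

/-- The last strand meets the rest of the closure in one crossing, and with its closing arc it forms
a kink. -/
theorem stab (g : Gen (n + 2)) {c : Crossing} (hc : c ≠ .singular)
    (hg : g.slice = ⟨n, .crossing c⟩) (α : STVB (n + 1)) :
    IsotopicClosures ⟨n, α⟩ ⟨n + 1, iota 0 1 α * braid (FreeMonoid.of g)⟩ := by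
  obtain ⟨u, rfl⟩ := exists_braid_eq α
  refine of_words (w := FreeMonoid.map (Gen.shift 0 1) u * FreeMonoid.of g) rfl
    (by rw [braid_mul, iota_braid]) (.of_derives (Derives.refl _) ?_)
  rw [closure_mul, slices_shift]
  have := Derives.last_strand u (T := [g.slice]) (by rw [hg]; exact Derives.kink n true c hc)
  rw [List.append_nil] at this
  exact this

theorem word_three {g₁ g₂ g₃ : Gen (n + 3)} (u : Word (n + 2)) {E : List Slice}
    (h : Derives (⟨n + 2, .maximum true⟩ :: ([g₁.slice, g₂.slice, g₃.slice] ++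
      [⟨n + 2, .minimum⟩])) E) :
    Derives (closure (FreeMonoid.map (Gen.shift 0 1) u * FreeMonoid.of g₁ * FreeMonoid.of g₂ *
      FreeMonoid.of g₃)).1 (maxima (n + 2) ++ (u.toList.map Gen.slice ++ E) ++ minima (n + 2)) := by
  have e : FreeMonoid.map (Gen.shift 0 1) u * FreeMonoid.of g₁ * FreeMonoid.of g₂ *
    FreeMonoid.of g₃ = FreeMonoid.map (Gen.shift 0 1) u * FreeMonoid.ofList [g₁, g₂, g₃] := by
    simp only [mul_assoc]; rfl
  rw [e, closure_mul, slices_shift]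
  exact Derives.last_strand u h

/-- After the turn the two real crossings are adjacent on the closing side and cancel; a virtual
kink remains. -/
theorem right_under (e : Bool) (α : STVB (n + 2)) :
    IsotopicClosures ⟨n + 1, α⟩ ⟨n + 2, iota 0 1 α * sigma e (n + 1) (by omega) *
      STV.virt n (by omega) * sigma (!e) (n + 1) (by omega)⟩ := by
  obtain ⟨u, rfl⟩ := exists_braid_eq α
  rw [iota_braid]
  refine of_words (w := FreeMonoid.map (Gen.shift 0 1) u * Word.σ e (n + 1) (by omega) *
    Word.v n (by omega) * Word.σ (!e) (n + 1) (by omega)) rfl rfl (.of_derives (Derives.refl _) ?_)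
  have key : ∀ c : Crossing, c ≠ .singular → Derives (⟨n + 2, .maximum true⟩ ::
      ([⟨n + 1, .crossing c⟩, ⟨n, .crossing .virtual⟩, ⟨n + 1, .crossing c.flip⟩] ++
        [⟨n + 2, .minimum⟩])) [] := fun c hc =>
    (Derives.turn n c c.flip).trans (((Derives.bigon (n + 2) c.flip (by cases c <;> simp_all
      [Crossing.flip])).context [⟨n + 1, .maximum true⟩, ⟨n, .crossing .virtual⟩]
        [⟨n + 1, .minimum⟩]).trans (Derives.kink n true .virtual (by simp)))
  have := word_three (g₁ := .sigma e (n + 1) (by omega)) (g₂ := .virt n (by omega))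
    (g₃ := .sigma (!e) (n + 1) (by omega)) u (E := []) (by
      cases e
      · exact key .backslash (by simp)
      · exact key .slash (by simp))
  rwa [List.append_nil] at this

/-- After the turn the real and the singular crossing are adjacent and S2 interchanges them. -/
theorem right_rs (e : Bool) (α : STVB (n + 2)) :
    IsotopicClosures ⟨n + 2, iota 0 1 α * STV.sing (n + 1) (by omega) * STV.virt n (by omega) *
        sigma e (n + 1) (by omega)⟩
      ⟨n + 2, iota 0 1 α * sigma e (n + 1) (by omega) * STV.virt n (by omega) *
        STV.sing (n + 1) (by omega)⟩ := by
  obtain ⟨u, rfl⟩ := exists_braid_eq α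
  rw [iota_braid]
  have key : ∀ c : Crossing, c.Real → Derives (⟨n + 2, .maximum true⟩ ::
      ([⟨n + 1, .crossing c⟩, ⟨n, .crossing .virtual⟩, ⟨n + 1, .crossing .singular⟩] ++
        [⟨n + 2, .minimum⟩])) [⟨n + 1, .maximum true⟩, ⟨n, .crossing .virtual⟩,
          ⟨n + 2, .crossing .singular⟩, ⟨n + 2, .crossing c.flip⟩, ⟨n + 1, .minimum⟩] :=
    fun c hc => (Derives.turn n c .singular).trans ((Derives.real_singular (n + 2) c.flip
      (hc.symm.imp (by rintro rfl; rfl) (by rintro rfl; rfl))).context [⟨n + 1, .maximum true⟩,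
        ⟨n, .crossing .virtual⟩] [⟨n + 1, .minimum⟩])
  refine of_words
    (u := FreeMonoid.map (Gen.shift 0 1) u * Word.τ (n + 1) (by omega) *
      Word.v n (by omega) * Word.σ e (n + 1) (by omega))
    (w := FreeMonoid.map (Gen.shift 0 1) u * Word.σ e (n + 1) (by omega) *
      Word.v n (by omega) * Word.τ (n + 1) (by omega)) rfl rfl ?_
  cases e
  · exact .of_derives (word_three u (Derives.turn n .singular .backslash))
      (word_three u (key .backslash (.inr rfl)))
  · exact .of_derives (word_three u (Derives.turn n .singular .slash))
      (word_three u (key .slash (.inl rfl)))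

end IsotopicClosures

end STV

namespace STV

/-! ### The half turn -/

/-- The word of a bar on each of the strands `x`. -/
def barWord (x : List ℕ) : List Letter := x.map .B

variable {n : ℕ} {x y : List ℕ}

namespace LEq

theorem comm_word (hx : x.Nodup) {l : Letter} {w : List Letter} (hl : l.Good x)
    (hw : ∀ m ∈ w, m.Good x) (h : ∀ m ∈ w, ∀ a ∈ m.names, a ∉ l.names) :
    LEq x (w ++ [l]) (l :: w) := by
  induction w with
  | nil => exact .refl _ _
  | cons m w ih =>
    simp only [List.forall_mem_cons] at hw h
    exact ((ih hw.2 h.2).left [m]).trans ((comm hx hw.1 hl h.1).right w)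

theorem comm_barWord (hx : x.Nodup) (hy : y ⊆ x) {l : Letter} (hl : l.Good x)
    (h : ∀ a ∈ y, a ∉ l.names) : LEq x (barWord y ++ [l]) (l :: barWord y) := by
  refine comm_word hx hl ?_ ?_ <;> simp only [barWord, List.forall_mem_map]
  · exact fun a ha => hy ha
  · exact fun a ha => by simpa [Letter.names] using h a ha

theorem barWord_reverse (hx : x.Nodup) (hy : y ⊆ x) :
    LEq x (barWord y ++ barWord y.reverse) [] := by
  induction y with
  | nil => exact .refl _ _
  | cons a y ih =>
    have h := ((ih (List.subset_of_cons_subset hy)).left [.B a]).right [.B a]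
    have e : barWord (a :: y) ++ barWord (a :: y).reverse =
        [.B a] ++ (barWord y ++ barWord y.reverse) ++ [.B a] := by
      simp [barWord]
    rw [e]
    exact h.trans (bar_bar_cancel hx (hy (by simp)))

theorem barWord_comm_bar (hx : x.Nodup) (hy : y ⊆ x) {a : ℕ} (ha : a ∈ x) :
    LEq x (barWord y ++ [.B a]) (.B a :: barWord y) := by
  induction y with
  | nil => exact .refl _ _
  | cons b y ih =>
    exact ((ih (List.subset_of_cons_subset hy)).left [.B b]).trans
      ((bar_bar hx (hy (by simp)) ha).right (barWord y))

/-- Only the bars on `a` and `b` matter. By `twist` they turn the crossing around, so that its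
strands enter in the other order. -/
theorem barWord_cross (hx : x.Nodup) {l r : List ℕ} {a b : ℕ} (e : x = l ++ a :: b :: r)
    (c : Crossing) :
    LEq x (barWord (l ++ a :: b :: r) ++ crWord c b a)
      (crWord c a b ++ barWord (l ++ b :: a :: r)) := by
  have ha : a ∈ x := by simp [e]
  have hb : b ∈ x := by simp [e]
  have hl : l ⊆ x := by simp [e]
  have hr : r ⊆ x := fun z hz => by simp [e, hz]
  have hn : a ≠ b ∧ (∀ z ∈ l, z ≠ a ∧ z ≠ b) ∧ ∀ z ∈ r, z ≠ a ∧ z ≠ b := by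
    rw [e, List.nodup_append] at hx
    simp only [List.nodup_cons, List.mem_cons, not_or] at hx
    grind
  have e₁ : ∀ l a b r, barWord (l ++ a :: b :: r) = barWord l ++ ([.B a, .B b] ++ barWord r) :=
    fun l a b r => by simp [barWord]
  rw [e₁, e₁]
  by_cases hc : c = .virtual
  · subst hc
    simp only [crWord, List.append_nil, List.nil_append]
    exact ((bar_bar hx ha hb).right _).left _
  · rw [crWord_of_ne hc, crWord_of_ne hc]
    have g : (Letter.X c b a).Good x := ⟨hc, hn.1.symm, hb, ha⟩
    have g' : (Letter.X c a b).Good x := ⟨hc, hn.1, ha, hb⟩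
    have k₁ := (comm_barWord hx hr g fun z hz => by
      have := hn.2.2 z hz
      simp [Letter.names, this]).left (barWord l ++ [.B a, .B b])
    have k₂ : LEq x [.B a, .B b, .X c b a] [.X c a b, .B b, .B a] := by
      have h₁ := (twist hx g').left [.B a, .B b]
      have h₂ := (bar_bar hx ha hb).right [.B a, .B b, .X c a b, .B b, .B a]
      have h₃ := ((bar_bar_cancel hx ha).left [.B b]).right [.B b, .X c a b, .B b, .B a]
      have h₄ := (bar_bar_cancel hx hb).right [.X c a b, .B b, .B a]
      exact h₁.trans (h₂.trans (h₃.trans h₄))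
    have k₃ := (k₂.left (barWord l)).right (barWord r)
    have k₄ := (comm_barWord hx hl g' fun z hz => by
      have := hn.2.1 z hz
      simp [Letter.names, this]).right ([.B b, .B a] ++ barWord r)
    simp only [List.append_assoc, List.cons_append, List.nil_append] at *
    exact k₁.trans (k₃.trans k₄)

end LEq

/-- It suffices to find the braid for the names `0, …, n - 1`; the names of any other row are
substituted, whether or not they are distinct. -/
theorem exists_halfTurn (n : ℕ) : ∃ δ : STVB n, ∀ x : List ℕ, x.length = n →
    Reads δ x (barWord x) x.reverse := by
  obtain ⟨δ, h⟩ := Reads.exists_of_good (n := n) (x := List.range n) (z := (List.range n).reverse)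
    (w := barWord (List.range n)) List.length_range (List.reverse_perm _).symm (by
      simp only [barWord, List.forall_mem_map]
      exact fun a ha => ha)
  refine ⟨δ, fun x hx => ?_⟩
  -- The default value is never attained, as all indices are below the length.
  have e : (List.range n).map (fun i => x.getD i 0) = x := by
    refine List.ext_getElem (by simp [hx]) fun i h₁ h₂ => ?_
    simp [h₂]
  have := h.map fun i => x.getD i 0
  rw [List.map_reverse, e] at this
  convert this using 1
  rw [barWord, barWord, List.map_map]
  conv_lhs => rw [← e, List.map_map]
  rfl

/-- The braid that turns all strands about a vertical axis by half a turn. -/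
noncomputable def halfTurn (n : ℕ) : STVB n := (exists_halfTurn n).choose

theorem halfTurn_reads (hx : x.length = n) : Reads (halfTurn n) x (barWord x) x.reverse :=
  (exists_halfTurn n).choose_spec x hx

/-- The second half turn restores the order and cancels the bars, starting with the innermost pair.
-/
theorem halfTurn_sq : halfTurn n * halfTurn n = 1 := by
  have hx : (List.range n).length = n := List.length_range
  have h := (halfTurn_reads hx).mul (halfTurn_reads (by rw [List.length_reverse, hx]))
  rw [List.reverse_reverse] at h
  exact ((LEq.barWord_reverse List.nodup_range (List.Subset.refl _) _ _).1 h).unique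
    (.one _ hx) List.nodup_range

/-- Both products are read on the same row and compared by `Reads.unique`. The half turn keeps the
type of a crossing and only reflects its position. -/
theorem halfTurn_cr (c : Crossing) {i j : ℕ} (hi : i + 1 < n) (hj : j + 1 < n) (h : i + j + 2 = n) :
    halfTurn n * cr c i hi = cr c j hj * halfTurn n := by
  obtain ⟨l, a, b, r, e, hl⟩ := Reads.exists_split (x := List.range n) (i := j) (by simpa)
  have hn : (l ++ a :: b :: r).length = n := by rw [← e, List.length_range]
  have hr : r.length = i := by simp at hn; omega
  have h₁ := halfTurn_reads hn
  rw [List.reverse_append, List.reverse_cons, List.reverse_cons, List.append_assoc,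
    List.append_assoc] at h₁
  have h₂ := h₁.mul (Reads.cr_one (l := r.reverse) (a := b) (b := a) (r := l.reverse) c hi
    (by simpa) (by simp at hn ⊢; omega))
  have h₃ := (Reads.cr_one c hj hl hn).mul (halfTurn_reads (x := l ++ b :: a :: r)
      (by simpa using hn))
  rw [List.reverse_append, List.reverse_cons, List.reverse_cons, List.append_assoc,
    List.append_assoc] at h₃
  have hx : (l ++ a :: b :: r).Nodup := e ▸ List.nodup_range
  exact ((LEq.barWord_cross hx rfl c _ _).1 h₂).unique h₃ hx

theorem halfTurn_bar {i j : ℕ} (hi : i < n) (hj : j < n) (h : i + j + 1 = n) :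
    halfTurn n * bar i hi = bar j hj * halfTurn n := by
  obtain ⟨l, a, r, e, hl⟩ := Reads.exists_split_one (x := List.range n) (i := j) (by simpa)
  have hn : (l ++ a :: r).length = n := by rw [← e, List.length_range]
  have hr : r.length = i := by simp at hn; omega
  have h₁ := halfTurn_reads hn
  rw [List.reverse_append, List.reverse_cons, List.append_assoc] at h₁
  have h₂ := h₁.mul (Reads.bar_one (l := r.reverse) (a := a) (r := l.reverse) hi
    (by simpa) (by simp at hn ⊢; omega))
  have h₃ := (Reads.bar_one hj hl hn).mul (halfTurn_reads hn)
  rw [List.reverse_append, List.reverse_cons, List.append_assoc] at h₃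
  have hx : (l ++ a :: r).Nodup := e ▸ List.nodup_range
  exact ((LEq.barWord_comm_bar hx (List.Subset.refl _) (by simp) _ _).1 h₂).unique h₃ hx

/-- The half turn exchanges the two ways to add a strand. -/
theorem halfTurn_iota (α : STVB n) : halfTurn (n + 1) * iota 1 0 α =
    iota 0 1 (halfTurn n * α * halfTurn n) * halfTurn (n + 1) := by
  induction α using braid_induction with
  | one => rw [map_one, mul_one, mul_one, halfTurn_sq, map_one, one_mul]
  | cross c i h α ih =>
    rw [map_mul, iota_cr, ← mul_assoc, halfTurn_cr c (j := n - 2 - i) (by omega) (by omega)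
      (by omega), mul_assoc, ih, ← mul_assoc (halfTurn n), halfTurn_cr c (j := n - 2 - i) h
      (by omega) (by omega), mul_assoc (cr c _ _), mul_assoc (cr c _ _),
      map_mul (iota 0 1) (cr c _ _), iota_cr]
    exact (mul_assoc _ _ _).symm
  | bars i h α ih =>
    rw [map_mul, iota_bar, ← mul_assoc, halfTurn_bar (j := n - 1 - i) (by omega) (by omega)
      (by omega), mul_assoc, ih, ← mul_assoc (halfTurn n), halfTurn_bar (j := n - 1 - i) h
      (by omega) (by omega), mul_assoc (bar _ _), mul_assoc (bar _ _),
      map_mul (iota 0 1) (bar _ _), iota_bar]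
    exact (mul_assoc _ _ _).symm

theorem conj_four {M : Type*} [Monoid M] {d a x y z a' x' y' z' : M} (hd : d * d = 1)
    (ha : d * a = a' * d) (hx : d * x = x' * d) (hy : d * y = y' * d) (hz : d * z = z' * d) :
    d * (a * x * y * z) * d = a' * x' * y' * z' := by
  calc d * (a * x * y * z) * d = d * a * x * y * z * d := by simp only [mul_assoc]
    _ = a' * x' * y' * z' * (d * d) := by
      rw [ha, mul_assoc a', hx, ← mul_assoc a', mul_assoc (a' * x'), hy, ← mul_assoc (a' * x'),
        mul_assoc (a' * x' * y'), hz]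
      simp only [mul_assoc]
    _ = a' * x' * y' * z' := by rw [hd, mul_one]

namespace IsotopicClosures

theorem halfTurn (α : STVB (n + 1)) :
    IsotopicClosures ⟨n, α⟩ ⟨n, halfTurn (n + 1) * α * halfTurn (n + 1)⟩ :=
  .symm ((conj _ _).trans (of_eq (by rw [← mul_assoc, halfTurn_sq, one_mul])))

theorem halfTurn_left (α : STVB (n + 2)) (c d : Crossing) :
    STV.halfTurn (n + 3) * (iota 1 0 α * cr c 0 (by omega) * STV.virt 1 (by omega) *
      cr d 0 (by omega)) * STV.halfTurn (n + 3) =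
    iota 0 1 (STV.halfTurn (n + 2) * α * STV.halfTurn (n + 2)) * cr c (n + 1) (by omega) *
      STV.virt n (by omega) * cr d (n + 1) (by omega) := by
  have h := fun c => halfTurn_cr (n := n + 3) c (i := 0) (j := n + 1) (by omega) (by omega)
    (by omega)
  exact conj_four halfTurn_sq (halfTurn_iota α) (h c)
    (halfTurn_cr .virtual (by omega) (by omega) (by omega)) (h d)

theorem left_under (e : Bool) (α : STVB (n + 2)) :
    IsotopicClosures ⟨n + 1, α⟩ ⟨n + 2, iota 1 0 α * sigma e 0 (by omega) *
      STV.virt 1 (by omega) * sigma (!e) 0 (by omega)⟩ := by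
  -- Both braids are conjugated by the half turns of their degrees, which turns the left threading
  -- into a right threading of the conjugate of `α`.
  refine (halfTurn α).trans ((right_under e _).trans
    (.symm ((halfTurn (n := n + 2) _).trans (of_eq ?_))))
  cases e
  · exact congrArg (Sigma.mk (n + 2)) (halfTurn_left α .backslash .slash)
  · exact congrArg (Sigma.mk (n + 2)) (halfTurn_left α .slash .backslash)

theorem left_rs (e : Bool) (α : STVB (n + 2)) :
    IsotopicClosures ⟨n + 2, iota 1 0 α * STV.sing 0 (by omega) * STV.virt 1 (by omega) *
        sigma e 0 (by omega)⟩
      ⟨n + 2, iota 1 0 α * sigma e 0 (by omega) * STV.virt 1 (by omega) *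
        STV.sing 0 (by omega)⟩ := by
  have h := right_rs e (STV.halfTurn (n + 2) * α * STV.halfTurn (n + 2))
  refine (halfTurn (n := n + 2) _).trans (.trans (of_eq ?_)
    (h.trans (.symm ((halfTurn (n := n + 2) _).trans (of_eq ?_)))))
  · cases e
    · exact congrArg (Sigma.mk (n + 2)) (halfTurn_left α .singular .backslash)
    · exact congrArg (Sigma.mk (n + 2)) (halfTurn_left α .singular .slash)
  · cases e
    · exact congrArg (Sigma.mk (n + 2)) (halfTurn_left α .backslash .singular)
    · exact congrArg (Sigma.mk (n + 2)) (halfTurn_left α .slash .singular)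

theorem of_markovMove {p q : STVBInfty} (h : MarkovMove p q) : IsotopicClosures p q := by
  cases h with
  | real_conj | virt_conj | sing_conj | twist_conj => exact conj _ _
  | real_stab e α =>
    cases e
    · exact stab (.sigma false _ _) (c := .backslash) (by simp) rfl α
    · exact stab (.sigma true _ _) (c := .slash) (by simp) rfl α
  | virt_stab α => exact stab (.virt _ _) (c := .virtual) (by simp) rfl α
  | right_under e α => exact right_under e α
  | left_under e α => exact left_under e α
  | right_rs e α => exact right_rs e α
  | left_rs e α => exact left_rs e α

theorem of_markovEquiv {p q : STVBInfty} (h : MarkovEquiv p q) : IsotopicClosures p q := by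
  induction h with
  | rel p q h => exact of_markovMove h
  | refl p => exact of_eq rfl
  | symm p q _ ih => exact ih.symm
  | trans p q r _ _ ih ih' => exact ih.trans ih'

end IsotopicClosures

end STV

theorem mainTheorem3 (m n : ℕ) (u : STV.Word (m + 1)) (w : STV.Word (n + 1)) :
    (STV.closure u).Isotopic (STV.closure w) ↔
      STV.MarkovEquiv ⟨m, STV.braid u⟩ ⟨n, STV.braid w⟩ :=
  ⟨STV.markovEquiv_of_isotopic, fun h => STV.IsotopicClosures.of_markovEquiv h u w rfl rfl⟩
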